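/- Let $k$ be a field of characteristic $0$ and $\otimes=\otimes_k$. A double bracket on a $k$-algebra $A$ is a $k$-bilinear map $\{\!\{-,-\}\!\}:A\times A\to A\otimes A$ with $\{\!\{a,b\}\!\}=-\{\!\{b,a\}\!\}^{\circ}$ (where $(x\otimes y)^\circ=y\otimes x$) and $\{\!\{a,bc\}\!\}=\{\!\{a,b\}\!\}c+b\{\!\{a,c\}\!\}$ for the outer bimodule structure. If $1=\sum_{s\in I}e_s$ is a finite decomposition into orthogonal idempotents and $B=\oplus_s ke_s$, the double bracket is quasi-Poisson over $B$ if it vanishes when one argument lies in $B$ and the triple bracket $\{\!\{a,b,c\}\!\}=\sum_{i=0}^{2}\tau^i(\{\!\{a_i,\{\!\{b_i,c_i\}\!\}'\}\!\}\otimes\{\!\{b_i,c_i\}\!\}'')$, with $(a_0,b_0,c_0)=(a,b,c)$, $(a_1,b_1,c_1)=(b,c,a)$, $(a_2,b_2,c_2)=(c,a,b)$ and $\tau(x\otimes y\otimes z)=z\otimes x\otimes y$, satisfies, for all $a,b,c$, $$\{\!\{a,b,c\}\!\}=\tfrac14\sum_{s}\big(ce_sa\otimes e_sb\otimes e_s-ce_sa\otimes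 e_s\otimes be_s-ce_s\otimes ae_sb\otimes e_s+ce_s\otimes ae_s\otimes be_s-e_sa\otimes e_sb\otimes e_sc+e_sa\otimes e_s\otimes be_sc+e_s\otimes ae_sb\otimes e_sc-e_s\otimes ae_s\otimes be_sc\big).$$ Fusion. For a $B$-linear double bracket on $A$ and $i\neq j$ in $I$, let $\bar A$ be obtained from $A$ by adjoining $e_{12},e_{21}$ which together with $e_{11}=e_i$, $e_{22}=e_j$ form a system of $2\times 2$ matrix units, put $\epsilon=1-e_j$ and $A^f=\epsilon\bar A\epsilon$. Fusing $e_j$ onto $e_i$ gives on $A^f$, with idempotents $e_s$ ($s\ne j$), the double bracket $\{\!\{-,-\}\!\}+\{\!\{-,-\}\!\}_{fus}$. Here the first term is the restriction of the extension of the given bracket to $\bar A$ that vanishes on $e_{12},e_{21}$; the second is $$\{\!\{b,c\}\!\}_{fus}=-\tfrac12\big(\delta_2(c)'\delta_1(b)''\otimes\delta_1(b)'\delta_2(c)''-\delta_1(c)'\delta_2(b)''\otimes\delta_2(b)'\delta_1(c)''\big),$$ with $\delta_1=\mathrm{Tr}(E_i)$, $\delta_2=\mathrm{Tr}(E_j)$,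 where $E_s$ is the double derivation of $\bar A$ that vanishes on $e_{12},e_{21}$ and satisfies $E_s(a)=ae_s\otimes e_s-e_s\otimes e_sa$ for $a\in A$, and $\mathrm{Tr}(\delta)(a)=\epsilon\delta(a)'\epsilon\otimes\epsilon\delta(a)''\epsilon+\epsilon\delta(a)'e_{21}\epsilon\otimes\epsilon e_{12}\delta(a)''\epsilon$. Double brackets considered. On $k\langle s,t\rangle$ (with $B=k$) consider double brackets such that $$\{\!\{t,t\}\!\}=\lambda(t\otimes1-1\otimes t)+\mu(t^2\otimes1-1\otimes t^2)+\nu(t^2\otimes t-t\otimes t^2),$$ $$\{\!\{s,s\}\!\}=l(s\otimes1-1\otimes s)+m(s^2\otimes1-1\otimes s^2)+n(s^2\otimes s-s\otimes s^2),$$ with $4(\mu^2-\lambda\nu)=1=4(m^2-ln)$, and such that $\{\!\{t,s\}\!\}$ is an arbitrary element of degree at most $2$ of $k\langle s,t\rangle^{\otimes2}$, where $|s|=|t|=1$. Such a bracket is reduced if ($\lambda=\nu=0$, $\mu=\pm\frac12$, or $\mu=0$, $\lambda\ne0$, $\nu=-\frac1{4\lambda}$) and ($l=n=0$, $m=\pm\frac12$,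 or $m=0$, $l\neq0$, $n=-\frac1{4l}$). Let $Q_1$ be the quiver with vertices $1,2$ and one arrow $t:1\to2$, and let $\bar Q_1$ be its double, with the additional arrow $s:2\to1$; paths are read from left to right and $e_1,e_2$ are the idempotents of the vertices. Theorem. Every double quasi-Poisson bracket on $k\langle s,t\rangle$ of the above form is isomorphic, by an automorphism of $k\langle s,t\rangle$, to a reduced double quasi-Poisson bracket $P$ of the same form for which at least one of the following holds. (a) $P$ is isomorphic to the double bracket obtained by fusing the two idempotents (in one of the two directions) of $k[t]\oplus k[s]$, where both summands carry double quasi-Poisson brackets and mixed brackets are zero. (b) $P$ is isomorphic to a double bracket obtained by two successive fusions from $kQ_1\oplus k[s]$, where both summands carry double quasi-Poisson brackets (over $ke_1\oplus ke_2$ and over $k$) and mixed brackets are zero. (c) $P$ is isomorphic to a double bracket obtained by fusing the idempotents $e_1,e_2$ (in one of the two directions) in $k\bar Q_1$, for some double quasi-Poisson bracket on $k\bar Q_1$ over $ke_1\oplus ke_2$. (d) The double bracket induced by $P$ on the universal localisation of $k\langle s,t\rangle$ at $\{s,t\}$ is isomorphic to a double bracket obtained by fusing the idempotents $e_1,e_2$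 (in one of the two directions) in the universal localisation of $k\bar Q_1$ at $\{ts+e_2,\,st+e_1\}$ (that is, $ts$ and $st$ are locally inverted), equipped with the double bracket induced by some double quasi-Poisson bracket on $k\bar Q_1$ over $ke_1\oplus ke_2$. -/

import Mathlib

open scoped TensorProduct

noncomputable section

namespace DoubleQP

universe u v w

/-! ### Double brackets -/

section Brackets

variable (k : Type u) (A : Type v) [CommRing k] [Ring A] [Algebra k A]

/-- A double bracket on the `k`-algebra `A`: a `k`-bilinear map `A × A → A ⊗ A` which is cyclically
antisymmetric and a derivation in its second argument for the outer bimodule structure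
`b · (x ⊗ y) · c = b x ⊗ y c`. -/
structure DoubleBracket where
  toFun : A →ₗ[k] A →ₗ[k] A ⊗[k] A
  antisymm : ∀ a b : A, toFun a b = -TensorProduct.comm k A A (toFun b a)
  leibniz : ∀ a b c : A,
    toFun a (b * c) = toFun a b * ((1 : A) ⊗ₜ[k] c) + (b ⊗ₜ[k] (1 : A)) * toFun a c

/-- A double derivation `A → A ⊗ A` (for the outer bimodule structure on `A ⊗ A`). -/
structure DoubleDerivation where
  toFun : A →ₗ[k] A ⊗[k] A
  leibniz : ∀ b c : A,
    toFun (b * c) = toFun b * ((1 : A) ⊗ₜ[k] c) + (b ⊗ₜ[k] (1 : A)) * toFun c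

instance : CoeFun (DoubleBracket k A) (fun _ => A → A → A ⊗[k] A) := ⟨fun br a b => br.toFun a b⟩

instance : CoeFun (DoubleDerivation k A) (fun _ => A → A ⊗[k] A) := ⟨fun d a => d.toFun a⟩

/-- `τ (a₁ ⊗ a₂ ⊗ a₃) = a₃ ⊗ a₁ ⊗ a₂`. -/
def rot : (A ⊗[k] A) ⊗[k] A →ₗ[k] (A ⊗[k] A) ⊗[k] A :=
  (TensorProduct.assoc k A A A).symm.toLinearMap ∘ₗ
    (TensorProduct.comm k (A ⊗[k] A) A).toLinearMap

variable {k A}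

namespace DoubleBracket

/-- `x ⊗ y ↦ ⦃a, x⦄ ⊗ y`. -/
def left (br : DoubleBracket k A) (a : A) : A ⊗[k] A →ₗ[k] (A ⊗[k] A) ⊗[k] A :=
  (br.toFun a).rTensor A

/-- The triple bracket associated with a double bracket. -/
def triple (br : DoubleBracket k A) (a b c : A) : (A ⊗[k] A) ⊗[k] A :=
  br.left a (br b c) + rot k A (br.left b (br c a)) + rot k A (rot k A (br.left c (br a b)))

/-- With `B = ⊕ k e_s`: the double bracket is `B`-linear (it vanishes if one argument is in `B`), and
its triple bracket is the one prescribed for a double quasi-Poisson bracket over `B`. -/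
structure IsQuasiPoisson {I : Type w} [Fintype I] (e : I → A) (br : DoubleBracket k A) :
    Prop where
  linear_left : ∀ (s : I) (a : A), br (e s) a = 0
  linear_right : ∀ (s : I) (a : A), br a (e s) = 0
  triple_eq : ∀ a b c : A, (4 : k) • br.triple a b c = ∑ s : I,
    ((c * e s * a) ⊗ₜ[k] (e s * b) ⊗ₜ[k] e s
      - (c * e s * a) ⊗ₜ[k] e s ⊗ₜ[k] (b * e s)
      - (c * e s) ⊗ₜ[k] (a * e s * b) ⊗ₜ[k] e s
      + (c * e s) ⊗ₜ[k] (a * e s) ⊗ₜ[k] (b * e s)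
      - (e s * a) ⊗ₜ[k] (e s * b) ⊗ₜ[k] (e s * c)
      + (e s * a) ⊗ₜ[k] e s ⊗ₜ[k] (b * e s * c)
      + e s ⊗ₜ[k] (a * e s * b) ⊗ₜ[k] (e s * c)
      - e s ⊗ₜ[k] (a * e s) ⊗ₜ[k] (b * e s * c))

/-- The map `f` is compatible with the double brackets on its source and target. -/
def Compatible {A' : Type w} [Ring A'] [Algebra k A'] (br : DoubleBracket k A)
    (br' : DoubleBracket k A') (f : A →ₐ[k] A') : Prop :=
  ∀ a b : A, TensorProduct.map f.toLinearMap f.toLinearMap (br a b) = br' (f a) (f b)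

/-- Isomorphism of algebras with double bracket. -/
def Isomorphic {A' : Type w} [Ring A'] [Algebra k A'] (br : DoubleBracket k A)
    (br' : DoubleBracket k A') : Prop :=
  ∃ ψ : A ≃ₐ[k] A', br.Compatible br' (ψ : A →ₐ[k] A')

section Prod

variable {A' : Type w} [Ring A'] [Algebra k A']

/-- The inclusion `A ⊗ A → (A × A') ⊗ (A × A')`. -/
def incl₁ (k : Type u) (A : Type v) (A' : Type w) [CommRing k] [Ring A] [Algebra k A] [Ring A']
    [Algebra k A'] : A ⊗[k] A →ₗ[k] (A × A') ⊗[k] (A × A') :=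
  TensorProduct.map (LinearMap.inl k A A') (LinearMap.inl k A A')

/-- The inclusion `A' ⊗ A' → (A × A') ⊗ (A × A')`. -/
def incl₂ (k : Type u) (A : Type v) (A' : Type w) [CommRing k] [Ring A] [Algebra k A] [Ring A']
    [Algebra k A'] : A' ⊗[k] A' →ₗ[k] (A × A') ⊗[k] (A × A') :=
  TensorProduct.map (LinearMap.inr k A A') (LinearMap.inr k A A')

theorem incl₁_mul_right (d : A ⊗[k] A) (c : A × A') :
    incl₁ k A A' (d * ((1 : A) ⊗ₜ[k] c.1)) = incl₁ k A A' d * ((1 : A × A') ⊗ₜ[k] c) := by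
  induction d with
  | zero => simp
  | add x y hx hy => simp only [add_mul, map_add, hx, hy]
  | tmul x y => simp [incl₁, Prod.mul_def]

theorem incl₁_mul_left (d : A ⊗[k] A) (c : A × A') :
    incl₁ k A A' ((c.1 ⊗ₜ[k] (1 : A)) * d) = (c ⊗ₜ[k] (1 : A × A')) * incl₁ k A A' d := by
  induction d with
  | zero => simp
  | add x y hx hy => simp only [mul_add, map_add, hx, hy]
  | tmul x y => simp [incl₁, Prod.mul_def]

theorem incl₂_mul_right (d : A' ⊗[k] A') (c : A × A') :
    incl₂ k A A' (d * ((1 : A') ⊗ₜ[k] c.2)) = incl₂ k A A' d * ((1 : A × A') ⊗ₜ[k] c) := by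
  induction d with
  | zero => simp
  | add x y hx hy => simp only [add_mul, map_add, hx, hy]
  | tmul x y => simp [incl₂, Prod.mul_def]

theorem incl₂_mul_left (d : A' ⊗[k] A') (c : A × A') :
    incl₂ k A A' ((c.2 ⊗ₜ[k] (1 : A')) * d) = (c ⊗ₜ[k] (1 : A × A')) * incl₂ k A A' d := by
  induction d with
  | zero => simp
  | add x y hx hy => simp only [mul_add, map_add, hx, hy]
  | tmul x y => simp [incl₂, Prod.mul_def]

theorem incl₁_comm (d : A ⊗[k] A) :
    incl₁ k A A' (TensorProduct.comm k A A d) = TensorProduct.comm k _ _ (incl₁ k A A' d) := by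
  induction d with
  | zero => simp
  | add x y hx hy => simp only [map_add, hx, hy]
  | tmul x y => simp [incl₁]

theorem incl₂_comm (d : A' ⊗[k] A') :
    incl₂ k A A' (TensorProduct.comm k A' A' d) = TensorProduct.comm k _ _ (incl₂ k A A' d) := by
  induction d with
  | zero => simp
  | add x y hx hy => simp only [map_add, hx, hy]
  | tmul x y => simp [incl₂]

/-- The double bracket on `A × A'` extending those on `A` and `A'`, with mixed brackets zero. -/
def prod (br : DoubleBracket k A) (br' : DoubleBracket k A') : DoubleBracket k (A × A') where
  toFun :=
    (br.toFun.compl₁₂ (LinearMap.fst k A A') (LinearMap.fst k A A')).compr₂ (incl₁ k A A') +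
    (br'.toFun.compl₁₂ (LinearMap.snd k A A') (LinearMap.snd k A A')).compr₂ (incl₂ k A A')
  antisymm a b := by
    simp only [LinearMap.add_apply, LinearMap.compr₂_apply, LinearMap.compl₁₂_apply,
      LinearMap.fst_apply, LinearMap.snd_apply]
    rw [br.antisymm a.1 b.1, br'.antisymm a.2 b.2, map_neg, map_neg, map_add, incl₁_comm,
      incl₂_comm, neg_add]
  leibniz a b c := by
    simp only [LinearMap.add_apply, LinearMap.compr₂_apply, LinearMap.compl₁₂_apply,
      LinearMap.fst_apply, LinearMap.snd_apply, Prod.fst_mul, Prod.snd_mul]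
    rw [br.leibniz, br'.leibniz, map_add, map_add, incl₁_mul_right, incl₁_mul_left,
      incl₂_mul_right, incl₂_mul_left, add_mul, mul_add]
    abel

end Prod

end DoubleBracket

/-- For `X = δ₁(b)` and `Y = δ₂(c)`, the element `Y' X'' ⊗ X' Y''` of `A ⊗ A`. -/
def cross (X : A ⊗[k] A) : A ⊗[k] A →ₗ[k] A ⊗[k] A :=
  TensorProduct.lift (LinearMap.mk₂ k
    (fun y z => (y ⊗ₜ[k] (1 : A)) * TensorProduct.comm k A A X * ((1 : A) ⊗ₜ[k] z))
    (fun y y' z => by simp only [TensorProduct.add_tmul, add_mul])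
    (fun c y z => by simp only [← TensorProduct.smul_tmul', smul_mul_assoc])
    (fun y z z' => by simp only [TensorProduct.tmul_add, mul_add])
    (fun c y z => by simp only [TensorProduct.tmul_smul, mul_smul_comm]))

end Brackets

/-! ### Adjoining generators and relations to an algebra; universal localisation -/

section Adjoin

variable (k : Type u) (A : Type v) [CommRing k] [Ring A] [Algebra k A] (X : Type w)

/-- The relations of `A` (making `a ↦ ι (inl a)` a morphism of `k`-algebras), together with `R`. -/
inductive AdjoinRel (R : FreeAlgebra k (A ⊕ X) → FreeAlgebra k (A ⊕ X) → Prop) :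
    FreeAlgebra k (A ⊕ X) → FreeAlgebra k (A ⊕ X) → Prop
  | add (a b : A) : AdjoinRel R (FreeAlgebra.ι k (Sum.inl (a + b)))
      (FreeAlgebra.ι k (Sum.inl a) + FreeAlgebra.ι k (Sum.inl b))
  | mul (a b : A) : AdjoinRel R (FreeAlgebra.ι k (Sum.inl (a * b)))
      (FreeAlgebra.ι k (Sum.inl a) * FreeAlgebra.ι k (Sum.inl b))
  | scalar (c : k) : AdjoinRel R (FreeAlgebra.ι k (Sum.inl (algebraMap k A c)))
      (algebraMap k (FreeAlgebra k (A ⊕ X)) c)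
  | rel {x y : FreeAlgebra k (A ⊕ X)} (h : R x y) : AdjoinRel R x y

variable {A X}

/-- The `k`-algebra obtained from `A` by freely adjoining generators indexed by `X` and then
imposing the relations `R`. -/
def Adjoin (R : FreeAlgebra k (A ⊕ X) → FreeAlgebra k (A ⊕ X) → Prop) : Type (max u v w) :=
  RingQuot (AdjoinRel k A X R)

variable (R : FreeAlgebra k (A ⊕ X) → FreeAlgebra k (A ⊕ X) → Prop)

instance : Ring (Adjoin k R) := inferInstanceAs (Ring (RingQuot (AdjoinRel k A X R)))

instance : Algebra k (Adjoin k R) := inferInstanceAs (Algebra k (RingQuot (AdjoinRel k A X R)))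

/-- The quotient map onto `Adjoin k R`. -/
def Adjoin.mk : FreeAlgebra k (A ⊕ X) →ₐ[k] Adjoin k R :=
  RingQuot.mkAlgHom k (AdjoinRel k A X R)

theorem Adjoin.mk_eq {x y : FreeAlgebra k (A ⊕ X)} (h : AdjoinRel k A X R x y) :
    Adjoin.mk k R x = Adjoin.mk k R y :=
  RingQuot.mkAlgHom_rel k h

/-- The canonical morphism `A → Adjoin k R`. -/
def Adjoin.of : A →ₐ[k] Adjoin k R :=
  AlgHom.ofLinearMap
    { toFun := fun a => Adjoin.mk k R (FreeAlgebra.ι k (Sum.inl a))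
      map_add' := fun a b => by
        rw [Adjoin.mk_eq k R (AdjoinRel.add a b), map_add]
      map_smul' := fun c a => by
        rw [Algebra.smul_def, Adjoin.mk_eq k R (AdjoinRel.mul _ _), map_mul,
          Adjoin.mk_eq k R (AdjoinRel.scalar c), AlgHom.commutes, RingHom.id_apply,
          ← Algebra.smul_def] }
    (by
      have h := Adjoin.mk_eq k R (AdjoinRel.scalar 1)
      rwa [map_one, map_one, map_one] at h)
    (fun a b => by
      change Adjoin.mk k R _ = Adjoin.mk k R _ * Adjoin.mk k R _
      rw [Adjoin.mk_eq k R (AdjoinRel.mul a b), map_mul])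

/-- The adjoined generators. -/
def Adjoin.gen (x : X) : Adjoin k R := Adjoin.mk k R (FreeAlgebra.ι k (Sum.inr x))

/-- Relations making the adjoined generator `s` a two-sided inverse of `s`, for `s ∈ S`. -/
inductive LocRel (S : Set A) : FreeAlgebra k (A ⊕ S) → FreeAlgebra k (A ⊕ S) → Prop
  | mul_inv (s : S) :
      LocRel S (FreeAlgebra.ι k (Sum.inl s.1) * FreeAlgebra.ι k (Sum.inr s)) 1
  | inv_mul (s : S) :
      LocRel S (FreeAlgebra.ι k (Sum.inr s) * FreeAlgebra.ι k (Sum.inl s.1)) 1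

/-- The universal localisation of `A` at the set `S`. -/
abbrev Loc (S : Set A) : Type (max u v) := Adjoin k (LocRel k S)

/-- The canonical morphism from `A` to its universal localisation. -/
abbrev Loc.of (S : Set A) : A →ₐ[k] Loc k S := Adjoin.of k (LocRel k S)

end Adjoin

/-! ### Corners -/

section Corner

variable {k : Type u} {A : Type v} [CommRing k] [Ring A] [Algebra k A] {p : A}

/-- The element `p a p` of the corner algebra `p A p`. -/
def cornerMk (h : IsIdempotentElem p) (a : A) : h.Corner := ⟨p * a * p, a, rfl⟩

instance (h : IsIdempotentElem p) : SMul k h.Corner where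
  smul c x := ⟨c • x.1, by
    obtain ⟨_, a, rfl⟩ := x
    exact ⟨c • a, by simp only [mul_smul_comm, smul_mul_assoc]⟩⟩

instance (h : IsIdempotentElem p) : Module k h.Corner where
  one_smul x := Subtype.ext (one_smul k x.1)
  mul_smul c d x := Subtype.ext (mul_smul c d x.1)
  smul_zero c := Subtype.ext (smul_zero c)
  smul_add c x y := Subtype.ext (smul_add c x.1 y.1)
  add_smul c d x := Subtype.ext (add_smul c d x.1)
  zero_smul x := Subtype.ext (zero_smul k x.1)

instance (h : IsIdempotentElem p) : Algebra k h.Corner :=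
  Algebra.ofModule (fun c x y => Subtype.ext (smul_mul_assoc c x.1 y.1))
    (fun c x y => Subtype.ext (mul_smul_comm c x.1 y.1))

/-- The (non-unital) inclusion of the corner `p A p` in `A`. -/
def cornerIncl (k : Type u) [CommRing k] [Algebra k A] (h : IsIdempotentElem p) :
    h.Corner →ₗ[k] A where
  toFun x := x.1
  map_add' _ _ := rfl
  map_smul' _ _ := rfl

end Corner

/-! ### Fusion -/

section Fusion

variable (k : Type u) {A : Type v} [CommRing k] [Ring A] [Algebra k A]
variable {I : Type w} [Fintype I] {e : I → A}

/-- Relations for adjoining matrix units `e₁₂` (`false`) and `e₂₁` (`true`) to `A`, the diagonal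
matrix units being `e₁₁ = p` and `e₂₂ = q`. For orthogonal idempotents `p, q` the result is the
free product of `A` and `Mat₂(k) ⊕ k` over `k p ⊕ k q ⊕ k (1 - p - q)`. -/
inductive MatRel (p q : A) : FreeAlgebra k (A ⊕ Bool) → FreeAlgebra k (A ⊕ Bool) → Prop
  | left₁₂ : MatRel p q (FreeAlgebra.ι k (Sum.inl p) * FreeAlgebra.ι k (Sum.inr false))
      (FreeAlgebra.ι k (Sum.inr false))
  | right₁₂ : MatRel p q (FreeAlgebra.ι k (Sum.inr false) * FreeAlgebra.ι k (Sum.inl q))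
      (FreeAlgebra.ι k (Sum.inr false))
  | left₂₁ : MatRel p q (FreeAlgebra.ι k (Sum.inl q) * FreeAlgebra.ι k (Sum.inr true))
      (FreeAlgebra.ι k (Sum.inr true))
  | right₂₁ : MatRel p q (FreeAlgebra.ι k (Sum.inr true) * FreeAlgebra.ι k (Sum.inl p))
      (FreeAlgebra.ι k (Sum.inr true))
  | mul₁₂₂₁ : MatRel p q (FreeAlgebra.ι k (Sum.inr false) * FreeAlgebra.ι k (Sum.inr true))
      (FreeAlgebra.ι k (Sum.inl p))
  | mul₂₁₁₂ : MatRel p q (FreeAlgebra.ι k (Sum.inr true) * FreeAlgebra.ι k (Sum.inr false))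
      (FreeAlgebra.ι k (Sum.inl q))

/-- The extension algebra `Ā` of `A` along the pair of idempotents `(p, q)`. -/
abbrev Ext (p q : A) : Type (max u v) := Adjoin k (MatRel k p q)

/-- The canonical morphism `A → Ā`. -/
abbrev Ext.of (p q : A) : A →ₐ[k] Ext k p q := Adjoin.of k (MatRel k p q)

/-- The matrix unit `e₁₂ ∈ Ā`. -/
abbrev Ext.e₁₂ (p q : A) : Ext k p q := Adjoin.gen k (MatRel k p q) false

/-- The matrix unit `e₂₁ ∈ Ā`. -/
abbrev Ext.e₂₁ (p q : A) : Ext k p q := Adjoin.gen k (MatRel k p q) true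

/-- The idempotent `ε = 1 - e_j` of the extension algebra of `A` along `(e_i, e_j)`. -/
def fusEps (e : I → A) (i j : I) : Ext k (e i) (e j) := 1 - Ext.of k (e i) (e j) (e j)

theorem fusEps_idem (he : CompleteOrthogonalIdempotents e) (i j : I) :
    IsIdempotentElem (fusEps k e i j) :=
  ((he.idem j).map (Ext.of k (e i) (e j))).one_sub

/-- The fusion algebra `A^f = ε Ā ε` obtained by fusing `e_j` onto `e_i`. -/
abbrev FusionAlgebra (he : CompleteOrthogonalIdempotents e) (i j : I) : Type (max u v) :=
  (fusEps_idem k he i j).Corner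

/-- The idempotents `e_s`, `s ≠ j`, in the fusion algebra. -/
def fusedIdem (he : CompleteOrthogonalIdempotents e) (i j : I) :
    {s : I // s ≠ j} → FusionAlgebra k he i j :=
  fun s => cornerMk (fusEps_idem k he i j) (Ext.of k (e i) (e j) (e s))

theorem fusedIdem_val (he : CompleteOrthogonalIdempotents e) (i j : I) (s : {s : I // s ≠ j}) :
    (fusedIdem k he i j s).1 = Ext.of k (e i) (e j) (e s) := by
  change fusEps k e i j * _ * fusEps k e i j = _
  have h1 := he.ortho s.2
  have h2 := he.ortho s.2.symm
  simp only [fusEps, sub_mul, mul_sub, one_mul, mul_one, ← map_mul]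
  simp only at h1 h2
  rw [h1, h2]
  simp

theorem fusedIdem_complete [DecidableEq I] (he : CompleteOrthogonalIdempotents e) (i j : I) :
    CompleteOrthogonalIdempotents (fusedIdem k he i j) where
  idem s := by
    apply Subtype.ext
    change (fusedIdem k he i j s).1 * (fusedIdem k he i j s).1 = (fusedIdem k he i j s).1
    rw [fusedIdem_val, ← map_mul, (he.idem s).eq]
  ortho s t hst := by
    apply Subtype.ext
    change (fusedIdem k he i j s).1 * (fusedIdem k he i j t).1 = 0
    have h : (e s.1 * e t.1) = 0 := he.ortho (fun h => hst (Subtype.ext h))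
    rw [fusedIdem_val, fusedIdem_val, ← map_mul, h, map_zero]
  complete := by
    apply Subtype.ext
    change cornerIncl k (fusEps_idem k he i j) _ = fusEps k e i j
    rw [map_sum]
    have h : ∀ s, cornerIncl k (fusEps_idem k he i j) (fusedIdem k he i j s)
        = Ext.of k (e i) (e j) (e s.1) := fusedIdem_val k he i j
    simp only [h]
    rw [← map_sum, fusEps, ← map_one (Ext.of k (e i) (e j)), ← he.complete, ← map_sub]
    congr 1
    rw [eq_sub_iff_add_eq, ← Finset.sum_erase_add _ _ (Finset.mem_univ j)]
    congr 1
    exact Finset.sum_subtype _ (by simp) _ |>.symm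

variable {k}

/-- A double derivation of `Ā` is the extension of the gauge element
`E_s (a) = a e_s ⊗ e_s - e_s ⊗ e_s a` of `A` which vanishes on the matrix units. -/
def ExtendsGauge (e : I → A) (i j s : I) (δ : DoubleDerivation k (Ext k (e i) (e j))) : Prop :=
  (∀ a : A, δ (Ext.of k (e i) (e j) a) =
    TensorProduct.map (Ext.of k (e i) (e j)).toLinearMap (Ext.of k (e i) (e j)).toLinearMap
      ((a * e s) ⊗ₜ[k] e s - e s ⊗ₜ[k] (e s * a))) ∧
  δ (Ext.e₁₂ k (e i) (e j)) = 0 ∧ δ (Ext.e₂₁ k (e i) (e j)) = 0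

/-- A double bracket on `Ā` is the extension of `br` which vanishes as soon as one argument is a
matrix unit. -/
def ExtendsBracket (e : I → A) (i j : I) (br : DoubleBracket k A)
    (brE : DoubleBracket k (Ext k (e i) (e j))) : Prop :=
  br.Compatible brE (Ext.of k (e i) (e j)) ∧
  (∀ x, brE x (Ext.e₁₂ k (e i) (e j)) = 0 ∧ brE (Ext.e₁₂ k (e i) (e j)) x = 0) ∧
  (∀ x, brE x (Ext.e₂₁ k (e i) (e j)) = 0 ∧ brE (Ext.e₂₁ k (e i) (e j)) x = 0)

/-- On values of a double derivation `δ` of `Ā` on `A^f = ε Ā ε`, this is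
`Tr(δ) = ε δ ε + ε e₁₂ δ e₂₁ ε` for the inner bimodule structure
`b * (x ⊗ y) * c = x c ⊗ b y`, with outer factors cut down to `ε`. -/
def trace (e : I → A) (i j : I) (X : Ext k (e i) (e j) ⊗[k] Ext k (e i) (e j)) :
    Ext k (e i) (e j) ⊗[k] Ext k (e i) (e j) :=
  let ε := fusEps k e i j
  (ε ⊗ₜ[k] ε) * X * (ε ⊗ₜ[k] ε) +
    (ε ⊗ₜ[k] (ε * Ext.e₁₂ k (e i) (e j))) * X * ((Ext.e₂₁ k (e i) (e j) * ε) ⊗ₜ[k] ε)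

/-- `brF` is the double bracket `⦃-,-⦄ + ⦃-,-⦄_fus` on the fusion algebra obtained by fusing `e_j`
onto `e_i`: the first term is induced by `br` through `Ā`, and the second one is the double bracket
defined by the bivector `-½ Tr(E_i) Tr(E_j)`. The equation is written in `Ā ⊗ Ā`; over a field,
`A^f ⊗ A^f → Ā ⊗ Ā` is injective. The extensions to `Ā` are determined by `br` and `e`. -/
def IsFusion {k : Type u} [Field k] [Algebra k A] (he : CompleteOrthogonalIdempotents e) (i j : I)
    (br : DoubleBracket k A) (brF : DoubleBracket k (FusionAlgebra k he i j)) : Prop :=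
  ∃ (brE : DoubleBracket k (Ext k (e i) (e j))) (E₁ E₂ : DoubleDerivation k (Ext k (e i) (e j))),
    ExtendsBracket e i j br brE ∧ ExtendsGauge e i j i E₁ ∧ ExtendsGauge e i j j E₂ ∧
    ∀ x y : FusionAlgebra k he i j,
      TensorProduct.map (cornerIncl k (fusEps_idem k he i j)) (cornerIncl k (fusEps_idem k he i j))
        (brF x y) =
      brE x.1 y.1 - (1 / 2 : k) •
        (cross (trace e i j (E₁ x.1)) (trace e i j (E₂ y.1))
          - cross (trace e i j (E₂ x.1)) (trace e i j (E₁ y.1)))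

end Fusion

/-! ### Idempotents in products and path algebras -/

section Idempotents

variable {A : Type u} {A' : Type v} [Ring A] [Ring A']

/-- The one-element family `(1)`, for algebras over `B = k`. -/
def unitIdem (A : Type u) [Ring A] : Unit → A := fun _ => 1

theorem unitIdem_complete (A : Type u) [Ring A] : CompleteOrthogonalIdempotents (unitIdem A) where
  idem _ := mul_one 1
  ortho _ _ h := (h rfl).elim
  complete := by simp [unitIdem]

/-- The idempotents `(e_s, 0)` and `(0, e'_s)` in `A × A'`. -/
def prodIdem {I J : Type} (e : I → A) (e' : J → A') : I ⊕ J → A × A' :=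
  Sum.elim (fun s => (e s, 0)) (fun s => (0, e' s))

theorem prodIdem_complete {I J : Type} [Fintype I] [Fintype J] {e : I → A} {e' : J → A'}
    (he : CompleteOrthogonalIdempotents e) (he' : CompleteOrthogonalIdempotents e') :
    CompleteOrthogonalIdempotents (prodIdem e e') where
  idem s := by
    rcases s with s | s
    · exact Prod.ext (he.idem s) (mul_zero _)
    · exact Prod.ext (mul_zero _) (he'.idem s)
  ortho s t h := by
    rcases s with s | s <;> rcases t with t | t
    · exact Prod.ext (he.ortho (fun h' => h (by rw [h']))) (mul_zero _)
    · exact Prod.ext (mul_zero _) (zero_mul _)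
    · exact Prod.ext (zero_mul _) (mul_zero _)
    · exact Prod.ext (mul_zero _) (he'.ortho (fun h' => h (by rw [h'])))
  complete := by
    rw [Fintype.sum_sum_type]
    apply Prod.ext
    · simp [prodIdem, Prod.fst_sum, he.complete]
    · simp [prodIdem, Prod.snd_sum, he'.complete]

end Idempotents

section PathAlgebra

variable (k : Type u) [CommRing k] {V E : Type} [Fintype V] (tail head : E → V)

/-- Relations of the path algebra of the quiver with vertices `V` and arrows `E`; paths are read
from left to right. -/
inductive PathRel : FreeAlgebra k (V ⊕ E) → FreeAlgebra k (V ⊕ E) → Prop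
  | idem (v : V) : PathRel (FreeAlgebra.ι k (Sum.inl v) * FreeAlgebra.ι k (Sum.inl v))
      (FreeAlgebra.ι k (Sum.inl v))
  | ortho (v w : V) (h : v ≠ w) :
      PathRel (FreeAlgebra.ι k (Sum.inl v) * FreeAlgebra.ι k (Sum.inl w)) 0
  | complete : PathRel (∑ v : V, FreeAlgebra.ι k (Sum.inl v)) 1
  | tail (a : E) : PathRel (FreeAlgebra.ι k (Sum.inl (tail a)) * FreeAlgebra.ι k (Sum.inr a))
      (FreeAlgebra.ι k (Sum.inr a))
  | head (a : E) : PathRel (FreeAlgebra.ι k (Sum.inr a) * FreeAlgebra.ι k (Sum.inl (head a)))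
      (FreeAlgebra.ι k (Sum.inr a))

/-- The path algebra of a quiver. -/
def PathAlgebra : Type u := RingQuot (PathRel k tail head)

instance : Ring (PathAlgebra k tail head) := inferInstanceAs (Ring (RingQuot (PathRel k tail head)))

instance : Algebra k (PathAlgebra k tail head) :=
  inferInstanceAs (Algebra k (RingQuot (PathRel k tail head)))

/-- The quotient map onto the path algebra. -/
def PathAlgebra.mk : FreeAlgebra k (V ⊕ E) →ₐ[k] PathAlgebra k tail head :=
  RingQuot.mkAlgHom k (PathRel k tail head)

theorem PathAlgebra.mk_eq {x y : FreeAlgebra k (V ⊕ E)} (h : PathRel k tail head x y) :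
    PathAlgebra.mk k tail head x = PathAlgebra.mk k tail head y :=
  RingQuot.mkAlgHom_rel k h

/-- The idempotent of a vertex. -/
def PathAlgebra.vertex (v : V) : PathAlgebra k tail head :=
  PathAlgebra.mk k tail head (FreeAlgebra.ι k (Sum.inl v))

/-- The element of the path algebra given by an arrow. -/
def PathAlgebra.arrow (a : E) : PathAlgebra k tail head :=
  PathAlgebra.mk k tail head (FreeAlgebra.ι k (Sum.inr a))

theorem PathAlgebra.vertex_complete :
    CompleteOrthogonalIdempotents (PathAlgebra.vertex k tail head) where
  idem v := by
    have h := PathAlgebra.mk_eq k tail head (PathRel.idem v)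
    rwa [map_mul] at h
  ortho v w hvw := by
    have h := PathAlgebra.mk_eq k tail head (PathRel.ortho v w hvw)
    rwa [map_mul, map_zero] at h
  complete := by
    have h := PathAlgebra.mk_eq k tail head PathRel.complete
    rwa [map_sum, map_one] at h

end PathAlgebra

section OneArrow

variable (k : Type u) [CommRing k]

/-- The path algebra of the quiver `Q₁` with vertices `0`, `1` and one arrow `t : 0 → 1`. -/
abbrev KQ₁ : Type u := PathAlgebra k (fun _ : Unit => (0 : Fin 2)) (fun _ : Unit => (1 : Fin 2))

/-- The idempotents of `k Q₁`. -/
abbrev KQ₁.e : Fin 2 → KQ₁ k := PathAlgebra.vertex k _ _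

theorem KQ₁.e_complete : CompleteOrthogonalIdempotents (KQ₁.e k) :=
  PathAlgebra.vertex_complete k _ _

/-- The path algebra of the double of `Q₁`: vertices `0`, `1`, an arrow `t : 0 → 1` (`false`) and
an arrow `s : 1 → 0` (`true`). -/
abbrev KQ₁d : Type u :=
  PathAlgebra k (fun b : Bool => if b then (1 : Fin 2) else 0)
    (fun b : Bool => if b then (0 : Fin 2) else 1)

/-- The idempotents of the path algebra of the double of `Q₁`. -/
abbrev KQ₁d.e : Fin 2 → KQ₁d k := PathAlgebra.vertex k _ _

theorem KQ₁d.e_complete : CompleteOrthogonalIdempotents (KQ₁d.e k) :=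
  PathAlgebra.vertex_complete k _ _

/-- The arrow `t : 0 → 1`. -/
def KQ₁d.t : KQ₁d k := PathAlgebra.arrow k _ _ false

/-- The arrow `s : 1 → 0`. -/
def KQ₁d.s : KQ₁d k := PathAlgebra.arrow k _ _ true

/-- Inverting `t s + e_1` and `s t + e_0` amounts to adding local inverses of `t s` in the corner of
`e_0` and of `s t` in the corner of `e_1`. -/
def KQ₁d.locSet : Set (KQ₁d k) :=
  {KQ₁d.t k * KQ₁d.s k + KQ₁d.e k 1, KQ₁d.s k * KQ₁d.t k + KQ₁d.e k 0}

/-- The algebra obtained from the path algebra of the double of `Q₁` by locally inverting `t s` and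
`s t`. -/
abbrev KQ₁dLoc : Type u := Loc k (KQ₁d.locSet k)

/-- The idempotents of this localisation. -/
def KQ₁dLoc.e : Fin 2 → KQ₁dLoc k := fun v => Loc.of k (KQ₁d.locSet k) (KQ₁d.e k v)

theorem KQ₁dLoc.e_complete : CompleteOrthogonalIdempotents (KQ₁dLoc.e k) :=
  (KQ₁d.e_complete k).map (Loc.of k (KQ₁d.locSet k)).toRingHom

end OneArrow

/-! ### Double brackets on `k⟨s, t⟩` -/

section Free2

variable (k : Type u) [Field k]

/-- The free algebra `k⟨s, t⟩`. -/
abbrev F2 : Type u := FreeAlgebra k (Fin 2)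

/-- The generator `s`. -/
def F2.s : F2 k := FreeAlgebra.ι k 0

/-- The generator `t`. -/
def F2.t : F2 k := FreeAlgebra.ι k 1

/-- Coefficients of a double bracket of the form under consideration; `a`, `b`, `g` stand for
`α`, `β`, `γ`, and a final `p` for a prime. -/
structure Coeffs where
  (lam mu nu : k)
  (l m n : k)
  (a0 a0p b0 b0p g0 g1 : k)
  (a1 a1p a2 a2p a3 a3p : k)
  (b1 b1p b2 b2p g : k)

variable {k}

/-- `λ (x ⊗ 1 - 1 ⊗ x) + μ (x² ⊗ 1 - 1 ⊗ x²) + ν (x² ⊗ x - x ⊗ x²)`. -/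
def selfTerm (lam mu nu : k) (x : F2 k) : F2 k ⊗[k] F2 k :=
  lam • (x ⊗ₜ[k] 1 - 1 ⊗ₜ[k] x) + mu • ((x * x) ⊗ₜ[k] 1 - 1 ⊗ₜ[k] (x * x)) +
    nu • ((x * x) ⊗ₜ[k] x - x ⊗ₜ[k] (x * x))

/-- The general element of degree at most `2`, which is the value of `⦃t, s⦄`. -/
def mixedTerm (c : Coeffs k) (s t : F2 k) : F2 k ⊗[k] F2 k :=
  c.a0 • ((t * t) ⊗ₜ[k] 1) + c.a0p • (1 ⊗ₜ[k] (t * t)) +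
  c.b0 • ((s * s) ⊗ₜ[k] 1) + c.b0p • (1 ⊗ₜ[k] (s * s)) +
  c.g0 • (t ⊗ₜ[k] t) + c.g1 • (s ⊗ₜ[k] s) +
  c.a1 • ((t * s) ⊗ₜ[k] 1) + c.a1p • ((s * t) ⊗ₜ[k] 1) +
  c.a2 • (t ⊗ₜ[k] s) + c.a2p • (s ⊗ₜ[k] t) +
  c.a3 • (1 ⊗ₜ[k] (t * s)) + c.a3p • (1 ⊗ₜ[k] (s * t)) +
  c.b1 • (t ⊗ₜ[k] 1) + c.b1p • (1 ⊗ₜ[k] t) +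
  c.b2 • (s ⊗ₜ[k] 1) + c.b2p • (1 ⊗ₜ[k] s) + c.g • (1 ⊗ₜ[k] 1)

/-- The double bracket on `k⟨s, t⟩` has the form under consideration, with coefficients `c`. -/
structure HasForm (c : Coeffs k) (br : DoubleBracket k (F2 k)) : Prop where
  disc_t : 4 * (c.mu ^ 2 - c.lam * c.nu) = 1
  disc_s : 4 * (c.m ^ 2 - c.l * c.n) = 1
  tt : br (F2.t k) (F2.t k) = selfTerm c.lam c.mu c.nu (F2.t k)
  ss : br (F2.s k) (F2.s k) = selfTerm c.l c.m c.n (F2.s k)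
  ts : br (F2.t k) (F2.s k) = mixedTerm c (F2.s k) (F2.t k)

/-- Reduced triples of coefficients: `λ = ν = 0`, `μ = ±1/2`, or `μ = 0`, `ν = -1/(4λ)`, `λ ≠ 0`. -/
def ReducedTriple (lam mu nu : k) : Prop :=
  (lam = 0 ∧ nu = 0 ∧ (mu = 1 / 2 ∨ mu = -(1 / 2))) ∨
    (mu = 0 ∧ lam ≠ 0 ∧ nu = -1 / (4 * lam))

/-- Reducedness of the coefficients of a double bracket. -/
def Coeffs.IsReduced (c : Coeffs k) : Prop :=
  ReducedTriple c.lam c.mu c.nu ∧ ReducedTriple c.l c.m c.n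

/-- `br` is isomorphic to the result of one fusion in `k[t] ⊕ k[s]`, for some double quasi-Poisson
brackets on the two summands. -/
def FusedFromTwoLoops (br : DoubleBracket k (F2 k)) : Prop :=
  ∃ br₁ br₂ : DoubleBracket k (Polynomial k),
    br₁.IsQuasiPoisson (unitIdem _) ∧ br₂.IsQuasiPoisson (unitIdem _) ∧
    ∃ i j : Unit ⊕ Unit, i ≠ j ∧
    ∃ brF : DoubleBracket k (FusionAlgebra k
        (prodIdem_complete (unitIdem_complete (Polynomial k)) (unitIdem_complete (Polynomial k)))
        i j),
      IsFusion _ i j (br₁.prod br₂) brF ∧ brF.Isomorphic br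

/-- `br` is isomorphic to the result of two successive fusions in `k Q₁ ⊕ k[s]` (identifying all
three idempotents), for some double quasi-Poisson brackets on the two summands. -/
def FusedFromArrowAndLoop (br : DoubleBracket k (F2 k)) : Prop :=
  ∃ (br₁ : DoubleBracket k (KQ₁ k)) (br₂ : DoubleBracket k (Polynomial k)),
    br₁.IsQuasiPoisson (KQ₁.e k) ∧ br₂.IsQuasiPoisson (unitIdem _) ∧
    ∃ i j : Fin 2 ⊕ Unit, i ≠ j ∧
    ∃ brF : DoubleBracket k (FusionAlgebra k
        (prodIdem_complete (KQ₁.e_complete k) (unitIdem_complete (Polynomial k))) i j),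
      IsFusion _ i j (br₁.prod br₂) brF ∧
    ∃ i' j' : {x : Fin 2 ⊕ Unit // x ≠ j}, i' ≠ j' ∧
    ∃ brF' : DoubleBracket k (FusionAlgebra k (fusedIdem_complete k
        (prodIdem_complete (KQ₁.e_complete k) (unitIdem_complete (Polynomial k))) i j) i' j'),
      IsFusion _ i' j' brF brF' ∧ brF'.Isomorphic br

/-- `br` is isomorphic to the result of fusing the two idempotents of the path algebra of the double
of `Q₁`, for some double quasi-Poisson bracket on it. -/
def FusedFromDoubleArrow (br : DoubleBracket k (F2 k)) : Prop :=
  ∃ br₁ : DoubleBracket k (KQ₁d k), br₁.IsQuasiPoisson (KQ₁d.e k) ∧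
    ∃ i j : Fin 2, i ≠ j ∧
    ∃ brF : DoubleBracket k (FusionAlgebra k (KQ₁d.e_complete k) i j),
      IsFusion _ i j br₁ brF ∧ brF.Isomorphic br

/-- After localisation of `k⟨s, t⟩` at `{s, t}`, the double bracket `br` is isomorphic to the result
of fusing the two idempotents of the path algebra of the double of `Q₁`, localised at `t s` and
`s t` and equipped with the double bracket induced by some double quasi-Poisson bracket on the path
algebra. -/
def FusedFromDoubleArrowLoc (br : DoubleBracket k (F2 k)) : Prop :=
  ∃ brL : DoubleBracket k (Loc k ({F2.s k, F2.t k} : Set (F2 k))),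
    br.Compatible brL (Loc.of k _) ∧
  ∃ br₁ : DoubleBracket k (KQ₁d k), br₁.IsQuasiPoisson (KQ₁d.e k) ∧
  ∃ br₁L : DoubleBracket k (KQ₁dLoc k), br₁.Compatible br₁L (Loc.of k _) ∧
    ∃ i j : Fin 2, i ≠ j ∧
    ∃ brF : DoubleBracket k (FusionAlgebra k (KQ₁dLoc.e_complete k) i j),
      IsFusion _ i j br₁L brF ∧ brF.Isomorphic brL

end Free2

end DoubleQP

end

open scoped TensorProduct

noncomputable section

namespace DoubleQP

universe u v w x

/-! ### Derivations as upper triangular matrix representations; uniqueness on generators. -/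

section Derivations

variable {k : Type u} [CommRing k] {C : Type v} [Ring C] [Algebra k C] {S : Type w} [Ring S]
  [Algebra k S]

/-! The proof has two halves: a classification of the brackets by their coefficients, and a
realisation of each class as a fusion.

Classification. Both sides of the quasi-Poisson identity are cyclically invariant and are
derivations in the last argument, so the identity is a finite system of polynomial equations in the
coefficients of ⦃t,t⦄, ⦃s,s⦄ and ⦃t,s⦄. Reading off coefficients of the triple brackets of (t,t,s)
and (t,s,s) first gives six equations of the form x² = 0 (`coeffs_vanish`), then quadratic equations
in the remaining unknowns (`coeffs_equations`). Constants bracket to zero, so translating s and t by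
scalars is harmless; the discriminant conditions allow such a translation to make the bracket
reduced (`HasForm.exists_reduced`). For reduced coefficients the equations can be solved: the linear
terms of ⦃t,s⦄ vanish and five families remain (`Coeffs.Equations.noLinear_normalForm`). Exchanging
s and t identifies two of them and normalises signs. The family with a free quadratic form is
brought to a standard one by a linear change of s and t, which exists because the discriminant of
the form is the square 1/4. Four representatives are left (`HasForm.exists_representative`).

Realisation. The fused bracket exists for every bracket that is linear over the idempotents
(`exists_isFusion`). If a is homogeneous with respect to e_j, then a, e₁₂a, ae₂₁ or e₁₂ae₂₁ lies in
the fusion algebra, and `IsFusion.apply` computes the fused bracket of such elements in closed form.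
In each case the images of the arrows and loops define a map from k⟨s,t⟩ to the fusion algebra. It
respects brackets because it does so on s and t. It is injective because a matrix representation of
the unfused algebra induces a left inverse (`exists_fusionHom`), and surjective because it reaches
the components of algebra generators (`surjective_of_components`).

The four representatives correspond to two loops; an arrow with a loop attached at one end, then
closed up; the two arrows of the double quiver, with ⦃t,s⦄ = γ e₂⊗e₁ ± ½(st⊗e₁ + e₂⊗ts); and one
that is reached only after localisation. For the last, inverting one of the two generators turns the
bracket into that of the double quiver with γ = 0, and the same comparison is made between the
localised algebras (`fusedFromDoubleArrowLoc`). -/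

/-- `d` is a derivation from `C` to `S`, regarded as a bimodule through `l` and `r`. -/
def IsDer (l r : C →ₐ[k] S) (d : C →ₗ[k] S) : Prop :=
  ∀ b c, d (b * c) = d b * r c + l b * d c

namespace IsDer

variable {l r : C →ₐ[k] S} {d d' : C →ₗ[k] S}

theorem map_one (h : IsDer l r d) : d 1 = 0 := by
  have := h 1 1
  simpa using this

theorem algebraMap (h : IsDer l r d) (c : k) : d (algebraMap k C c) = 0 := by
  rw [Algebra.algebraMap_eq_smul_one, map_smul, h.map_one, smul_zero]

theorem add (h : IsDer l r d) (h' : IsDer l r d') : IsDer l r (d + d') := fun b c => by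
  simp only [LinearMap.add_apply, h b c, h' b c, add_mul, mul_add]; abel

theorem neg (h : IsDer l r d) : IsDer l r (-d) := fun b c => by
  simp only [LinearMap.neg_apply, h b c, neg_mul, mul_neg]; abel

theorem smul (h : IsDer l r d) (a : k) : IsDer l r (a • d) := fun b c => by
  simp only [LinearMap.smul_apply, h b c, smul_add, smul_mul_assoc, mul_smul_comm]

theorem zero : IsDer l r (0 : C →ₗ[k] S) := fun b c => by simp

theorem comp {C' : Type x} [Ring C'] [Algebra k C'] (h : IsDer l r d) (f : C' →ₐ[k] C) :
    IsDer (l.comp f) (r.comp f) (d ∘ₗ f.toLinearMap) := fun b c => by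
  simp [h (f b) (f c)]

theorem map {S' : Type x} [Ring S'] [Algebra k S'] (h : IsDer l r d) (f : S →ₐ[k] S') :
    IsDer (f.comp l) (f.comp r) (f.toLinearMap ∘ₗ d) := fun b c => by
  simp [h b c]

/-- Multiplication by an element on the left commuting with `l`. -/
theorem mul_left (h : IsDer l r d) {z : S} (hz : ∀ c, z * l c = l c * z) :
    IsDer l r (LinearMap.mulLeft k z ∘ₗ d) := fun b c => by
  simp [h b c, mul_add, ← mul_assoc, hz]

/-- Multiplication by an element on the right commuting with `r`. -/
theorem mul_right (h : IsDer l r d) {z : S} (hz : ∀ c, z * r c = r c * z) :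
    IsDer l r (LinearMap.mulRight k z ∘ₗ d) := fun b c => by
  simp [h b c, add_mul, mul_assoc, hz]

/-- The algebra morphism to matrices attached to a derivation. -/
def toMatrix (h : IsDer l r d) : C →ₐ[k] Matrix (Fin 2) (Fin 2) S :=
  AlgHom.ofLinearMap
    { toFun := fun c => !![l c, d c; 0, r c]
      map_add' := fun b c => by ext i j; fin_cases i <;> fin_cases j <;> simp
      map_smul' := fun a c => by ext i j; fin_cases i <;> fin_cases j <;> simp }
    (by ext i j; fin_cases i <;> fin_cases j <;> simp [h.map_one])
    (fun b c => by ext i j; fin_cases i <;> fin_cases j <;> simp [h b c, add_comm])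

theorem toMatrix_apply (h : IsDer l r d) (c : C) : h.toMatrix c = !![l c, d c; 0, r c] := rfl

/-- Upper triangular morphisms to matrices give derivations. -/
theorem of_matrix (H : C →ₐ[k] Matrix (Fin 2) (Fin 2) S)
    (h0 : ∀ c, H c 0 0 = l c) (h2 : ∀ c, H c 1 1 = r c) (hd : ∀ c, d c = H c 0 1) :
    IsDer l r d := fun b c => by
  rw [hd, map_mul, Matrix.mul_apply, Fin.sum_univ_two, h0, h2, ← hd, ← hd, add_comm]

/-- The elements on which two derivations agree. -/
def eqLocus (h : IsDer l r d) (h' : IsDer l r d') : Subalgebra k C where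
  carrier := {c | d c = d' c}
  mul_mem' {b c} (hb : d b = d' b) (hc : d c = d' c) := show d (b * c) = d' (b * c) by
    rw [h b c, h' b c, hb, hc]
  add_mem' {b c} (hb : d b = d' b) (hc : d c = d' c) := show d (b + c) = d' (b + c) by
    rw [map_add, map_add, hb, hc]
  algebraMap_mem' c := show d _ = d' _ by rw [h.algebraMap, h'.algebraMap]

/-- Differentiate bc = 1 and multiply by l(c) on the left. Derivations that agree on an element
therefore agree on its inverse, which is why `Generates` may close up under inverses. -/
theorem map_inv (h : IsDer l r d) {b c : C} (hbc : b * c = 1) (hcb : c * b = 1) :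
    d c = -(l c * d b * r c) := by
  have h1 := h b c
  rw [hbc, h.map_one] at h1
  have h2 : l c * l b = 1 := by rw [← _root_.map_mul, hcb, _root_.map_one]
  have : l c * (d b * r c + l b * d c) = 0 := by rw [← h1, mul_zero]
  rw [mul_add, ← mul_assoc, ← mul_assoc, h2, one_mul] at this
  rw [eq_neg_iff_add_eq_zero, add_comm, this]

end IsDer

/-- `s` generates `C` as an algebra, when inverses may be taken. -/
def Generates (k : Type u) [CommRing k] {C : Type v} [Ring C] [Algebra k C] (s : Set C) : Prop :=
  ∀ U : Subalgebra k C, s ⊆ U → (∀ b c, b * c = 1 → c * b = 1 → b ∈ U → c ∈ U) → U = ⊤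

theorem Generates.of_adjoin {s : Set C} (h : Algebra.adjoin k s = ⊤) : Generates k s :=
  fun _ hU _ => top_le_iff.1 (h ▸ Algebra.adjoin_le hU)

theorem Generates.ext {s : Set C} (hs : Generates k s) {l r : C →ₐ[k] S} {d d' : C →ₗ[k] S}
    (h : IsDer l r d) (h' : IsDer l r d') (H : ∀ c ∈ s, d c = d' c) : d = d' := by
  have := hs (h.eqLocus h') H (fun b c hbc hcb hb => by
    change d c = d' c
    rw [h.map_inv hbc hcb, h'.map_inv hbc hcb, show d b = d' b from hb])
  ext c
  have hc : c ∈ h.eqLocus h' := this ▸ Algebra.mem_top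
  exact hc

theorem Generates.algHom_ext {s : Set C} (hs : Generates k s) {f g : C →ₐ[k] S}
    (H : ∀ c ∈ s, f c = g c) : f = g := by
  have := hs (AlgHom.equalizer f g) H (fun b c hbc hcb hb => by
    change f c = g c
    have hb : f b = g b := hb
    have h1 : f c * f b = 1 := by rw [← map_mul, hcb, map_one]
    have h2 : g b * g c = 1 := by rw [← map_mul, hbc, map_one]
    exact left_inv_eq_right_inv h1 (hb ▸ h2))
  ext c
  have hc : c ∈ AlgHom.equalizer f g := this ▸ Algebra.mem_top
  exact hc

/-- Existence of derivations of free algebras with given values on the generators. -/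
theorem exists_isDer_freeAlgebra {X : Type x} (l r : FreeAlgebra k X →ₐ[k] S) (w : X → S) :
    ∃ d : FreeAlgebra k X →ₗ[k] S, IsDer l r d ∧ ∀ x, d (FreeAlgebra.ι k x) = w x := by
  let H : FreeAlgebra k X →ₐ[k] Matrix (Fin 2) (Fin 2) S := FreeAlgebra.lift k
    (fun x => !![l (FreeAlgebra.ι k x), w x; 0, r (FreeAlgebra.ι k x)])
  have hι : ∀ x, H (FreeAlgebra.ι k x) =
      !![l (FreeAlgebra.ι k x), w x; 0, r (FreeAlgebra.ι k x)] := fun x => by simp [H]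
  -- The diagonal entries are multiplicative only because the lower left entry vanishes, so all
  -- three statements are proved in one induction.
  have key : ∀ c, H c 0 0 = l c ∧ H c 1 0 = 0 ∧ H c 1 1 = r c := by
    intro c
    induction c using FreeAlgebra.induction with
    | grade0 a =>
      simp [Matrix.algebraMap_matrix_apply]
    | grade1 x => simp [hι]
    | mul a b ha hb => simp [Matrix.mul_apply, Fin.sum_univ_two, ha, hb]
    | add a b ha hb => simp [ha, hb]
  refine ⟨{ toFun := fun c => H c 0 1, map_add' := fun a b => by simp,
            map_smul' := fun a b => by simp }, ?_, fun x => ?_⟩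
  · exact IsDer.of_matrix H (fun c => (key c).1) (fun c => (key c).2.2) (fun c => rfl)
  · simp [hι]

/-- Derivations descend to presented algebras. -/
theorem IsDer.exists_descend {rel : C → C → Prop}
    {l r : RingQuot rel →ₐ[k] S} {d : C →ₗ[k] S}
    (h : IsDer (l.comp (RingQuot.mkAlgHom k rel)) (r.comp (RingQuot.mkAlgHom k rel)) d)
    (hrel : ∀ x y, rel x y → d x = d y) :
    ∃ D : RingQuot rel →ₗ[k] S, IsDer l r D ∧ ∀ x, D (RingQuot.mkAlgHom k rel x) = d x := by
  let H : RingQuot rel →ₐ[k] Matrix (Fin 2) (Fin 2) S := RingQuot.liftAlgHom k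
    ⟨h.toMatrix, fun x y hxy => by
      rw [h.toMatrix_apply, h.toMatrix_apply, hrel x y hxy]
      simp only [AlgHom.comp_apply, RingQuot.mkAlgHom_rel k hxy]⟩
  have hH : ∀ x, H (RingQuot.mkAlgHom k rel x) = h.toMatrix x := fun x => by simp [H]
  refine ⟨{ toFun := fun c => H c 0 1, map_add' := fun a b => by simp,
            map_smul' := fun a b => by simp }, ?_, fun x => ?_⟩
  · refine IsDer.of_matrix H (fun c => ?_) (fun c => ?_) (fun c => rfl)
    · obtain ⟨c, rfl⟩ := RingQuot.mkAlgHom_surjective k rel c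
      rw [hH]; rfl
    · obtain ⟨c, rfl⟩ := RingQuot.mkAlgHom_surjective k rel c
      rw [hH]; rfl
  · change H (RingQuot.mkAlgHom k rel x) 0 1 = _
    rw [hH]; rfl

end Derivations

section Tensor

variable {k : Type u} [CommRing k] {C : Type v} [Ring C] [Algebra k C]

variable (k C) in
/-- `c ↦ c ⊗ 1`. -/
abbrev inL : C →ₐ[k] C ⊗[k] C := Algebra.TensorProduct.includeLeft

variable (k C) in
/-- `c ↦ 1 ⊗ c`. -/
abbrev inR : C →ₐ[k] C ⊗[k] C := Algebra.TensorProduct.includeRight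

theorem inL_mul_inR (b c : C) : inL k C b * inR k C c = inR k C c * inL k C b := by
  simp [inL, inR]

variable (k C) in
/-- The flip as an algebra morphism. -/
abbrev flip : C ⊗[k] C →ₐ[k] C ⊗[k] C := (Algebra.TensorProduct.comm k C C : _ →ₐ[k] _)

theorem comm_eq_flip (x : C ⊗[k] C) : TensorProduct.comm k C C x = flip k C x := rfl

theorem flip_flip (x : C ⊗[k] C) : flip k C (flip k C x) = x := by
  change TensorProduct.comm k C C (TensorProduct.comm k C C x) = x
  exact (TensorProduct.comm k C C).symm_apply_apply x

theorem flip_inL (c : C) : flip k C (inL k C c) = inR k C c := by simp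

theorem flip_inR (c : C) : flip k C (inR k C c) = inL k C c := by simp

theorem flip_comp_inL : (flip k C).comp (inL k C) = inR k C := by ext; simp

theorem flip_comp_inR : (flip k C).comp (inR k C) = inL k C := by ext; simp

end Tensor

/-! ### Double brackets constructed from their values on generators. -/

namespace DoubleBracket

variable {k : Type u} [CommRing k] {C : Type v} [Ring C] [Algebra k C] (br : DoubleBracket k C)

theorem isDer_right (a : C) : IsDer (inL k C) (inR k C) (br.toFun a) := fun b c => br.leibniz a b c

/-- Antisymmetry turns the outer Leibniz rule in the second argument into the inner one in the
first: conjugating by the flip exchanges the two embeddings of C. -/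
theorem isDer_left (c : C) : IsDer (inR k C) (inL k C) (br.toFun.flip c) := by
  have h : br.toFun.flip c = -((flip k C).toLinearMap ∘ₗ br.toFun c) := by
    ext a
    simp only [LinearMap.flip_apply, LinearMap.neg_apply, LinearMap.comp_apply]
    exact br.antisymm a c
  rw [h]
  have := ((br.isDer_right c).map (flip k C)).neg
  rwa [flip_comp_inL, flip_comp_inR] at this

theorem leibniz_left (a b c : C) :
    br.toFun (a * b) c = br.toFun a c * (b ⊗ₜ[k] (1 : C)) + ((1 : C) ⊗ₜ[k] a) * br.toFun b c :=
  br.isDer_left c a b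

/-- Construction of double brackets from their values on generators. -/
theorem exists_of_generators {X : Type w} (g : X → C) (hg : Generates k (Set.range g))
    (v : X → X → C ⊗[k] C) (hv : ∀ x y, v x y = -flip k C (v y x))
    (H₁ : ∀ x, ∃ D : C →ₗ[k] C ⊗[k] C, IsDer (inL k C) (inR k C) D ∧ ∀ y, D (g y) = v x y)
    (H₂ : ∀ D : X → C →ₗ[k] C ⊗[k] C, (∀ x, IsDer (inL k C) (inR k C) (D x)) →
      (∀ x y, D x (g y) = v x y) → ∀ c, ∃ G : C →ₗ[k] C ⊗[k] C,
        IsDer (inR k C) (inL k C) G ∧ ∀ x, G (g x) = D x c) :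
    ∃ br : DoubleBracket k C, ∀ x y, br (g x) (g y) = v x y := by
  choose D hD hDv using H₁
  choose G hG hGD using H₂ D hD hDv
  -- The derivations G c were chosen separately for each c. Linearity and the Leibniz rule in c hold
  -- because both sides are derivations that agree on the generators.
  have hadd : ∀ c c', G (c + c') = G c + G c' := fun c c' =>
    hg.ext (hG _) ((hG c).add (hG c')) (by rintro _ ⟨x, rfl⟩; simp [hGD])
  have hsmul : ∀ (a : k) c, G (a • c) = a • G c := fun a c =>
    hg.ext (hG _) ((hG c).smul a) (by rintro _ ⟨x, rfl⟩; simp [hGD])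
  have hleib : ∀ x b c, G (b * c) x = G b x * inR k C c + inL k C b * G c x := fun x b c => by
    have := hg.ext (hG (b * c)) (((hG b).mul_right (z := inR k C c)
      (fun y => (inL_mul_inR _ _).symm)).add ((hG c).mul_left (z := inL k C b)
      (fun y => inL_mul_inR _ _)))
      (by rintro _ ⟨x, rfl⟩; simp [hGD, hD x b c])
    rw [this]; simp
  let T : C →ₗ[k] C →ₗ[k] C ⊗[k] C :=
    (LinearMap.flip { toFun := G, map_add' := hadd, map_smul' := hsmul })
  have hT : ∀ a c, T a c = G c a := fun a c => rfl
  have hTder : ∀ a, IsDer (inL k C) (inR k C) (T a) := fun a b c => hleib a b c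
  have hflip : ∀ a, IsDer (inL k C) (inR k C) (-((flip k C).toLinearMap ∘ₗ G a)) := fun a => by
    have := ((hG a).map (flip k C)).neg
    rwa [flip_comp_inL, flip_comp_inR] at this
  have hflip' : ∀ a, IsDer (inR k C) (inL k C) (-((flip k C).toLinearMap ∘ₗ T a)) := fun a => by
    have := ((hTder a).map (flip k C)).neg
    rwa [flip_comp_inL, flip_comp_inR] at this
  -- Antisymmetry is known for two generators. It is extended to one arbitrary argument, and then to
  -- both, each time by uniqueness of derivations.
  have hanti : ∀ a, T a = -((flip k C).toLinearMap ∘ₗ G a) := fun a => by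
    refine hg.ext (hTder a) (hflip a) ?_
    rintro _ ⟨y, rfl⟩
    have h : G (g y) = -((flip k C).toLinearMap ∘ₗ T (g y)) := by
      refine hg.ext (hG _) (hflip' _) ?_
      rintro _ ⟨x, rfl⟩
      simp only [hGD, hDv, LinearMap.neg_apply, LinearMap.comp_apply, hT]
      exact hv x y
    exact congrArg (fun f => f a) h
  refine ⟨⟨T, fun a b => ?_, fun a b c => hleib a b c⟩, fun x y => ?_⟩
  · rw [hanti a]; rfl
  · change G (g y) (g x) = _
    rw [hGD, hDv]

end DoubleBracket

end DoubleQP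

end

open scoped TensorProduct

noncomputable section

namespace DoubleQP

universe u v w x y

/-! ### Universal properties of presented algebras, localisations and the algebra Ā. -/

section Adjoin

variable {k : Type u} [CommRing k] {A : Type v} [Ring A] [Algebra k A] {X : Type w}
  {R : FreeAlgebra k (A ⊕ X) → FreeAlgebra k (A ⊕ X) → Prop} {S : Type x} [Ring S] [Algebra k S]

theorem Adjoin.mk_surjective : Function.Surjective (Adjoin.mk k R) :=
  RingQuot.mkAlgHom_surjective k _

theorem Adjoin.of_apply (a : A) :
    Adjoin.of k R a = Adjoin.mk k R (FreeAlgebra.ι k (Sum.inl a)) := rfl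

theorem Adjoin.gen_apply (x : X) :
    Adjoin.gen k R x = Adjoin.mk k R (FreeAlgebra.ι k (Sum.inr x)) := rfl

theorem Adjoin.adjoin_eq_top :
    Algebra.adjoin k (Set.range (Adjoin.of k R) ∪ Set.range (Adjoin.gen k R)) = ⊤ := by
  rw [eq_top_iff]
  rintro z -
  obtain ⟨z, rfl⟩ := Adjoin.mk_surjective z
  induction z using FreeAlgebra.induction with
  | grade0 a => rw [AlgHom.commutes]; exact Subalgebra.algebraMap_mem _ _
  | grade1 x =>
    apply Algebra.subset_adjoin
    rcases x with x | x
    · exact Or.inl ⟨x, rfl⟩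
    · exact Or.inr ⟨x, rfl⟩
  | mul a b ha hb => rw [map_mul]; exact mul_mem ha hb
  | add a b ha hb => rw [map_add]; exact add_mem ha hb

/-- The universal property of `Adjoin`. -/
theorem Adjoin.exists_lift (f : A →ₐ[k] S) (w : X → S)
    (hR : ∀ x y, R x y → FreeAlgebra.lift k (Sum.elim f w) x = FreeAlgebra.lift k (Sum.elim f w) y) :
    ∃ F : Adjoin k R →ₐ[k] S, (∀ a, F (Adjoin.of k R a) = f a) ∧ ∀ x,
      F (Adjoin.gen k R x) = w x := by
  let F : Adjoin k R →ₐ[k] S := RingQuot.liftAlgHom k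
    ⟨FreeAlgebra.lift k (Sum.elim f w), fun x y h => by
      induction h with
      | add a b => simp
      | mul a b => simp
      | scalar c => simp
      | rel h => exact hR _ _ h⟩
  have hF : ∀ x, F (Adjoin.mk k R x) = FreeAlgebra.lift k (Sum.elim f w) x := fun x =>
    RingQuot.liftAlgHom_mkAlgHom_apply ..
  exact ⟨F, fun a => by rw [Adjoin.of_apply, hF]; simp, fun x => by rw [Adjoin.gen_apply, hF]; simp⟩

/-- Derivations of `Adjoin k R` extending a derivation of `A`, with given values on the adjoined
generators. -/
theorem Adjoin.exists_isDer (l r : Adjoin k R →ₐ[k] S) {d : A →ₗ[k] S}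
    (hd : IsDer (l.comp (Adjoin.of k R)) (r.comp (Adjoin.of k R)) d) (w : X → S)
    (hR : ∀ δ : FreeAlgebra k (A ⊕ X) →ₗ[k] S,
      IsDer (l.comp (Adjoin.mk k R)) (r.comp (Adjoin.mk k R)) δ →
      (∀ a, δ (FreeAlgebra.ι k (Sum.inl a)) = d a) →
      (∀ x, δ (FreeAlgebra.ι k (Sum.inr x)) = w x) → ∀ x y, R x y → δ x = δ y) :
    ∃ D : Adjoin k R →ₗ[k] S, IsDer l r D ∧ (∀ a, D (Adjoin.of k R a) = d a) ∧
      ∀ x, D (Adjoin.gen k R x) = w x := by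
  obtain ⟨δ, hδ, hw⟩ := exists_isDer_freeAlgebra (l.comp (Adjoin.mk k R)) (r.comp (Adjoin.mk k R))
    (Sum.elim d w)
  have hl : ∀ a, δ (FreeAlgebra.ι k (Sum.inl a)) = d a := fun a => hw (Sum.inl a)
  have hr : ∀ a, δ (FreeAlgebra.ι k (Sum.inr a)) = w a := fun a => hw (Sum.inr a)
  obtain ⟨D, hD, hDδ⟩ := IsDer.exists_descend (l := l) (r := r) hδ (fun x y h => by
    induction h with
    | add a b => simp [hl]
    | mul a b => rw [hδ, hl, hl, hl, hd]; rfl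
    | scalar c => rw [hl, hd.algebraMap, hδ.algebraMap]
    | rel h => exact hR δ hδ hl hr _ _ h)
  exact ⟨D, hD, fun a => (hDδ _).trans (hl a), fun x => (hDδ _).trans (hr x)⟩

end Adjoin

section Loc

variable {k : Type u} [CommRing k] {A : Type v} [Ring A] [Algebra k A] {s : Set A}
  {S : Type x} [Ring S] [Algebra k S]

theorem Loc.mul_gen (a : s) : Loc.of k s a.1 * Adjoin.gen k (LocRel k s) a = 1 := by
  rw [Adjoin.of_apply, Adjoin.gen_apply, ← map_mul,
    Adjoin.mk_eq k _ (AdjoinRel.rel (LocRel.mul_inv a)), map_one]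

theorem Loc.gen_mul (a : s) : Adjoin.gen k (LocRel k s) a * Loc.of k s a.1 = 1 := by
  rw [Adjoin.of_apply, Adjoin.gen_apply, ← map_mul,
    Adjoin.mk_eq k _ (AdjoinRel.rel (LocRel.inv_mul a)), map_one]

/-- The adjoined elements are inverses of elements already reached, so no new generators are needed.
-/
theorem Loc.generates {g : Set A} (hg : Generates k g) : Generates k (Loc.of k s '' g) := by
  intro U hU hinv
  have h1 : ∀ a, Loc.of k s a ∈ U := by
    have := hg (U.comap (Loc.of k s)) (fun a ha => hU ⟨a, ha, rfl⟩) (fun b c hbc hcb hb =>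
      hinv (Loc.of k s b) (Loc.of k s c) (by rw [← map_mul, hbc, map_one])
        (by rw [← map_mul, hcb, map_one]) hb)
    intro a
    have ha : a ∈ U.comap (Loc.of k s) := this ▸ Algebra.mem_top
    exact ha
  rw [eq_top_iff, ← Adjoin.adjoin_eq_top, Algebra.adjoin_le_iff]
  rintro _ (⟨a, rfl⟩ | ⟨a, rfl⟩)
  · exact h1 a
  · exact hinv _ _ (Loc.mul_gen a) (Loc.gen_mul a) (h1 a.1)

theorem generates_univ : Generates k (Set.univ : Set A) := fun _ hU _ =>
  eq_top_iff.2 fun a _ => hU (Set.mem_univ a)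

theorem Loc.generates_range : Generates k (Set.range (Loc.of k s)) := by
  rw [← Set.image_univ]; exact Loc.generates generates_univ

/-- The value on the inverse of a is forced to be −a⁻¹ · d(a) · a⁻¹, and this choice respects both
relations defining the inverse. -/
theorem Loc.exists_isDer (l r : Loc k s →ₐ[k] S) {d : A →ₗ[k] S}
    (hd : IsDer (l.comp (Loc.of k s)) (r.comp (Loc.of k s)) d) :
    ∃ D : Loc k s →ₗ[k] S, IsDer l r D ∧ ∀ a, D (Loc.of k s a) = d a := by
  obtain ⟨D, hD, h, -⟩ := Adjoin.exists_isDer l r hd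
    (fun a => -(l (Adjoin.gen k _ a) * d a.1 * r (Adjoin.gen k _ a))) (by
      rintro δ hδ hl hr _ _ (⟨a⟩ | ⟨a⟩)
      · rw [hδ, hl, hr, hδ.map_one]
        change d a * r (Adjoin.gen k _ a) + l (Loc.of k s a) * _ = 0
        rw [mul_neg, mul_assoc, ← mul_assoc, ← map_mul, Loc.mul_gen, map_one, one_mul,
          add_neg_cancel]
      · rw [hδ, hl, hr, hδ.map_one]
        change _ * r (Loc.of k s a) + l (Adjoin.gen k _ a) * d a = 0
        rw [neg_mul, mul_assoc, ← map_mul, Loc.gen_mul, map_one, mul_one, neg_add_cancel])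
  exact ⟨D, hD, h⟩

theorem Loc.exists_lift (f : A →ₐ[k] S) (w : s → S) (h₁ : ∀ a, f a.1 * w a = 1)
    (h₂ : ∀ a, w a * f a.1 = 1) :
    ∃ F : Loc k s →ₐ[k] S, (∀ a, F (Loc.of k s a) = f a) ∧
      ∀ x, F (Adjoin.gen k _ x) = w x :=
  Adjoin.exists_lift f w (by
    rintro _ _ (⟨a⟩ | ⟨a⟩)
    · simp [h₁]
    · simp [h₂])

end Loc

section Ext

variable {k : Type u} [CommRing k] {A : Type v} [Ring A] [Algebra k A] {p q : A}
  {S : Type x} [Ring S] [Algebra k S]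

section Relations

variable (k p q)

theorem Ext.of_mul_e₁₂ : Ext.of k p q p * Ext.e₁₂ k p q = Ext.e₁₂ k p q := by
  have := Adjoin.mk_eq k _ (AdjoinRel.rel (MatRel.left₁₂ (k := k) (p := p) (q := q)))
  rwa [map_mul] at this

theorem Ext.e₁₂_mul_of : Ext.e₁₂ k p q * Ext.of k p q q = Ext.e₁₂ k p q := by
  have := Adjoin.mk_eq k _ (AdjoinRel.rel (MatRel.right₁₂ (k := k) (p := p) (q := q)))
  rwa [map_mul] at this

theorem Ext.of_mul_e₂₁ : Ext.of k p q q * Ext.e₂₁ k p q = Ext.e₂₁ k p q := by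
  have := Adjoin.mk_eq k _ (AdjoinRel.rel (MatRel.left₂₁ (k := k) (p := p) (q := q)))
  rwa [map_mul] at this

theorem Ext.e₂₁_mul_of : Ext.e₂₁ k p q * Ext.of k p q p = Ext.e₂₁ k p q := by
  have := Adjoin.mk_eq k _ (AdjoinRel.rel (MatRel.right₂₁ (k := k) (p := p) (q := q)))
  rwa [map_mul] at this

theorem Ext.e₁₂_mul_e₂₁ : Ext.e₁₂ k p q * Ext.e₂₁ k p q = Ext.of k p q p := by
  have := Adjoin.mk_eq k _ (AdjoinRel.rel (MatRel.mul₁₂₂₁ (k := k) (p := p) (q := q)))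
  rwa [map_mul] at this

theorem Ext.e₂₁_mul_e₁₂ : Ext.e₂₁ k p q * Ext.e₁₂ k p q = Ext.of k p q q := by
  have := Adjoin.mk_eq k _ (AdjoinRel.rel (MatRel.mul₂₁₁₂ (k := k) (p := p) (q := q)))
  rwa [map_mul] at this

end Relations

/-- Algebra generators of `A`, together with the matrix units, generate `Ā`. -/
theorem Ext.adjoin_eq_top {g : Set A} (hg : Algebra.adjoin k g = ⊤) :
    Algebra.adjoin k (Ext.of k p q '' g ∪ {Ext.e₁₂ k p q, Ext.e₂₁ k p q}) = ⊤ := by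
  rw [eq_top_iff, ← Adjoin.adjoin_eq_top, Algebra.adjoin_le_iff]
  rintro _ (⟨a, rfl⟩ | ⟨b, rfl⟩)
  · have ha : a ∈ Algebra.adjoin k g := hg ▸ Algebra.mem_top
    have : Ext.of k p q a ∈ (Algebra.adjoin k g).map (Ext.of k p q) := ⟨a, ha, rfl⟩
    rw [AlgHom.map_adjoin] at this
    exact Algebra.adjoin_mono Set.subset_union_left this
  · apply Algebra.subset_adjoin
    right
    cases b
    · exact Or.inl rfl
    · exact Or.inr rfl

theorem Ext.generates_range :
    Generates k (Set.range (Sum.elim (Ext.of k p q) (Adjoin.gen k (MatRel k p q)))) := by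
  apply Generates.of_adjoin
  rw [Set.Sum.elim_range]
  exact Adjoin.adjoin_eq_top

/-- The matrix units get derivative zero. The relations e₁₂e₂₁ = p and e₂₁e₁₂ = q then require d to
kill p and q, and nothing else is needed. -/
theorem Ext.exists_isDer (l r : Ext k p q →ₐ[k] S) {d : A →ₗ[k] S}
    (hd : IsDer (l.comp (Ext.of k p q)) (r.comp (Ext.of k p q)) d) (hp : d p = 0) (hq : d q = 0) :
    ∃ D : Ext k p q →ₗ[k] S, IsDer l r D ∧ (∀ a, D (Ext.of k p q a) = d a) ∧
      ∀ b, D (Adjoin.gen k _ b) = 0 :=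
  Adjoin.exists_isDer l r hd (fun _ => 0) (by
    rintro δ hδ hl hr _ _ (_ | _ | _ | _ | _ | _) <;> rw [hδ] <;> simp [hl, hr, hp, hq])

theorem Ext.exists_lift (f : A →ₐ[k] S) (e₁₂ e₂₁ : S) (h₁ : f p * e₁₂ = e₁₂) (h₂ : e₁₂ * f q = e₁₂)
    (h₃ : f q * e₂₁ = e₂₁) (h₄ : e₂₁ * f p = e₂₁) (h₅ : e₁₂ * e₂₁ = f p) (h₆ : e₂₁ * e₁₂ = f q) :
    ∃ F : Ext k p q →ₐ[k] S, (∀ a, F (Ext.of k p q a) = f a) ∧ F (Ext.e₁₂ k p q) = e₁₂ ∧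
      F (Ext.e₂₁ k p q) = e₂₁ := by
  obtain ⟨F, hF, hF'⟩ := Adjoin.exists_lift (R := MatRel k p q) f
    (fun b : Bool => if b then e₂₁ else e₁₂) (by
      rintro _ _ (_ | _ | _ | _ | _ | _) <;> simp [*])
  exact ⟨F, hF, by simp [Ext.e₁₂, hF'], by simp [Ext.e₂₁, hF']⟩

end Ext

/-! ### Extension of double brackets to localisations and to Ā. -/

namespace DoubleBracket

section

variable {k : Type u} [CommRing k] {A : Type v} [Ring A] [Algebra k A] (br : DoubleBracket k A)
  {C : Type v} [Ring C] [Algebra k C]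

/-- The square of an algebra morphism. -/
abbrev sq {C : Type w} [Ring C] [Algebra k C] (f : A →ₐ[k] C) : A ⊗[k] A →ₐ[k] C ⊗[k] C :=
  Algebra.TensorProduct.map f f

theorem sq_comp_inL {C : Type w} [Ring C] [Algebra k C] (f : A →ₐ[k] C) :
    (sq f).comp (inL k A) = (inL k C).comp f := by
  ext; simp

theorem sq_comp_inR {C : Type w} [Ring C] [Algebra k C] (f : A →ₐ[k] C) :
    (sq f).comp (inR k A) = (inR k C).comp f := by
  ext; simp

theorem flip_sq {C : Type w} [Ring C] [Algebra k C] (f : A →ₐ[k] C) (z : A ⊗[k] A) :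
    flip k C (sq f z) = sq f (flip k A z) := by
  have : (flip k C).comp (sq f) = (sq f).comp (flip k A) := by
    ext <;> simp
  exact DFunLike.congr_fun this z

theorem sq_isDer_right {C : Type w} [Ring C] [Algebra k C] (f : A →ₐ[k] C) (a : A) :
    IsDer ((inL k C).comp f) ((inR k C).comp f) ((sq f).toLinearMap ∘ₗ br.toFun a) := by
  have := (br.isDer_right a).map (sq f)
  rwa [sq_comp_inL, sq_comp_inR] at this

theorem sq_isDer_left {C : Type w} [Ring C] [Algebra k C] (f : A →ₐ[k] C) (a : A) :
    IsDer ((inR k C).comp f) ((inL k C).comp f) ((sq f).toLinearMap ∘ₗ br.toFun.flip a) := by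
  have := (br.isDer_left a).map (sq f)
  rwa [sq_comp_inL, sq_comp_inR] at this

/-- Compatibility may be checked on generators. -/
theorem compatible_of_generates {C : Type w} [Ring C] [Algebra k C] {br' : DoubleBracket k C}
    {f : A →ₐ[k] C} {s : Set A} (hs : Generates k s)
    (h : ∀ a ∈ s, ∀ b ∈ s, sq f (br a b) = br' (f a) (f b)) : br.Compatible br' f := by
  have h1 : ∀ a ∈ s, (sq f).toLinearMap ∘ₗ br.toFun a = br'.toFun (f a) ∘ₗ f.toLinearMap :=
    fun a ha => hs.ext (br.sq_isDer_right f a) ((br'.isDer_right (f a)).comp f) (h a ha)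
  intro a b
  have h2 : (sq f).toLinearMap ∘ₗ br.toFun.flip b = br'.toFun.flip (f b) ∘ₗ f.toLinearMap :=
    hs.ext (br.sq_isDer_left f b) ((br'.isDer_left (f b)).comp f)
      (fun a ha => DFunLike.congr_fun (h1 a ha) b)
  exact DFunLike.congr_fun h2 a

/-- Extension of a double bracket to a localisation. -/
theorem exists_loc {s : Set A} : ∃ brL : DoubleBracket k (Loc k s),
    br.Compatible brL (Loc.of k s) := by
  have hgen : Generates k (Set.range (Loc.of k s)) := Loc.generates_range
  suffices ∃ brL : DoubleBracket k (Loc k s), ∀ a b,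
      brL (Loc.of k s a) (Loc.of k s b) = sq (Loc.of k s) (br a b) by
    obtain ⟨brL, h⟩ := this
    exact ⟨brL, fun a b => (h a b).symm⟩
  refine exists_of_generators (Loc.of k s) hgen
    (fun a b => sq (Loc.of k s) (br a b)) (fun a b => ?_) (fun a => ?_) (fun D hD hDv c => ?_)
  · change sq _ (br.toFun a b) = _
    rw [br.antisymm, map_neg, flip_sq]; rfl
  · exact Loc.exists_isDer _ _ (br.sq_isDer_right _ a)
  -- All elements of A serve as generators here, so D is indexed by A with no assumed structure.
  -- Uniqueness makes a ↦ D a c a derivation of A for the inner structure, which then extends to the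
  -- localisation.
  · have hadd : ∀ a b, D (a + b) = D a + D b := fun a b => hgen.ext (hD _) ((hD a).add (hD b))
      (by rintro _ ⟨x, rfl⟩; simp [hDv])
    have hsmul : ∀ (t : k) a, D (t • a) = t • D a := fun t a => hgen.ext (hD _) ((hD a).smul t)
      (by rintro _ ⟨x, rfl⟩; simp [hDv])
    have hmul : ∀ a b c, D (a * b) c = D a c * inL k _ (Loc.of k s b)
        + inR k _ (Loc.of k s a) * D b c := fun a b c => by
      have := hgen.ext (hD (a * b))
        (((hD a).mul_right (z := inL k _ (Loc.of k s b)) (fun c => inL_mul_inR _ _)).add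
          ((hD b).mul_left (z := inR k _ (Loc.of k s a)) (fun c => (inL_mul_inR _ _).symm)))
        (by rintro _ ⟨x, rfl⟩; simp [hDv]; exact br.sq_isDer_left (Loc.of k s) x a b)
      rw [this]; simp
    exact Loc.exists_isDer (inR k _) (inL k _)
      (d := ⟨⟨fun a => D a c, fun a b => by simp [hadd]⟩, fun t a => by simp [hsmul]⟩)
      (fun a b => hmul a b c)

/-- Extension of a double bracket to `Ā`. -/
theorem exists_ext {p q : A} (hp : ∀ a, br p a = 0) (hq : ∀ a, br q a = 0) :
    ∃ brE : DoubleBracket k (Ext k p q), br.Compatible brE (Ext.of k p q) ∧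
      ∀ b, (∀ x, brE x (Adjoin.gen k _ b) = 0) ∧ ∀ x, brE (Adjoin.gen k _ b) x = 0 := by
  have hgen := Ext.generates_range (k := k) (p := p) (q := q)
  have hp' : ∀ a, br a p = 0 := fun a => by
    have h : br.toFun p a = 0 := hp a
    change br.toFun a p = 0; rw [br.antisymm, h]; simp
  have hq' : ∀ a, br a q = 0 := fun a => by
    have h : br.toFun q a = 0 := hq a
    change br.toFun a q = 0; rw [br.antisymm, h]; simp
  obtain ⟨brE, hE⟩ := exists_of_generators _ hgen
    (Sum.elim (fun a => Sum.elim (fun b => sq (Ext.of k p q) (br a b)) (fun _ => 0))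
      (fun _ => fun _ => 0)) (by
      rintro (a | a) (b | b)
      · change sq _ (br.toFun a b) = _
        rw [br.antisymm, map_neg]
        simp only [Sum.elim_inl, flip_sq]; rfl
      all_goals simp) (by
      rintro (a | a)
      · obtain ⟨D, hD, h₁, h₂⟩ := Ext.exists_isDer _ _ (br.sq_isDer_right (Ext.of k p q) a)
          (by simp [hp']) (by simp [hq'])
        exact ⟨D, hD, by
          rintro (b | b)
          · exact h₁ b
          · exact h₂ b⟩
      · exact ⟨0, IsDer.zero, by simp⟩) (by
      intro D hD hDv c
      have hll : ∀ a b, D (Sum.inl a) (Ext.of k p q b) = sq (Ext.of k p q) (br.toFun a b) :=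
        fun a b => hDv (Sum.inl a) (Sum.inl b)
      have hlr : ∀ a b, D (Sum.inl a) (Adjoin.gen k _ b) = 0 := fun a b =>
        hDv (Sum.inl a) (Sum.inr b)
      have hrl : ∀ a b, D (Sum.inr a) (Ext.of k p q b) = 0 := fun a b =>
        hDv (Sum.inr a) (Sum.inl b)
      have hrr : ∀ a b, D (Sum.inr a) (Adjoin.gen k _ b) = 0 := fun a b =>
        hDv (Sum.inr a) (Sum.inr b)
      have hp'' : br.toFun p = 0 := LinearMap.ext hp
      have hq'' : br.toFun q = 0 := LinearMap.ext hq
      have hadd : ∀ a b, D (Sum.inl (a + b)) = D (Sum.inl a) + D (Sum.inl b) := fun a b =>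
        hgen.ext (hD _) ((hD _).add (hD _)) (by rintro _ ⟨x | x, rfl⟩ <;> simp [hll, hlr])
      have hsmul : ∀ (t : k) a, D (Sum.inl (t • a)) = t • D (Sum.inl a) := fun t a =>
        hgen.ext (hD _) ((hD _).smul t) (by rintro _ ⟨x | x, rfl⟩ <;> simp [hll, hlr])
      have hmul : ∀ a b c, D (Sum.inl (a * b)) c = D (Sum.inl a) c * inL k _ (Ext.of k p q b)
          + inR k _ (Ext.of k p q a) * D (Sum.inl b) c := fun a b c => by
        have := hgen.ext (hD (Sum.inl (a * b)))
          (((hD (Sum.inl a)).mul_right (z := inL k _ (Ext.of k p q b))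
              (fun c => inL_mul_inR _ _)).add
            ((hD (Sum.inl b)).mul_left (z := inR k _ (Ext.of k p q a))
              (fun c => (inL_mul_inR _ _).symm)))
          (by
            rintro _ ⟨x | x, rfl⟩
            · simp [hll]; exact br.sq_isDer_left (Ext.of k p q) x a b
            · simp [hlr])
        rw [this]; simp
      -- The vanishing of the bracket on p and q is what allows the extension in the first argument
      -- to be zero on the matrix units.
      have hp0 : D (Sum.inl p) = 0 := hgen.ext (hD _) IsDer.zero
        (by rintro _ ⟨x | x, rfl⟩ <;> simp [hll, hlr, hp''])
      have hq0 : D (Sum.inl q) = 0 := hgen.ext (hD _) IsDer.zero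
        (by rintro _ ⟨x | x, rfl⟩ <;> simp [hll, hlr, hq''])
      have hb0 : ∀ b, D (Sum.inr b) = 0 := fun b => hgen.ext (hD _) IsDer.zero
        (by rintro _ ⟨x | x, rfl⟩ <;> simp [hrl, hrr])
      obtain ⟨G, hG, h₁, h₂⟩ := Ext.exists_isDer (inR k (Ext k p q)) (inL k _)
        (d := ⟨⟨fun a => D (Sum.inl a) c, fun a b => by simp [hadd]⟩, fun t a => by simp [hsmul]⟩)
        (fun a b => hmul a b c) (by simp [hp0]) (by simp [hq0])
      exact ⟨G, hG, by rintro (x | x) <;> simp [h₁, h₂, hb0]⟩)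
  have h0 : ∀ b, brE.toFun (Adjoin.gen k _ b) = 0 := fun b =>
    hgen.ext (brE.isDer_right _) IsDer.zero
      (by
        rintro _ ⟨x | x, rfl⟩
        exacts [hE (Sum.inr b) (Sum.inl x), hE (Sum.inr b) (Sum.inr x)])
  refine ⟨brE, fun a b => (hE (Sum.inl a) (Sum.inl b)).symm, fun b => ⟨fun x => ?_, fun x => ?_⟩⟩
  · change brE.toFun x _ = 0
    rw [brE.antisymm, h0]; simp
  · change brE.toFun _ x = 0
    rw [h0]; simp

end

end DoubleBracket

end DoubleQP

end

open scoped TensorProduct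

noncomputable section

namespace DoubleQP

universe u v w x y

/-! ### Existence of the fused double bracket on a corner algebra. -/

section Cross

variable {k : Type u} [CommRing k] {A : Type v} [Ring A] [Algebra k A]

theorem cross_tmul (a b c d : A) :
    cross (a ⊗ₜ[k] b) (c ⊗ₜ[k] d) = (c * b) ⊗ₜ[k] (a * d) := by
  simp [cross]

theorem cross_add_left (X X' Y : A ⊗[k] A) : cross (X + X') Y = cross X Y + cross X' Y := by
  induction Y with
  | zero => simp
  | add a b ha hb => simp only [map_add, ha, hb]; abel
  | tmul a b => simp [cross, mul_add, add_mul]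

theorem cross_smul_left (t : k) (X Y : A ⊗[k] A) : cross (t • X) Y = t • cross X Y := by
  induction Y with
  | zero => simp
  | add a b ha hb => simp only [map_add, ha, hb, smul_add]
  | tmul a b => simp [cross]

theorem cross_zero_left (Y : A ⊗[k] A) : cross (0 : A ⊗[k] A) Y = 0 := by
  simpa using cross_smul_left (0 : k) (0 : A ⊗[k] A) Y

theorem cross_mul_right (X Y : A ⊗[k] A) (c : A) :
    cross X (Y * (1 ⊗ₜ[k] c)) = cross X Y * (1 ⊗ₜ[k] c) := by
  induction Y with
  | zero => simp
  | add a b ha hb => simp only [map_add, add_mul, ha, hb]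
  | tmul a b => simp [cross, mul_assoc]

theorem cross_mul_left (X Y : A ⊗[k] A) (c : A) :
    cross X ((c ⊗ₜ[k] 1) * Y) = (c ⊗ₜ[k] 1) * cross X Y := by
  induction Y with
  | zero => simp
  | add a b ha hb => simp only [map_add, mul_add, ha, hb]
  | tmul a b =>
    simp only [cross, Algebra.TensorProduct.tmul_mul_tmul, one_mul, TensorProduct.lift.tmul,
      LinearMap.mk₂_apply, ← mul_assoc]

theorem flip_cross (X Y : A ⊗[k] A) : flip k A (cross X Y) = cross Y X := by
  induction Y with
  | zero => simp [cross_zero_left]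
  | add a b ha hb => simp only [map_add, cross_add_left, ha, hb]
  | tmul a b =>
    induction X with
    | zero => simp [cross_zero_left]
    | add a b ha hb => simp only [map_add, cross_add_left, ha, hb]
    | tmul c d => simp [cross_tmul]

/-- Outer multiplication of `cross X Y` acts through Y. Inner multiplication acts through X, since
the flip exchanges the roles of X and Y by `flip_cross`. -/
theorem cross_support {ε : A} {X Y : A ⊗[k] A} (hX : (ε ⊗ₜ[k] 1) * X = X)
    (hX' : X * (1 ⊗ₜ[k] ε) = X) (hY : (ε ⊗ₜ[k] 1) * Y = Y) (hY' : Y * (1 ⊗ₜ[k] ε) = Y) :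
    (ε ⊗ₜ[k] ε) * cross X Y * (ε ⊗ₜ[k] ε) = cross X Y := by
  have h1 : (ε ⊗ₜ[k] 1) * cross X Y = cross X Y := by rw [← cross_mul_left, hY]
  have h2 : cross X Y * (1 ⊗ₜ[k] ε) = cross X Y := by rw [← cross_mul_right, hY']
  have h3 : (1 ⊗ₜ[k] ε) * cross X Y = cross X Y := by
    change inR k A ε * _ = _
    rw [← flip_cross Y X, ← flip_inL, ← map_mul]
    congr 1
    change (ε ⊗ₜ[k] 1) * _ = _
    rw [← cross_mul_left, hX]
  have h4 : cross X Y * (ε ⊗ₜ[k] 1) = cross X Y := by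
    change _ * inL k A ε = _
    rw [← flip_cross Y X, ← flip_inR, ← map_mul]
    congr 1
    change _ * (1 ⊗ₜ[k] ε) = _
    rw [← cross_mul_right, hX']
  have h5 : ε ⊗ₜ[k] ε = (ε ⊗ₜ[k] (1 : A)) * (1 ⊗ₜ[k] ε) := by simp
  rw [h5, mul_assoc _ _ (cross X Y), h3, h1, ← mul_assoc, h4, h2]

end Cross

section Corner

variable {k : Type u} [CommRing k] {A : Type v} [Ring A] [Algebra k A] {p : A}
  (h : IsIdempotentElem p)

theorem Corner.mul_val (x y : h.Corner) : (x * y).1 = x.1 * y.1 := rfl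

theorem Corner.one_val : (1 : h.Corner).1 = p := rfl

theorem Corner.left_mul (x : h.Corner) : p * x.1 = x.1 := by
  obtain ⟨_, a, rfl⟩ := x
  simp only [← mul_assoc, h.eq]

theorem Corner.mul_right (x : h.Corner) : x.1 * p = x.1 := by
  obtain ⟨_, a, rfl⟩ := x
  simp only [mul_assoc, h.eq]

theorem Corner.algebraMap_val (c : k) : (algebraMap k h.Corner c).1 = c • p := rfl

/-- The projection to the corner as a linear map. -/
def cornerProj (k : Type u) [CommRing k] [Algebra k A] : A →ₗ[k] h.Corner where
  toFun := cornerMk h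
  map_add' a b := Subtype.ext (by
    change p * (a + b) * p = p * a * p + p * b * p
    rw [mul_add, add_mul])
  map_smul' c a := Subtype.ext (by
    change p * (c • a) * p = c • (p * a * p)
    rw [mul_smul_comm, smul_mul_assoc])

theorem cornerProj_comp_incl : cornerProj h k ∘ₗ cornerIncl k h = LinearMap.id := by
  ext x
  apply Subtype.ext
  change p * x.1 * p = x.1
  rw [Corner.left_mul, Corner.mul_right]

/-- The inclusion of the tensor square of a corner. -/
abbrev cornerIncl₂ (k : Type u) [CommRing k] [Algebra k A] :
    h.Corner ⊗[k] h.Corner →ₗ[k] A ⊗[k] A :=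
  TensorProduct.map (cornerIncl k h) (cornerIncl k h)

/-- The compression a ↦ pap is a linear retraction of the inclusion, so injectivity survives the
tensor square without any flatness. -/
theorem cornerIncl₂_injective : Function.Injective (cornerIncl₂ h k) := by
  apply Function.LeftInverse.injective
    (g := TensorProduct.map (cornerProj h k) (cornerProj h k))
  intro z
  rw [← LinearMap.comp_apply, ← TensorProduct.map_comp, cornerProj_comp_incl, TensorProduct.map_id,
    LinearMap.id_apply]

theorem cornerIncl₂_proj (z : A ⊗[k] A) :
    cornerIncl₂ h k (TensorProduct.map (cornerProj h k) (cornerProj h k) z)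
      = (p ⊗ₜ[k] p) * z * (p ⊗ₜ[k] p) := by
  induction z with
  | zero => simp
  | add a b ha hb => simp only [map_add, ha, hb, mul_add, add_mul]
  | tmul a b => simp only [TensorProduct.map_tmul, Algebra.TensorProduct.tmul_mul_tmul]; rfl

theorem cornerIncl₂_mul (y z : h.Corner ⊗[k] h.Corner) :
    cornerIncl₂ h k (y * z) = cornerIncl₂ h k y * cornerIncl₂ h k z := by
  induction y with
  | zero => simp
  | add a b ha hb => simp only [map_add, ha, hb, add_mul]
  | tmul a b =>
    induction z with
    | zero => simp
    | add a b ha hb => simp only [map_add, ha, hb, mul_add]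
    | tmul c d => simp only [TensorProduct.map_tmul, Algebra.TensorProduct.tmul_mul_tmul]; rfl

theorem cornerIncl₂_comm (z : h.Corner ⊗[k] h.Corner) :
    cornerIncl₂ h k (TensorProduct.comm k _ _ z) = flip k A (cornerIncl₂ h k z) := by
  induction z with
  | zero => simp
  | add a b ha hb => simp only [map_add, ha, hb]
  | tmul a b => simp

theorem cornerIncl₂_neg (z : h.Corner ⊗[k] h.Corner) :
    cornerIncl₂ h k (-z) = -cornerIncl₂ h k z :=
  eq_neg_of_add_eq_zero_left (by
    rw [← map_add]
    exact (congrArg (cornerIncl₂ h k) (neg_add_cancel z)).trans (map_zero _))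

/-- Construction of a double bracket on a corner. -/
theorem exists_corner_bracket (F : h.Corner →ₗ[k] h.Corner →ₗ[k] A ⊗[k] A)
    (hs : ∀ x y, (p ⊗ₜ[k] p) * F x y * (p ⊗ₜ[k] p) = F x y)
    (ha : ∀ x y, F x y = -flip k A (F y x))
    (hl : ∀ x y z, F x (y * z) = F x y * (1 ⊗ₜ[k] z.1) + (y.1 ⊗ₜ[k] 1) * F x z) :
    ∃ br : DoubleBracket k h.Corner, ∀ x y, cornerIncl₂ h k (br x y) = F x y := by
  let P := TensorProduct.map (cornerProj h k) (cornerProj h k)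
  have key : ∀ x y, cornerIncl₂ h k (P (F x y)) = F x y := fun x y => by
    rw [cornerIncl₂_proj, hs]
  have hpp : (p ⊗ₜ[k] p) * (p ⊗ₜ[k] p) = p ⊗ₜ[k] p := by simp [h.eq]
  have hs' : ∀ x y, F x y * (p ⊗ₜ[k] p) = F x y := fun x y => by
    conv_lhs => rw [← hs, mul_assoc, hpp, hs]
  have hs'' : ∀ x y, (p ⊗ₜ[k] p) * F x y = F x y := fun x y => by
    conv_lhs => rw [← hs, ← mul_assoc, ← mul_assoc, hpp, hs]
  refine ⟨⟨F.compr₂ P, fun x y => ?_, fun x y z => ?_⟩, key⟩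
  · apply cornerIncl₂_injective h (k := k)
    rw [cornerIncl₂_neg, cornerIncl₂_comm]
    simp only [LinearMap.compr₂_apply]
    rw [key, key, ha]
  · apply cornerIncl₂_injective h (k := k)
    rw [map_add, cornerIncl₂_mul, cornerIncl₂_mul]
    simp only [LinearMap.compr₂_apply]
    rw [key, key, key, hl]
    have h1 : cornerIncl₂ h k (1 ⊗ₜ[k] z) = (p ⊗ₜ[k] p) * (1 ⊗ₜ[k] z.1) := by
      rw [Algebra.TensorProduct.tmul_mul_tmul, mul_one, Corner.left_mul]; rfl
    have h2 : cornerIncl₂ h k (y ⊗ₜ[k] 1) = (y.1 ⊗ₜ[k] 1) * (p ⊗ₜ[k] p) := by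
      rw [Algebra.TensorProduct.tmul_mul_tmul, one_mul, Corner.mul_right]; rfl
    rw [h1, h2, ← mul_assoc, hs', mul_assoc _ _ (F x z), hs'']

end Corner

section Fusion

variable {k : Type u} [Field k] {A : Type v} [Ring A] [Algebra k A] {I : Type w}
  {e : I → A} (i j : I)

theorem trace_add (X Y) : trace (k := k) e i j (X + Y) = trace e i j X + trace e i j Y := by
  simp only [trace, mul_add, add_mul]; abel

theorem trace_smul (t : k) (X) : trace (k := k) e i j (t • X) = t • trace e i j X := by
  simp only [trace, mul_smul_comm, smul_mul_assoc, smul_add]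

/-- Elements of the corner commute with ε. With its left counterpart this makes Tr(δ) a double
derivation on the fusion algebra. -/
theorem trace_mul_right (X) {c : Ext k (e i) (e j)}
    (hc : c * fusEps k e i j = fusEps k e i j * c) :
    trace (k := k) e i j (X * (1 ⊗ₜ[k] c)) = trace e i j X * (1 ⊗ₜ[k] c) := by
  simp only [trace, add_mul, mul_assoc, Algebra.TensorProduct.tmul_mul_tmul, one_mul, mul_one, hc]

theorem trace_mul_left (X) {c : Ext k (e i) (e j)}
    (hc : c * fusEps k e i j = fusEps k e i j * c) :
    trace (k := k) e i j ((c ⊗ₜ[k] 1) * X) = (c ⊗ₜ[k] 1) * trace e i j X := by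
  simp only [trace, mul_add, ← mul_assoc, Algebra.TensorProduct.tmul_mul_tmul, one_mul, mul_one, hc]

theorem trace_left_support [Fintype I] (he : CompleteOrthogonalIdempotents e)
    (X) : (fusEps k e i j ⊗ₜ[k] 1) * trace (k := k) e i j X = trace e i j X := by
  simp only [trace, mul_add, ← mul_assoc, Algebra.TensorProduct.tmul_mul_tmul, one_mul,
    (fusEps_idem k he i j).eq]

theorem trace_right_support [Fintype I] (he : CompleteOrthogonalIdempotents e)
    (X) : trace (k := k) e i j X * (1 ⊗ₜ[k] fusEps k e i j) = trace e i j X := by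
  simp only [trace, add_mul, mul_assoc, Algebra.TensorProduct.tmul_mul_tmul, mul_one,
    (fusEps_idem k he i j).eq]

/-- On A the gauge element is the inner derivation attached to e_s ⊗ e_s. By orthogonality it kills
every idempotent of the family, so it extends to Ā by zero on the matrix units. -/
theorem exists_extendsGauge [Fintype I] (he : CompleteOrthogonalIdempotents e) (s : I) :
    ∃ δ : DoubleDerivation k (Ext k (e i) (e j)), ExtendsGauge e i j s δ := by
  let f := Ext.of k (e i) (e j)
  let d₀ : A →ₗ[k] A ⊗[k] A :=
    LinearMap.mulRight k (e s ⊗ₜ[k] e s) ∘ₗ (inL k A).toLinearMap -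
      LinearMap.mulLeft k (e s ⊗ₜ[k] e s) ∘ₗ (inR k A).toLinearMap
  have hd₀' : ∀ a, d₀ a = (a * e s) ⊗ₜ[k] e s - e s ⊗ₜ[k] (e s * a) := fun a => by simp [d₀]
  have hd₀ : IsDer (inL k A) (inR k A) d₀ := fun a b => by
    simp [hd₀', sub_mul, mul_sub, mul_assoc]
  have hd := hd₀.map (DoubleBracket.sq f)
  rw [DoubleBracket.sq_comp_inL, DoubleBracket.sq_comp_inR] at hd
  have h0 : ∀ t, d₀ (e t) = 0 := fun t => by
    rw [hd₀']
    by_cases hts : t = s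
    · subst hts; simp [(he.idem t).eq]
    · have h1 : e t * e s = 0 := he.ortho hts
      have h2 : e s * e t = 0 := he.ortho (Ne.symm hts)
      simp [h1, h2]
  obtain ⟨D, hD, hDa, hDb⟩ := Ext.exists_isDer (inL k _) (inR k _) hd (by simp [h0]) (by simp [h0])
  refine ⟨⟨D, hD⟩, fun a => ?_, hDb false, hDb true⟩
  rw [← hd₀']
  exact hDa a

/-- The idempotent e_j equals e₂₁e₁₂, a product of two elements killed by the bracket. Hence ε is
killed as well, and brackets of elements of the corner stay in the corner. -/
theorem ExtendsBracket.idem_left {br : DoubleBracket k A}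
    {brE : DoubleBracket k (Ext k (e i) (e j))} (h : ExtendsBracket e i j br brE)
    (x) : brE (Ext.of k _ _ (e j)) x = 0 := by
  obtain ⟨-, h1, h2⟩ := h
  have h1' : brE.toFun (Ext.e₁₂ k (e i) (e j)) x = 0 := (h1 x).2
  have h2' : brE.toFun (Ext.e₂₁ k (e i) (e j)) x = 0 := (h2 x).2
  change brE.toFun _ x = 0
  rw [← Ext.e₂₁_mul_e₁₂ k (e i) (e j), brE.leibniz_left, h1', h2']; simp

/-- The restricted bracket and the fusion term are each supported on ε ⊗ ε, antisymmetric and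
Leibniz. For the fusion term this follows from the traces being double derivations on the corner and
from `flip_cross`. -/
theorem exists_isFusion [Fintype I] (he : CompleteOrthogonalIdempotents e) {br : DoubleBracket k A}
    (hbr : ∀ s a, br (e s) a = 0) :
    ∃ brF : DoubleBracket k (FusionAlgebra k he i j), IsFusion he i j br brF := by
  obtain ⟨brE, hE, hE'⟩ := br.exists_ext (hbr i) (hbr j)
  obtain ⟨E₁, hE₁⟩ := exists_extendsGauge (k := k) i j he i
  obtain ⟨E₂, hE₂⟩ := exists_extendsGauge (k := k) i j he j
  have hext : ExtendsBracket e i j br brE :=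
    ⟨hE, fun x => ⟨(hE' false).1 x, (hE' false).2 x⟩, fun x => ⟨(hE' true).1 x, (hE' true).2 x⟩⟩
  let h := fusEps_idem k he i j
  let T₁ : h.Corner → _ := fun x => trace e i j (E₁ x.1)
  let T₂ : h.Corner → _ := fun x => trace e i j (E₂ x.1)
  have T₁add : ∀ x y, T₁ (x + y) = T₁ x + T₁ y := fun x y => by
    change trace e i j (E₁.toFun (x.1 + y.1)) = _
    rw [map_add, trace_add]
  have T₂add : ∀ x y, T₂ (x + y) = T₂ x + T₂ y := fun x y => by
    change trace e i j (E₂.toFun (x.1 + y.1)) = _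
    rw [map_add, trace_add]
  have T₁smul : ∀ (c : k) x, T₁ (c • x) = c • T₁ x := fun c x => by
    change trace e i j (E₁.toFun (c • x.1)) = _
    rw [map_smul, trace_smul]
  have T₂smul : ∀ (c : k) x, T₂ (c • x) = c • T₂ x := fun c x => by
    change trace e i j (E₂.toFun (c • x.1)) = _
    rw [map_smul, trace_smul]
  have hcomm : ∀ x : h.Corner, x.1 * fusEps k e i j = fusEps k e i j * x.1 := fun x => by
    rw [Corner.mul_right, Corner.left_mul]
  have T₁mul : ∀ x y, T₁ (x * y) = T₁ x * (1 ⊗ₜ[k] y.1) + (x.1 ⊗ₜ[k] 1) * T₁ y := fun x y => by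
    change trace e i j (E₁.toFun (x.1 * y.1)) = _
    rw [E₁.leibniz, trace_add, trace_mul_right _ _ _ (hcomm y), trace_mul_left _ _ _ (hcomm x)]
  have T₂mul : ∀ x y, T₂ (x * y) = T₂ x * (1 ⊗ₜ[k] y.1) + (x.1 ⊗ₜ[k] 1) * T₂ y := fun x y => by
    change trace e i j (E₂.toFun (x.1 * y.1)) = _
    rw [E₂.leibniz, trace_add, trace_mul_right _ _ _ (hcomm y), trace_mul_left _ _ _ (hcomm x)]
  let F : h.Corner →ₗ[k] h.Corner →ₗ[k] _ := LinearMap.mk₂ k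
    (fun x y => brE.toFun x.1 y.1 - (1 / 2 : k) • (cross (T₁ x) (T₂ y) - cross (T₂ x) (T₁ y)))
    (fun x x' y => by
      change brE.toFun (x.1 + x'.1) y.1 - _ = _
      simp only [T₁add, T₂add, cross_add_left, map_add, LinearMap.add_apply, smul_sub, smul_add]
      abel)
    (fun c x y => by
      change brE.toFun (c • x.1) y.1 - _ = _
      simp only [T₁smul, T₂smul, cross_smul_left, map_smul, LinearMap.smul_apply, smul_sub]
      rw [smul_comm c (1 / 2 : k), smul_comm c (1 / 2 : k)])
    (fun x y y' => by
      change brE.toFun x.1 (y.1 + y'.1) - _ = _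
      simp only [T₁add, T₂add, map_add, smul_sub, smul_add]
      abel)
    (fun c x y => by
      change brE.toFun x.1 (c • y.1) - _ = _
      simp only [T₁smul, T₂smul, map_smul, smul_sub]
      rw [smul_comm c (1 / 2 : k), smul_comm c (1 / 2 : k)])
  have hF : ∀ x y, F x y = brE.toFun x.1 y.1 -
      (1 / 2 : k) • (cross (T₁ x) (T₂ y) - cross (T₂ x) (T₁ y)) := fun x y => rfl
  have hε : ∀ x, brE (fusEps k e i j) x = 0 := fun x => by
    change brE.toFun _ x = 0
    rw [fusEps, map_sub, LinearMap.sub_apply]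
    have h1 : brE.toFun (Ext.of k _ _ (e j)) x = 0 := hext.idem_left i j x
    have h2 : brE.toFun 1 x = 0 := (brE.isDer_left x).map_one
    rw [h1, h2, sub_zero]
  have hε' : ∀ x, brE x (fusEps k e i j) = 0 := fun x => by
    have h1 : brE.toFun (fusEps k e i j) x = 0 := hε x
    change brE.toFun x _ = 0
    rw [brE.antisymm, h1]; simp
  -- Since ε brackets to zero, expanding the brackets of εx, xε with y and of x with εy, yε moves ε
  -- out on each of the four sides.
  have hEs : ∀ x y : h.Corner, (fusEps k e i j ⊗ₜ[k] fusEps k e i j) * brE.toFun x.1 y.1 *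
      (fusEps k e i j ⊗ₜ[k] fusEps k e i j) = brE.toFun x.1 y.1 := fun x y => by
    have h1 := brE.leibniz_left (fusEps k e i j) x.1 y.1
    have h2 := brE.leibniz_left x.1 (fusEps k e i j) y.1
    have h3 := brE.leibniz x.1 (fusEps k e i j) y.1
    have h4 := brE.leibniz x.1 y.1 (fusEps k e i j)
    have h5 : brE.toFun (fusEps k e i j) y.1 = 0 := hε _
    have h6 : brE.toFun x.1 (fusEps k e i j) = 0 := hε' _
    simp only [Corner.left_mul, Corner.mul_right, h5, h6, zero_mul, mul_zero, zero_add, add_zero]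
      at h1 h2 h3 h4
    have h7 : fusEps k e i j ⊗ₜ[k] fusEps k e i j =
      (fusEps k e i j ⊗ₜ[k] (1 : Ext k (e i) (e j))) * (1 ⊗ₜ[k] fusEps k e i j) := by simp
    rw [h7, mul_assoc _ _ (brE.toFun x.1 y.1), ← h1, ← h3, ← mul_assoc, ← h2, ← h4]
  obtain ⟨brF, hbrF⟩ := exists_corner_bracket h F (fun x y => by
      rw [hF, mul_sub, sub_mul, hEs, mul_smul_comm, smul_mul_assoc, mul_sub, sub_mul,
        cross_support, cross_support]
      all_goals first | exact trace_left_support i j he _ | exact trace_right_support i j he _)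
    (fun x y => by
      rw [hF, hF, brE.antisymm x.1 y.1, map_sub, map_smul, map_sub, flip_cross, flip_cross,
        comm_eq_flip, neg_sub, ← neg_sub (cross (T₁ x) (T₂ y)), smul_neg]
      abel)
    (fun x y z => by
      rw [hF, hF, hF]
      change brE.toFun x.1 (y.1 * z.1) - _ = _
      rw [brE.leibniz, T₁mul, T₂mul]
      simp only [map_add, cross_mul_left, cross_mul_right, sub_mul, mul_sub, smul_sub, smul_add,
        smul_mul_assoc, mul_smul_comm]
      abel)
  exact ⟨brF, brE, E₁, E₂, hext, hE₁, hE₂, hbrF⟩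

end Fusion

end DoubleQP

end

open scoped TensorProduct

noncomputable section

namespace DoubleQP

universe u v w x y

/-! ### The triple bracket and the quasi-Poisson property: reduction to generators, and transport.
-/

namespace DoubleBracket

variable {k : Type u} [CommRing k] {A : Type v} [Ring A] [Algebra k A] (br : DoubleBracket k A)

section Triple

/-- The cube of an algebra morphism. -/
abbrev cube {C : Type w} [Ring C] [Algebra k C] (f : A →ₐ[k] C) :
    (A ⊗[k] A) ⊗[k] A →ₐ[k] (C ⊗[k] C) ⊗[k] C :=
  Algebra.TensorProduct.map (sq f) f

theorem left_tmul (a x y : A) : br.left a (x ⊗ₜ[k] y) = br a x ⊗ₜ[k] y := rfl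

theorem rot_tmul (x y z : A) : rot k A ((x ⊗ₜ[k] y) ⊗ₜ[k] z) = (z ⊗ₜ[k] x) ⊗ₜ[k] y := rfl

theorem rot_rot_rot (z : (A ⊗[k] A) ⊗[k] A) : rot k A (rot k A (rot k A z)) = z := by
  have : rot k A ∘ₗ rot k A ∘ₗ rot k A = LinearMap.id := by
    ext x y z; simp [rot_tmul]
  exact DFunLike.congr_fun this z

theorem rot_cube {C : Type w} [Ring C] [Algebra k C] (f : A →ₐ[k] C) (z : (A ⊗[k] A) ⊗[k] A) :
    rot k C (cube f z) = cube f (rot k A z) := by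
  have : rot k C ∘ₗ (cube f).toLinearMap = (cube f).toLinearMap ∘ₗ rot k A := by
    ext x y z; simp [rot_tmul]
  exact DFunLike.congr_fun this z

theorem rot_mul (y z : (A ⊗[k] A) ⊗[k] A) : rot k A (y * z) = rot k A y * rot k A z := by
  induction y with
  | zero => simp
  | add a b ha hb => simp only [map_add, ha, hb, add_mul]
  | tmul y y₃ =>
    induction y with
    | zero => simp
    | add a b ha hb => simp only [TensorProduct.add_tmul, map_add, ha, hb, add_mul]
    | tmul y₁ y₂ =>
      induction z with
      | zero => simp
      | add a b ha hb => simp only [map_add, ha, hb, mul_add]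
      | tmul z z₃ =>
        induction z with
        | zero => simp
        | add a b ha hb => simp only [TensorProduct.add_tmul, map_add, ha, hb, mul_add]
        | tmul z₁ z₂ => simp [rot_tmul]

theorem left_sq {C : Type w} [Ring C] [Algebra k C] {br' : DoubleBracket k C} {f : A →ₐ[k] C}
    (h : br.Compatible br' f) (a : A) (z : A ⊗[k] A) :
    br'.left (f a) (sq f z) = cube f (br.left a z) := by
  induction z with
  | zero => simp
  | add a b ha hb => simp only [map_add, ha, hb]
  | tmul y z =>
    have : sq f (br.toFun a y) = br'.toFun (f a) (f y) := h a y
    simp only [Algebra.TensorProduct.map_tmul, left_tmul]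
    rw [← this]

theorem triple_map {C : Type w} [Ring C] [Algebra k C] {br' : DoubleBracket k C} {f : A →ₐ[k] C}
    (h : br.Compatible br' f) (a b c : A) :
    br'.triple (f a) (f b) (f c) = cube f (br.triple a b c) := by
  have h' : ∀ a b, br' (f a) (f b) = sq f (br a b) := fun a b => (h a b).symm
  simp only [triple, map_add]
  simp only [h', br.left_sq h, rot_cube]

/-- The three summands are permuted cyclically and τ³ = 1. With `qpRhs_rot` this lets an argument in
any position be moved to the last one. -/
theorem triple_rot (a b c : A) : rot k A (br.triple b c a) = br.triple a b c := by
  simp only [triple, map_add, rot_rot_rot]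
  abel

end Triple

section Right

variable (k A) in
/-- `c ↦ c ⊗ 1 ⊗ 1`. -/
abbrev inL₃ : A →ₐ[k] (A ⊗[k] A) ⊗[k] A :=
  (Algebra.TensorProduct.includeLeft : A ⊗[k] A →ₐ[k] (A ⊗[k] A) ⊗[k] A).comp (inL k A)

variable (k A) in
/-- `c ↦ 1 ⊗ 1 ⊗ c`. -/
abbrev inR₃ : A →ₐ[k] (A ⊗[k] A) ⊗[k] A := Algebra.TensorProduct.includeRight

variable (k) in
/-- The element whose commutator with `c` is the right-hand side of the quasi-Poisson property. -/
def qpCore {I : Type w} [Fintype I] (e : I → A) (a b : A) : (A ⊗[k] A) ⊗[k] A :=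
  ∑ s, ((e s * a) ⊗ₜ[k] (e s * b) ⊗ₜ[k] e s - (e s * a) ⊗ₜ[k] e s ⊗ₜ[k] (b * e s)
    - e s ⊗ₜ[k] (a * e s * b) ⊗ₜ[k] e s + e s ⊗ₜ[k] (a * e s) ⊗ₜ[k] (b * e s))

variable (k) in
/-- The right-hand side of the quasi-Poisson property. -/
def qpRhs {I : Type w} [Fintype I] (e : I → A) (a b : A) : A →ₗ[k] (A ⊗[k] A) ⊗[k] A :=
  LinearMap.mulRight k (qpCore k e a b) ∘ₗ (inL₃ k A).toLinearMap -
    LinearMap.mulLeft k (qpCore k e a b) ∘ₗ (inR₃ k A).toLinearMap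

theorem qpRhs_apply' {I : Type w} [Fintype I] (e : I → A) (a b c : A) :
    qpRhs k e a b c = inL₃ k A c * qpCore k e a b - qpCore k e a b * inR₃ k A c := by
  simp [qpRhs]

theorem qpRhs_apply {I : Type w} [Fintype I] (e : I → A) (a b c : A) :
    qpRhs k e a b c = ∑ s : I,
    ((c * e s * a) ⊗ₜ[k] (e s * b) ⊗ₜ[k] e s
      - (c * e s * a) ⊗ₜ[k] e s ⊗ₜ[k] (b * e s)
      - (c * e s) ⊗ₜ[k] (a * e s * b) ⊗ₜ[k] e s
      + (c * e s) ⊗ₜ[k] (a * e s) ⊗ₜ[k] (b * e s)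
      - (e s * a) ⊗ₜ[k] (e s * b) ⊗ₜ[k] (e s * c)
      + (e s * a) ⊗ₜ[k] e s ⊗ₜ[k] (b * e s * c)
      + e s ⊗ₜ[k] (a * e s * b) ⊗ₜ[k] (e s * c)
      - e s ⊗ₜ[k] (a * e s) ⊗ₜ[k] (b * e s * c)) := by
  rw [qpRhs_apply', qpCore, Finset.mul_sum, Finset.sum_mul, ← Finset.sum_sub_distrib]
  refine Finset.sum_congr rfl fun s _ => ?_
  simp only [inL₃, inR₃, inL, AlgHom.comp_apply, Algebra.TensorProduct.includeLeft_apply,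
    Algebra.TensorProduct.includeRight_apply, mul_sub, mul_add, sub_mul, add_mul,
    Algebra.TensorProduct.tmul_mul_tmul, one_mul, mul_one, Algebra.TensorProduct.one_def, mul_assoc]
  abel

theorem qpRhs_rot {I : Type w} [Fintype I] (e : I → A) (a b c : A) :
    rot k A (qpRhs k e b c a) = qpRhs k e a b c := by
  rw [qpRhs_apply, qpRhs_apply, map_sum]
  refine Finset.sum_congr rfl fun s _ => ?_
  simp only [map_sub, map_add, rot_tmul, mul_assoc]
  abel

/-- As a function of c the right-hand side is a commutator with the fixed element `qpCore`, that is,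
an inner derivation. -/
theorem qpRhs_isDer {I : Type w} [Fintype I] (e : I → A) (a b : A) :
    IsDer (inL₃ k A) (inR₃ k A) (qpRhs k e a b) := fun c d => by
  rw [qpRhs_apply', qpRhs_apply', qpRhs_apply', map_mul, map_mul, sub_mul, mul_sub]
  simp only [mul_assoc]
  abel

theorem qpRhs_idem {I : Type w} [Fintype I] {e : I → A} (he : CompleteOrthogonalIdempotents e)
    (a b : A) (r : I) : qpRhs k e a b (e r) = 0 := by
  classical
  rw [qpRhs_apply]
  rw [Finset.sum_eq_single r]
  · simp only [(he.idem r).eq, mul_assoc]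
    abel
  · intro s _ hs
    have h1 : e r * e s = 0 := he.ortho hs.symm
    have h2 : e s * e r = 0 := he.ortho hs
    simp [h1, h2, mul_assoc]
  · simp

end Right

section Leibniz

theorem left_mul_right (a c : A) (z : A ⊗[k] A) :
    br.left a (z * inR k A c) = br.left a z * inR₃ k A c := by
  induction z with
  | zero => simp
  | add a b ha hb => simp only [map_add, add_mul, ha, hb]
  | tmul y z => simp [left_tmul]

variable (k A) in
/-- `x ⊗ y ↦ x ⊗ y ⊗ 1`. -/
abbrev inLM₃ : A ⊗[k] A →ₐ[k] (A ⊗[k] A) ⊗[k] A := Algebra.TensorProduct.includeLeft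

variable (k A) in
/-- `x ⊗ y ↦ 1 ⊗ x ⊗ y`. -/
abbrev inMR₃ : A ⊗[k] A →ₐ[k] (A ⊗[k] A) ⊗[k] A :=
  Algebra.TensorProduct.map (inR k A) (AlgHom.id k A)

variable (k A) in
/-- `x ⊗ y ↦ x ⊗ 1 ⊗ y`. -/
abbrev inLR₃ : A ⊗[k] A →ₐ[k] (A ⊗[k] A) ⊗[k] A :=
  Algebra.TensorProduct.map (inL k A) (AlgHom.id k A)

theorem left_mul_left (a c : A) (z : A ⊗[k] A) :
    br.left a (inL k A c * z) = inL₃ k A c * br.left a z +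
      inLM₃ k A (br.toFun a c) * inMR₃ k A z := by
  induction z with
  | zero => simp
  | add a b ha hb => simp only [map_add, mul_add, ha, hb]; abel
  | tmul y z =>
    simp only [inL, Algebra.TensorProduct.includeLeft_apply, Algebra.TensorProduct.tmul_mul_tmul,
      one_mul, left_tmul]
    rw [br.leibniz, TensorProduct.add_tmul, add_comm]
    simp

/-- Expanding ⦃b,cd⦄, ⦃cd,a⦄ and the action of cd on ⦃a,b⦄ produces the desired terms and two
products of ⦃a,c⦄ with ⦃b,d⦄. The latter cancel by antisymmetry of the double bracket. -/
theorem triple_isDer_aux (a b : A) : ∀ c d : A,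
    br.triple a b (c * d) = br.triple a b c * inR₃ k A d + inL₃ k A c * br.triple a b d := by
  intro c d
  have hL : ∀ z : A ⊗[k] A, br.left (c * d) z =
      br.left c z * inLM₃ k A (inL k A d) +
        inLM₃ k A (inR k A c) * br.left d z := fun z => by
    induction z with
    | zero => simp
    | add a b ha hb => simp only [map_add, mul_add, add_mul, ha, hb]; abel
    | tmul y z =>
      simp only [left_tmul]
      rw [br.leibniz_left, TensorProduct.add_tmul]
      simp
  have hB : ∀ z : A ⊗[k] A, br.left b (z * inL k A d) =
      br.left b z * inLM₃ k A (inR k A d) +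
        inLR₃ k A z * inLM₃ k A (br.toFun b d) := fun z => by
    induction z with
    | zero => simp
    | add a b ha hb => simp only [map_add, add_mul, ha, hb]; abel
    | tmul y z =>
      simp only [inL, Algebra.TensorProduct.includeLeft_apply, Algebra.TensorProduct.tmul_mul_tmul,
        mul_one, left_tmul]
      rw [br.leibniz, TensorProduct.add_tmul]
      simp
  have hC : ∀ z : A ⊗[k] A, br.left b (inR k A c * z) = inR₃ k A c * br.left b z := fun z => by
    induction z with
    | zero => simp
    | add a b ha hb => simp only [map_add, mul_add, ha, hb]
    | tmul y z => simp [left_tmul]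
  have e1 : br.toFun b (c * d) = br.toFun b c * inR k A d
      + inL k A c * br.toFun b d := br.leibniz b c d
  have e2 : br.toFun (c * d) a = br.toFun c a * inL k A d
      + inR k A c * br.toFun d a := br.leibniz_left c d a
  have r1 : ∀ x, rot k A (inLM₃ k A (inR k A x)) = inR₃ k A x :=
    fun x => rfl
  have r2 : ∀ x, rot k A (inR₃ k A x) = inL₃ k A x := fun x => rfl
  have r3 : ∀ x, rot k A (inLM₃ k A (inL k A x)) =
    inLM₃ k A (inR k A x) := fun x => rfl
  have r4 : ∀ x y : A ⊗[k] A,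
      rot k A (inLR₃ k A (flip k A x) *
        inLM₃ k A y) =
      inLM₃ k A x *
        inMR₃ k A y := fun x y => by
    induction x with
    | zero => simp
    | add a b ha hb => simp only [map_add, add_mul, ha, hb]
    | tmul x x' =>
      induction y with
      | zero => simp
      | add a b ha hb => simp only [map_add, mul_add, ha, hb]
      | tmul y y' => simp [rot_tmul]
  have e3 : br.toFun c a = -flip k A (br.toFun a c) := br.antisymm c a
  -- One unwanted term comes from ⦃a, c⦃b,d⦄'⦄, the other from ⦃b, ⦃c,a⦄'d⦄ after rotation.
  -- Replacing ⦃c,a⦄ by −⦃a,c⦄° makes them opposite.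
  have r5 : rot k A (inLR₃ k A (br.toFun c a)) * rot k A (inLM₃ k A (br.toFun b d)) =
      -(inLM₃ k A (br.toFun a c) * inMR₃ k A (br.toFun b d)) := by
    have e4 : br.toFun c a + flip k A (br.toFun a c) = 0 := by rw [e3]; exact neg_add_cancel _
    apply eq_neg_of_add_eq_zero_left
    rw [← r4, ← rot_mul, ← map_add, ← add_mul, ← map_add, e4, map_zero, zero_mul, map_zero]
  simp only [triple]
  rw [e1, e2, map_add, map_add, left_mul_right, left_mul_left, hB, hC, hL]
  simp only [map_add, rot_mul, r1, r2, r3, r5, add_mul, mul_add]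
  abel

end Leibniz

section QuasiPoisson

/-- The quasi-Poisson property may be checked on generators; idempotents may be disregarded. -/
theorem isQuasiPoisson_of_generates {I : Type w} [Fintype I] {e : I → A}
    (he : CompleteOrthogonalIdempotents e) (hl : ∀ s a, br (e s) a = 0) {G : Set A}
    (hG : Generates k (Set.range e ∪ G))
    (h : ∀ a ∈ G, ∀ b ∈ G, ∀ c ∈ G, (4 : k) • br.triple a b c = qpRhs k e a b c) :
    br.IsQuasiPoisson e := by
  have hl0 : ∀ s, br.toFun (e s) = 0 := fun s => LinearMap.ext (hl s)
  have hr : ∀ a s, br.toFun a (e s) = 0 := fun a s => by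
    rw [br.antisymm, hl0]; simp
  let P : A → A → A → Prop := fun a b c => (4 : k) • br.triple a b c = qpRhs k e a b c
  have hrot : ∀ a b c, P a b c → P b c a := fun a b c hP => by
    change (4 : k) • br.triple a b c = qpRhs k e a b c at hP
    change (4 : k) • br.triple b c a = qpRhs k e b c a
    rw [← br.triple_rot, ← br.triple_rot, ← qpRhs_rot, ← qpRhs_rot, ← map_smul, ← map_smul, hP]
  -- Both sides vanish when the last argument is an idempotent. Rotation gives the other two
  -- positions.
  have hidem : ∀ a b s, P a b (e s) := fun a b s => by
    change _ = _
    rw [qpRhs_idem he]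
    simp [triple, left, hr, hl0]
  have hgen : ∀ a ∈ Set.range e ∪ G, ∀ b ∈ Set.range e ∪ G, ∀ c ∈ Set.range e ∪ G, P a b c := by
    rintro a (⟨s, rfl⟩ | ha) b hb c hc
    · exact hrot c (e s) b (hrot b c (e s) (hidem b c s))
    rcases hb with ⟨s, rfl⟩ | hb
    · exact hrot c a (e s) (hidem c a s)
    rcases hc with ⟨s, rfl⟩ | hc
    · exact hidem _ _ _
    exact h a ha b hb c hc
  -- Both sides are derivations in the last argument, so agreement on generators suffices there.
  -- Rotating and repeating frees the three arguments one after another.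
  have hext : ∀ a b, (∀ c ∈ Set.range e ∪ G, P a b c) → ∀ c, P a b c := fun a b hc c => by
    let d : A →ₗ[k] (A ⊗[k] A) ⊗[k] A :=
      { toFun := fun c => br.triple a b c
        map_add' := fun c d => by
          simp only [triple, left, map_add, LinearMap.add_apply, LinearMap.rTensor_add]
          abel
        map_smul' := fun t c => by
          simp only [triple, left, map_smul, LinearMap.smul_apply, LinearMap.rTensor_smul,
            RingHom.id_apply, smul_add] }
    have hd : IsDer (inL₃ k A) (inR₃ k A) ((4 : k) • d) :=
      IsDer.smul (fun c d => br.triple_isDer_aux a b c d) 4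
    exact DFunLike.congr_fun (hG.ext hd (qpRhs_isDer e a b) hc) c
  have h1 : ∀ a ∈ Set.range e ∪ G, ∀ b ∈ Set.range e ∪ G, ∀ c, P a b c :=
    fun a ha b hb => hext a b (hgen a ha b hb)
  have h2 : ∀ a ∈ Set.range e ∪ G, ∀ b c, P a b c := fun a ha b =>
    hext a b (fun c hc => hrot c a b (h1 c hc a ha b))
  have h3 : ∀ a b c, P a b c := fun a b =>
    hext a b (fun c hc => hrot c a b (h2 c hc a b))
  exact ⟨hl, fun s a => hr a s, fun a b c => (h3 a b c).trans (qpRhs_apply e a b c)⟩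

theorem IsQuasiPoisson.eq_qpRhs {I : Type w} [Fintype I] {e : I → A} {br : DoubleBracket k A}
    (h : br.IsQuasiPoisson e) (a b c : A) : (4 : k) • br.triple a b c = qpRhs k e a b c :=
  (h.triple_eq a b c).trans (qpRhs_apply e a b c).symm

theorem cube_qpRhs {I : Type w} [Fintype I] (e : I → A) {C : Type x} [Ring C] [Algebra k C]
    (f : A →ₐ[k] C) (a b c : A) :
    cube f (qpRhs k e a b c) = qpRhs k (fun s => f (e s)) (f a) (f b) (f c) := by
  rw [qpRhs_apply, qpRhs_apply, map_sum]
  simp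

/-- The quasi-Poisson property passes to subalgebras which are retracts. -/
theorem IsQuasiPoisson.of_retract {C : Type x} [Ring C] [Algebra k C] {br' : DoubleBracket k C}
    {br : DoubleBracket k A} {f : A →ₐ[k] C} {g : C →ₐ[k] A} (hgf : ∀ a, g (f a) = a)
    (hf : br.Compatible br' f) {I : Type w} [Fintype I] {e : I → A} {e' : I → C}
    (hee : ∀ s, f (e s) = e' s) (h : br'.IsQuasiPoisson e') : br.IsQuasiPoisson e := by
  obtain rfl : (fun s => f (e s)) = e' := funext hee
  -- The retraction makes the tensor square and the tensor cube of f split injective, so identities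
  -- may be checked after applying f.
  have hid : g.comp f = AlgHom.id k A := AlgHom.ext hgf
  have hsq : ∀ z, sq g (sq f z) = z := fun z => by
    have : (sq g).comp (sq f) = AlgHom.id k _ := by
      rw [← Algebra.TensorProduct.map_comp, hid, Algebra.TensorProduct.map_id]
    exact DFunLike.congr_fun this z
  have hcube : ∀ z, cube g (cube f z) = z := fun z => by
    have : (cube g).comp (cube f) = AlgHom.id k _ := by
      rw [← Algebra.TensorProduct.map_comp, ← Algebra.TensorProduct.map_comp, hid,
        Algebra.TensorProduct.map_id, Algebra.TensorProduct.map_id]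
    exact DFunLike.congr_fun this z
  refine ⟨fun s a => ?_, fun s a => ?_, fun a b c => ?_⟩
  · rw [← hsq (br (e s) a), show sq f (br (e s) a) = br' (f (e s)) (f a) from hf _ _,
      h.linear_left, map_zero]
  · rw [← hsq (br a (e s)), show sq f (br a (e s)) = br' (f a) (f (e s)) from hf _ _,
      h.linear_right, map_zero]
  · rw [← qpRhs_apply, ← hcube (_ • _), map_smul, ← br.triple_map hf, h.eq_qpRhs, ← cube_qpRhs,
      hcube]

end QuasiPoisson

section Transport

variable {C : Type w} [Ring C] [Algebra k C]

theorem sq_symm_sq (ψ : A ≃ₐ[k] C) (z : A ⊗[k] A) :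
    sq (ψ.symm : C →ₐ[k] A) (sq (ψ : A →ₐ[k] C) z) = z := by
  have : (sq (ψ.symm : C →ₐ[k] A)).comp (sq (ψ : A →ₐ[k] C)) = AlgHom.id k _ := by
    rw [← Algebra.TensorProduct.map_comp, AlgEquiv.symm_comp, Algebra.TensorProduct.map_id]
  exact DFunLike.congr_fun this z

theorem Isomorphic.symm {br : DoubleBracket k A} {br' : DoubleBracket k C}
    (h : br.Isomorphic br') : br'.Isomorphic br := by
  obtain ⟨ψ, hψ⟩ := h
  refine ⟨ψ.symm, fun a b => ?_⟩
  have := hψ (ψ.symm a) (ψ.symm b)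
  change sq (ψ : A →ₐ[k] C) (br (ψ.symm a) (ψ.symm b)) = _ at this
  simp only [AlgEquiv.coe_toAlgHom, AlgEquiv.apply_symm_apply] at this
  change sq (ψ.symm : C →ₐ[k] A) (br'.toFun a b) = _
  rw [← this, sq_symm_sq]
  rfl

theorem Compatible.comp {D : Type x} [Ring D] [Algebra k D] {br : DoubleBracket k A}
    {br' : DoubleBracket k C} {br'' : DoubleBracket k D} {f : A →ₐ[k] C} {g : C →ₐ[k] D}
    (hg : br'.Compatible br'' g) (hf : br.Compatible br' f) : br.Compatible br'' (g.comp f) := by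
  intro a b
  have h1 : sq (g.comp f) (br a b) = sq g (sq f (br a b)) := by
    have : sq (g.comp f) = (sq g).comp (sq f) := by
      rw [← Algebra.TensorProduct.map_comp]
    rw [this]; rfl
  have h2 : sq f (br a b) = br' (f a) (f b) := hf a b
  change sq (g.comp f) (br a b) = _
  rw [h1, h2]
  exact hg _ _

theorem Isomorphic.trans {D : Type x} [Ring D] [Algebra k D] {br : DoubleBracket k A}
    {br' : DoubleBracket k C} {br'' : DoubleBracket k D}
    (h : br.Isomorphic br') (h' : br'.Isomorphic br'') : br.Isomorphic br'' := by
  obtain ⟨ψ, hψ⟩ := h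
  obtain ⟨φ, hφ⟩ := h'
  have h : ((ψ.trans φ : A ≃ₐ[k] D) : A →ₐ[k] D) = (φ : C →ₐ[k] D).comp (ψ : A →ₐ[k] C) := rfl
  refine ⟨ψ.trans φ, ?_⟩
  rw [h]
  exact Compatible.comp hφ hψ

/-- Transport of a double bracket along an isomorphism. -/
def transport (ψ : A ≃ₐ[k] C) : DoubleBracket k C where
  toFun := (br.toFun.compl₁₂ ψ.symm.toLinearMap ψ.symm.toLinearMap).compr₂
    (sq (ψ : A →ₐ[k] C)).toLinearMap
  antisymm a b := by
    simp only [LinearMap.compr₂_apply, LinearMap.compl₁₂_apply]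
    rw [br.antisymm, map_neg]
    exact congrArg _ (flip_sq _ _).symm
  leibniz a b c := by
    simp only [LinearMap.compr₂_apply, LinearMap.compl₁₂_apply, AlgEquiv.toLinearMap_apply,
      map_mul, AlgHom.toLinearMap_apply]
    rw [br.leibniz, map_add, map_mul, map_mul]
    simp

theorem transport_apply (ψ : A ≃ₐ[k] C) (a b : C) :
    br.transport ψ a b = sq (ψ : A →ₐ[k] C) (br (ψ.symm a) (ψ.symm b)) := rfl

theorem transport_compatible (ψ : A ≃ₐ[k] C) :
    br.Compatible (br.transport ψ) (ψ : A →ₐ[k] C) := fun a b => by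
  rw [transport_apply]
  simp only [AlgEquiv.coe_toAlgHom, AlgEquiv.symm_apply_apply]
  rfl

theorem isomorphic_transport (ψ : A ≃ₐ[k] C) : br.Isomorphic (br.transport ψ) :=
  ⟨ψ, br.transport_compatible ψ⟩

theorem Isomorphic.isQuasiPoisson {br : DoubleBracket k A} {br' : DoubleBracket k C}
    (h : br.Isomorphic br') (hq : br.IsQuasiPoisson (unitIdem A)) :
    br'.IsQuasiPoisson (unitIdem C) := by
  obtain ⟨ψ, hψ⟩ := h.symm
  exact hq.of_retract (f := (ψ : C →ₐ[k] A)) (g := (ψ.symm : A →ₐ[k] C)) (by simp) hψ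
    (fun _ => map_one ψ)

end Transport

end DoubleBracket

end DoubleQP

end

open scoped TensorProduct

noncomputable section

namespace DoubleQP

universe u

/-! ### Computation of triple brackets of generators by means of lists of words. -/

section WordLists

variable {k : Type u} [Field k]

/-- The generator `t` (`true`) or `s` (`false`). -/
def F2.gen (k : Type u) [Field k] (b : Bool) : F2 k := if b then F2.t k else F2.s k

/-- The monomial attached to a word. -/
def F2.word (k : Type u) [Field k] (w : List Bool) : F2 k := (w.map (F2.gen k)).prod

/-- A term of the tensor square with coefficient in `α`. -/
abbrev Term₂ (α : Type) : Type := α × List Bool × List Bool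

/-- A term of the tensor cube with coefficient in `α`. -/
abbrev Term₃ (α : Type) : Type := (α × α) × List Bool × List Bool × List Bool

variable {α : Type}

/-- Evaluation of a list of terms in the tensor square. -/
def ev₂ (v : α → k) (l : List (Term₂ α)) : F2 k ⊗[k] F2 k :=
  (l.map fun x => v x.1 • (F2.word k x.2.1 ⊗ₜ[k] F2.word k x.2.2)).sum

/-- Evaluation of a list of terms in the tensor cube. -/
def ev₃ (v : α → k) (l : List (Term₃ α)) : (F2 k ⊗[k] F2 k) ⊗[k] F2 k :=
  (l.map fun x => (v x.1.1 * v x.1.2) •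
    (F2.word k x.2.1 ⊗ₜ[k] F2.word k x.2.2.1 ⊗ₜ[k] F2.word k x.2.2.2)).sum

/-- The bracket of a generator with a word, from the brackets `G` of the generators. -/
def brW (G : Bool → Bool → List (Term₂ α)) (x : Bool) : List Bool → List (Term₂ α)
  | [] => []
  | y :: w => (G x y).map (fun z => (z.1, z.2.1, z.2.2 ++ w)) ++
      (brW G x w).map (fun z => (z.1, y :: z.2.1, z.2.2))

/-- `⦃x, -⦄ ⊗ id` on lists of terms. -/
def leftW (G : Bool → Bool → List (Term₂ α)) (x : Bool) (l : List (Term₂ α)) : List (Term₃ α) :=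
  l.flatMap fun z => (brW G x z.2.1).map fun y => ((z.1, y.1), y.2.1, y.2.2, z.2.2)

/-- The triple bracket of three generators. -/
def tripleW (G : Bool → Bool → List (Term₂ α)) (x y z : Bool) : List (Term₃ α) :=
  leftW G x (G y z) ++
    (leftW G y (G z x)).map (fun a => (a.1, a.2.2.2, a.2.1, a.2.2.1)) ++
    (leftW G z (G x y)).map (fun a => (a.1, a.2.2.1, a.2.2.2, a.2.1))

/-- Comparison of words. -/
def eqW : List Bool → List Bool → Bool
  | [], [] => true
  | true :: v, true :: w => eqW v w
  | false :: v, false :: w => eqW v w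
  | _, _ => false

/-- The coefficients of a given triple of words in a list of terms. -/
def coefW (p q r : List Bool) : List (Term₃ α) → List (α × α)
  | [] => []
  | x :: l => bif eqW x.2.1 p && eqW x.2.2.1 q && eqW x.2.2.2 r then x.1 :: coefW p q r l
      else coefW p q r l

/-- Signed symbols for the coefficients of the double brackets under consideration. -/
abbrev Sym : Type := Bool × ℕ

/-- The values of the unsigned symbols. -/
def symVal (c : Coeffs k) (n : ℕ) : k :=
  -- Index 0 is the constant 1 used by `qpW`. Indices 1–3 and 4–6 are the consecutive triples read
  -- by `selfW`, and 7–23 follow the order of `mixedW`. The default value is never reached by these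
  -- lists.
  [1, c.lam, c.mu, c.nu, c.l, c.m, c.n, c.a0, c.a0p, c.b0, c.b0p, c.g0, c.g1, c.a1, c.a1p, c.a2,
    c.a2p, c.a3, c.a3p, c.b1, c.b1p, c.b2, c.b2p, c.g].getD n 0

/-- The values of the signed symbols. -/
def Sym.val (c : Coeffs k) (x : Sym) : k := bif x.1 then symVal c x.2 else -symVal c x.2

/-- The right-hand side of the quasi-Poisson property, on three generators. -/
def qpW (a b c : Bool) : List (Term₃ Sym) :=
  let p : Sym := (true, 0)
  let n : Sym := (false, 0)
  [((p, p), [c, a], [b], []), ((n, p), [c, a], [], [b]), ((n, p), [c], [a, b], []),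
    ((p, p), [c], [a], [b]), ((n, p), [a], [b], [c]), ((p, p), [a], [], [b, c]),
    ((p, p), [], [a, b], [c]), ((n, p), [], [a], [b, c])]

/-- The value of `⦃t, s⦄`. -/
def mixedW : List (Term₂ Sym) :=
  [((true, 7), [true, true], []), ((true, 8), [], [true, true]), ((true, 9), [false, false], []),
    ((true, 10), [], [false, false]), ((true, 11), [true], [true]), ((true, 12), [false], [false]),
    ((true, 13), [true, false], []), ((true, 14), [false, true], []), ((true, 15), [true], [false]),
    ((true, 16), [false], [true]), ((true, 17), [], [true, false]), ((true, 18), [], [false, true]),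
    ((true, 19), [true], []), ((true, 20), [], [true]), ((true, 21), [false], []),
    ((true, 22), [], [false]), ((true, 23), [], [])]

/-- The value of `⦃x, x⦄` for a generator `x`. -/
def selfW (n : ℕ) (x : Bool) : List (Term₂ Sym) :=
  [((true, n), [x], []), ((false, n), [], [x]), ((true, n + 1), [x, x], []),
    ((false, n + 1), [], [x, x]), ((true, n + 2), [x, x], [x]), ((false, n + 2), [x], [x, x])]

/-- The values of the double bracket on generators. -/
def genW : Bool → Bool → List (Term₂ Sym)
  | true, true => selfW 1 true
  | false, false => selfW 4 false
  | true, false => mixedW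
  | false, true => mixedW.map fun x => ((!x.1.1, x.1.2), x.2.2, x.2.1)

theorem F2.word_nil : F2.word k [] = 1 := rfl

theorem F2.word_cons (b : Bool) (w : List Bool) :
    F2.word k (b :: w) = F2.gen k b * F2.word k w := by
  simp [F2.word]

theorem F2.word_append (v w : List Bool) : F2.word k (v ++ w) = F2.word k v * F2.word k w := by
  simp [F2.word]

variable {v : α → k}

theorem ev₂_append (l l' : List (Term₂ α)) : ev₂ v (l ++ l') = ev₂ v l + ev₂ v l' := by
  simp [ev₂]

theorem ev₃_append (l l' : List (Term₃ α)) :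
    ev₃ v (l ++ l') = ev₃ v l + ev₃ v l' := by
  simp [ev₃]

theorem ev₂_nil : ev₂ v ([] : List (Term₂ α)) = 0 := rfl

theorem ev₂_cons (x : Term₂ α) (l : List (Term₂ α)) :
    ev₂ v (x :: l) = v x.1 • (F2.word k x.2.1 ⊗ₜ[k] F2.word k x.2.2) + ev₂ v l := by
  simp [ev₂]

theorem ev₃_nil : ev₃ v ([] : List (Term₃ α)) = 0 := rfl

theorem ev₃_cons (x : Term₃ α)
    (l : List (Term₃ α)) : ev₃ v (x :: l) =
      (v x.1.1 * v x.1.2) • (F2.word k x.2.1 ⊗ₜ[k] F2.word k x.2.2.1 ⊗ₜ[k] F2.word k x.2.2.2)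
        + ev₃ v l := by
  simp [ev₃]

theorem ev₂_map_right (l : List (Term₂ α)) (w : List Bool) :
    ev₂ v (l.map fun z => (z.1, z.2.1, z.2.2 ++ w)) = ev₂ v l * ((1 : F2 k) ⊗ₜ[k] F2.word k w) := by
  induction l with
  | nil => simp [ev₂_nil]
  | cons x l ih =>
    rw [List.map_cons, ev₂_cons, ev₂_cons, ih, add_mul]
    rw [smul_mul_assoc, Algebra.TensorProduct.tmul_mul_tmul, mul_one, F2.word_append]

theorem ev₂_map_left (l : List (Term₂ α)) (y : Bool) :
    ev₂ v (l.map fun z => (z.1, y :: z.2.1, z.2.2)) = (F2.gen k y ⊗ₜ[k] (1 : F2 k)) * ev₂ v l := by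
  induction l with
  | nil => simp [ev₂_nil]
  | cons x l ih =>
    rw [List.map_cons, ev₂_cons, ev₂_cons, ih, mul_add]
    rw [mul_smul_comm, Algebra.TensorProduct.tmul_mul_tmul, one_mul, F2.word_cons]

theorem ev₃_map_rot (l : List (Term₃ α)) :
    ev₃ v (l.map fun a => (a.1, a.2.2.2, a.2.1, a.2.2.1)) = rot k _ (ev₃ v l) := by
  induction l with
  | nil => simp [ev₃_nil]
  | cons x l ih =>
    rw [List.map_cons, ev₃_cons, ev₃_cons, ih, map_add, map_smul, DoubleBracket.rot_tmul]

theorem ev₃_map_rot_rot (l : List (Term₃ α)) :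
    ev₃ v (l.map fun a => (a.1, a.2.2.1, a.2.2.2, a.2.1)) = rot k _ (rot k _ (ev₃ v l)) := by
  rw [← ev₃_map_rot, ← ev₃_map_rot, List.map_map]
  rfl

variable {br : DoubleBracket k (F2 k)} {G : Bool → Bool → List (Term₂ α)}

theorem ev₂_brW
    (hG : ∀ x y, br.toFun (F2.gen k x) (F2.gen k y) = ev₂ v (G x y)) (x : Bool) (w : List Bool) :
    br.toFun (F2.gen k x) (F2.word k w) = ev₂ v (brW G x w) := by
  induction w with
  | nil => exact (br.isDer_right _).map_one
  | cons y w ih =>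
    rw [F2.word_cons, br.leibniz, hG, ih, brW, ev₂_append, ev₂_map_right, ev₂_map_left]

theorem ev₃_leftW
    (hG : ∀ x y, br.toFun (F2.gen k x) (F2.gen k y) = ev₂ v (G x y)) (x : Bool)
      (l : List (Term₂ α)) :
    br.left (F2.gen k x) (ev₂ v l) = ev₃ v (leftW G x l) := by
  induction l with
  | nil => simp [leftW, ev₂_nil, ev₃_nil]
  | cons z l ih =>
    have h : leftW G x (z :: l) = ((brW G x z.2.1).map fun y => ((z.1, y.1), y.2.1, y.2.2,
        z.2.2)) ++
      leftW G x l := by simp [leftW]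
    rw [h, ev₃_append, ← ih, ev₂_cons, map_add, map_smul, DoubleBracket.left_tmul]
    congr 1
    change v z.1 • (br.toFun (F2.gen k x) (F2.word k z.2.1) ⊗ₜ[k] _) = _
    rw [ev₂_brW hG]
    generalize brW G x z.2.1 = l'
    induction l' with
    | nil => simp [ev₂_nil, ev₃_nil]
    | cons y l' ih =>
      rw [List.map_cons, ev₃_cons, ← ih, ev₂_cons, TensorProduct.add_tmul, smul_add,
        ← TensorProduct.smul_tmul', smul_smul]

/-- Words and coefficients are kept as formal symbols until evaluation. The expansion of a triple
bracket is thus a closed computation that does not involve the field, and a single evaluation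
transfers it to the tensor cube. -/
theorem ev₃_tripleW
    (hG : ∀ x y, br.toFun (F2.gen k x) (F2.gen k y) = ev₂ v (G x y)) (x y z : Bool) :
    br.triple (F2.gen k x) (F2.gen k y) (F2.gen k z) = ev₃ v (tripleW G x y z) := by
  rw [tripleW, ev₃_append, ev₃_append, ev₃_map_rot, ev₃_map_rot_rot, ← ev₃_leftW hG,
    ← ev₃_leftW hG, ← ev₃_leftW hG, ← hG, ← hG, ← hG]
  rfl

theorem ev₃_qpW (c : Coeffs k) (x y z : Bool) : DoubleBracket.qpRhs k (unitIdem (F2 k))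
    (F2.gen k x) (F2.gen k y)
    (F2.gen k z) = ev₃ (Sym.val c) (qpW x y z) := by
  have hneg : ∀ z : (F2 k ⊗[k] F2 k) ⊗[k] F2 k, (-1 : k) • z = -z := fun z => neg_one_smul k z
  have h1 : Sym.val c (true, 0) = 1 := rfl
  have h2 : Sym.val c (false, 0) = -1 := rfl
  rw [DoubleBracket.qpRhs_apply]
  simp only [hneg, h1, h2, Finset.univ_unique, Finset.sum_singleton, unitIdem, qpW, ev₃_cons,
    ev₃_nil, F2.word_cons, F2.word_nil, mul_one, one_mul, one_smul]
  abel

theorem eqW_iff (v w : List Bool) : eqW v w = true ↔ v = w := by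
  induction v generalizing w with
  | nil => cases w <;> simp [eqW]
  | cons a v ih =>
    rcases w with _ | ⟨b, w⟩
    · cases a <;> simp [eqW]
    · cases a <;> cases b <;> simp [eqW, ih]

variable (k) in
/-- The coefficient of a word. -/
theorem exists_wordCoeff (w : List Bool) : ∃ f : F2 k →ₗ[k] k,
    ∀ v, f (F2.word k v) = bif eqW v w then 1 else 0 := by
  let i : Bool → Fin 2 := fun b => if b then 1 else 0
  have hi : Function.Injective i := by decide
  let Φ := FreeAlgebra.equivMonoidAlgebraFreeMonoid (R := k) (X := Fin 2)
  have hg : ∀ b, Φ (F2.gen k b) = MonoidAlgebra.of k _ (FreeMonoid.of (i b)) := fun b => by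
    cases b <;>
      simp [Φ, F2.gen, F2.s, F2.t, i, FreeAlgebra.equivMonoidAlgebraFreeMonoid]
  have hw : ∀ v, Φ (F2.word k v) = MonoidAlgebra.of k _ (FreeMonoid.ofList (v.map i)) := fun v => by
    induction v with
    | nil => rw [F2.word_nil, map_one]; exact (map_one (MonoidAlgebra.of k _)).symm
    | cons b v ih => rw [F2.word_cons, map_mul, hg, ih, ← map_mul]; rfl
  classical
  refine ⟨Finsupp.lapply (FreeMonoid.ofList (w.map i)) ∘ₗ
    (MonoidAlgebra.coeffLinearEquiv k).toLinearMap ∘ₗ Φ.toLinearMap, fun v => ?_⟩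
  change (Φ (F2.word k v)).coeff _ = _
  rw [hw, MonoidAlgebra.of_apply, MonoidAlgebra.coeff_single, Finsupp.single_apply]
  have h : FreeMonoid.ofList (v.map i) = FreeMonoid.ofList (w.map i) ↔ v = w :=
    (List.map_injective_iff.2 hi).eq_iff
  have h' : eqW v w = true ↔ v = w := eqW_iff v w
  by_cases hvw : v = w
  · rw [if_pos (h.2 hvw), h'.2 hvw]; rfl
  · rw [if_neg (mt h.1 hvw), Bool.eq_false_iff.2 (mt h'.1 hvw)]; rfl

/-- The product of three word-coefficient functionals isolates one triple of words. It turns an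
identity in the tensor cube into an identity between scalars. -/
theorem exists_tripleCoeff (v : α → k) (p q r : List Bool) :
    ∃ f : (F2 k ⊗[k] F2 k) ⊗[k] F2 k →ₗ[k] k,
    ∀ l, f (ev₃ v l) = ((coefW p q r l).map fun x => v x.1 * v x.2).sum := by
  obtain ⟨f, hf⟩ := exists_wordCoeff k p
  obtain ⟨g, hg⟩ := exists_wordCoeff k q
  obtain ⟨h, hh⟩ := exists_wordCoeff k r
  refine ⟨LinearMap.mul' k k ∘ₗ TensorProduct.map (LinearMap.mul' k k ∘ₗ TensorProduct.map f g) h,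
    fun l => ?_⟩
  induction l with
  | nil => simp [ev₃_nil, coefW]
  | cons x l ih =>
    rw [ev₃_cons, map_add, map_smul, ih, coefW]
    simp only [LinearMap.comp_apply, TensorProduct.map_tmul, LinearMap.mul'_apply, hf, hg, hh]
    cases eqW x.2.1 p <;> cases eqW x.2.2.1 q <;> cases eqW x.2.2.2 r <;> simp

theorem F2.gen_true : F2.gen k true = F2.t k := rfl

theorem F2.gen_false : F2.gen k false = F2.s k := rfl

theorem ev₂_map_flip {c : Coeffs k} (l : List (Term₂ Sym)) :
    ev₂ (Sym.val c) (l.map fun x => ((!x.1.1, x.1.2), x.2.2, x.2.1)) =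
      -flip k _ (ev₂ (Sym.val c) l) := by
  induction l with
  | nil => simp [ev₂_nil]
  | cons x l ih =>
    have h : flip k _ (F2.word k x.2.1 ⊗ₜ[k] F2.word k x.2.2) =
      F2.word k x.2.2 ⊗ₜ[k] F2.word k x.2.1 := rfl
    have h' : Sym.val c (!x.1.1, x.1.2) = -Sym.val c x.1 := by
      obtain ⟨⟨_ | _, n⟩, -⟩ := x <;> simp [Sym.val]
    rw [List.map_cons, ev₂_cons, ev₂_cons, ih, map_add, map_smul, h, h']
    module

theorem ev₂_selfW {c : Coeffs k} (n : ℕ) (x : Bool) : ev₂ (Sym.val c) (selfW n x) =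
    selfTerm (symVal c n) (symVal c (n + 1)) (symVal c (n + 2)) (F2.gen k x) := by
  simp only [selfTerm, selfW, ev₂_cons, ev₂_nil, F2.word_cons, F2.word_nil, mul_one, Sym.val,
    cond_true, cond_false]
  module

theorem ev₂_genW {c : Coeffs k} (h : HasForm c br) (x y : Bool) :
    br.toFun (F2.gen k x) (F2.gen k y) = ev₂ (Sym.val c) (genW x y) := by
  have hts : br.toFun (F2.t k) (F2.s k) = ev₂ (Sym.val c) mixedW := by
    refine (h.ts).trans ?_
    simp only [mixedTerm, mixedW, ev₂_cons, ev₂_nil, F2.word_cons, F2.word_nil, F2.gen_true,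
      F2.gen_false, add_assoc, mul_one, add_zero]
    rfl
  cases x <;> cases y
  · exact h.ss.trans (ev₂_selfW 4 false).symm
  · exact ((br.antisymm _ _).trans (congrArg (fun z => -flip k _ z) hts)).trans
      (ev₂_map_flip _).symm
  · exact hts
  · exact h.tt.trans (ev₂_selfW 1 true).symm

/-- The coefficients of the quasi-Poisson property, on three generators. -/
theorem coefW_eq {c : Coeffs k} (h : HasForm c br) (hq : br.IsQuasiPoisson (unitIdem (F2 k)))
    {x y z : Bool} (p q r : List Bool) {l l' : List (Sym × Sym)}
    (hl : coefW p q r (tripleW genW x y z) = l) (hl' : coefW p q r (qpW x y z) = l') :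
    4 * (l.map fun x => x.1.val c * x.2.val c).sum =
      (l'.map fun x => x.1.val c * x.2.val c).sum := by
  obtain ⟨f, hf⟩ := exists_tripleCoeff (Sym.val c) p q r
  rw [← hl, ← hl', ← hf, ← hf, ← ev₃_tripleW (ev₂_genW h), ← ev₃_qpW, ← hq.eq_qpRhs, map_smul,
    smul_eq_mul]

end WordLists

end DoubleQP

end

open scoped TensorProduct

noncomputable section

namespace DoubleQP

universe u

/-! ### The polynomial equations satisfied by the coefficients. -/

section Classification

variable {k : Type u} [Field k]

/-- The coefficients which vanish for double quasi-Poisson brackets. -/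
structure Coeffs.Vanish (c : Coeffs k) : Prop where
  a0 : c.a0 = 0
  a0p : c.a0p = 0
  b0 : c.b0 = 0
  b0p : c.b0p = 0
  a1 : c.a1 = 0
  a3p : c.a3p = 0

/-- Equations satisfied by the coefficients of a double quasi-Poisson bracket. The name of a field
records the arguments of the triple bracket and the triple of words considered. -/
structure Coeffs.Equations (c : Coeffs k) : Prop where
  tts_e_e_s : -4 * c.b2p * c.b2p - 4 * c.b2p * c.lam + 4 * c.g * c.g1 = 0
  tts_s_e_e : 4 * c.b2 * c.b2 - 4 * c.b2 * c.lam - 4 * c.g * c.g1 = 0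
  tts_e_e_t : 4 * c.a2p * c.g - 4 * c.b1p * c.b2p - 4 * c.g * c.mu = 0
  tts_t_e_e : -4 * c.a2 * c.g + 4 * c.b1 * c.b2 - 4 * c.g * c.mu = 0
  tts_e_t_e : 4 * c.a1p * c.g - 4 * c.a3 * c.g - 4 * c.b1 * c.b2p - 4 * c.b1 * c.lam
    + 4 * c.b1p * c.b2 - 4 * c.b1p * c.lam = 0
  tts_e_t_t : 4 * c.a2p * c.b1p - 4 * c.a3 * c.b1p - 4 * c.b2p * c.g0 - 4 * c.g * c.nu - 4 * c.g0 * c.lam = 0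
  tts_e_t_ts : -4 * c.a3 * c.a3 - 4 * c.b2p * c.nu + 1 = 0
  tts_t_e_ts : -4 * c.a2 * c.a3 - 4 * c.a2 * c.mu - 4 * c.a3 * c.mu - 1 = 0
  tts_st_e_t : 4 * c.a1p * c.a2p - 4 * c.a1p * c.mu - 4 * c.a2p * c.mu + 1 = 0
  tts_st_t_e : 4 * c.a1p * c.a1p - 4 * c.b2 * c.nu - 1 = 0
  tts_t_t_s : -4 * c.a2 * c.a2 - 4 * c.b2p * c.nu + 4 * c.g0 * c.g1 + 1 = 0
  tts_s_t_t : 4 * c.a2p * c.a2p - 4 * c.b2 * c.nu - 4 * c.g0 * c.g1 - 1 = 0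
  tts_s_e_ts : -4 * c.a3 * c.g1 - 4 * c.g1 * c.mu = 0
  tts_st_e_s : 4 * c.a1p * c.g1 - 4 * c.g1 * c.mu = 0
  tts_e_tt_t : -4 * c.a3 * c.g0 - 4 * c.g0 * c.mu = 0
  tts_t_tt_e : 4 * c.a1p * c.g0 - 4 * c.g0 * c.mu = 0
  tts_s_t_s : -4 * c.a2 * c.g1 + 4 * c.a2p * c.g1 = 0
  tts_st_t_t : -4 * c.a1p * c.nu - 4 * c.a2p * c.nu = 0
  tts_t_t_ts : -4 * c.a2 * c.nu - 4 * c.a3 * c.nu = 0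
  tts_t_tt_t : -4 * c.g0 * c.nu = 0
  tts_s_tt_s : 4 * c.g1 * c.nu = 0
  tss_e_e_s : -4 * c.a1p * c.g + 4 * c.a3 * c.g - 4 * c.b1 * c.b2p + 4 * c.b1p * c.b2
    + 4 * c.b2 * c.l + 4 * c.b2p * c.l = 0
  tss_e_t_e : 4 * c.b1p * c.b1p + 4 * c.b1p * c.l - 4 * c.g * c.g0 = 0
  tss_t_e_e : -4 * c.b1 * c.b1 + 4 * c.b1 * c.l + 4 * c.g * c.g0 = 0
  tss_e_s_e : -4 * c.a2 * c.g + 4 * c.b1p * c.b2p + 4 * c.g * c.m = 0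
  tss_e_ts_s : 4 * c.a3 * c.a3 + 4 * c.b1p * c.n - 1 = 0
  tss_st_e_s : -4 * c.a1p * c.a1p + 4 * c.b1 * c.n + 1 = 0
  tss_st_t_e : -4 * c.a1p * c.g0 + 4 * c.g0 * c.m = 0
  tss_s_e_ss : -4 * c.a1p * c.g1 + 4 * c.g1 * c.m = 0
  tss_s_ts_e : 4 * c.a2p * c.a3 + 4 * c.a2p * c.m + 4 * c.a3 * c.m + 1 = 0
  tss_st_s_e : -4 * c.a1p * c.a2 + 4 * c.a1p * c.m + 4 * c.a2 * c.m - 1 = 0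
  tss_s_ts_s : 4 * c.a2p * c.n + 4 * c.a3 * c.n = 0
  tss_st_s_s : 4 * c.a1p * c.n + 4 * c.a2 * c.n = 0
  tss_t_ts_s : 4 * c.g0 * c.n = 0
  tss_s_s_ss : 4 * c.g1 * c.n = 0
  tss_s_e_s : -4 * c.a1p * c.b2 + 4 * c.a2p * c.b2 - 4 * c.b1 * c.g1 + 4 * c.g * c.n
    + 4 * c.g1 * c.l = 0
  tss_t_t_s : -4 * c.a2 * c.g0 + 4 * c.a2p * c.g0 = 0

variable [CharZero k] {br : DoubleBracket k (F2 k)} {c : Coeffs k}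

/-- Each of these coefficients is alone, up to sign, in contributing its square to a suitable triple
of words that is absent from the right-hand side. For instance t³ ⊗ 1 ⊗ 1 occurs in the triple
bracket of (t,s,s) with coefficient −`a0`². Since 4 is invertible, the coefficient is zero. -/
theorem coeffs_vanish (h : HasForm c br) (hq : br.IsQuasiPoisson (unitIdem (F2 k))) : c.Vanish := by
  exact ⟨by
    have := coefW_eq h hq (x := true) (y := false) (z := false) [true, true, true] [] []
      (l := [((true, 7), (false, 7))]) (by decide +kernel) rfl
    change 4 * (c.a0 * -c.a0 + 0) = 0 at this
    simpa using this,
    by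
    have := coefW_eq h hq (x := true) (y := false) (z := false) [] [true, true, true] []
      (l := [((false, 8), (false, 8))]) (by decide +kernel) rfl
    change 4 * (-c.a0p * -c.a0p + 0) = 0 at this
    simpa using this,
    by
    have := coefW_eq h hq (x := true) (y := true) (z := false) [false, false, false] [] []
      (l := [((true, 9), (true, 9))]) (by decide +kernel) rfl
    change 4 * (c.b0 * c.b0 + 0) = 0 at this
    simpa using this,
    by
    have := coefW_eq h hq (x := true) (y := true) (z := false) [] [] [false, false, false]
      (l := [((false, 10), (true, 10))]) (by decide +kernel) rfl
    change 4 * (-c.b0p * c.b0p + 0) = 0 at this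
    simpa using this,
    by
    have := coefW_eq h hq (x := true) (y := true) (z := false) [true, true, false] [] []
      (l := [((true, 13), (true, 13))]) (by decide +kernel) rfl
    change 4 * (c.a1 * c.a1 + 0) = 0 at this
    simpa using this,
    by
    have := coefW_eq h hq (x := true) (y := true) (z := false) [] [] [false, true, true]
      (l := [((false, 18), (true, 18))]) (by decide +kernel) rfl
    change 4 * (-c.a3p * c.a3p + 0) = 0 at this
    simpa using this⟩

/-- Every equation compares one coefficient on the two sides of the identity for (t,t,s) or (t,s,s).
The list `l` is the collection of contributing products; once it is confirmed by evaluation, the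
coefficients already known to vanish are discarded. -/
theorem coeffs_equations (h : HasForm c br) (hq : br.IsQuasiPoisson (unitIdem (F2 k))) :
    c.Equations := by
  obtain ⟨a0, a0p, b0, b0p, a1, a3p⟩ := coeffs_vanish h hq
  constructor
  · have := coefW_eq h hq (x := true) (y := true) (z := false) [] [] [false]
      (l := [((true, 12), (true, 23)), ((false, 10), (true, 23)), ((false, 22), (true, 22)),
          ((true, 1), (false, 22))]) (by decide +kernel) rfl
    change 4 * (c.g1 * c.g + (-c.b0p * c.g + (-c.b2p * c.b2p + (c.lam * -c.b2p + 0)))) = 0 at this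
    simp only [b0p, zero_mul, mul_zero, neg_zero] at this
    linear_combination this
  · have := coefW_eq h hq (x := true) (y := true) (z := false) [false] [] []
      (l := [((true, 9), (true, 23)), ((true, 21), (true, 21)), ((false, 12), (true, 23)),
          ((true, 1), (false, 21))]) (by decide +kernel) rfl
    change 4 * (c.b0 * c.g + (c.b2 * c.b2 + (-c.g1 * c.g + (c.lam * -c.b2 + 0)))) = 0 at this
    simp only [b0, zero_mul, mul_zero, neg_zero] at this
    linear_combination this
  · have := coefW_eq h hq (x := true) (y := true) (z := false) [] [] [true]
      (l := [((true, 16), (true, 23)), ((false, 18), (true, 23)), ((false, 20), (false, 1)),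
          ((false, 22), (true, 20)), ((true, 1), (false, 20)), ((true, 2), (false, 23))])
          (by decide +kernel) rfl
    change 4 * (c.a2p * c.g + (-c.a3p * c.g + (-c.b1p * -c.lam + (-c.b2p * c.b1p
        + (c.lam * -c.b1p + (c.mu * -c.g + 0)))))) = 0 at this
    simp only [a3p, zero_mul, mul_zero, neg_zero] at this
    linear_combination this
  · have := coefW_eq h hq (x := true) (y := true) (z := false) [true] [] []
      (l := [((true, 13), (true, 23)), ((true, 19), (true, 1)), ((true, 21), (true, 19)),
          ((false, 15), (true, 23)), ((true, 1), (false, 19)), ((true, 2), (false, 23))])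
          (by decide +kernel) rfl
    change 4 * (c.a1 * c.g + (c.b1 * c.lam + (c.b2 * c.b1 + (-c.a2 * c.g + (c.lam * -c.b1
        + (c.mu * -c.g + 0)))))) = 0 at this
    simp only [a1, zero_mul, mul_zero, neg_zero] at this
    linear_combination this
  · have := coefW_eq h hq (x := true) (y := true) (z := false) [] [true] []
      (l := [((true, 14), (true, 23)), ((true, 19), (false, 1)), ((true, 21), (true, 20)),
          ((false, 17), (true, 23)), ((false, 20), (true, 1)), ((false, 22), (true, 19))])
          (by decide +kernel) rfl
    change 4 * (c.a1p * c.g + (c.b1 * -c.lam + (c.b2 * c.b1p + (-c.a3 * c.g + (-c.b1p * c.lam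
        + (-c.b2p * c.b1 + 0)))))) = 0 at this
    linear_combination this
  · have := coefW_eq h hq (x := true) (y := true) (z := false) [] [true] [true]
      (l := [((true, 11), (false, 1)), ((true, 16), (true, 20)), ((false, 8), (true, 1)),
          ((false, 8), (false, 1)), ((false, 17), (true, 20)), ((false, 18), (true, 19)), ((false, 22),
          (true, 11)), ((true, 3), (false, 23))]) (by decide +kernel) rfl
    change 4 * (c.g0 * -c.lam + (c.a2p * c.b1p + (-c.a0p * c.lam + (-c.a0p * -c.lam
        + (-c.a3 * c.b1p + (-c.a3p * c.b1 + (-c.b2p * c.g0 + (c.nu * -c.g + 0)))))))) = 0 at this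
    simp only [a0p, a3p, zero_mul, mul_zero, neg_zero] at this
    linear_combination this
  · have := coefW_eq h hq (x := true) (y := true) (z := false) [] [true] [true, false]
      (l := [((false, 10), (true, 11)), ((false, 17), (true, 17)), ((true, 3), (false, 22))])
          (by decide +kernel) rfl
    change 4 * (-c.b0p * c.g0 + (-c.a3 * c.a3 + (c.nu * -c.b2p + 0))) = -1 * 1 + 0 at this
    simp only [b0p, zero_mul, mul_zero, neg_zero] at this
    linear_combination this
  · have := coefW_eq h hq (x := true) (y := true) (z := false) [true] [] [true, false]
      (l := [((false, 15), (true, 17)), ((true, 2), (false, 17)), ((true, 2), (false, 15))])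
          (by decide +kernel) rfl
    change 4 * (-c.a2 * c.a3 + (c.mu * -c.a3 + (c.mu * -c.a2 + 0))) = 1 * 1 + 0 at this
    linear_combination this
  · have := coefW_eq h hq (x := true) (y := true) (z := false) [false, true] [] [true]
      (l := [((true, 16), (true, 14)), ((true, 2), (false, 16)), ((true, 2), (false, 14))])
          (by decide +kernel) rfl
    change 4 * (c.a2p * c.a1p + (c.mu * -c.a2p + (c.mu * -c.a1p + 0))) = -1 * 1 + 0 at this
    linear_combination this
  · have := coefW_eq h hq (x := true) (y := true) (z := false) [false, true] [true] []
      (l := [((true, 9), (true, 11)), ((true, 14), (true, 14)), ((true, 3), (false, 21))])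
          (by decide +kernel) rfl
    change 4 * (c.b0 * c.g0 + (c.a1p * c.a1p + (c.nu * -c.b2 + 0))) = 1 * 1 + 0 at this
    simp only [b0, zero_mul, mul_zero, neg_zero] at this
    linear_combination this
  · have := coefW_eq h hq (x := true) (y := true) (z := false) [true] [true] [false]
      (l := [((true, 12), (true, 11)), ((false, 15), (true, 15)), ((true, 3), (false, 22))])
          (by decide +kernel) rfl
    change 4 * (c.g1 * c.g0 + (-c.a2 * c.a2 + (c.nu * -c.b2p + 0))) = -1 * 1 + 0 at this
    linear_combination this
  · have := coefW_eq h hq (x := true) (y := true) (z := false) [false] [true] [true]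
      (l := [((true, 16), (true, 16)), ((false, 12), (true, 11)), ((true, 3), (false, 21))])
          (by decide +kernel) rfl
    change 4 * (c.a2p * c.a2p + (-c.g1 * c.g0 + (c.nu * -c.b2 + 0))) = 1 * 1 + 0 at this
    linear_combination this
  · have := coefW_eq h hq (x := true) (y := true) (z := false) [false] [] [true, false]
      (l := [((false, 12), (true, 17)), ((true, 2), (false, 12))]) (by decide +kernel) rfl
    change 4 * (-c.g1 * c.a3 + (c.mu * -c.g1 + 0)) = 0 at this
    linear_combination this
  · have := coefW_eq h hq (x := true) (y := true) (z := false) [false, true] [] [false]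
      (l := [((true, 12), (true, 14)), ((true, 2), (false, 12))]) (by decide +kernel) rfl
    change 4 * (c.g1 * c.a1p + (c.mu * -c.g1 + 0)) = 0 at this
    linear_combination this
  · have := coefW_eq h hq (x := true) (y := true) (z := false) [] [true, true] [true]
      (l := [((true, 11), (false, 2)), ((true, 16), (true, 8)), ((false, 8), (true, 2)),
          ((false, 17), (true, 11)), ((false, 18), (true, 7)), ((false, 20), (true, 3)), ((false, 3),
          (false, 20))]) (by decide +kernel) rfl
    change 4 * (c.g0 * -c.mu + (c.a2p * c.a0p + (-c.a0p * c.mu + (-c.a3 * c.g0 + (-c.a3p * c.a0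
        + (-c.b1p * c.nu + (-c.nu * -c.b1p + 0))))))) = 0 at this
    simp only [a0, a0p, a3p, zero_mul, mul_zero, neg_zero] at this
    linear_combination this
  · have := coefW_eq h hq (x := true) (y := true) (z := false) [true] [true, true] []
      (l := [((true, 7), (false, 2)), ((true, 13), (true, 8)), ((true, 14), (true, 11)),
          ((true, 19), (false, 3)), ((false, 11), (true, 2)), ((false, 15), (true, 7)), ((false, 3),
          (false, 19))]) (by decide +kernel) rfl
    change 4 * (c.a0 * -c.mu + (c.a1 * c.a0p + (c.a1p * c.g0 + (c.b1 * -c.nu + (-c.g0 * c.mu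
        + (-c.a2 * c.a0 + (-c.nu * -c.b1 + 0))))))) = 0 at this
    simp only [a0, a0p, a1, zero_mul, mul_zero, neg_zero] at this
    linear_combination this
  · have := coefW_eq h hq (x := true) (y := true) (z := false) [false] [true] [false]
      (l := [((true, 12), (true, 16)), ((false, 12), (true, 15))]) (by decide +kernel) rfl
    change 4 * (c.g1 * c.a2p + (-c.g1 * c.a2 + 0)) = 0 at this
    linear_combination this
  · have := coefW_eq h hq (x := true) (y := true) (z := false) [false, true] [true] [true]
      (l := [((true, 3), (false, 16)), ((true, 3), (false, 14))]) (by decide +kernel) rfl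
    change 4 * (c.nu * -c.a2p + (c.nu * -c.a1p + 0)) = 0 at this
    linear_combination this
  · have := coefW_eq h hq (x := true) (y := true) (z := false) [true] [true] [true, false]
      (l := [((true, 3), (false, 17)), ((true, 3), (false, 15))]) (by decide +kernel) rfl
    change 4 * (c.nu * -c.a3 + (c.nu * -c.a2 + 0)) = 0 at this
    linear_combination this
  · have := coefW_eq h hq (x := true) (y := true) (z := false) [true] [true, true] [true]
      (l := [((true, 11), (false, 3)), ((false, 11), (true, 3)), ((false, 3), (false, 11))])
          (by decide +kernel) rfl
    change 4 * (c.g0 * -c.nu + (-c.g0 * c.nu + (-c.nu * -c.g0 + 0))) = 0 at this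
    linear_combination this
  · have := coefW_eq h hq (x := true) (y := true) (z := false) [false] [true, true] [false]
      (l := [((false, 3), (false, 12))]) (by decide +kernel) rfl
    change 4 * (-c.nu * -c.g1 + 0) = 0 at this
    linear_combination this
  · have := coefW_eq h hq (x := true) (y := false) (z := false) [] [] [false]
      (l := [((false, 17), (false, 23)), ((false, 20), (false, 21)), ((false, 22), (false, 4)),
          ((true, 14), (false, 23)), ((true, 19), (false, 22)), ((true, 21), (true, 4))])
          (by decide +kernel) rfl
    change 4 * (-c.a3 * -c.g + (-c.b1p * -c.b2 + (-c.b2p * -c.l + (c.a1p * -c.g + (c.b1 * -c.b2p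
        + (c.b2 * c.l + 0)))))) = 0 at this
    linear_combination this
  · have := coefW_eq h hq (x := true) (y := false) (z := false) [] [true] []
      (l := [((true, 4), (true, 20)), ((false, 8), (false, 23)), ((false, 20), (false, 20)),
          ((true, 11), (false, 23))]) (by decide +kernel) rfl
    change 4 * (c.l * c.b1p + (-c.a0p * -c.g + (-c.b1p * -c.b1p + (c.g0 * -c.g + 0)))) = 0 at this
    simp only [a0p, zero_mul, mul_zero, neg_zero] at this
    linear_combination this
  · have := coefW_eq h hq (x := true) (y := false) (z := false) [true] [] []
      (l := [((true, 4), (true, 19)), ((false, 11), (false, 23)), ((true, 7), (false, 23)),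
          ((true, 19), (false, 19))]) (by decide +kernel) rfl
    change 4 * (c.l * c.b1 + (-c.g0 * -c.g + (c.a0 * -c.g + (c.b1 * -c.b1 + 0)))) = 0 at this
    simp only [a0, zero_mul, mul_zero, neg_zero] at this
    linear_combination this
  · have := coefW_eq h hq (x := true) (y := false) (z := false) [] [false] []
      (l := [((true, 4), (true, 22)), ((true, 5), (true, 23)), ((false, 18), (false, 23)),
          ((false, 20), (false, 22)), ((false, 22), (true, 4)), ((true, 15), (false, 23))])
          (by decide +kernel) rfl
    change 4 * (c.l * c.b2p + (c.m * c.g + (-c.a3p * -c.g + (-c.b1p * -c.b2p + (-c.b2p * c.l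
        + (c.a2 * -c.g + 0)))))) = 0 at this
    simp only [a3p, zero_mul, mul_zero, neg_zero] at this
    linear_combination this
  · have := coefW_eq h hq (x := true) (y := false) (z := false) [] [true, false] [false]
      (l := [((true, 6), (true, 20)), ((false, 8), (false, 12)), ((false, 17), (false, 17))])
          (by decide +kernel) rfl
    change 4 * (c.n * c.b1p + (-c.a0p * -c.g1 + (-c.a3 * -c.a3 + 0))) = 1 * 1 + 0 at this
    simp only [a0p, zero_mul, mul_zero, neg_zero] at this
    linear_combination this
  · have := coefW_eq h hq (x := true) (y := false) (z := false) [false, true] [] [false]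
      (l := [((true, 6), (true, 19)), ((true, 7), (false, 12)), ((true, 14), (false, 14))])
          (by decide +kernel) rfl
    change 4 * (c.n * c.b1 + (c.a0 * -c.g1 + (c.a1p * -c.a1p + 0))) = -1 * 1 + 0 at this
    simp only [a0, zero_mul, mul_zero, neg_zero] at this
    linear_combination this
  · have := coefW_eq h hq (x := true) (y := false) (z := false) [false, true] [true] []
      (l := [((true, 5), (true, 11)), ((true, 11), (false, 14))]) (by decide +kernel) rfl
    change 4 * (c.m * c.g0 + (c.g0 * -c.a1p + 0)) = 0 at this
    linear_combination this
  · have := coefW_eq h hq (x := true) (y := false) (z := false) [false] [] [false, false]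
      (l := [((false, 6), (true, 21)), ((false, 12), (false, 5)), ((false, 16), (false, 9)),
          ((true, 9), (true, 5)), ((true, 13), (false, 10)), ((true, 14), (false, 12)),
          ((true, 21), (true, 6))]) (by decide +kernel) rfl
    change 4 * (-c.n * c.b2 + (-c.g1 * -c.m + (-c.a2p * -c.b0 + (c.b0 * c.m + (c.a1 * -c.b0p
        + (c.a1p * -c.g1 + (c.b2 * c.n + 0))))))) = 0 at this
    simp only [b0, b0p, a1, zero_mul, mul_zero, neg_zero] at this
    linear_combination this
  · have := coefW_eq h hq (x := true) (y := false) (z := false) [false] [true, false] []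
      (l := [((true, 5), (true, 16)), ((true, 5), (true, 17)), ((false, 16), (false, 17))])
          (by decide +kernel) rfl
    change 4 * (c.m * c.a2p + (c.m * c.a3 + (-c.a2p * -c.a3 + 0))) = -1 * 1 + 0 at this
    linear_combination this
  · have := coefW_eq h hq (x := true) (y := false) (z := false) [false, true] [false] []
      (l := [((true, 5), (true, 14)), ((true, 5), (true, 15)), ((true, 15), (false, 14))])
          (by decide +kernel) rfl
    change 4 * (c.m * c.a1p + (c.m * c.a2 + (c.a2 * -c.a1p + 0))) = 1 * 1 + 0 at this
    linear_combination this
  · have := coefW_eq h hq (x := true) (y := false) (z := false) [false] [true, false] [false]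
      (l := [((true, 6), (true, 16)), ((true, 6), (true, 17))]) (by decide +kernel) rfl
    change 4 * (c.n * c.a2p + (c.n * c.a3 + 0)) = 0 at this
    linear_combination this
  · have := coefW_eq h hq (x := true) (y := false) (z := false) [false, true] [false] [false]
      (l := [((true, 6), (true, 14)), ((true, 6), (true, 15))]) (by decide +kernel) rfl
    change 4 * (c.n * c.a1p + (c.n * c.a2 + 0)) = 0 at this
    linear_combination this
  · have := coefW_eq h hq (x := true) (y := false) (z := false) [true] [true, false] [false]
      (l := [((true, 6), (true, 11))]) (by decide +kernel) rfl
    change 4 * (c.n * c.g0 + 0) = 0 at this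
    linear_combination this
  · have := coefW_eq h hq (x := true) (y := false) (z := false) [false] [false] [false, false]
      (l := [((false, 6), (true, 12)), ((false, 12), (false, 6)), ((true, 12), (true, 6))])
          (by decide +kernel) rfl
    change 4 * (-c.n * c.g1 + (-c.g1 * -c.n + (c.g1 * c.n + 0))) = 0 at this
    linear_combination this
  · have := coefW_eq h hq (x := true) (y := false) (z := false) [false] [] [false]
      (l := [((true, 6), (true, 23)), ((false, 12), (false, 4)), ((false, 16), (false, 21)),
          ((true, 9), (true, 4)), ((true, 9), (false, 4)), ((true, 13), (false, 22)), ((true, 14),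
          (false, 21)), ((true, 19), (false, 12))]) (by decide +kernel) rfl
    change 4 * (c.n * c.g + (-c.g1 * -c.l + (-c.a2p * -c.b2 + (c.b0 * c.l + (c.b0 * -c.l
        + (c.a1 * -c.b2p + (c.a1p * -c.b2 + (c.b1 * -c.g1 + 0)))))))) = 0 at this
    simp only [b0, a1, zero_mul, mul_zero, neg_zero] at this
    linear_combination this
  · have := coefW_eq h hq (x := true) (y := false) (z := false) [true] [true] [false]
      (l := [((false, 11), (false, 16)), ((true, 11), (false, 15))]) (by decide +kernel) rfl
    change 4 * (-c.g0 * -c.a2p + (c.g0 * -c.a2 + 0)) = 0 at this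
    linear_combination this

end Classification

end DoubleQP

end

open scoped TensorProduct

noncomputable section

namespace DoubleQP

universe u

/-! ### Solution of the equations for reduced coefficients. -/

section NormalForms

variable {k : Type u} [Field k]

/-- The coefficients of the words of degree at most one in `⦃t, s⦄` vanish, except possibly for
that of `1 ⊗ 1`. -/
structure Coeffs.NoLinear (c : Coeffs k) : Prop where
  b1 : c.b1 = 0
  b1p : c.b1p = 0
  b2 : c.b2 = 0
  b2p : c.b2p = 0

/-- `⦃t, s⦄ = a₁' st ⊗ 1 + a₂ t ⊗ s + a₂' s ⊗ t + a₃ 1 ⊗ ts` up to the terms with coefficients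
`γ₀`, `γ₁`, `γ`. -/
structure Coeffs.Quad (c : Coeffs k) (a1p a2 a2p a3 : k) : Prop where
  a1p : c.a1p = a1p
  a2 : c.a2 = a2
  a2p : c.a2p = a2p
  a3 : c.a3 = a3

/-- The possible mixed brackets for reduced coefficients. -/
inductive Coeffs.NormalForm (c : Coeffs k) : Prop
  | loops (σ : k) (hσ : σ = 1 / 2 ∨ σ = -(1 / 2)) (h0 : c.g0 = 0) (h1 : c.g1 = 0) (h : c.g = 0)
      (hX : c.Quad σ (-σ) (-σ) σ)
  | arrow (hl : c.lam = 0) (hn : c.nu = 0) (hm : c.mu = 1 / 2 ∨ c.mu = -(1 / 2))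
      (h0 : c.g0 = 0) (h1 : c.g1 = 0) (h : c.g = 0) (hX : c.Quad c.mu (-c.mu) c.mu (-c.mu))
  | arrow' (hl : c.l = 0) (hn : c.n = 0) (hm : c.m = 1 / 2 ∨ c.m = -(1 / 2))
      (h0 : c.g0 = 0) (h1 : c.g1 = 0) (h : c.g = 0) (hX : c.Quad c.m c.m (-c.m) (-c.m))
  | double (hl : c.lam = 0) (hn : c.nu = 0) (hl' : c.l = 0) (hn' : c.n = 0)
      (hm : c.mu = 1 / 2 ∨ c.mu = -(1 / 2)) (hm' : c.m = -c.mu) (κ : k)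
      (hκ : κ = 1 / 2 ∨ κ = -(1 / 2)) (h0 : c.g0 = 0) (h1 : c.g1 = 0)
      (hX : c.Quad κ (-c.mu) c.mu κ)
  | quadratic (hl : c.lam = 0) (hn : c.nu = 0) (hl' : c.l = 0) (hn' : c.n = 0)
      (hm : c.mu = 1 / 2 ∨ c.mu = -(1 / 2)) (hm' : c.m = c.mu) (a : k)
      (ha : a ^ 2 = 1 / 4 + c.g0 * c.g1) (h : c.g = 0) (hX : c.Quad c.mu a a (-c.mu))

theorem eq_or_eq_neg_of_mul_self_eq {x y : k} (h : x * x - y * y = 0) : x = y ∨ x = -y :=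
  mul_self_eq_mul_self_iff.mp (sub_eq_zero.mp h)

variable [CharZero k]

theorem eq_half_or_of_sq {x : k} (h : 4 * (x * x) = 1) : x = 1 / 2 ∨ x = -(1 / 2) := by
  have h' : (x - 1 / 2) * (x + 1 / 2) = 0 := by linear_combination h / 4
  rcases mul_eq_zero.mp h' with h | h
  · left; linear_combination h
  · right; linear_combination h

theorem ReducedTriple.cases {lam mu nu : k} (h : ReducedTriple lam mu nu) :
    (lam = 0 ∧ nu = 0 ∧ (mu = 1 / 2 ∨ mu = -(1 / 2))) ∨ (mu = 0 ∧ lam ≠ 0 ∧ nu ≠ 0) := by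
  rcases h with h | ⟨h, h', h''⟩
  · exact Or.inl h
  · refine Or.inr ⟨h, h', ?_⟩
    rw [h'']
    exact div_ne_zero (by norm_num) (mul_ne_zero (by norm_num) h')

/-- All five unknowns are ±μ, so there are 32 sign patterns. Each of them belongs to one of the
families or violates one of the relations `e₁`–`e₄`, whose factors would all be ±2μ. -/
theorem normalForm_of_signs {c : Coeffs k} (hlam : c.lam = 0) (hnu : c.nu = 0) (hl : c.l = 0)
    (hn : c.n = 0) (hmu : c.mu = 1 / 2 ∨ c.mu = -(1 / 2)) (hmu4 : 4 * (c.mu * c.mu) = 1)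
    (h0 : c.g0 = 0) (h1 : c.g1 = 0) (hg : c.g = 0)
    (e₁ : (c.a2 + c.mu) * (c.a3 + c.mu) = 0) (e₂ : (c.a1p - c.mu) * (c.a2p - c.mu) = 0)
    (e₃ : (c.a2p + c.m) * (c.a3 + c.m) = 0) (e₄ : (c.a1p - c.m) * (c.a2 - c.m) = 0)
    (hm : c.m = c.mu ∨ c.m = -c.mu) (ha1p : c.a1p = c.mu ∨ c.a1p = -c.mu)
    (ha2 : c.a2 = c.mu ∨ c.a2 = -c.mu) (ha2p : c.a2p = c.mu ∨ c.a2p = -c.mu)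
    (ha3 : c.a3 = c.mu ∨ c.a3 = -c.mu) : c.NormalForm := by
  have hmu' : -c.mu = 1 / 2 ∨ -c.mu = -(1 / 2) := by
    rcases hmu with h | h <;> simp [h]
  have ha : c.mu ^ 2 = 1 / 4 + c.g0 * c.g1 := by rw [h0]; linear_combination hmu4 / 4
  -- This is (2μ)² = 1, the value that a violated relation would force to be zero.
  have hp : (c.mu + c.mu) * (c.mu + c.mu) ≠ 0 := by
    intro h; exact one_ne_zero (by linear_combination h - hmu4)
  have hm' : c.m = 1 / 2 ∨ c.m = -(1 / 2) := by
    rcases hm with h | h <;> rw [h] <;> assumption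
  rcases hm with hm | hm <;> rcases ha1p with h₁ | h₁ <;> rcases ha2 with h₂ | h₂ <;>
    rcases ha2p with h₃ | h₃ <;> rcases ha3 with h₄ | h₄ <;>
    first
    | exact .loops c.mu hmu h0 h1 hg ⟨h₁, h₂, h₃, h₄⟩
    | exact .loops (-c.mu) hmu' h0 h1 hg ⟨h₁, h₂.trans (neg_neg _).symm,
        h₃.trans (neg_neg _).symm, h₄⟩
    | exact .arrow hlam hnu hmu h0 h1 hg ⟨h₁, h₂, h₃, h₄⟩
    | (refine .arrow' hl hn hm' h0 h1 hg ⟨?_, ?_, ?_, ?_⟩ <;>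
        (simp only [h₁, h₂, h₃, h₄, hm, neg_neg]; done))
    | exact .double hlam hnu hl hn hmu hm c.mu hmu h0 h1 ⟨h₁, h₂, h₃, h₄⟩
    | exact .double hlam hnu hl hn hmu hm (-c.mu) hmu' h0 h1 ⟨h₁, h₂, h₃, h₄⟩
    | exact .quadratic hlam hnu hl hn hmu hm c.mu ha hg ⟨h₁, h₂, h₃, h₄⟩
    | exact .quadratic hlam hnu hl hn hmu hm (-c.mu) ((neg_sq _).trans ha) hg ⟨h₁, h₂, h₃, h₄⟩
    | (rw [h₂, h₄] at e₁; exact (hp e₁).elim)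
    | (rw [h₁, h₃] at e₂; refine (hp ?_).elim; linear_combination e₂)
    | (rw [h₃, h₄, hm] at e₃; refine (hp ?_).elim; linear_combination e₃)
    | (rw [h₁, h₂, hm] at e₄; refine (hp ?_).elim; linear_combination e₄)

/-- The cases are those in which each of ν and n vanishes or not. A nonzero ν or n can be cancelled
from many equations and leaves few possibilities. If both vanish, the linear coefficients square to
γγ₀ or γγ₁, and the answer depends on which of γ, γ₀, γ₁ are nonzero. -/
theorem Coeffs.Equations.noLinear_normalForm {c : Coeffs k} (E : c.Equations) (hr : c.IsReduced) :
    c.NoLinear ∧ c.NormalForm := by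
  rcases hr.1.cases with ⟨hlam, hnu, hmu⟩ | ⟨hmu, hlam, hnu⟩ <;>
  rcases hr.2.cases with ⟨hl, hn, hm⟩ | ⟨hm, hl, hn⟩
  · have hm4 : 4 * (c.mu * c.mu) = 1 := by rcases hmu with h | h <;> rw [h] <;> norm_num
    have hm4' : 4 * (c.m * c.m) = 1 := by rcases hm with h | h <;> rw [h] <;> norm_num
    have hmu0 : c.mu ≠ 0 := by rintro h; simp [h] at hm4
    have ha3 := eq_half_or_of_sq (x := c.a3) (by linear_combination -E.tts_e_t_ts - 4 * c.b2p * hnu)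
    have ha1 := eq_half_or_of_sq (x := c.a1p) (by linear_combination E.tts_st_t_e + 4 * c.b2 * hnu)
    have e1 : (c.a2 + c.mu) * (c.a3 + c.mu) = 0 := by
      linear_combination -E.tts_t_e_ts / 4 + hm4 / 4
    have e2 : (c.a1p - c.mu) * (c.a2p - c.mu) = 0 := by
      linear_combination E.tts_st_e_t / 4 + hm4 / 4
    have e3 : (c.a2p + c.m) * (c.a3 + c.m) = 0 := by
      linear_combination E.tss_s_ts_e / 4 + hm4' / 4
    have e4 : (c.a1p - c.m) * (c.a2 - c.m) = 0 := by
      linear_combination -E.tss_st_s_e / 4 + hm4' / 4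
    -- A nonzero `g0` or `g1` cancels from the equations it multiplies. This fixes `a3`, `a1p` and
    -- `m`, makes `a2` and `a2p` equal, and then forces γ = 0: the quadratic family.
    have hdich : (c.g0 = 0 ∧ c.g1 = 0) ∨
        (c.g = 0 ∧ c.a3 = -c.mu ∧ c.a1p = c.mu ∧ c.m = c.mu ∧ c.a2 = c.a2p) := by
      by_cases h0 : c.g0 = 0
      · by_cases h1 : c.g1 = 0
        · exact Or.inl ⟨h0, h1⟩
        · right
          have h3 : c.a3 = -c.mu := mul_left_cancel₀ h1 (by linear_combination -E.tts_s_e_ts / 4)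
          have h4 : c.a1p = c.mu := mul_left_cancel₀ h1 (by linear_combination E.tts_st_e_s / 4)
          have h5 : c.m = c.mu := mul_left_cancel₀ h1
            (by linear_combination E.tss_s_e_ss / 4 + c.g1 * h4)
          have h6 : c.a2 = c.a2p := mul_left_cancel₀ h1 (by linear_combination -E.tts_s_t_s / 4)
          refine ⟨mul_left_cancel₀ hmu0 ?_, h3, h4, h5, h6⟩
          -- The mixed products of linear coefficients cancel in this difference. As λ = l = 0, it
          -- reads 8(`a1p` − `a3`)γ = 16μγ = 0.
          linear_combination (E.tts_e_t_e - E.tss_e_e_s) / 16 + c.g / 2 * h3 - c.g / 2 * h4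
            + (c.b1 + c.b1p) / 4 * hlam + (c.b2 + c.b2p) / 4 * hl
      · right
        have h3 : c.a3 = -c.mu := mul_left_cancel₀ h0 (by linear_combination -E.tts_e_tt_t / 4)
        have h4 : c.a1p = c.mu := mul_left_cancel₀ h0 (by linear_combination E.tts_t_tt_e / 4)
        have h5 : c.m = c.mu := mul_left_cancel₀ h0
          (by linear_combination E.tss_st_t_e / 4 + c.g0 * h4)
        have h6 : c.a2 = c.a2p := mul_left_cancel₀ h0 (by linear_combination -E.tss_t_t_s / 4)
        refine ⟨mul_left_cancel₀ hmu0 ?_, h3, h4, h5, h6⟩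
        linear_combination (E.tts_e_t_e - E.tss_e_e_s) / 16 + c.g / 2 * h3 - c.g / 2 * h4
            + (c.b1 + c.b1p) / 4 * hlam + (c.b2 + c.b2p) / 4 * hl
    -- Because λ = l = 0, the square of each linear coefficient is one of these two products, so all
    -- four linear coefficients vanish.
    have hg01 : c.g * c.g0 = 0 ∧ c.g * c.g1 = 0 := by
      rcases hdich with ⟨h0, h1⟩ | ⟨h, -⟩
      · simp [h0, h1]
      · simp [h]
    refine ⟨⟨?_, ?_, ?_, ?_⟩, ?_⟩
    · exact mul_self_eq_zero.mp
        (by linear_combination -E.tss_t_e_e / 4 + hg01.1 + c.b1 * hl)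
    · exact mul_self_eq_zero.mp
        (by linear_combination E.tss_e_t_e / 4 + hg01.1 - c.b1p * hl)
    · exact mul_self_eq_zero.mp
        (by linear_combination E.tts_s_e_e / 4 + hg01.2 + c.b2 * hlam)
    · exact mul_self_eq_zero.mp
        (by linear_combination -E.tts_e_e_s / 4 + hg01.2 - c.b2p * hlam)
    · rcases hdich with ⟨h0, h1⟩ | ⟨h, h3, h4, h5, h6⟩
      · by_cases hg : c.g = 0
        · refine normalForm_of_signs hlam hnu hl hn hmu hm4 h0 h1 hg e1 e2 e3 e4
            (eq_or_eq_neg_of_mul_self_eq ?_) (eq_or_eq_neg_of_mul_self_eq ?_)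
            (eq_or_eq_neg_of_mul_self_eq ?_) (eq_or_eq_neg_of_mul_self_eq ?_)
            (eq_or_eq_neg_of_mul_self_eq ?_)
          · linear_combination (hm4' - hm4) / 4
          · linear_combination (E.tts_st_t_e - hm4) / 4 + c.b2 * hnu
          · linear_combination (-E.tts_t_t_s - hm4) / 4 - c.b2p * hnu + c.g0 * h1
          · linear_combination (E.tts_s_t_t - hm4) / 4 + c.b2 * hnu + c.g0 * h1
          · linear_combination (-E.tts_e_t_ts - hm4) / 4 - c.b2p * hnu
        -- Here γ ≠ 0. Once the linear coefficients are zero, γ cancels from the equations and gives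
        -- `a2p` = μ, `a2` = −μ = `m` and `a1p` = `a3`: the double-arrow family, where γ stays free.
        · have hb1 : c.b1 * c.b1 = 0 := by
            linear_combination -E.tss_t_e_e / 4 + hg01.1 + c.b1 * hl
          have hb1p : c.b1p * c.b1p = 0 := by
            linear_combination E.tss_e_t_e / 4 + hg01.1 - c.b1p * hl
          have h5 : c.a2p = c.mu := mul_left_cancel₀ hg (by
            linear_combination E.tts_e_e_t / 4 + c.b2p * mul_self_eq_zero.mp hb1p)
          have h6 : c.a2 = -c.mu := mul_left_cancel₀ hg (by
            linear_combination -E.tts_t_e_e / 4 + c.b2 * mul_self_eq_zero.mp hb1)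
          have h7 : c.a2 = c.m := mul_left_cancel₀ hg (by
            linear_combination -E.tss_e_s_e / 4 + c.b2p * mul_self_eq_zero.mp hb1p)
          have h8 : c.a1p = c.a3 := mul_left_cancel₀ hg (by
            linear_combination E.tts_e_t_e / 4 + (c.b2p + c.lam) * mul_self_eq_zero.mp hb1
              + (c.lam - c.b2) * mul_self_eq_zero.mp hb1p)
          exact .double hlam hnu hl hn hmu (h7.symm.trans h6) c.a1p ha1 h0 h1 ⟨rfl, h6, h5, h8.symm⟩
      · refine .quadratic hlam hnu hl hn hmu h5 c.a2 ?_ h ⟨h4, rfl, h6.symm, h3⟩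
        linear_combination -E.tts_t_t_s / 4 - c.b2p * hnu
  -- With n ≠ 0 only t can play the part of an arrow. Cancelling n leaves `a1p` and `a3` as unknown
  -- signs, with the single relation (μ − `a1p`)(`a3` + μ) = 0.
  · have hmu4 : 4 * (c.mu * c.mu) = 1 := by rcases hmu with h | h <;> rw [h] <;> norm_num
    have h0 : c.g0 = 0 := mul_right_cancel₀ hn (by linear_combination E.tss_t_ts_s / 4)
    have h1 : c.g1 = 0 := mul_right_cancel₀ hn (by linear_combination E.tss_s_s_ss / 4)
    have h2p : c.a2p = -c.a3 := mul_right_cancel₀ hn (by linear_combination E.tss_s_ts_s / 4)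
    have h2 : c.a2 = -c.a1p := mul_right_cancel₀ hn (by linear_combination E.tss_st_s_s / 4)
    have hb2 : c.b2 = 0 := mul_self_eq_zero.mp (by
      linear_combination E.tts_s_e_e / 4 + c.g * h1 + c.b2 * hlam)
    have hb2p : c.b2p = 0 := mul_self_eq_zero.mp (by
      linear_combination -E.tts_e_e_s / 4 + c.g * h1 - c.b2p * hlam)
    have h3 : 4 * (c.a3 * c.a3) = 1 := by linear_combination -E.tts_e_t_ts - 4 * c.b2p * hnu
    have h1' : 4 * (c.a1p * c.a1p) = 1 := by linear_combination E.tts_st_t_e + 4 * c.b2 * hnu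
    have hb1 : c.b1 = 0 := mul_right_cancel₀ hn (by linear_combination E.tss_st_e_s / 4 + h1' / 4)
    have hb1p : c.b1p = 0 := mul_right_cancel₀ hn (by linear_combination E.tss_e_ts_s / 4 - h3 / 4)
    have hg : c.g = 0 := mul_right_cancel₀ hn (by
      linear_combination E.tss_s_e_s / 4 + (c.a1p - c.a2p) * hb2 + (c.b1 - c.l) * h1)
    have e : (c.mu - c.a1p) * (c.a3 + c.mu) = 0 := by
      linear_combination -E.tts_t_e_ts / 4 - (c.a3 + c.mu) * h2 + hmu4 / 4
    refine ⟨⟨hb1, hb1p, hb2, hb2p⟩, ?_⟩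
    rcases mul_eq_zero.mp e with e | e
    · have e' : c.a1p = c.mu := by linear_combination -e
      have h3' : c.a3 = c.mu ∨ c.a3 = -c.mu :=
        eq_or_eq_neg_of_mul_self_eq (by linear_combination (h3 - hmu4) / 4)
      rcases h3' with h3' | h3'
      · exact .loops c.mu hmu h0 h1 hg ⟨e', by rw [h2, e'], by rw [h2p, h3'], h3'⟩
      · exact .arrow hlam hnu hmu h0 h1 hg ⟨e', by rw [h2, e'], by rw [h2p, h3', neg_neg], h3'⟩
    · have e' : c.a3 = -c.mu := by linear_combination e
      have h3' : c.a1p = c.mu ∨ c.a1p = -c.mu :=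
        eq_or_eq_neg_of_mul_self_eq (by linear_combination (h1' - hmu4) / 4)
      rcases h3' with h3' | h3'
      · exact .arrow hlam hnu hmu h0 h1 hg ⟨h3', by rw [h2, h3'], by rw [h2p, e', neg_neg], e'⟩
      · refine .loops (-c.mu) (hmu.symm.imp ?_ ?_) h0 h1 hg ⟨h3', by rw [h2, h3'], by rw [h2p, e'],
          e'⟩
        · intro h; rw [h, neg_neg]
        · intro h; rw [h]
  -- This is the mirror image of the preceding case under the exchange of s and t.
  · have hm4 : 4 * (c.m * c.m) = 1 := by rcases hm with h | h <;> rw [h] <;> norm_num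
    have h0 : c.g0 = 0 := mul_right_cancel₀ hnu (by linear_combination -E.tts_t_tt_t / 4)
    have h1 : c.g1 = 0 := mul_right_cancel₀ hnu (by linear_combination E.tts_s_tt_s / 4)
    have h2p : c.a2p = -c.a1p := mul_right_cancel₀ hnu (by linear_combination -E.tts_st_t_t / 4)
    have h2 : c.a2 = -c.a3 := mul_right_cancel₀ hnu (by linear_combination -E.tts_t_t_ts / 4)
    have hb1 : c.b1 = 0 := mul_self_eq_zero.mp (by
      linear_combination -E.tss_t_e_e / 4 + c.g * h0 + c.b1 * hl)
    have hb1p : c.b1p = 0 := mul_self_eq_zero.mp (by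
      linear_combination E.tss_e_t_e / 4 + c.g * h0 - c.b1p * hl)
    have h3 : 4 * (c.a3 * c.a3) = 1 := by linear_combination E.tss_e_ts_s - 4 * c.b1p * hn
    have h1' : 4 * (c.a1p * c.a1p) = 1 := by linear_combination -E.tss_st_e_s + 4 * c.b1 * hn
    have hb2 : c.b2 = 0 := mul_right_cancel₀ hnu (by linear_combination -E.tts_st_t_e / 4 + h1' / 4)
    have hb2p : c.b2p = 0 := mul_right_cancel₀ hnu (by linear_combination -E.tts_e_t_ts / 4 - h3 / 4)
    have hg : c.g = 0 := mul_right_cancel₀ hnu (by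
      linear_combination -E.tts_e_t_t / 4 + (c.a2p - c.a3) * hb1p - (c.b2p + c.lam) * h0)
    have e : (c.m - c.a1p) * (c.a3 + c.m) = 0 := by
      linear_combination E.tss_s_ts_e / 4 - (c.a3 + c.m) * h2p + hm4 / 4
    refine ⟨⟨hb1, hb1p, hb2, hb2p⟩, ?_⟩
    rcases mul_eq_zero.mp e with e | e
    · have e' : c.a1p = c.m := by linear_combination -e
      have h3' : c.a3 = c.m ∨ c.a3 = -c.m :=
        eq_or_eq_neg_of_mul_self_eq (by linear_combination (h3 - hm4) / 4)
      rcases h3' with h3' | h3'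
      · exact .loops c.m hm h0 h1 hg ⟨e', by rw [h2, h3'], by rw [h2p, e'], h3'⟩
      · exact .arrow' hl hn hm h0 h1 hg ⟨e', by rw [h2, h3', neg_neg], by rw [h2p, e'], h3'⟩
    · have e' : c.a3 = -c.m := by linear_combination e
      have h3' : c.a1p = c.m ∨ c.a1p = -c.m :=
        eq_or_eq_neg_of_mul_self_eq (by linear_combination (h1' - hm4) / 4)
      rcases h3' with h3' | h3'
      · exact .arrow' hl hn hm h0 h1 hg ⟨h3', by rw [h2, e', neg_neg], by rw [h2p, h3'], e'⟩
      · refine .loops (-c.m) (hm.symm.imp ?_ ?_) h0 h1 hg ⟨h3', by rw [h2, e'], by rw [h2p, h3'],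
          e'⟩
        · intro h; rw [h, neg_neg]
        · intro h; rw [h]
  -- If neither ν nor n vanishes, all four quadratic coefficients are determined by `a1p` and only
  -- the two-loops family survives.
  · have h0 : c.g0 = 0 := mul_right_cancel₀ hnu (by linear_combination -E.tts_t_tt_t / 4)
    have h1 : c.g1 = 0 := mul_right_cancel₀ hnu (by linear_combination E.tts_s_tt_s / 4)
    have h2p : c.a2p = -c.a1p := mul_right_cancel₀ hnu (by linear_combination -E.tts_st_t_t / 4)
    have h2 : c.a2 = -c.a3 := mul_right_cancel₀ hnu (by linear_combination -E.tts_t_t_ts / 4)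
    have h3 : c.a2p = -c.a3 := mul_right_cancel₀ hn (by linear_combination E.tss_s_ts_s / 4)
    have h31 : c.a3 = c.a1p := by linear_combination h3 - h2p
    have hx : 4 * (c.a1p * c.a1p) = 1 := by
      linear_combination -E.tts_st_e_t + 4 * (c.a1p - c.mu) * h2p
    have hb2 : c.b2 = 0 := mul_right_cancel₀ hnu (by linear_combination -E.tts_st_t_e / 4 + hx / 4)
    have hb2p : c.b2p = 0 := mul_right_cancel₀ hnu (by
      linear_combination -E.tts_e_t_ts / 4 - hx / 4 - (c.a3 + c.a1p) * h31)
    have hb1 : c.b1 = 0 := mul_right_cancel₀ hn (by linear_combination E.tss_st_e_s / 4 + hx / 4)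
    have hb1p : c.b1p = 0 := mul_right_cancel₀ hn (by
      linear_combination E.tss_e_ts_s / 4 - hx / 4 - (c.a3 + c.a1p) * h31)
    have hg : c.g = 0 := mul_right_cancel₀ hnu (by
      linear_combination -E.tts_e_t_t / 4 + (c.a2p - c.a3) * hb1p - (c.b2p + c.lam) * h0)
    exact ⟨⟨hb1, hb1p, hb2, hb2p⟩, .loops c.a1p (eq_half_or_of_sq hx) h0 h1 hg
      ⟨rfl, by rw [h2, h31], h2p, h31⟩⟩

end NormalForms

end DoubleQP

end

open scoped TensorProduct

noncomputable section

namespace DoubleQP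

universe u v

open DoubleBracket

/-! ### Changes of generators in k⟨s,t⟩. -/

section FreeHoms

variable {k : Type u} [Field k] {A : Type v} [Ring A] [Algebra k A]

/-- The homomorphism `k⟨s, t⟩ → A` with given values on `s` and `t`. -/
def F2.hom (x y : A) : F2 k →ₐ[k] A := FreeAlgebra.lift k ![x, y]

@[simp]
theorem F2.hom_s (x y : A) : F2.hom x y (F2.s k) = x := by simp [F2.hom, F2.s]

@[simp]
theorem F2.hom_t (x y : A) : F2.hom x y (F2.t k) = y := by simp [F2.hom, F2.t]

theorem F2.hom_ext {f g : F2 k →ₐ[k] A} (hs : f (F2.s k) = g (F2.s k))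
    (ht : f (F2.t k) = g (F2.t k)) : f = g := by
  apply FreeAlgebra.hom_ext
  funext i
  fin_cases i
  · exact hs
  · exact ht

/-- The automorphism with `s ↦ x`, `t ↦ y` whose inverse is `s ↦ x'`, `t ↦ y'`. -/
def F2.aut (x y x' y' : F2 k) (hx : F2.hom x y x' = F2.s k) (hy : F2.hom x y y' = F2.t k)
    (hx' : F2.hom x' y' x = F2.s k) (hy' : F2.hom x' y' y = F2.t k) : F2 k ≃ₐ[k] F2 k :=
  AlgEquiv.ofAlgHom (F2.hom x y) (F2.hom x' y')
    (F2.hom_ext (by simpa using hx) (by simpa using hy))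
    (F2.hom_ext (by simpa using hx') (by simpa using hy'))

theorem sq_selfTerm (f : F2 k →ₐ[k] F2 k) (lam mu nu : k) (x : F2 k) :
    sq f (selfTerm lam mu nu x) = selfTerm lam mu nu (f x) := by
  have h (a b : F2 k) : sq f (a ⊗ₜ[k] b) = f a ⊗ₜ[k] f b := rfl
  simp only [selfTerm, map_add, map_sub, map_smul, h, map_mul, map_one]

theorem sq_mixedTerm (f : F2 k →ₐ[k] F2 k) (c : Coeffs k) (x y : F2 k) :
    sq f (mixedTerm c x y) = mixedTerm c (f x) (f y) := by
  have h (a b : F2 k) : sq f (a ⊗ₜ[k] b) = f a ⊗ₜ[k] f b := rfl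
  simp only [mixedTerm, map_add, map_smul, h, map_mul, map_one]

variable {br : DoubleBracket k (F2 k)}

/-- Bracket of the form `c` for the generators `x`, `y` in place of `s`, `t`. -/
structure HasFormAt (c : Coeffs k) (br : DoubleBracket k (F2 k)) (x y : F2 k) : Prop where
  disc_t : 4 * (c.mu ^ 2 - c.lam * c.nu) = 1
  disc_s : 4 * (c.m ^ 2 - c.l * c.n) = 1
  yy : br.toFun y y = selfTerm c.lam c.mu c.nu y
  xx : br.toFun x x = selfTerm c.l c.m c.n x
  yx : br.toFun y x = mixedTerm c x y

/-- Transport along the inverse of the automorphism s ↦ x, t ↦ y turns x and y into the standard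
generators. -/
theorem HasFormAt.exists_isomorphic {c : Coeffs k} {x y x' y' : F2 k} (h : HasFormAt c br x y)
    (hq : br.IsQuasiPoisson (unitIdem _))
    (hx : F2.hom x y x' = F2.s k) (hy : F2.hom x y y' = F2.t k)
    (hx' : F2.hom x' y' x = F2.s k) (hy' : F2.hom x' y' y = F2.t k) :
    ∃ br' : DoubleBracket k (F2 k), HasForm c br' ∧ br'.IsQuasiPoisson (unitIdem _) ∧
      br.Isomorphic br' := by
  refine ⟨br.transport (F2.aut x y x' y' hx hy hx' hy').symm, ⟨h.disc_t, h.disc_s, ?_, ?_, ?_⟩,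
    (br.isomorphic_transport _).isQuasiPoisson hq, br.isomorphic_transport _⟩
  · change sq (F2.hom x' y') (br.toFun (F2.hom x y (F2.t k)) (F2.hom x y (F2.t k))) = _
    rw [F2.hom_t, h.yy, sq_selfTerm, hy']
  · change sq (F2.hom x' y') (br.toFun (F2.hom x y (F2.s k)) (F2.hom x y (F2.s k))) = _
    rw [F2.hom_s, h.xx, sq_selfTerm, hx']
  · change sq (F2.hom x' y') (br.toFun (F2.hom x y (F2.t k)) (F2.hom x y (F2.s k))) = _
    rw [F2.hom_t, F2.hom_s, h.yx, sq_mixedTerm, hx', hy']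

/-- The coefficients after exchanging `s` and `t`. -/
def Coeffs.swap (c : Coeffs k) : Coeffs k where
  lam := c.l
  mu := c.m
  nu := c.n
  l := c.lam
  m := c.mu
  n := c.nu
  a0 := -c.b0p
  a0p := -c.b0
  b0 := -c.a0p
  b0p := -c.a0
  g0 := -c.g1
  g1 := -c.g0
  a1 := -c.a3p
  a1p := -c.a3
  a2 := -c.a2
  a2p := -c.a2p
  a3 := -c.a1p
  a3p := -c.a1
  b1 := -c.b2p
  b1p := -c.b2
  b2 := -c.b1p
  b2p := -c.b1
  g := -c.g

theorem HasForm.swap {c : Coeffs k} (h : HasForm c br) (hq : br.IsQuasiPoisson (unitIdem _)) :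
    ∃ br' : DoubleBracket k (F2 k), HasForm c.swap br' ∧ br'.IsQuasiPoisson (unitIdem _) ∧
      br.Isomorphic br' := by
  refine HasFormAt.exists_isomorphic (x := F2.t k) (y := F2.s k) (x' := F2.t k) (y' := F2.s k)
    ⟨h.disc_s, h.disc_t, h.ss, h.tt, ?_⟩ hq (by simp) (by simp) (by simp) (by simp)
  have := h.ts
  change br.toFun _ _ = _ at this
  rw [br.antisymm, this]
  simp only [mixedTerm, map_add, map_smul, TensorProduct.comm_tmul, Coeffs.swap]
  module

/-- The coefficients in terms of the generators `s + x`, `t + y`. -/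
def Coeffs.translate (c : Coeffs k) (x y : k) : Coeffs k where
  lam := c.lam - 2 * y * c.mu + y ^ 2 * c.nu
  mu := c.mu - y * c.nu
  nu := c.nu
  l := c.l - 2 * x * c.m + x ^ 2 * c.n
  m := c.m - x * c.n
  n := c.n
  a0 := c.a0
  a0p := c.a0p
  b0 := c.b0
  b0p := c.b0p
  g0 := c.g0
  g1 := c.g1
  a1 := c.a1
  a1p := c.a1p
  a2 := c.a2
  a2p := c.a2p
  a3 := c.a3
  a3p := c.a3p
  b1 := c.b1 - 2 * y * c.a0 - y * c.g0 - x * c.a1 - x * c.a1p - x * c.a2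
  b1p := c.b1p - 2 * y * c.a0p - y * c.g0 - x * c.a3 - x * c.a3p - x * c.a2p
  b2 := c.b2 - 2 * x * c.b0 - x * c.g1 - y * c.a1 - y * c.a1p - y * c.a2p
  b2p := c.b2p - 2 * x * c.b0p - x * c.g1 - y * c.a3 - y * c.a3p - y * c.a2
  g := c.g - y * c.b1 - y * c.b1p - x * c.b2 - x * c.b2p + y ^ 2 * (c.a0 + c.a0p + c.g0)
    + x ^ 2 * (c.b0 + c.b0p + c.g1) + x * y * (c.a1 + c.a1p + c.a2 + c.a2p + c.a3 + c.a3p)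

theorem selfTerm_translate (lam mu nu a : k) (x : F2 k) :
    selfTerm (lam - 2 * a * mu + a ^ 2 * nu) (mu - a * nu) nu (x + a • 1) =
      selfTerm lam mu nu x := by
  simp only [selfTerm, mul_add, add_mul, smul_mul_assoc, mul_smul_comm, one_mul, mul_one,
    TensorProduct.add_tmul, TensorProduct.tmul_add, ← TensorProduct.smul_tmul',
    TensorProduct.tmul_smul]
  module

theorem mixedTerm_translate (c : Coeffs k) (x y : k) (s t : F2 k) :
    mixedTerm (c.translate x y) (s + x • 1) (t + y • 1) = mixedTerm c s t := by
  simp only [mixedTerm, Coeffs.translate, mul_add, add_mul, smul_mul_assoc, mul_smul_comm,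
    one_mul, mul_one, TensorProduct.add_tmul, TensorProduct.tmul_add, ← TensorProduct.smul_tmul',
    TensorProduct.tmul_smul]
  module

/-- Over B = k the bracket kills scalars. Adding constants to the generators therefore leaves the
brackets unchanged as tensors and only rewrites them in the new generators; the discriminants μ² −
λν and m² − ln are invariant. -/
theorem HasForm.translate {c : Coeffs k} (h : HasForm c br) (hq : br.IsQuasiPoisson (unitIdem _))
    (x y : k) :
    ∃ br' : DoubleBracket k (F2 k), HasForm (c.translate x y) br' ∧
      br'.IsQuasiPoisson (unitIdem _) ∧ br.Isomorphic br' := by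
  have hl (a : F2 k) : br.toFun 1 a = 0 := hq.linear_left () a
  have hr (a : F2 k) : br.toFun a 1 = 0 := hq.linear_right () a
  have hb (a b : F2 k) (p q : k) : br.toFun (a + p • 1) (b + q • 1) = br.toFun a b := by
    rw [map_add, map_smul, hr, smul_zero, add_zero, map_add, LinearMap.add_apply, map_smul,
      LinearMap.smul_apply, hl, smul_zero, add_zero]
  refine HasFormAt.exists_isomorphic (x := F2.s k + x • 1) (y := F2.t k + y • 1)
    (x' := F2.s k - x • 1) (y' := F2.t k - y • 1) ⟨?_, ?_, ?_, ?_, ?_⟩ hq (by simp) (by simp)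
    (by simp) (by simp)
  · simp only [Coeffs.translate]
    linear_combination h.disc_t
  · simp only [Coeffs.translate]
    linear_combination h.disc_s
  · rw [hb]
    exact h.tt.trans (selfTerm_translate ..).symm
  · rw [hb]
    exact h.ss.trans (selfTerm_translate ..).symm
  · rw [hb]
    exact h.ts.trans (mixedTerm_translate ..).symm

/-- If ν = 0 the discriminant forces μ = ±1/2, and translating by λ/(2μ) removes λ. If ν ≠ 0,
translating by μ/ν completes the square and removes μ; the discriminant then reads λν = −1/4 for the
new λ. -/
theorem exists_translate_reducedTriple [CharZero k] {lam mu nu : k}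
    (h : 4 * (mu ^ 2 - lam * nu) = 1) :
    ∃ y, ReducedTriple (lam - 2 * y * mu + y ^ 2 * nu) (mu - y * nu) nu := by
  by_cases hnu : nu = 0
  · subst hnu
    have hmu := eq_half_or_of_sq (x := mu) (by linear_combination h)
    have hmu0 : mu ≠ 0 := by rintro rfl; simp at h
    refine ⟨lam / (2 * mu), Or.inl ⟨?_, rfl, ?_⟩⟩
    · field_simp
      ring
    · simpa using hmu
  · have hl : (lam - 2 * (mu / nu) * mu + (mu / nu) ^ 2 * nu) * nu = -(1 / 4) := by
      field_simp
      linear_combination -h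
    have hl0 : lam - 2 * (mu / nu) * mu + (mu / nu) ^ 2 * nu ≠ 0 := by
      intro h0
      rw [h0] at hl
      norm_num at hl
    refine ⟨mu / nu, Or.inr ⟨?_, hl0, ?_⟩⟩
    · field_simp
      ring
    · rw [eq_div_iff (mul_ne_zero (by norm_num) hl0)]
      linear_combination 4 * hl

theorem HasForm.exists_reduced [CharZero k] {c : Coeffs k} (h : HasForm c br)
    (hq : br.IsQuasiPoisson (unitIdem _)) :
    ∃ (br' : DoubleBracket k (F2 k)) (c' : Coeffs k), HasForm c' br' ∧ c'.IsReduced ∧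
      br'.IsQuasiPoisson (unitIdem _) ∧ br.Isomorphic br' := by
  obtain ⟨y, hy⟩ := exists_translate_reducedTriple h.disc_t
  obtain ⟨x, hx⟩ := exists_translate_reducedTriple h.disc_s
  obtain ⟨br', h', hq', hi⟩ := h.translate hq x y
  exact ⟨br', _, h', ⟨hy, hx⟩, hq', hi⟩

/-- `p st ⊗ 1 + q t ⊗ s + r s ⊗ t + w 1 ⊗ ts + g 1 ⊗ 1`. -/
def quadTerm (p q r w g : k) (s t : A) : A ⊗[k] A :=
  p • ((s * t) ⊗ₜ[k] 1) + q • (t ⊗ₜ[k] s) + r • (s ⊗ₜ[k] t) + w • (1 ⊗ₜ[k] (t * s)) +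
    g • (1 ⊗ₜ[k] 1)

theorem mixedTerm_eq_quadTerm {c : Coeffs k} (hV : c.Vanish) (hL : c.NoLinear) {p q r w : k}
    (hX : c.Quad p q r w) (h0 : c.g0 = 0) (h1 : c.g1 = 0) (s t : F2 k) :
    mixedTerm c s t = quadTerm p q r w c.g s t := by
  simp only [mixedTerm, quadTerm, hV.a0, hV.a0p, hV.b0, hV.b0p, hV.a1, hV.a3p, hL.b1, hL.b1p,
    hL.b2, hL.b2p, hX.a1p, hX.a2, hX.a2p, hX.a3, h0, h1, zero_smul, zero_add, add_zero]

/-- Representatives of the isomorphism classes of the brackets under consideration. -/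
inductive Representative (c : Coeffs k) (br : DoubleBracket k (F2 k)) : Prop
  | loops (h : br.toFun (F2.t k) (F2.s k) =
      quadTerm (1 / 2) (-(1 / 2)) (-(1 / 2)) (1 / 2) 0 (F2.s k) (F2.t k))
  | arrow (hl : c.lam = 0) (hn : c.nu = 0) (hm : c.mu = 1 / 2 ∨ c.mu = -(1 / 2))
      (h : br.toFun (F2.t k) (F2.s k) =
        quadTerm c.mu (-c.mu) c.mu (-c.mu) 0 (F2.s k) (F2.t k))
  | double (hl : c.lam = 0) (hn : c.nu = 0) (hl' : c.l = 0) (hn' : c.n = 0)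
      (hm : c.mu = 1 / 2) (hm' : c.m = -(1 / 2)) (κ g : k) (hκ : κ = 1 / 2 ∨ κ = -(1 / 2))
      (h : br.toFun (F2.t k) (F2.s k) = quadTerm κ (-(1 / 2)) (1 / 2) κ g (F2.s k) (F2.t k))
  | quadratic (hl : c.lam = 0) (hn : c.nu = 0) (hl' : c.l = 0) (hn' : c.n = 0)
      (hm : c.mu = 1 / 2 ∨ c.mu = -(1 / 2)) (hm' : c.m = c.mu)
      (h : br.toFun (F2.t k) (F2.s k) = quadTerm c.mu c.mu c.mu (-c.mu) 0 (F2.s k) (F2.t k))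

end FreeHoms

end DoubleQP

end

open scoped TensorProduct

noncomputable section

namespace DoubleQP

universe u v

open DoubleBracket

/-! ### Diagonalisation of the quadratic family and the list of representatives. -/

section Representatives

variable {k : Type u} [Field k] {br : DoubleBracket k (F2 k)} {c : Coeffs k}

/-- The coefficients with `⦃t, s⦄ = μ st ⊗ 1 + a t ⊗ s + a s ⊗ t - μ 1 ⊗ ts`. -/
def Coeffs.quadratic (μ a : k) : Coeffs k where
  lam := 0
  mu := μ
  nu := 0
  l := 0
  m := μ
  n := 0
  a0 := 0
  a0p := 0
  b0 := 0
  b0p := 0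
  g0 := 0
  g1 := 0
  a1 := 0
  a1p := μ
  a2 := a
  a2p := a
  a3 := -μ
  a3p := 0
  b1 := 0
  b1p := 0
  b2 := 0
  b2p := 0
  g := 0

theorem mixedTerm_quadratic (μ a : k) (s t : F2 k) :
    mixedTerm (Coeffs.quadratic μ a) s t = quadTerm μ a a (-μ) 0 s t := by
  simp only [mixedTerm, quadTerm, Coeffs.quadratic, zero_smul, zero_add, add_zero]

theorem reducedTriple_half {μ : k} (h : μ = 1 / 2 ∨ μ = -(1 / 2)) : ReducedTriple 0 μ 0 :=
  Or.inl ⟨rfl, rfl, h⟩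

/-- The bracket with mixed part given by the quadratic form `g₀ t² + 2 a ts + g₁ s²`, in the
coordinates `p s + q t`, `r s + w t`. -/
theorem HasForm.linear_change (h : HasForm c br) (hV : c.Vanish) (hL : c.NoLinear)
    (hl : c.lam = 0) (hn : c.nu = 0) (hl' : c.l = 0) (hn' : c.n = 0) (hm' : c.m = c.mu)
    {a : k} (hg : c.g = 0) (hX : c.Quad c.mu a a (-c.mu)) {p q r w b : k}
    (h₁ : (p * w - q * r) * c.g0 = 2 * b * (q * w))
    (h₂ : (p * w - q * r) * a = b * (p * w + q * r))
    (h₃ : (p * w - q * r) * c.g1 = 2 * b * (p * r)) :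
    HasFormAt (Coeffs.quadratic c.mu b) br (p • F2.s k + q • F2.t k) (r • F2.s k + w • F2.t k) := by
  have hmu : 4 * (c.mu ^ 2 - 0 * 0) = 1 := by
    have := h.disc_t
    rwa [hl, hn] at this
  have htt : br.toFun (F2.t k) (F2.t k) = selfTerm 0 c.mu 0 (F2.t k) := by
    have := h.tt
    rwa [hl, hn] at this
  have hss : br.toFun (F2.s k) (F2.s k) = selfTerm 0 c.mu 0 (F2.s k) := by
    have := h.ss
    rwa [hl', hn', hm'] at this
  have hts : br.toFun (F2.t k) (F2.s k) = _ := h.ts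
  have hst : br.toFun (F2.s k) (F2.t k) = _ := br.antisymm _ _
  simp only [mixedTerm, hV.a0, hV.a0p, hV.b0, hV.b0p, hV.a1, hV.a3p, hL.b1, hL.b1p, hL.b2, hL.b2p,
    hX.a1p, hX.a2, hX.a2p, hX.a3, hg, zero_smul, zero_add, add_zero] at hts
  rw [hts] at hst
  simp only [map_add, map_smul, TensorProduct.comm_tmul] at hst
  -- For u, v in the span of s and t one has ⦃u,v⦄ = μ(vu ⊗ 1 − 1 ⊗ uv) + ω(u,v)Q, with ω
  -- alternating, ω(t,s) = 1, and Q the symmetric tensor with coefficients γ₀, a, γ₁. The first term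
  -- keeps its shape under linear changes and Q gets multiplied by the determinant. The hypotheses
  -- `h₁`–`h₃` say that the result is b times the symmetrised product of the new generators.
  refine ⟨hmu, hmu, ?_, ?_, ?_⟩
  · simp only [map_add, map_smul, LinearMap.add_apply, LinearMap.smul_apply, htt, hss, hts, hst,
      selfTerm, Coeffs.quadratic]
    simp only [mul_add, add_mul, smul_mul_assoc, mul_smul_comm, TensorProduct.add_tmul,
      TensorProduct.tmul_add, ← TensorProduct.smul_tmul', TensorProduct.tmul_smul]
    module
  · simp only [map_add, map_smul, LinearMap.add_apply, LinearMap.smul_apply, htt, hss, hts, hst,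
      selfTerm, Coeffs.quadratic]
    simp only [mul_add, add_mul, smul_mul_assoc, mul_smul_comm, TensorProduct.add_tmul,
      TensorProduct.tmul_add, ← TensorProduct.smul_tmul', TensorProduct.tmul_smul]
    module
  · rw [mixedTerm_quadratic]
    simp only [map_add, map_smul, LinearMap.add_apply, LinearMap.smul_apply, htt, hss, hts, hst,
      selfTerm, quadTerm]
    simp only [mul_add, add_mul, smul_mul_assoc, mul_smul_comm, TensorProduct.add_tmul,
      TensorProduct.tmul_add, ← TensorProduct.smul_tmul', TensorProduct.tmul_smul]
    linear_combination (norm := module) h₁ • (F2.t k ⊗ₜ[k] F2.t k) +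
      h₂ • (F2.t k ⊗ₜ[k] F2.s k + F2.s k ⊗ₜ[k] F2.t k) + h₃ • (F2.s k ⊗ₜ[k] F2.s k)

variable [CharZero k]

/-- The form γ₀t² + 2a·ts + γ₁s², in commuting variables, has a² − γ₀γ₁ = 1/4, a square. It splits
into two independent linear factors over k, which are the new generators up to scalars. -/
theorem HasForm.exists_linear_change (h : HasForm c br) (hq : br.IsQuasiPoisson (unitIdem _))
    (hV : c.Vanish) (hL : c.NoLinear)
    (hl : c.lam = 0) (hn : c.nu = 0) (hl' : c.l = 0) (hn' : c.n = 0) (hm' : c.m = c.mu)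
    {a : k} (ha : a ^ 2 = 1 / 4 + c.g0 * c.g1) (hg : c.g = 0) (hX : c.Quad c.mu a a
    (-c.mu)) : ∃ (b : k) (br' : DoubleBracket k (F2 k)), (b = 1 / 2 ∨ b = -(1 / 2)) ∧
      HasForm (Coeffs.quadratic c.mu b) br' ∧ br'.IsQuasiPoisson (unitIdem _) ∧
      br.Isomorphic br' := by
  by_cases h0 : c.g0 = 0
  · have ha' := eq_half_or_of_sq (x := a) (by linear_combination 4 * ha + 4 * c.g1 * h0)
    have ha0 : a ≠ 0 := by rintro rfl; norm_num at ha'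
    have H := h.linear_change hV hL hl hn hl' hn' hm' hg hX (p := 1) (q := 0) (r := c.g1 / (2 * a))
      (w := 1) (b := a) (by rw [h0]; ring) (by ring) (by field_simp; ring)
    obtain ⟨br', h', hq', hi⟩ := H.exists_isomorphic hq (x' := F2.s k)
      (y' := F2.t k - (c.g1 / (2 * a)) • F2.s k) (by simp) (by simp) (by simp) (by simp)
    exact ⟨a, br', ha', h', hq', hi⟩
  -- The form is the product of γ₀t + (a − ½)s and t + rs, where r = (a + ½)/γ₀. The change of
  -- generators has determinant −1, whence b = −½.
  · obtain ⟨r, hr⟩ : ∃ r, r * c.g0 = a + 1 / 2 := ⟨_, div_mul_cancel₀ _ h0⟩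
    have H := h.linear_change hV hL hl hn hl' hn' hm' hg hX (p := a - 1 / 2) (q := c.g0)
      (r := r) (w := 1) (b := -(1 / 2)) (by linear_combination -c.g0 * hr)
      (by linear_combination (1 / 2 - a) * hr)
      (mul_right_cancel₀ h0 (by linear_combination (a - 1 / 2 - c.g0 * c.g1) * hr + ha))
    obtain ⟨br', h', hq', hi⟩ := H.exists_isomorphic hq (x' := c.g0 • F2.t k - F2.s k)
      (y' := r • F2.s k - (a - 1 / 2) • F2.t k)
      (by simp; match_scalars <;> first | ring1 | linear_combination hr)
      (by simp; match_scalars <;> first | ring1 | linear_combination hr)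
      (by simp; match_scalars <;> first | ring1 | linear_combination hr)
      (by simp; match_scalars <;> first | ring1 | linear_combination hr)
    exact ⟨_, br', Or.inr rfl, h', hq', hi⟩

/-- Every double quasi-Poisson bracket of the form under consideration is isomorphic to one of the
representatives. -/
theorem HasForm.exists_representative (h : HasForm c br) (hq : br.IsQuasiPoisson (unitIdem _)) :
    ∃ (br' : DoubleBracket k (F2 k)) (c' : Coeffs k), HasForm c' br' ∧ c'.IsReduced ∧
      br'.IsQuasiPoisson (unitIdem _) ∧ br.Isomorphic br' ∧ Representative c' br' := by
  obtain ⟨br₁, c₁, h₁, hr₁, hq₁, hi₁⟩ := h.exists_reduced hq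
  obtain ⟨hL, hN⟩ := (coeffs_equations h₁ hq₁).noLinear_normalForm hr₁
  have hV := coeffs_vanish h₁ hq₁
  obtain ⟨br₂, h₂, hq₂, hi₂⟩ := h₁.swap hq₁
  have hr₂ : c₁.swap.IsReduced := ⟨hr₁.2, hr₁.1⟩
  obtain ⟨hL₂, -⟩ := (coeffs_equations h₂ hq₂).noLinear_normalForm hr₂
  have hV₂ := coeffs_vanish h₂ hq₂
  have hts₁ : br₁.toFun (F2.t k) (F2.s k) = _ := h₁.ts
  have hts₂ : br₂.toFun (F2.t k) (F2.s k) = _ := h₂.ts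
  cases hN with
  | loops σ hσ h0 h1 h hX =>
    rcases hσ with rfl | rfl
    · refine ⟨br₁, c₁, h₁, hr₁, hq₁, hi₁, .loops ?_⟩
      rw [hts₁, mixedTerm_eq_quadTerm hV hL hX h0 h1, h]
    -- Exchanging the generators changes the sign of σ, so one direction of fusion is enough.
    · refine ⟨br₂, _, h₂, hr₂, hq₂, hi₁.trans hi₂, .loops ?_⟩
      have hX' : c₁.swap.Quad (1 / 2) (-(1 / 2)) (-(1 / 2)) (1 / 2) := by
        constructor <;> simp [Coeffs.swap, hX.a1p, hX.a2, hX.a2p, hX.a3]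
      rw [hts₂, mixedTerm_eq_quadTerm hV₂ hL₂ hX' (by simp [Coeffs.swap, h1])
        (by simp [Coeffs.swap, h0]), show c₁.swap.g = 0 by simp [Coeffs.swap, h]]
  | arrow hl hn hm h0 h1 h hX =>
    refine ⟨br₁, c₁, h₁, hr₁, hq₁, hi₁, .arrow hl hn hm ?_⟩
    rw [hts₁, mixedTerm_eq_quadTerm hV hL hX h0 h1, h]
  | arrow' hl hn hm h0 h1 h hX =>
    refine ⟨br₂, _, h₂, hr₂, hq₂, hi₁.trans hi₂, .arrow hl hn hm ?_⟩
    have hX' : c₁.swap.Quad c₁.m (-c₁.m) c₁.m (-c₁.m) := by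
      constructor <;> simp [Coeffs.swap, hX.a1p, hX.a2, hX.a2p, hX.a3]
    rw [hts₂, mixedTerm_eq_quadTerm hV₂ hL₂ hX' (by simp [Coeffs.swap, h1])
      (by simp [Coeffs.swap, h0]), show c₁.swap.g = 0 by simp [Coeffs.swap, h]]
    rfl
  | double hl hn hl' hn' hm hm' κ hκ h0 h1 hX =>
    rcases hm with hm | hm
    · refine ⟨br₁, c₁, h₁, hr₁, hq₁, hi₁,
        .double hl hn hl' hn' hm (by rw [hm', hm]) κ c₁.g hκ ?_⟩
      rw [hm] at hX
      rw [hts₁, mixedTerm_eq_quadTerm hV hL hX h0 h1]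
    · refine ⟨br₂, _, h₂, hr₂, hq₂, hi₁.trans hi₂,
        .double hl' hn' hl hn (by simp [Coeffs.swap, hm', hm]) hm (-κ) c₁.swap.g ?_ ?_⟩
      · rcases hκ with rfl | rfl <;> simp
      have hX' : c₁.swap.Quad (-κ) (-(1 / 2)) (1 / 2) (-κ) := by
        constructor <;> simp [Coeffs.swap, hX.a1p, hX.a2, hX.a2p, hX.a3, hm]
      rw [hts₂, mixedTerm_eq_quadTerm hV₂ hL₂ hX' (by simp [Coeffs.swap, h1])
        (by simp [Coeffs.swap, h0])]
  | quadratic hl hn hl' hn' hm hm' a ha hg hX =>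
    obtain ⟨b, br₃, hb, h₃, hq₃, hi₃⟩ :=
      h₁.exists_linear_change hq₁ hV hL hl hn hl' hn' hm' ha hg hX
    have hr₃ : (Coeffs.quadratic c₁.mu b).IsReduced :=
      ⟨reducedTriple_half hm, reducedTriple_half hm⟩
    have hts₃ : br₃.toFun (F2.t k) (F2.s k) = _ := h₃.ts
    rw [mixedTerm_quadratic] at hts₃
    by_cases hbm : b = c₁.mu
    · refine ⟨br₃, _, h₃, hr₃, hq₃, hi₁.trans hi₃, .quadratic rfl rfl rfl rfl hm rfl ?_⟩
      rw [hts₃, hbm]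
      rfl
    -- Both b and μ are ±1/2. The exchange of s and t changes the sign of b and keeps μ, so it leads
    -- back to b = μ.
    · have hbm' : b = -c₁.mu := by
        rcases hb with rfl | rfl <;> rcases hm with hm | hm <;> rw [hm] at hbm ⊢ <;> simp at hbm ⊢
      obtain ⟨br₄, h₄, hq₄, hi₄⟩ := h₃.swap hq₃
      refine ⟨br₄, _, h₄, ⟨hr₃.2, hr₃.1⟩, hq₄, (hi₁.trans hi₃).trans hi₄,
        .quadratic rfl rfl rfl rfl hm rfl ?_⟩
      have hts₄ : br₄.toFun (F2.t k) (F2.s k) = _ := h₄.ts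
      rw [hts₄]
      simp only [mixedTerm, Coeffs.swap, Coeffs.quadratic, quadTerm, hbm', neg_neg, neg_zero,
        zero_smul, zero_add, add_zero]

end Representatives

end DoubleQP

end

open scoped TensorProduct

noncomputable section

namespace DoubleQP

universe u v w

open DoubleBracket

/-! ### Explicit values of the fused bracket. -/

section FusedValues

variable {k : Type u} [Field k] {A : Type v} [Ring A] [Algebra k A] {I : Type w}
  {e : I → A} (i j : I)

variable (k e) in
/-- The left factor `1` or `e₁₂`. -/
def fusRow (p : Bool) : Ext k (e i) (e j) := bif p then Ext.e₁₂ k (e i) (e j) else 1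

variable (k e) in
/-- The right factor `1` or `e₂₁`. -/
def fusCol (q : Bool) : Ext k (e i) (e j) := bif q then Ext.e₂₁ k (e i) (e j) else 1

variable (k) in
/-- The elements `ε a ε`, `ε e₁₂ a ε`, `ε a e₂₁ ε` and `ε e₁₂ a e₂₁ ε` of the fusion algebra. -/
def fusMk [Fintype I] (he : CompleteOrthogonalIdempotents e) (i j : I) (p q : Bool) :
    A →ₗ[k] FusionAlgebra k he i j :=
  cornerProj (fusEps_idem k he i j) k ∘ₗ LinearMap.mulLeft k (fusRow k e i j p) ∘ₗ
    LinearMap.mulRight k (fusCol k e i j q) ∘ₗ (Ext.of k (e i) (e j)).toLinearMap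

/-- `a` starts at `e_j` or is killed by `e_j` on the left, according to `p`, and similarly on the
right, according to `q`. -/
structure Placed (e : I → A) (j : I) (p q : Bool) (a : A) : Prop where
  left : e j * a = bif p then a else 0
  right : a * e j = bif q then a else 0

theorem fusEps_mul_e₁₂ [Fintype I] (he : CompleteOrthogonalIdempotents e) (i j : I) (hij : i ≠ j) :
    fusEps k e i j * Ext.e₁₂ k (e i) (e j) = Ext.e₁₂ k (e i) (e j) := by
  have h : e j * e i = 0 := he.ortho hij.symm
  rw [fusEps, sub_mul, one_mul, ← Ext.of_mul_e₁₂, ← mul_assoc, ← map_mul, h, map_zero, zero_mul,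
    sub_zero]

theorem e₂₁_mul_fusEps [Fintype I] (he : CompleteOrthogonalIdempotents e) (i j : I) (hij : i ≠ j) :
    Ext.e₂₁ k (e i) (e j) * fusEps k e i j = Ext.e₂₁ k (e i) (e j) := by
  have h : e i * e j = 0 := he.ortho hij
  rw [fusEps, mul_sub, mul_one, ← Ext.e₂₁_mul_of, mul_assoc, ← map_mul, h, map_zero, mul_zero,
    sub_zero]

theorem e₁₂_mul_fusEps : Ext.e₁₂ k (e i) (e j) * fusEps k e i j = 0 := by
  rw [fusEps, mul_sub, mul_one, Ext.e₁₂_mul_of, sub_self]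

theorem fusEps_mul_e₂₁ : fusEps k e i j * Ext.e₂₁ k (e i) (e j) = 0 := by
  rw [fusEps, sub_mul, one_mul, Ext.of_mul_e₂₁, sub_self]

theorem fusMk_val_raw [Fintype I] (he : CompleteOrthogonalIdempotents e) (i j : I) (p q : Bool)
    (a : A) : (fusMk k he i j p q a).1 =
    fusEps k e i j * (fusRow k e i j p * (Ext.of k (e i) (e j) a * fusCol k e i j q)) *
      fusEps k e i j := rfl

variable {i j}

theorem fusMk_val [Fintype I] (he : CompleteOrthogonalIdempotents e) (hij : i ≠ j) {p q : Bool}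
    {a : A} (ha : Placed e j p q a) :
    (fusMk k he i j p q a).1 =
      fusRow k e i j p * Ext.of k (e i) (e j) a * fusCol k e i j q := by
  obtain ⟨hl, hr⟩ := ha
  have h1 : fusEps k e i j * (fusRow k e i j p * Ext.of k (e i) (e j) a) =
      fusRow k e i j p * Ext.of k (e i) (e j) a := by
    cases p
    · simp only [fusRow, cond_false, one_mul] at hl ⊢
      rw [fusEps, sub_mul, one_mul, ← map_mul, hl, map_zero, sub_zero]
    · simp only [fusRow, cond_true]
      rw [← mul_assoc, fusEps_mul_e₁₂ he i j hij]
  have h2 : Ext.of k (e i) (e j) a * fusCol k e i j q * fusEps k e i j =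
      Ext.of k (e i) (e j) a * fusCol k e i j q := by
    cases q
    · simp only [fusCol, cond_false, mul_one] at hr ⊢
      rw [fusEps, mul_sub, mul_one, ← map_mul, hr, map_zero, sub_zero]
    · simp only [fusCol, cond_true]
      rw [mul_assoc, e₂₁_mul_fusEps he i j hij]
  rw [fusMk_val_raw, ← mul_assoc, mul_assoc _ (Ext.of k (e i) (e j) a * _), h2, ← mul_assoc,
    mul_assoc (fusEps k e i j), h1]

/-- When the middle index is `true`, the inner factor e₂₁e₁₂ = e_j appears and is absorbed by a,
which ends at e_j. -/
theorem fusMk_mul [Fintype I] (he : CompleteOrthogonalIdempotents e) (hij : i ≠ j) {p q r : Bool}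
    {a b : A} (ha : Placed e j p q a)
    (hb : Placed e j q r b) :
    fusMk k he i j p q a * fusMk k he i j q r b = fusMk k he i j p r (a * b) := by
  have hab : Placed e j p r (a * b) := by
    constructor
    · rw [← mul_assoc, ha.left]; cases p <;> simp
    · rw [mul_assoc, hb.right]; cases r <;> simp
  apply Subtype.ext
  rw [Corner.mul_val, fusMk_val he hij ha, fusMk_val he hij hb, fusMk_val he hij hab]
  cases q
  · simp [fusCol, fusRow, mul_assoc]
  · have h := ha.right
    simp only [cond_true] at h
    simp only [fusCol, fusRow, cond_true]
    rw [mul_assoc _ _ (Ext.e₁₂ _ _ _ * _ * _), ← mul_assoc _ (Ext.e₁₂ _ _ _ * _),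
      ← mul_assoc _ (Ext.e₁₂ _ _ _), Ext.e₂₁_mul_e₁₂, ← mul_assoc, ← mul_assoc,
      mul_assoc _ _ (Ext.of _ _ _ (e j)), ← map_mul, h, mul_assoc _ _ (Ext.of _ _ _ b), ← map_mul]

theorem placed_idem [Fintype I] (he : CompleteOrthogonalIdempotents e) {s : I} (h : s ≠ j) :
    Placed e j false false (e s) :=
  ⟨he.ortho h.symm, he.ortho h⟩

theorem placed_idem_self [Fintype I] (he : CompleteOrthogonalIdempotents e) :
    Placed e j true true (e j) :=
  ⟨he.idem j, he.idem j⟩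

theorem fusMk_idem_self [Fintype I] (he : CompleteOrthogonalIdempotents e) (hij : i ≠ j) :
    fusMk k he i j true true (e j) = fusMk k he i j false false (e i) := by
  apply Subtype.ext
  rw [fusMk_val he hij (placed_idem_self he), fusMk_val he hij (placed_idem he hij)]
  simp only [fusRow, fusCol, cond_true, cond_false, one_mul, mul_one, Ext.e₁₂_mul_of,
    Ext.e₁₂_mul_e₂₁]

theorem fusMk_idem [Fintype I] (he : CompleteOrthogonalIdempotents e) (hij : i ≠ j)
    (s : {s : I // s ≠ j}) :
    fusMk k he i j false false (e s.1) = fusedIdem k he i j s := by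
  apply Subtype.ext
  rw [fusMk_val he hij (placed_idem he s.2), fusedIdem_val]
  simp [fusRow, fusCol]

variable (k) in
/-- The values of `Tr(E_i)` on `fusMk p q a`. -/
def fusGauge₁ [Fintype I] (he : CompleteOrthogonalIdempotents e) (i j : I) (p q : Bool) (a : A) :
    FusionAlgebra k he i j ⊗[k] FusionAlgebra k he i j :=
  (bif q then 0 else fusMk k he i j p false (a * e i) ⊗ₜ[k] fusMk k he i j false false (e i)) -
    (bif p then 0 else fusMk k he i j false false (e i) ⊗ₜ[k] fusMk k he i j false q (e i * a))

variable (k) in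
/-- The values of `Tr(E_j)` on `fusMk p q a`. -/
def fusGauge₂ [Fintype I] (he : CompleteOrthogonalIdempotents e) (i j : I) (p q : Bool) (a : A) :
    FusionAlgebra k he i j ⊗[k] FusionAlgebra k he i j :=
  (bif q then fusMk k he i j p q a ⊗ₜ[k] fusMk k he i j false false (e i) else 0) -
    (bif p then fusMk k he i j false false (e i) ⊗ₜ[k] fusMk k he i j p q a else 0)

theorem trace_tmul (a b : Ext k (e i) (e j)) : trace e i j (a ⊗ₜ[k] b) =
    (fusEps k e i j * a * fusEps k e i j) ⊗ₜ[k] (fusEps k e i j * b * fusEps k e i j) +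
    (fusEps k e i j * a * (Ext.e₂₁ k (e i) (e j) * fusEps k e i j)) ⊗ₜ[k]
      (fusEps k e i j * Ext.e₁₂ k (e i) (e j) * b * fusEps k e i j) := by
  simp only [trace, Algebra.TensorProduct.tmul_mul_tmul]

/-- Only the first summand of the trace survives, because e_i e₂₁ = e_i e_j e₂₁ = 0. -/
theorem trace_gauge₁_aux [Fintype I] (he : CompleteOrthogonalIdempotents e) (hij : i ≠ j)
    (z w : Ext k (e i) (e j)) :
    trace e i j ((z * Ext.of k (e i) (e j) (e i)) ⊗ₜ[k] (Ext.of k (e i) (e j) (e i) * w)) =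
      (fusEps k e i j * (z * Ext.of k (e i) (e j) (e i)) * fusEps k e i j) ⊗ₜ[k]
        (fusEps k e i j * (Ext.of k (e i) (e j) (e i) * w) * fusEps k e i j) := by
  have h : Ext.of k (e i) (e j) (e i) * Ext.e₂₁ k (e i) (e j) = 0 := by
    rw [← Ext.of_mul_e₂₁, ← mul_assoc, ← map_mul, show e i * e j = 0 from he.ortho hij, map_zero,
      zero_mul]
  rw [trace_tmul, e₂₁_mul_fusEps he i j hij, mul_assoc _ (z * _) (Ext.e₂₁ _ _ _), mul_assoc z, h]
  simp

/-- Only the second summand of the trace survives, because e_j ε = 0; its matrix units replace e_j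
on both sides. -/
theorem trace_gauge₂_aux [Fintype I] (he : CompleteOrthogonalIdempotents e) (hij : i ≠ j)
    (z w : Ext k (e i) (e j)) :
    trace e i j ((z * Ext.of k (e i) (e j) (e j)) ⊗ₜ[k] (Ext.of k (e i) (e j) (e j) * w)) =
      (fusEps k e i j * (z * Ext.e₂₁ k (e i) (e j)) * fusEps k e i j) ⊗ₜ[k]
        (fusEps k e i j * (Ext.e₁₂ k (e i) (e j) * w) * fusEps k e i j) := by
  have h : Ext.of k (e i) (e j) (e j) * fusEps k e i j = 0 := by
    rw [fusEps, mul_sub, mul_one, ← map_mul, he.idem j, sub_self]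
  have h' : z * Ext.e₂₁ k (e i) (e j) * fusEps k e i j = z * Ext.e₂₁ k (e i) (e j) := by
    rw [mul_assoc, e₂₁_mul_fusEps he i j hij]
  rw [trace_tmul, mul_assoc _ (z * _) (fusEps _ _ _ _), mul_assoc z, h, mul_zero, mul_zero,
    TensorProduct.zero_tmul, zero_add, e₂₁_mul_fusEps he i j hij, mul_assoc _ (z * _)
      (Ext.e₂₁ _ _ _),
    mul_assoc z, Ext.of_mul_e₂₁, mul_assoc _ _ (Ext.of _ _ _ _ * w), ← mul_assoc _ _ w,
    Ext.e₁₂_mul_of, mul_assoc _ (z * _) (fusEps _ _ _ _), h']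

theorem gauge_apply {s : I} {δ : DoubleDerivation k (Ext k (e i) (e j))}
    (hδ : ExtendsGauge e i j s δ) (p q : Bool) (a : A) :
    δ.toFun (fusRow k e i j p * Ext.of k (e i) (e j) a * fusCol k e i j q) =
      (fusRow k e i j p * Ext.of k (e i) (e j) a * Ext.of k (e i) (e j) (e s)) ⊗ₜ[k]
        (Ext.of k (e i) (e j) (e s) * fusCol k e i j q) -
      (fusRow k e i j p * Ext.of k (e i) (e j) (e s)) ⊗ₜ[k]
        (Ext.of k (e i) (e j) (e s) * (Ext.of k (e i) (e j) a * fusCol k e i j q)) := by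
  obtain ⟨h1, h2, h3⟩ := hδ
  have hone : δ.toFun 1 = 0 := IsDer.map_one (l := inL k _) (r := inR k _)
    (fun b c => δ.leibniz b c)
  have hr : δ.toFun (fusRow k e i j p) = 0 := by cases p; exacts [hone, h2]
  have hc : δ.toFun (fusCol k e i j q) = 0 := by cases q; exacts [hone, h3]
  have h1' : δ.toFun (Ext.of k (e i) (e j) a) = _ := h1 a
  rw [δ.leibniz, δ.leibniz, hr, hc, h1', zero_mul, zero_add, mul_zero, add_zero]
  simp only [map_sub, TensorProduct.map_tmul, AlgHom.toLinearMap_apply, map_mul, mul_sub, sub_mul,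
    Algebra.TensorProduct.tmul_mul_tmul, one_mul, mul_one, mul_assoc]

theorem trace_gauge₁ [Fintype I] (he : CompleteOrthogonalIdempotents e) (hij : i ≠ j)
    {δ : DoubleDerivation k (Ext k (e i) (e j))}
    (hδ : ExtendsGauge e i j i δ) {p q : Bool} {a : A} (ha : Placed e j p q a) :
    trace e i j (δ (fusMk k he i j p q a).1) =
      cornerIncl₂ (fusEps_idem k he i j) k (fusGauge₁ k he i j p q a) := by
  have hadd := fun X Y => trace_add (k := k) i j (e := e) X Y
  have hsub : ∀ X Y, trace (k := k) e i j (X - Y) = trace e i j X - trace e i j Y := fun X Y => by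
    rw [eq_sub_iff_add_eq, ← hadd, sub_add_cancel]
  change trace e i j (δ.toFun _) = _
  rw [fusMk_val he hij ha, gauge_apply hδ, hsub, trace_gauge₁_aux he hij, trace_gauge₁_aux he hij,
    fusGauge₁, map_sub]
  congr 1
  · cases q
    · simp only [cond_false, TensorProduct.map_tmul]
      change _ = (fusMk k he i j p false (a * e i)).1 ⊗ₜ[k] (fusMk k he i j false false (e i)).1
      rw [fusMk_val_raw, fusMk_val_raw]
      simp [fusCol, fusRow, mul_assoc]
    · simp only [fusCol, cond_true, map_zero]
      rw [← Ext.of_mul_e₂₁, ← mul_assoc _ _ (Ext.e₂₁ _ _ _), ← map_mul _ (e i),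
        show e i * e j = 0 from he.ortho hij]
      simp
  · cases p
    · simp only [cond_false, TensorProduct.map_tmul]
      change _ = (fusMk k he i j false false (e i)).1 ⊗ₜ[k] (fusMk k he i j false q (e i * a)).1
      rw [fusMk_val_raw, fusMk_val_raw]
      simp [fusCol, fusRow, mul_assoc]
    · simp only [fusRow, cond_true, map_zero]
      rw [← Ext.e₁₂_mul_of, mul_assoc _ _ (Ext.of _ _ _ (e i)), ← map_mul _ (e j),
        show e j * e i = 0 from he.ortho hij.symm]
      simp

theorem trace_gauge₂ [Fintype I] (he : CompleteOrthogonalIdempotents e) (hij : i ≠ j)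
    {δ : DoubleDerivation k (Ext k (e i) (e j))}
    (hδ : ExtendsGauge e i j j δ) {p q : Bool} {a : A} (ha : Placed e j p q a) :
    trace e i j (δ (fusMk k he i j p q a).1) =
      cornerIncl₂ (fusEps_idem k he i j) k (fusGauge₂ k he i j p q a) := by
  have hadd := fun X Y => trace_add (k := k) i j (e := e) X Y
  have hsub : ∀ X Y, trace (k := k) e i j (X - Y) = trace e i j X - trace e i j Y := fun X Y => by
    rw [eq_sub_iff_add_eq, ← hadd, sub_add_cancel]
  have hE : (fusMk k he i j false false (e i)).1 = Ext.of k (e i) (e j) (e i) := by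
    rw [fusMk_val he hij (placed_idem he hij)]
    simp [fusRow, fusCol]
  have hE' : fusEps k e i j * Ext.of k (e i) (e j) (e i) * fusEps k e i j =
      Ext.of k (e i) (e j) (e i) := by
    rw [← hE, Corner.left_mul, Corner.mul_right]
  change trace e i j (δ.toFun _) = _
  rw [fusMk_val he hij ha, gauge_apply hδ, hsub, trace_gauge₂_aux he hij, trace_gauge₂_aux he hij,
    fusGauge₂, map_sub]
  congr 1
  · cases q
    · have h := ha.right
      simp only [cond_false] at h
      simp only [cond_false, map_zero]
      rw [← Ext.of_mul_e₂₁, ← mul_assoc _ _ (Ext.e₂₁ _ _ _), mul_assoc _ (Ext.of _ _ _ a),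
        ← map_mul,
        h]
      simp
    · simp only [cond_true, TensorProduct.map_tmul]
      change _ = (fusMk k he i j p true a).1 ⊗ₜ[k] (fusMk k he i j false false (e i)).1
      rw [hE, fusMk_val_raw, ← mul_assoc (fusRow _ _ _ _ _)]
      simp only [fusCol, cond_true]
      rw [Ext.e₁₂_mul_e₂₁, hE']
  · cases p
    · have h := ha.left
      simp only [cond_false] at h
      simp only [cond_false, map_zero]
      rw [← Ext.e₁₂_mul_of, mul_assoc (Ext.e₁₂ _ _ _), ← mul_assoc (Ext.of _ _ _ (e j)), ← map_mul,
        h]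
      simp
    · simp only [cond_true, TensorProduct.map_tmul]
      change _ = (fusMk k he i j false false (e i)).1 ⊗ₜ[k] (fusMk k he i j true q a).1
      rw [hE, fusMk_val_raw]
      simp only [fusRow, cond_true]
      rw [Ext.e₁₂_mul_e₂₁, hE']

theorem cornerIncl₂_cross {p : A} (h : IsIdempotentElem p) (X Y : h.Corner ⊗[k] h.Corner) :
    cornerIncl₂ h k (cross X Y) = cross (cornerIncl₂ h k X) (cornerIncl₂ h k Y) := by
  induction X with
  | zero => simp [cross_zero_left]
  | add a b ha hb => simp only [map_add, cross_add_left, ha, hb]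
  | tmul a b =>
    induction Y with
    | zero => simp
    | add a b ha hb => simp only [map_add, ha, hb]
    | tmul c d => simp only [cross_tmul, TensorProduct.map_tmul]; rfl

/-- The matrix units are constants for the extended bracket and for the gauge elements, so they can
be pulled out. Those attached to b come out on the outer side and those attached to a on the inner
side, which explains the indices p', q on the left factor and p, q' on the right one. -/
theorem IsFusion.apply [Fintype I] (he : CompleteOrthogonalIdempotents e)
    {br : DoubleBracket k A} {brF : DoubleBracket k (FusionAlgebra k he i j)}
    (hF : IsFusion he i j br brF) (hij : i ≠ j) {p q p' q' : Bool} {a b : A}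
    (ha : Placed e j p q a) (hb : Placed e j p' q' b) :
    brF.toFun (fusMk k he i j p q a) (fusMk k he i j p' q' b) =
      TensorProduct.map (fusMk k he i j p' q) (fusMk k he i j p q') (br.toFun a b) -
      (1 / 2 : k) • (cross (fusGauge₁ k he i j p q a) (fusGauge₂ k he i j p' q' b) -
        cross (fusGauge₂ k he i j p q a) (fusGauge₁ k he i j p' q' b)) := by
  obtain ⟨brE, E₁, E₂, ⟨hE, h12, h21⟩, hE₁, hE₂, h⟩ := hF
  have hr (p : Bool) (x) : brE.toFun (fusRow k e i j p) x = 0 := by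
    cases p
    exacts [(brE.isDer_left x).map_one, (h12 x).2]
  have hr' (p : Bool) (x) : brE.toFun x (fusRow k e i j p) = 0 := by
    cases p
    exacts [(brE.isDer_right x).map_one, (h12 x).1]
  have hc (p : Bool) (x) : brE.toFun (fusCol k e i j p) x = 0 := by
    cases p
    exacts [(brE.isDer_left x).map_one, (h21 x).2]
  have hc' (p : Bool) (x) : brE.toFun x (fusCol k e i j p) = 0 := by
    cases p
    exacts [(brE.isDer_right x).map_one, (h21 x).1]
  have hbrE : brE.toFun (fusMk k he i j p q a).1 (fusMk k he i j p' q' b).1 =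
      (fusRow k e i j p' ⊗ₜ[k] fusRow k e i j p) * sq (Ext.of k (e i) (e j)) (br.toFun a b) *
        (fusCol k e i j q ⊗ₜ[k] fusCol k e i j q') := by
    have hab : sq (Ext.of k (e i) (e j)) (br.toFun a b) = brE.toFun _ _ := hE a b
    rw [fusMk_val he hij ha, fusMk_val he hij hb, hab, brE.leibniz, brE.leibniz, hr', hc', zero_mul,
      zero_add, mul_zero, add_zero, brE.leibniz_left, brE.leibniz_left, hr, hc, zero_mul,
      zero_add, mul_zero, add_zero]
    simp only [← mul_assoc, Algebra.TensorProduct.tmul_mul_tmul, one_mul, mul_one]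
    simp only [mul_assoc, Algebra.TensorProduct.tmul_mul_tmul, one_mul, mul_one]
  have hmap (z : A ⊗[k] A) : TensorProduct.map (fusMk k he i j p' q) (fusMk k he i j p q') z =
      TensorProduct.map (cornerProj (fusEps_idem k he i j) k) (cornerProj (fusEps_idem k he i j) k)
        ((fusRow k e i j p' ⊗ₜ[k] fusRow k e i j p) * sq (Ext.of k (e i) (e j)) z *
        (fusCol k e i j q ⊗ₜ[k] fusCol k e i j q')) := by
    induction z with
    | zero => simp
    | add a b ha hb => simp only [map_add, mul_add, add_mul, ha, hb]
    | tmul a b =>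
      have h (a b : A) : sq (Ext.of k (e i) (e j)) (a ⊗ₜ[k] b) =
        Ext.of k (e i) (e j) a ⊗ₜ[k] Ext.of k (e i) (e j) b := rfl
      simp only [h, TensorProduct.map_tmul, Algebra.TensorProduct.tmul_mul_tmul, mul_assoc]
      rfl
  have h' := h (fusMk k he i j p q a) (fusMk k he i j p' q' b)
  rw [trace_gauge₁ he hij hE₁ ha, trace_gauge₁ he hij hE₁ hb, trace_gauge₂ he hij hE₂ ha,
    trace_gauge₂ he hij hE₂ hb, ← cornerIncl₂_cross, ← cornerIncl₂_cross, ← map_sub, ← map_smul,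
    eq_sub_iff_add_eq] at h'
  rw [eq_sub_iff_add_eq, hmap, ← hbrE]
  apply cornerIncl₂_injective (fusEps_idem k he i j) (k := k)
  rw [cornerIncl₂_proj]
  have h'' : brE.toFun (fusMk k he i j p q a).1 (fusMk k he i j p' q' b).1 = _ := h'.symm
  rw [h'', ← map_add]
  have hsupp (z : FusionAlgebra k he i j ⊗[k] FusionAlgebra k he i j) :
      (fusEps k e i j ⊗ₜ[k] fusEps k e i j) * cornerIncl₂ (fusEps_idem k he i j) k z *
        (fusEps k e i j ⊗ₜ[k] fusEps k e i j) = cornerIncl₂ (fusEps_idem k he i j) k z := by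
    rw [← cornerIncl₂_proj]
    congr 1
    rw [← LinearMap.comp_apply, ← TensorProduct.map_comp, cornerProj_comp_incl,
      TensorProduct.map_id, LinearMap.id_apply]
    exact fusEps_idem k he i j
  exact (hsupp _).symm

end FusedValues

end DoubleQP

end

open scoped TensorProduct

noncomputable section

namespace DoubleQP

universe u v w x y

open DoubleBracket

/-! ### Maps onto and out of fusion algebras; path algebras. -/

section FusionIso

variable {k : Type u} [Field k] {A : Type v} [Ring A] [Algebra k A] {I : Type w} [Fintype I]
  {e : I → A} (he : CompleteOrthogonalIdempotents e) {i j : I}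

theorem fusMk_eq_zero_left {p p' q q' : Bool} {a : A} (ha : Placed e j p q a) (h : p ≠ p') :
    fusMk k he i j p' q' a = 0 := by
  apply Subtype.ext
  change _ = (0 : Ext k (e i) (e j))
  have hl := ha.left
  rw [fusMk_val_raw]
  cases p
  · obtain rfl : p' = true := by cases p' <;> simp_all
    simp only [cond_false] at hl
    simp only [fusRow, cond_true]
    rw [← Ext.e₁₂_mul_of, mul_assoc _ (Ext.of k (e i) (e j) (e j)),
      ← mul_assoc (Ext.of k (e i) (e j) (e j)), ← map_mul, hl]
    simp
  · obtain rfl : p' = false := by cases p' <;> simp_all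
    simp only [cond_true] at hl
    rw [← hl, map_mul]
    simp only [fusRow, cond_false, one_mul, ← mul_assoc]
    rw [fusEps, sub_mul _ _ (Ext.of k (e i) (e j) (e j)), one_mul, ← map_mul, he.idem j]
    simp

theorem fusMk_eq_zero_right {p p' q q' : Bool} {a : A} (ha : Placed e j p q a) (h : q ≠ q') :
    fusMk k he i j p' q' a = 0 := by
  apply Subtype.ext
  change _ = (0 : Ext k (e i) (e j))
  have hr := ha.right
  rw [fusMk_val_raw]
  cases q
  · obtain rfl : q' = true := by cases q' <;> simp_all
    simp only [cond_false] at hr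
    simp only [fusCol, cond_true]
    rw [← Ext.of_mul_e₂₁, ← mul_assoc (Ext.of k (e i) (e j) a), ← map_mul, hr]
    simp
  · obtain rfl : q' = false := by cases q' <;> simp_all
    simp only [cond_true] at hr
    rw [← hr, map_mul]
    simp only [fusCol, cond_false, mul_one, mul_assoc]
    rw [fusEps, mul_sub (Ext.of k (e i) (e j) (e j)), mul_one, ← map_mul, he.idem j]
    simp

variable {C : Type x} [Ring C] [Algebra k C] (F : C →ₐ[k] FusionAlgebra k he i j)

/-- At most one of the four components of a homogeneous element is nonzero, so surjectivity requires
one check per generator. -/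
theorem Placed.exists_fusMk {p q : Bool} {a : A} (ha : Placed e j p q a)
    (h : ∃ c, F c = fusMk k he i j p q a) (p' q' : Bool) : ∃ c, F c = fusMk k he i j p' q' a := by
  by_cases hp : p = p'
  · by_cases hq : q = q'
    · rwa [← hp, ← hq]
    · exact ⟨0, by rw [map_zero, fusMk_eq_zero_right he ha hq]⟩
  · exact ⟨0, by rw [map_zero, fusMk_eq_zero_left he ha hp]⟩

/-- The elements of `Ā` all of whose components are in the range of `F`. -/
def componentSubalgebra (hij : i ≠ j) (hi : ∃ c, F c = fusMk k he i j false false (e i)) :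
    Subalgebra k (Ext k (e i) (e j)) where
  carrier := {x | ∀ p q, ∃ c, (F c).1 =
    fusEps k e i j * (fusRow k e i j p * (x * fusCol k e i j q)) * fusEps k e i j}
  add_mem' := fun {x y} hx hy p q => by
    obtain ⟨c, hc⟩ := hx p q
    obtain ⟨d, hd⟩ := hy p q
    refine ⟨c + d, ?_⟩
    rw [map_add]
    change (F c).1 + (F d).1 = _
    rw [hc, hd]
    simp only [add_mul, mul_add]
  mul_mem' := fun {x y} hx hy p q => by
    obtain ⟨c₁, hc₁⟩ := hx p false
    obtain ⟨d₁, hd₁⟩ := hy false q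
    obtain ⟨c₂, hc₂⟩ := hx p true
    obtain ⟨d₂, hd₂⟩ := hy true q
    refine ⟨c₁ * d₁ + c₂ * d₂, ?_⟩
    rw [map_add, map_mul, map_mul]
    change (F c₁).1 * (F d₁).1 + (F c₂).1 * (F d₂).1 = _
    rw [hc₁, hd₁, hc₂, hd₂]
    -- This resolution of the identity is inserted between x and y. It writes a component of xy as a
    -- sum of products of components of x and y.
    have h1 : fusEps k e i j * fusEps k e i j +
        Ext.e₂₁ k (e i) (e j) * fusEps k e i j * (fusEps k e i j * Ext.e₁₂ k (e i) (e j)) = 1 := by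
      rw [e₂₁_mul_fusEps he i j hij, fusEps_mul_e₁₂ he i j hij, Ext.e₂₁_mul_e₁₂,
        (fusEps_idem k he i j).eq, fusEps, sub_add_cancel]
    have h2 : x * y = x * (fusEps k e i j * fusEps k e i j +
        Ext.e₂₁ k (e i) (e j) * fusEps k e i j * (fusEps k e i j * Ext.e₁₂ k (e i) (e j))) * y := by
      rw [h1, mul_one]
    rw [h2]
    simp only [fusRow, fusCol, cond_true, cond_false, one_mul, mul_one, mul_add, add_mul, mul_assoc]
  algebraMap_mem' r p q := by
    obtain ⟨c, hc⟩ := hi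
    have hc' : (F c).1 = Ext.of k (e i) (e j) (e i) := by
      rw [hc, fusMk_val he hij (placed_idem he hij)]
      simp [fusRow, fusCol]
    have h1 : fusEps k e i j * (fusRow k e i j p * (algebraMap k _ r * fusCol k e i j q)) *
        fusEps k e i j =
        r • (fusEps k e i j * (fusRow k e i j p * fusCol k e i j q) * fusEps k e i j) := by
      rw [← Algebra.smul_def]
      simp only [mul_smul_comm, smul_mul_assoc]
    rw [h1]
    cases p <;> cases q
    · refine ⟨algebraMap k C r, ?_⟩
      rw [AlgHom.commutes, Corner.algebraMap_val]
      simp only [fusRow, fusCol, cond_false, mul_one, (fusEps_idem k he i j).eq]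
    · refine ⟨0, ?_⟩
      rw [map_zero]
      change 0 = _
      simp only [fusRow, fusCol, cond_false, cond_true, one_mul, fusEps_mul_e₂₁, zero_mul,
        smul_zero]
    · refine ⟨0, ?_⟩
      rw [map_zero]
      change 0 = _
      simp only [fusRow, fusCol, cond_false, cond_true, mul_one, mul_assoc, e₁₂_mul_fusEps,
        mul_zero, smul_zero]
    · refine ⟨r • c, ?_⟩
      rw [map_smul]
      change r • (F c).1 = _
      simp only [fusRow, fusCol, cond_true, Ext.e₁₂_mul_e₂₁]
      rw [← hc', Corner.left_mul, Corner.mul_right]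

/-- The elements of Ā whose components all lie in the range of F form a subalgebra. It contains the
matrix units, whose only nonzero component is e_i, so it is everything once it contains generators
of A. An element of the corner is its own (`false`, `false`) component. -/
theorem surjective_of_components (hij : i ≠ j) (hi : ∃ c, F c = fusMk k he i j false false (e i))
    {g : Set A} (hg : Algebra.adjoin k g = ⊤)
    (h : ∀ a ∈ g, ∀ p q, ∃ c, F c = fusMk k he i j p q a) : Function.Surjective F := by
  have h12 : Ext.e₁₂ k (e i) (e j) * Ext.e₁₂ k (e i) (e j) = 0 := by
    rw [← Ext.e₁₂_mul_of, mul_assoc, ← Ext.of_mul_e₁₂, ← mul_assoc (Ext.of k (e i) (e j) (e j)),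
      ← mul_assoc (Ext.of k (e i) (e j) (e j)), ← map_mul,
      show e j * e i = 0 from he.ortho hij.symm]
    simp
  have h21 : Ext.e₂₁ k (e i) (e j) * Ext.e₂₁ k (e i) (e j) = 0 := by
    rw [← Ext.e₂₁_mul_of, mul_assoc, ← Ext.of_mul_e₂₁, ← mul_assoc (Ext.of k (e i) (e j) (e i)),
      ← mul_assoc (Ext.of k (e i) (e j) (e i)), ← map_mul, show e i * e j = 0 from he.ortho hij]
    simp
  have htop : componentSubalgebra he F hij hi = ⊤ := by
    rw [eq_top_iff, ← Ext.adjoin_eq_top (p := e i) (q := e j) hg, Algebra.adjoin_le_iff]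
    obtain ⟨c, hc⟩ := hi
    have hc' : (F c).1 = Ext.of k (e i) (e j) (e i) := by
      rw [hc, fusMk_val he hij (placed_idem he hij)]
      simp [fusRow, fusCol]
    have hc'' : (F c).1 = fusEps k e i j * Ext.of k (e i) (e j) (e i) * fusEps k e i j := by
      rw [← hc', Corner.left_mul, Corner.mul_right]
    have h0 : (F 0).1 = 0 := by rw [map_zero]; rfl
    rintro _ (⟨a, ha, rfl⟩ | rfl | rfl)
    · intro p q
      obtain ⟨c, hc⟩ := h a ha p q
      exact ⟨c, by rw [hc, fusMk_val_raw]⟩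
    · intro p q
      cases p <;> cases q
      · refine ⟨0, h0.trans ?_⟩
        simp only [fusRow, fusCol, cond_false, one_mul, mul_one, mul_assoc, e₁₂_mul_fusEps,
          mul_zero]
      · refine ⟨c, hc''.trans ?_⟩
        simp only [fusRow, fusCol, cond_false, cond_true, one_mul, Ext.e₁₂_mul_e₂₁]
      · refine ⟨0, h0.trans ?_⟩
        simp only [fusRow, fusCol, cond_false, cond_true, mul_one, h12, mul_zero, zero_mul]
      · refine ⟨0, h0.trans ?_⟩
        simp only [fusRow, fusCol, cond_true]
        rw [← mul_assoc (Ext.e₁₂ k (e i) (e j)), h12]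
        simp
    · intro p q
      cases p <;> cases q
      · refine ⟨0, h0.trans ?_⟩
        simp only [fusRow, fusCol, cond_false, one_mul, mul_one, fusEps_mul_e₂₁, zero_mul]
      · refine ⟨0, h0.trans ?_⟩
        simp only [fusRow, fusCol, cond_false, cond_true, one_mul, h21, mul_zero, zero_mul]
      · refine ⟨c, hc''.trans ?_⟩
        simp only [fusRow, fusCol, cond_false, cond_true, mul_one, Ext.e₁₂_mul_e₂₁]
      · refine ⟨0, h0.trans ?_⟩
        simp only [fusRow, fusCol, cond_true]
        rw [h21]
        simp
  intro z
  have hz : z.1 ∈ componentSubalgebra he F hij hi := htop ▸ Algebra.mem_top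
  obtain ⟨c, hc⟩ := hz false false
  refine ⟨c, Subtype.ext (hc.trans ?_)⟩
  simp only [fusRow, fusCol, cond_false, one_mul, mul_one]
  rw [Corner.left_mul, Corner.mul_right]

/-- Homomorphisms from a fusion algebra. -/
theorem exists_cornerHom {B : Type x} [Ring B] [Algebra k B] {B' : Type y} [Ring B'] [Algebra k B']
    (Φ : Ext k (e i) (e j) →ₐ[k] B') (p : B' →ₗ[k] B) (hone : p (Φ (fusEps k e i j)) = 1)
    (hmul : ∀ x y, p (x * Φ (fusEps k e i j) * y) = p x * p y) :
    ∃ G : FusionAlgebra k he i j →ₐ[k] B, ∀ x, G x = p (Φ x.1) := by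
  refine ⟨AlgHom.ofLinearMap (p ∘ₗ Φ.toLinearMap ∘ₗ cornerIncl k (fusEps_idem k he i j))
    hone (fun x y => ?_), fun x => rfl⟩
  change p (Φ (x.1 * y.1)) = p (Φ x.1) * p (Φ y.1)
  rw [← hmul, ← map_mul, Corner.mul_right, map_mul]

theorem injective_of_comp {B : Type y} [Ring B] [Algebra k B]
    {g : Set C} (hg : Generates k g) (f : C →ₐ[k] B) (G : B →ₐ[k] C)
    (h : ∀ c ∈ g, G (f c) = c) : Function.Injective f := by
  have hid : G.comp f = AlgHom.id k C := hg.algHom_ext h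
  intro x y hxy
  have h1 := DFunLike.congr_fun hid x
  have h2 := DFunLike.congr_fun hid y
  simp only [AlgHom.comp_apply, AlgHom.id_apply] at h1 h2
  rw [← h1, ← h2, hxy]

theorem isomorphic_of_bijective {B : Type y} [Ring B] [Algebra k B] {br : DoubleBracket k C}
    {br' : DoubleBracket k B} (f : C →ₐ[k] B) (hf : Function.Bijective f)
    (h : br.Compatible br' f) : br'.Isomorphic br := by
  apply Isomorphic.symm
  exact ⟨AlgEquiv.ofBijective f hf, h⟩

end FusionIso

section PathAlgebra

variable {k : Type u} [Field k] {V E : Type} [Fintype V] {tail head : E → V} {S : Type v} [Ring S]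
  [Algebra k S]

theorem PathAlgebra.mk_surjective : Function.Surjective (PathAlgebra.mk k tail head) :=
  RingQuot.mkAlgHom_surjective k _

theorem PathAlgebra.adjoin_eq_top :
    Algebra.adjoin k (Set.range (PathAlgebra.vertex k tail head) ∪
      Set.range (PathAlgebra.arrow k tail head)) = ⊤ := by
  rw [eq_top_iff]
  rintro z -
  obtain ⟨z, rfl⟩ := PathAlgebra.mk_surjective z
  induction z using FreeAlgebra.induction with
  | grade0 a => rw [AlgHom.commutes]; exact Subalgebra.algebraMap_mem _ _
  | grade1 x =>
    apply Algebra.subset_adjoin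
    rcases x with x | x
    · exact Or.inl ⟨x, rfl⟩
    · exact Or.inr ⟨x, rfl⟩
  | mul a b ha hb => rw [map_mul]; exact mul_mem ha hb
  | add a b ha hb => rw [map_add]; exact add_mem ha hb

theorem PathAlgebra.tail_mul (a : E) :
    vertex k tail head (tail a) * arrow k tail head a = arrow k tail head a := by
  have h := mk_eq k tail head (PathRel.tail a)
  rwa [map_mul] at h

theorem PathAlgebra.mul_head (a : E) :
    arrow k tail head a * vertex k tail head (head a) = arrow k tail head a := by
  have h := mk_eq k tail head (PathRel.head a)
  rwa [map_mul] at h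

theorem PathAlgebra.exists_lift {e : V → S} (he : CompleteOrthogonalIdempotents e) (f : E → S)
    (ht : ∀ a, e (tail a) * f a = f a) (hh : ∀ a, f a * e (head a) = f a) :
    ∃ F : PathAlgebra k tail head →ₐ[k] S, (∀ v, F (vertex k tail head v) = e v) ∧
      ∀ a, F (arrow k tail head a) = f a := by
  refine ⟨RingQuot.liftAlgHom k ⟨FreeAlgebra.lift k (Sum.elim e f), ?_⟩, fun v => ?_, fun a => ?_⟩
  · rintro _ _ (⟨v⟩ | ⟨v, w, h⟩ | _ | ⟨a⟩ | ⟨a⟩)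
    · simp [(he.idem v).eq]
    · simpa using he.ortho h
    · simpa using he.complete
    · simpa using ht a
    · simpa using hh a
  · exact (RingQuot.liftAlgHom_mkAlgHom_apply k _ _ _).trans (by simp)
  · exact (RingQuot.liftAlgHom_mkAlgHom_apply k _ _ _).trans (by simp)

end PathAlgebra

end DoubleQP

end

open scoped TensorProduct

noncomputable section

namespace DoubleQP

universe u v w x y

open DoubleBracket

/-! ### Common tools: self-brackets, comparison on s and t, and polynomial rings. -/

section Self

variable {k : Type u} [Field k] {A : Type v} [Ring A] [Algebra k A]

/-- `λ (x ⊗ u - u ⊗ x) + μ (x² ⊗ u - u ⊗ x²) + ν (x² ⊗ x - x ⊗ x²)`. -/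
def selfAt (lam mu nu : k) (u x : A) : A ⊗[k] A :=
  lam • (x ⊗ₜ[k] u - u ⊗ₜ[k] x) + mu • ((x * x) ⊗ₜ[k] u - u ⊗ₜ[k] (x * x)) +
    nu • ((x * x) ⊗ₜ[k] x - x ⊗ₜ[k] (x * x))

theorem map_selfAt {B : Type w} [Ring B] [Algebra k B] (f : A →ₗ[k] B) (lam mu nu : k) {x : A}
    (u : A) (hx : f (x * x) = f x * f x) :
    TensorProduct.map f f (selfAt lam mu nu u x) = selfAt lam mu nu (f u) (f x) := by
  simp only [selfAt, map_add, map_sub, map_smul, TensorProduct.map_tmul, hx]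

theorem sq_quadTerm {B : Type w} [Ring B] [Algebra k B] (f : A →ₐ[k] B) (p q r w g : k) (s t : A) :
    sq f (quadTerm p q r w g s t) = quadTerm p q r w g (f s) (f t) := by
  have h (a b : A) : sq f (a ⊗ₜ[k] b) = f a ⊗ₜ[k] f b := rfl
  simp only [quadTerm, map_add, map_smul, h, map_mul, map_one]

theorem cross_sub_left (X X' Y : A ⊗[k] A) : cross (X - X') Y = cross X Y - cross X' Y := by
  rw [eq_sub_iff_add_eq, ← cross_add_left, sub_add_cancel]

theorem cross_neg_left (X Y : A ⊗[k] A) : cross (-X) Y = -cross X Y := by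
  rw [eq_neg_iff_add_eq_zero, ← cross_add_left, neg_add_cancel, cross_zero_left]

theorem tensor_sub_zero (X : A ⊗[k] A) : X - 0 = X := sub_zero X

theorem tensor_zero_sub (X : A ⊗[k] A) : 0 - X = -X := zero_sub X

theorem tensor_sub_smul_zero (X : A ⊗[k] A) (c : k) : X - c • 0 = X := by simp

theorem F2.generates : Generates k ({F2.s k, F2.t k} : Set (F2 k)) := by
  apply Generates.of_adjoin
  rw [← FreeAlgebra.adjoin_range_ι]
  congr 1
  ext x
  constructor
  · rintro (rfl | rfl)
    exacts [⟨0, rfl⟩, ⟨1, rfl⟩]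
  · rintro ⟨i, rfl⟩
    fin_cases i
    exacts [Or.inl rfl, Or.inr rfl]

theorem compatible_of_pair {C : Type v} [Ring C] [Algebra k C] {D : Type w} [Ring D] [Algebra k D]
    {br : DoubleBracket k C} {br' : DoubleBracket k D} {s t : C}
    (hg : Generates k ({s, t} : Set C)) (f : C →ₐ[k] D)
    (htt : sq f (br.toFun t t) = br'.toFun (f t) (f t))
    (hss : sq f (br.toFun s s) = br'.toFun (f s) (f s))
    (hts : sq f (br.toFun t s) = br'.toFun (f t) (f s)) : br.Compatible br' f := by
  have hst : sq f (br.toFun s t) = br'.toFun (f s) (f t) := by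
    rw [br.antisymm, br'.antisymm, map_neg, ← hts]
    exact congrArg _ (flip_sq _ _).symm
  apply br.compatible_of_generates hg
  rintro a (rfl | rfl) b (rfl | rfl)
  exacts [hss, hst, hts, htt]

theorem HasForm.compatible_hom {br : DoubleBracket k (F2 k)} {c : Coeffs k} (h : HasForm c br)
    {p q r w g : k} (hts : br.toFun (F2.t k) (F2.s k) = quadTerm p q r w g (F2.s k) (F2.t k))
    {br' : DoubleBracket k A} {s t : A} (htt : br'.toFun t t = selfAt c.lam c.mu c.nu 1 t)
    (hss : br'.toFun s s = selfAt c.l c.m c.n 1 s)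
    (hts' : br'.toFun t s = quadTerm p q r w g s t) : br.Compatible br' (F2.hom s t) := by
  have hself (lam mu nu : k) (y : F2 k) : sq (F2.hom s t) (selfTerm lam mu nu y) =
      selfAt lam mu nu 1 (F2.hom s t y) := by
    have := map_selfAt (F2.hom s t).toLinearMap lam mu nu 1 (map_mul (F2.hom s t) y y)
    rw [AlgHom.toLinearMap_apply, map_one] at this
    exact this
  refine compatible_of_pair F2.generates (F2.hom s t) ?_ ?_ ?_
  · rw [F2.hom_t, htt]
    exact (congrArg _ h.tt).trans ((hself _ _ _ _).trans (by rw [F2.hom_t]))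
  · rw [F2.hom_s, hss]
    exact (congrArg _ h.ss).trans ((hself _ _ _ _).trans (by rw [F2.hom_s]))
  · rw [hts, sq_quadTerm, F2.hom_s, F2.hom_t, hts']

end Self

section Polynomials

variable {k : Type u} [Field k] {A : Type v} [Ring A] [Algebra k A]

/-- Restriction of a double bracket along a split injection. -/
def restrict {C : Type w} [Ring C] [Algebra k C] (br : DoubleBracket k C) (ι : A →ₐ[k] C)
    (π : C →ₐ[k] A) (h : ∀ a, π (ι a) = a) : DoubleBracket k A where
  toFun := (br.toFun.compl₁₂ ι.toLinearMap ι.toLinearMap).compr₂ (sq π).toLinearMap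
  antisymm a b := by
    simp only [LinearMap.compr₂_apply, LinearMap.compl₁₂_apply]
    rw [br.antisymm, map_neg]
    exact congrArg _ (flip_sq _ _).symm
  leibniz a b c := by
    simp only [LinearMap.compr₂_apply, LinearMap.compl₁₂_apply, map_mul,
      AlgHom.toLinearMap_apply]
    rw [br.leibniz, map_add, map_mul, map_mul]
    have h' (a b : C) : sq π (a ⊗ₜ[k] b) = π a ⊗ₜ[k] π b := rfl
    simp only [h', h, map_one]

/-- The subalgebra k[x] of k⟨s,t⟩ is closed under the bracket and is a retract, through the map
sending both generators to X. The quasi-Poisson property on k[x] is thus inherited and needs no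
separate computation. -/
theorem exists_polynomial_bracket {br : DoubleBracket k (F2 k)}
    (hq : br.IsQuasiPoisson (unitIdem _)) {x : F2 k} {lam mu nu : k}
    (hx : F2.hom (Polynomial.X : Polynomial k) Polynomial.X x = Polynomial.X)
    (h : br.toFun x x = selfTerm lam mu nu x) :
    ∃ br₁ : DoubleBracket k (Polynomial k), br₁.IsQuasiPoisson (unitIdem _) ∧
      br₁.toFun Polynomial.X Polynomial.X = selfAt lam mu nu 1 Polynomial.X := by
  have hι (p : Polynomial k) : F2.hom (Polynomial.X : Polynomial k) Polynomial.X
      (Polynomial.aeval x p) = p := by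
    rw [← Polynomial.aeval_algHom_apply, hx, Polynomial.aeval_X_left, AlgHom.id_apply]
  have hself {R R' : Type u} [Ring R] [Algebra k R] [Ring R'] [Algebra k R'] (f : R →ₐ[k] R')
      (y : R) : sq f (selfAt lam mu nu 1 y) = selfAt lam mu nu 1 (f y) := by
    have := map_selfAt f.toLinearMap lam mu nu 1 (map_mul f y y)
    rw [AlgHom.toLinearMap_apply, map_one] at this
    exact this
  let π : F2 k →ₐ[k] Polynomial k := F2.hom Polynomial.X Polynomial.X
  let ι : Polynomial k →ₐ[k] F2 k := Polynomial.aeval x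
  have hιX : ι Polynomial.X = x := Polynomial.aeval_X x
  let br₁ := restrict br ι π hι
  have hX : br₁.toFun Polynomial.X Polynomial.X = selfAt lam mu nu 1 Polynomial.X := by
    change sq π (br.toFun (ι Polynomial.X) (ι Polynomial.X)) = _
    rw [hιX, h]
    exact (hself π x).trans (by rw [hx])
  refine ⟨br₁, hq.of_retract (f := ι) (g := π) hι ?_ (fun _ => map_one _), hX⟩
  apply br₁.compatible_of_generates (Generates.of_adjoin Polynomial.adjoin_X)
  rintro _ rfl _ rfl
  change sq ι (br₁.toFun _ _) = br.toFun (ι _) (ι _)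
  rw [hX, hself, hιX, h]
  rfl

theorem prod_adjoin_eq_top {B : Type w} [Ring B] [Algebra k B] {s : Set A} {t : Set B}
    (hs : Algebra.adjoin k s = ⊤) (ht : Algebra.adjoin k t = ⊤) :
    Algebra.adjoin k ((fun a => (a, (0 : B))) '' (s ∪ {1}) ∪ (fun b => ((0 : A), b)) '' (t ∪ {1}))
      = ⊤ := by
  have := Algebra.adjoin_inl_union_inr_eq_prod k s t
  rw [hs, ht, Subalgebra.prod_top] at this
  exact this

end Polynomials

/-! ### Fusion of two loops. -/

section TwoLoops

variable {k : Type u} [Field k]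

section

variable {A : Type v} [Ring A] [Algebra k A] {I : Type w} [Fintype I] {e : I → A}
  {he : CompleteOrthogonalIdempotents e} {i j : I} {br : DoubleBracket k A}
  {brF : DoubleBracket k (FusionAlgebra k he i j)}

theorem IsFusion.apply_ff_ff (hF : IsFusion he i j br brF) (hij : i ≠ j) {a b : A}
    (ha : Placed e j false false a) (hb : Placed e j false false b) :
    brF.toFun (fusMk k he i j false false a) (fusMk k he i j false false b) =
      TensorProduct.map (fusMk k he i j false false) (fusMk k he i j false false)
        (br.toFun a b) := by
  rw [hF.apply he hij ha hb]
  simp only [fusGauge₂, cond_false, tensor_sub_zero, map_zero, cross_zero_left,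
    tensor_sub_smul_zero]

theorem IsFusion.apply_tt_tt (hF : IsFusion he i j br brF) (hij : i ≠ j) {a b : A}
    (ha : Placed e j true true a) (hb : Placed e j true true b) :
    brF.toFun (fusMk k he i j true true a) (fusMk k he i j true true b) =
      TensorProduct.map (fusMk k he i j true true) (fusMk k he i j true true)
        (br.toFun a b) := by
  rw [hF.apply he hij ha hb]
  simp only [fusGauge₁, cond_true, tensor_sub_zero, map_zero, cross_zero_left,
    tensor_sub_smul_zero]

theorem IsFusion.selfAt_ff (hF : IsFusion he i j br brF) (hij : i ≠ j) {a u : A} {lam mu nu : k}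
    (ha : Placed e j false false a) (h : br.toFun a a = selfAt lam mu nu u a) :
    brF.toFun (fusMk k he i j false false a) (fusMk k he i j false false a) =
      selfAt lam mu nu (fusMk k he i j false false u) (fusMk k he i j false false a) := by
  have hm := map_selfAt (fusMk k he i j false false) lam mu nu u (fusMk_mul he hij ha ha).symm
  exact (hF.apply_ff_ff hij ha ha).trans ((congrArg _ h).trans hm)

theorem IsFusion.selfAt_tt (hF : IsFusion he i j br brF) (hij : i ≠ j) {a u : A} {lam mu nu : k}
    (ha : Placed e j true true a) (h : br.toFun a a = selfAt lam mu nu u a) :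
    brF.toFun (fusMk k he i j true true a) (fusMk k he i j true true a) =
      selfAt lam mu nu (fusMk k he i j true true u) (fusMk k he i j true true a) := by
  have hm := map_selfAt (fusMk k he i j true true) lam mu nu u (fusMk_mul he hij ha ha).symm
  exact (hF.apply_tt_tt hij ha ha).trans ((congrArg _ h).trans hm)

end

theorem fusMk_idem_eq_one {A : Type v} [Ring A] [Algebra k A] {I : Type w} [Fintype I]
    {e : I → A} (he : CompleteOrthogonalIdempotents e) {i j : I} (hij : i ≠ j)
    (h : e i + e j = 1) : fusMk k he i j false false (e i) = 1 := by
  apply Subtype.ext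
  rw [fusMk_val he hij (placed_idem he hij), Corner.one_val, fusEps,
    ← map_one (Ext.of k (e i) (e j)),
    ← h, map_add]
  simp [fusRow, fusCol]

/-- The representation extends to Ā by the standard off-diagonal matrix units. Then ε acts as the
first diagonal unit, and the corner is mapped to the upper left entry. -/
theorem exists_fusionHom {A : Type v} [Ring A] [Algebra k A] {I : Type w} [Fintype I] {e : I → A}
    (he : CompleteOrthogonalIdempotents e) {i j : I} (hij : i ≠ j) {C : Type x} [Ring C]
    [Algebra k C] (f : A →ₐ[k] Matrix (Fin 2) (Fin 2) C) (hi : f (e i) = !![1, 0; 0, 0])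
    (hj : f (e j) = !![0, 0; 0, 1]) :
    ∃ G : FusionAlgebra k he i j →ₐ[k] C, ∀ p q a, Placed e j p q a →
      G (fusMk k he i j p q a) = f a (bif p then 1 else 0) (bif q then 1 else 0) := by
  obtain ⟨Φ, hΦ, hΦ₁₂, hΦ₂₁⟩ := Ext.exists_lift (p := e i) (q := e j) f
    !![0, 1; 0, 0] !![0, 0; 1, 0]
    (by rw [hi]; ext a b; fin_cases a <;> fin_cases b <;> simp)
    (by rw [hj]; ext a b; fin_cases a <;> fin_cases b <;> simp)
    (by rw [hj]; ext a b; fin_cases a <;> fin_cases b <;> simp)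
    (by rw [hi]; ext a b; fin_cases a <;> fin_cases b <;> simp)
    (by rw [hi]; ext a b; fin_cases a <;> fin_cases b <;> simp)
    (by rw [hj]; ext a b; fin_cases a <;> fin_cases b <;> simp)
  have hε : Φ (fusEps k e i j) = !![1, 0; 0, 0] := by
    rw [fusEps, map_sub, map_one, hΦ, hj]
    ext a b
    fin_cases a <;> fin_cases b <;> simp
  obtain ⟨G, hG⟩ := exists_cornerHom he Φ (Matrix.entryLinearMap k C 0 0) (by rw [hε]; rfl)
    (fun x y => by
      rw [hε]
      simp [Matrix.mul_apply, Fin.sum_univ_two])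
  refine ⟨G, fun p q a ha => ?_⟩
  rw [hG, fusMk_val he hij ha, map_mul Φ, map_mul Φ, hΦ]
  change (Φ (fusRow k e i j p) * f a * Φ (fusCol k e i j q)) 0 0 = _
  rw [Matrix.mul_apply, Fin.sum_univ_two, Matrix.mul_apply, Fin.sum_univ_two, Matrix.mul_apply,
    Fin.sum_univ_two]
  cases p <;> cases q <;> simp [fusRow, fusCol, hΦ₁₂, hΦ₂₁]

/-- Here t = T and s = e₁₂Se₂₁. Only Tr(E_i) sees t and only Tr(E_j) sees s, so the self-brackets
are unchanged and the mixed bracket is −½ times the cross product of t⊗1 − 1⊗t and s⊗1 − 1⊗s. -/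
theorem fusedFromTwoLoops [CharZero k] {br : DoubleBracket k (F2 k)} {c : Coeffs k}
    (h : HasForm c br) (hq : br.IsQuasiPoisson (unitIdem _))
    (hts : br.toFun (F2.t k) (F2.s k) =
      quadTerm (1 / 2) (-(1 / 2)) (-(1 / 2)) (1 / 2) 0 (F2.s k) (F2.t k)) :
    FusedFromTwoLoops br := by
  obtain ⟨br₁, hq₁, h₁⟩ := exists_polynomial_bracket hq (F2.hom_t _ _) h.tt
  obtain ⟨br₂, hq₂, h₂⟩ := exists_polynomial_bracket hq (F2.hom_s _ _) h.ss
  have he := prodIdem_complete (unitIdem_complete (Polynomial k)) (unitIdem_complete (Polynomial k))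
  have hij : (Sum.inl () : Unit ⊕ Unit) ≠ Sum.inr () := Sum.inl_ne_inr
  have hbr : ∀ s a, (br₁.prod br₂) (prodIdem (unitIdem (Polynomial k))
      (unitIdem (Polynomial k)) s) a
      = 0 := by
    have h1 (a : Polynomial k) : br₁.toFun 1 a = 0 := hq₁.linear_left () a
    have h2 (a : Polynomial k) : br₂.toFun 1 a = 0 := hq₂.linear_left () a
    rintro (s | s) a
    · change incl₁ _ _ _ (br₁.toFun 1 a.1) + incl₂ _ _ _ (br₂.toFun 0 a.2) = 0
      rw [h1, map_zero, map_zero, LinearMap.zero_apply, map_zero, add_zero]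
    · change incl₁ _ _ _ (br₁.toFun 0 a.1) + incl₂ _ _ _ (br₂.toFun 1 a.2) = 0
      rw [h2, map_zero, map_zero, LinearMap.zero_apply, map_zero, add_zero]
  obtain ⟨brF, hF⟩ := exists_isFusion (Sum.inl ()) (Sum.inr ()) he hbr
  refine ⟨br₁, br₂, hq₁, hq₂, Sum.inl (), Sum.inr (), hij, brF, hF, ?_⟩
  let T : Polynomial k × Polynomial k := (Polynomial.X, 0)
  let S : Polynomial k × Polynomial k := (0, Polynomial.X)
  let e : Unit ⊕ Unit → Polynomial k × Polynomial k :=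
    prodIdem (unitIdem (Polynomial k)) (unitIdem (Polynomial k))
  have hT : Placed e (Sum.inr ()) false false T := by
    constructor <;> simp [T, e, prodIdem, unitIdem]
  have hS : Placed e (Sum.inr ()) true true S := by
    constructor <;> simp [S, e, prodIdem, unitIdem]
  have hone : fusMk k he (Sum.inl ()) (Sum.inr ()) false false (e (Sum.inl ())) = 1 :=
    fusMk_idem_eq_one he hij (by simp [prodIdem, unitIdem])
  have hone' : fusMk k he (Sum.inl ()) (Sum.inr ()) true true (e (Sum.inr ())) = 1 := by
    rw [← hone]
    exact fusMk_idem_self he hij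
  have hTT : (br₁.prod br₂).toFun T T = selfAt c.lam c.mu c.nu (e (Sum.inl ())) T := by
    change incl₁ _ _ _ (br₁.toFun Polynomial.X Polynomial.X) + incl₂ _ _ _ (br₂.toFun 0 0) = _
    rw [h₁, map_zero, map_zero, add_zero]
    exact map_selfAt _ _ _ _ _ (by simp)
  have hSS : (br₁.prod br₂).toFun S S = selfAt c.l c.m c.n (e (Sum.inr ())) S := by
    change incl₁ _ _ _ (br₁.toFun 0 0) + incl₂ _ _ _ (br₂.toFun Polynomial.X Polynomial.X) = _
    rw [h₂, map_zero, map_zero, zero_add]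
    exact map_selfAt _ _ _ _ _ (by simp)
  have hTS : (br₁.prod br₂).toFun T S = 0 := by
    change incl₁ _ _ _ (br₁.toFun Polynomial.X 0) + incl₂ _ _ _ (br₂.toFun 0 Polynomial.X) = _
    rw [map_zero, map_zero, map_zero, LinearMap.zero_apply, map_zero, add_zero]
  let t := fusMk k he (Sum.inl ()) (Sum.inr ()) false false T
  let s := fusMk k he (Sum.inl ()) (Sum.inr ()) true true S
  have htt : brF.toFun t t = selfAt c.lam c.mu c.nu 1 t :=
    (hF.selfAt_ff hij hT hTT).trans (congrArg (fun u => selfAt c.lam c.mu c.nu u t) hone)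
  have hss : brF.toFun s s = selfAt c.l c.m c.n 1 s :=
    (hF.selfAt_tt hij hS hSS).trans (congrArg (fun u => selfAt c.l c.m c.n u s) hone')
  have hts' : brF.toFun t s = quadTerm (1 / 2) (-(1 / 2)) (-(1 / 2)) (1 / 2) 0 s t := by
    have := hF.apply he hij hT hS
    refine this.trans ?_
    have h1 : T * prodIdem (unitIdem (Polynomial k)) (unitIdem (Polynomial k))
        (Sum.inl ()) = T := by
      simp [T, prodIdem, unitIdem]
    have h2 : prodIdem (unitIdem (Polynomial k)) (unitIdem (Polynomial k))
        (Sum.inl ()) * T = T := by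
      simp [T, prodIdem, unitIdem]
    have h3 : fusMk k he (Sum.inl ()) (Sum.inr ()) false false
      (prodIdem (unitIdem (Polynomial k)) (unitIdem (Polynomial k)) (Sum.inl ())) = 1 := hone
    rw [hTS]
    simp only [fusGauge₁, fusGauge₂, cond_true, cond_false, h1, h2, h3, map_zero,
      tensor_sub_zero, map_sub, cross_sub_left, cross_tmul, one_mul, mul_one]
    simp only [quadTerm, t, s]
    module
  let F : F2 k →ₐ[k] FusionAlgebra k he (Sum.inl ()) (Sum.inr ()) := F2.hom s t
  have hFs : F (F2.s k) = s := F2.hom_s _ _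
  have hFt : F (F2.t k) = t := F2.hom_t _ _
  have hcompat : br.Compatible brF F := h.compatible_hom hts htt hss hts'
  refine isomorphic_of_bijective F ⟨?_, ?_⟩ hcompat
  -- Evaluating the two polynomial rings at t and s on the diagonal gives a homomorphism from the
  -- fusion algebra that sends the fused generators back to t and s.
  · let D := Matrix.diagonalAlgHom k (n := Fin 2) (α := F2 k)
    let f : Polynomial k × Polynomial k →ₐ[k] Matrix (Fin 2) (Fin 2) (F2 k) :=
      D.comp (AlgHom.pi ![(Polynomial.aeval (F2.t k)).comp (AlgHom.fst k _ _),
        (Polynomial.aeval (F2.s k)).comp (AlgHom.snd k _ _)])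
    have hf (x : Polynomial k × Polynomial k) :
        f x = !![Polynomial.aeval (F2.t k) x.1, 0; 0, Polynomial.aeval (F2.s k) x.2] := by
      ext a b
      fin_cases a <;> fin_cases b <;> rfl
    have hf1 : f (e (Sum.inl ())) = !![1, 0; 0, 0] := by simp [hf, e, prodIdem, unitIdem]
    have hf2 : f (e (Sum.inr ())) = !![0, 0; 0, 1] := by simp [hf, e, prodIdem, unitIdem]
    obtain ⟨G, hG⟩ := exists_fusionHom he hij f hf1 hf2
    refine injective_of_comp F2.generates F G ?_
    rintro _ (rfl | rfl)
    · rw [hFs]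
      refine (hG true true S hS).trans ?_
      simp [hf, S]
    · rw [hFt]
      refine (hG false false T hT).trans ?_
      simp [hf, T]
  · refine surjective_of_components he F hij ⟨1, (map_one F).trans hone.symm⟩
      (prod_adjoin_eq_top Polynomial.adjoin_X Polynomial.adjoin_X) ?_
    rintro _ (⟨_, rfl | rfl, rfl⟩ | ⟨_, rfl | rfl, rfl⟩)
    · exact hT.exists_fusMk he F ⟨_, hFt⟩
    · exact (placed_idem he hij).exists_fusMk he F ⟨1, (map_one F).trans hone.symm⟩
    · exact hS.exists_fusMk he F ⟨_, hFs⟩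
    · exact (placed_idem_self he).exists_fusMk he F ⟨1, (map_one F).trans hone'.symm⟩

end TwoLoops

end DoubleQP

end

open scoped TensorProduct

noncomputable section

namespace DoubleQP

universe u v w x y

open DoubleBracket

/-! ### Two opposite arrows: the quasi-Poisson property. -/

section ArrowPair

variable {k : Type u} [Field k] {A : Type v} [Ring A] [Algebra k A]

/-- `T` goes from `e₀` to `e₁` and `S` from `e₁` to `e₀`. -/
structure ArrowPair (e : Fin 2 → A) (T S : A) : Prop where
  left_T : e 0 * T = T
  T_right : T * e 1 = T
  left_S : e 1 * S = S
  S_right : S * e 0 = S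

/-- `⦃T, T⦄ = ⦃S, S⦄ = 0` and `⦃T, S⦄ = g e₁ ⊗ e₀ + κ (S T ⊗ e₀ + e₁ ⊗ T S)`. -/
structure ArrowBracket (br : DoubleBracket k A) (e : Fin 2 → A) (T S : A) (κ g : k) : Prop where
  TT : br.toFun T T = 0
  SS : br.toFun S S = 0
  TS : br.toFun T S = g • (e 1 ⊗ₜ[k] e 0) + κ • ((S * T) ⊗ₜ[k] e 0 + e 1 ⊗ₜ[k] (T * S))

variable {e : Fin 2 → A} {T S : A} {br : DoubleBracket k A} {κ g : k}

/-- Only triples formed from T and S have to be checked, and non-composable products vanish. The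
surviving terms match for every g provided 4κ² = 1. -/
theorem arrowPair_isQuasiPoisson [CharZero k] (he : CompleteOrthogonalIdempotents e)
    (h : ArrowPair e T S) (hl : ∀ s a, br (e s) a = 0) (hb : ArrowBracket br e T S κ g)
    (hκ : κ = 1 / 2 ∨ κ = -(1 / 2)) (hG : Generates k (Set.range e ∪ {T, S})) :
    br.IsQuasiPoisson e := by
  have h1 := h.left_T
  have h2 := h.T_right
  have h3 := h.left_S
  have h4 := h.S_right
  have e00 : e 0 * e 0 = e 0 := he.idem 0
  have e11 : e 1 * e 1 = e 1 := he.idem 1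
  have e01 : e 0 * e 1 = 0 := he.ortho (by decide)
  have e10 : e 1 * e 0 = 0 := he.ortho (by decide)
  have h5 : e 1 * T = 0 := by rw [← h1, ← mul_assoc, e10, zero_mul]
  have h6 : T * e 0 = 0 := by rw [← h2, mul_assoc, e10, mul_zero]
  have h7 : e 0 * S = 0 := by rw [← h3, ← mul_assoc, e01, zero_mul]
  have h8 : S * e 1 = 0 := by rw [← h4, mul_assoc, e01, mul_zero]
  have h9 : T * T = 0 := by nth_rw 1 [← h2]; rw [mul_assoc, h5, mul_zero]
  have h10 : S * S = 0 := by nth_rw 1 [← h4]; rw [mul_assoc, h7, mul_zero]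
  have hr (a : A) (s : Fin 2) : br.toFun a (e s) = 0 := by
    have : br.toFun (e s) a = 0 := hl s a
    rw [br.antisymm, this, map_zero, neg_zero]
  have hTS := hb.TS
  have hST : br.toFun S T =
      -(g • (e 0 ⊗ₜ[k] e 1) + κ • (e 0 ⊗ₜ[k] (S * T) + (T * S) ⊗ₜ[k] e 1)) := by
    rw [br.antisymm, hTS]
    simp only [map_add, map_smul, TensorProduct.comm_tmul]
  refine br.isQuasiPoisson_of_generates he hl hG ?_
  -- The numerical value of κ is substituted so that the final comparison is linear; the relation
  -- 4κ² = 1 never has to be invoked.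
  rcases hκ with rfl | rfl <;>
  · rintro a (rfl | rfl) b (rfl | rfl) c (rfl | rfl) <;>
    · rw [qpRhs_apply, Fin.sum_univ_two]
      simp only [triple, hb.TT, hb.SS, hTS, hST, map_add, map_neg, map_smul, left_tmul, hr,
        TensorProduct.zero_tmul, br.leibniz, map_zero, add_zero, zero_add, mul_zero, zero_mul]
      simp only [add_mul, mul_add, smul_mul_assoc, mul_smul_comm, neg_mul, mul_neg,
        Algebra.TensorProduct.tmul_mul_tmul, one_mul, mul_one, mul_assoc, h1, h2, h3, h4, h5, h6,
          h7,
        h8, h9, h10,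
        TensorProduct.zero_tmul, TensorProduct.tmul_zero, TensorProduct.add_tmul,
        TensorProduct.neg_tmul, ← TensorProduct.smul_tmul', map_add, map_neg, map_smul, rot_tmul,
        smul_zero, add_zero, zero_add, sub_zero, zero_sub, zero_mul,
        sub_self, smul_add, smul_neg]
      module

end ArrowPair

end DoubleQP

end

open scoped TensorProduct

noncomputable section

namespace DoubleQP

universe u v w x y

open DoubleBracket

/-! ### Double brackets on path algebras and the effect of closing up two arrows. -/

section PathBracket

variable {k : Type u} [Field k] {V E : Type} [Fintype V] {tail head : E → V} {S : Type v} [Ring S]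
  [Algebra k S]

theorem PathAlgebra.exists_isDer (l r : PathAlgebra k tail head →ₐ[k] S) (d : E → S)
    (ht : ∀ a, l (vertex k tail head (tail a)) * d a = d a)
    (hh : ∀ a, d a * r (vertex k tail head (head a)) = d a) :
    ∃ D : PathAlgebra k tail head →ₗ[k] S, IsDer l r D ∧
      (∀ v, D (vertex k tail head v) = 0) ∧ ∀ a, D (arrow k tail head a) = d a := by
  obtain ⟨δ, hδ, hδd⟩ := exists_isDer_freeAlgebra (l.comp (mk k tail head))
    (r.comp (mk k tail head)) (Sum.elim (fun _ => 0) d)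
  obtain ⟨D, hD, hDδ⟩ := IsDer.exists_descend (rel := PathRel k tail head) (l := l) (r := r) hδ (by
    rintro _ _ (⟨v⟩ | ⟨v, w, h⟩ | _ | ⟨a⟩ | ⟨a⟩)
    · rw [hδ, hδd]; simp
    · rw [hδ, hδd, hδd]; simp
    · rw [map_sum, hδ.map_one]; simp [hδd]
    · rw [hδ, hδd, hδd, Sum.elim_inl, Sum.elim_inr, zero_mul, zero_add]
      exact ht a
    · rw [hδ, hδd, hδd, Sum.elim_inl, Sum.elim_inr, mul_zero, add_zero]
      exact hh a)
  exact ⟨D, hD, fun v => (hDδ _).trans (hδd _), fun a => (hDδ _).trans (hδd _)⟩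

theorem PathAlgebra.generates : Generates k
    (Set.range (Sum.elim (vertex k tail head) (arrow k tail head))) := by
  apply Generates.of_adjoin
  rw [Set.Sum.elim_range]
  exact adjoin_eq_top

/-- Linearity over the vertices requires ⦃a,b⦄ to start at the tail of b and end at its head for the
outer structure. Antisymmetry supplies the corresponding inner conditions for a, and these
conditions suffice. -/
theorem PathAlgebra.exists_bracket
    (z : E → E → PathAlgebra k tail head ⊗[k] PathAlgebra k tail head)
    (hz : ∀ a b, z a b = -flip k _ (z b a))
    (ht : ∀ a b, inL k _ (vertex k tail head (tail b)) * z a b = z a b)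
    (hh : ∀ a b, z a b * inR k _ (vertex k tail head (head b)) = z a b) :
    ∃ br : DoubleBracket k (PathAlgebra k tail head),
      (∀ v x, br.toFun (vertex k tail head v) x = 0) ∧
      ∀ a b, br.toFun (arrow k tail head a) (arrow k tail head b) = z a b := by
  have ht' (a b : E) : inR k _ (vertex k tail head (tail a)) * z a b = z a b := by
    rw [hz a b, mul_neg, ← flip_inL, ← map_mul, ht]
  have hh' (a b : E) : z a b * inL k _ (vertex k tail head (head a)) = z a b := by
    rw [hz a b, neg_mul, ← flip_inR, ← map_mul, hh]
  have hg := PathAlgebra.generates (k := k) (tail := tail) (head := head)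
  obtain ⟨br, hbr⟩ := DoubleBracket.exists_of_generators _ hg
    (Sum.elim (fun _ _ => 0) (fun a => Sum.elim (fun _ => 0) (z a)))
    (by
      rintro (v | a) (w | b)
      · simp
      · simp
      · simp
      · exact hz a b)
    (by
      rintro (v | a)
      · exact ⟨0, IsDer.zero, fun y => rfl⟩
      · obtain ⟨D, hD, h1, h2⟩ := PathAlgebra.exists_isDer (inL k _) (inR k _) (z a) (ht a) (hh a)
        exact ⟨D, hD, by rintro (v | b); exacts [h1 v, h2 b]⟩)
    (by
      intro D hD hDv c
      have h0 (v : V) : D (Sum.inl v) = 0 := hg.ext (hD _) IsDer.zero (by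
        rintro _ ⟨y, rfl⟩
        rw [hDv]
        rfl)
      -- The inner support condition passes from generators to every c by uniqueness of derivations.
      -- It is needed to extend a ↦ ⦃a,c⦄ from arrows to the path algebra.
      have h1 (a : E) : LinearMap.mulLeft k (inR k _ (vertex k tail head (tail a))) ∘ₗ
          D (Sum.inr a) = D (Sum.inr a) :=
        hg.ext ((hD _).mul_left (fun c => (inL_mul_inR _ _).symm)) (hD _) (by
          rintro _ ⟨y, rfl⟩
          rw [LinearMap.comp_apply, hDv, LinearMap.mulLeft_apply]
          rcases y with v | b
          · exact mul_zero _
          · exact ht' a b)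
      have h2 (a : E) : LinearMap.mulRight k (inL k _ (vertex k tail head (head a))) ∘ₗ
          D (Sum.inr a) = D (Sum.inr a) :=
        hg.ext ((hD _).mul_right (fun c => inL_mul_inR _ _)) (hD _) (by
          rintro _ ⟨y, rfl⟩
          rw [LinearMap.comp_apply, hDv, LinearMap.mulRight_apply]
          rcases y with v | b
          · exact zero_mul _
          · exact hh' a b)
      obtain ⟨G, hG, hG1, hG2⟩ := PathAlgebra.exists_isDer (inR k _) (inL k _)
        (fun a => D (Sum.inr a) c) (fun a => DFunLike.congr_fun (h1 a) c)
        (fun a => DFunLike.congr_fun (h2 a) c)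
      refine ⟨G, hG, ?_⟩
      rintro (v | a)
      · rw [h0]; exact hG1 v
      · exact hG2 a)
  refine ⟨br, fun v => ?_, fun a b => hbr (Sum.inr a) (Sum.inr b)⟩
  have : br.toFun (vertex k tail head v) = 0 := hg.ext (br.isDer_right _) IsDer.zero (by
    rintro _ ⟨y, rfl⟩
    exact hbr (Sum.inl v) y)
  exact fun x => by rw [this]; rfl

end PathBracket

section FusedPair

variable {k : Type u} [Field k] {A : Type v} [Ring A] [Algebra k A]
  {e : Fin 2 → A} {T S : A} {br : DoubleBracket k A} {κ g : k}

theorem ArrowPair.placed_T (he : CompleteOrthogonalIdempotents e) (h : ArrowPair e T S) :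
    Placed e 1 false true T := by
  refine ⟨?_, h.T_right⟩
  have : e 1 * e 0 = 0 := he.ortho (by decide)
  rw [← h.left_T, ← mul_assoc, this, zero_mul, cond_false]

theorem ArrowPair.placed_S (he : CompleteOrthogonalIdempotents e) (h : ArrowPair e T S) :
    Placed e 1 true false S := by
  refine ⟨h.left_S, ?_⟩
  have : e 0 * e 1 = 0 := he.ortho (by decide)
  rw [← h.S_right, mul_assoc, this, mul_zero, cond_false]

theorem fusMk_vertex_eq_one (he : CompleteOrthogonalIdempotents e) :
    fusMk k he 0 1 false false (e 0) = 1 :=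
  fusMk_idem_eq_one he (by decide) (by rw [← he.complete, Fin.sum_univ_two])

theorem fusMk_vertex_eq_one' (he : CompleteOrthogonalIdempotents e) :
    fusMk k he 0 1 true true (e 1) = 1 :=
  (fusMk_idem_self he (by decide)).trans (fusMk_vertex_eq_one he)

variable {he : CompleteOrthogonalIdempotents e} {brF : DoubleBracket k (FusionAlgebra k he 0 1)}

/-- The arrow has zero self-bracket, but Tr(E_i) and Tr(E_j) take the values −1⊗t and t⊗1 on the
resulting loop t. Their cross products give ½(t²⊗1 − 1⊗t²). The opposite arrow yields the opposite
sign. -/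
theorem ArrowPair.fused_TT (h : ArrowPair e T S) (hb : ArrowBracket br e T S κ g)
    (hF : IsFusion he 0 1 br brF) :
    brF.toFun (fusMk k he 0 1 false true T) (fusMk k he 0 1 false true T) =
      selfAt 0 (1 / 2) 0 1 (fusMk k he 0 1 false true T) := by
  have hT := h.placed_T he
  refine (hF.apply he (by decide) hT hT).trans ?_
  rw [hb.TT]
  simp only [fusGauge₁, fusGauge₂, cond_true, cond_false, fusMk_vertex_eq_one, h.left_T, map_zero,
    tensor_sub_zero, tensor_zero_sub, cross_neg_left, map_neg, cross_tmul, mul_one, selfAt]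
  module

theorem ArrowPair.fused_SS (h : ArrowPair e T S) (hb : ArrowBracket br e T S κ g)
    (hF : IsFusion he 0 1 br brF) :
    brF.toFun (fusMk k he 0 1 true false S) (fusMk k he 0 1 true false S) =
      selfAt 0 (-(1 / 2)) 0 1 (fusMk k he 0 1 true false S) := by
  have hS := h.placed_S he
  refine (hF.apply he (by decide) hS hS).trans ?_
  rw [hb.SS]
  simp only [fusGauge₁, fusGauge₂, cond_true, cond_false, fusMk_vertex_eq_one, h.S_right, map_zero,
    tensor_sub_zero, tensor_zero_sub, cross_neg_left, map_neg, cross_tmul, mul_one, selfAt]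
  module

theorem ArrowPair.fused_TS (h : ArrowPair e T S) (hb : ArrowBracket br e T S κ g)
    (hF : IsFusion he 0 1 br brF) :
    brF.toFun (fusMk k he 0 1 false true T) (fusMk k he 0 1 true false S) =
      quadTerm κ (-(1 / 2)) (1 / 2) κ g (fusMk k he 0 1 true false S)
        (fusMk k he 0 1 false true T) := by
  have hT := h.placed_T he
  have hS := h.placed_S he
  have h1 := fusMk_mul (k := k) he (i := 0) (by decide) hS hT
  have h2 := fusMk_mul (k := k) he (i := 0) (by decide) hT hS
  refine (hF.apply he (by decide) hT hS).trans ?_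
  rw [hb.TS]
  simp only [fusGauge₁, fusGauge₂, cond_true, cond_false, fusMk_vertex_eq_one,
    fusMk_vertex_eq_one', h.S_right, h.left_T, map_add, map_smul, TensorProduct.map_tmul, ← h1,
      ← h2,
    tensor_sub_zero, tensor_zero_sub, cross_neg_left, map_neg, cross_tmul, one_mul, mul_one,
    quadTerm]
  module

end FusedPair

end DoubleQP

end

open scoped TensorProduct

noncomputable section

namespace DoubleQP

universe u v w x y

open DoubleBracket

/-! ### Fusion of the double quiver. -/

section DoubleArrow

variable {k : Type u} [Field k]

theorem KQ₁d.arrowPair : ArrowPair (KQ₁d.e k) (KQ₁d.t k) (KQ₁d.s k) :=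
  ⟨PathAlgebra.tail_mul false, PathAlgebra.mul_head false, PathAlgebra.tail_mul true,
    PathAlgebra.mul_head true⟩

theorem KQ₁d.adjoin_eq_top :
    Algebra.adjoin k (Set.range (KQ₁d.e k) ∪ {KQ₁d.t k, KQ₁d.s k}) = ⊤ := by
  rw [← PathAlgebra.adjoin_eq_top]
  congr 2
  ext x
  constructor
  · rintro (rfl | rfl)
    exacts [⟨false, rfl⟩, ⟨true, rfl⟩]
  · rintro ⟨b, rfl⟩
    cases b
    exacts [Or.inl rfl, Or.inr rfl]

theorem KQ₁d.exists_bracket [CharZero k] (κ g : k) (hκ : κ = 1 / 2 ∨ κ = -(1 / 2)) :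
    ∃ br : DoubleBracket k (KQ₁d k), br.IsQuasiPoisson (KQ₁d.e k) ∧
      ArrowBracket br (KQ₁d.e k) (KQ₁d.t k) (KQ₁d.s k) κ g := by
  let z : KQ₁d k ⊗[k] KQ₁d k := g • (KQ₁d.e k 1 ⊗ₜ[k] KQ₁d.e k 0) +
    κ • ((KQ₁d.s k * KQ₁d.t k) ⊗ₜ[k] KQ₁d.e k 0 + KQ₁d.e k 1 ⊗ₜ[k] (KQ₁d.t k * KQ₁d.s k))
  have hp := KQ₁d.arrowPair (k := k)
  have e0 : KQ₁d.e k 0 * KQ₁d.e k 0 = KQ₁d.e k 0 := (KQ₁d.e_complete k).idem 0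
  have e1 : KQ₁d.e k 1 * KQ₁d.e k 1 = KQ₁d.e k 1 := (KQ₁d.e_complete k).idem 1
  have z1 : inL k _ (KQ₁d.e k 1) * z = z := by
    simp only [z, mul_add, mul_smul_comm, Algebra.TensorProduct.includeLeft_apply,
      Algebra.TensorProduct.tmul_mul_tmul, one_mul, e1, ← mul_assoc, hp.left_S]
  have z2 : z * inR k _ (KQ₁d.e k 0) = z := by
    simp only [z, add_mul, smul_mul_assoc, Algebra.TensorProduct.includeRight_apply,
      Algebra.TensorProduct.tmul_mul_tmul, mul_one, e0, mul_assoc, hp.S_right]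
  have z3 : inR k _ (KQ₁d.e k 0) * z = z := by
    simp only [z, mul_add, mul_smul_comm, Algebra.TensorProduct.includeRight_apply,
      Algebra.TensorProduct.tmul_mul_tmul, one_mul, e0, ← mul_assoc, hp.left_T]
  have z4 : z * inL k _ (KQ₁d.e k 1) = z := by
    simp only [z, add_mul, smul_mul_assoc, Algebra.TensorProduct.includeLeft_apply,
      Algebra.TensorProduct.tmul_mul_tmul, mul_one, e1, mul_assoc, hp.T_right]
  obtain ⟨br, hl, hv⟩ := PathAlgebra.exists_bracket (k := k)
    (tail := fun b : Bool => if b then (1 : Fin 2) else 0)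
    (head := fun b : Bool => if b then (0 : Fin 2) else 1)
    (fun a b => match a, b with
      | false, true => z
      | true, false => -flip k _ z
      | _, _ => 0)
    (by
      rintro (_ | _) (_ | _)
      · simp
      · change z = -flip k _ (-flip k _ z)
        rw [map_neg, flip_flip, neg_neg]
      · rfl
      · simp)
    (by
      rintro (_ | _) (_ | _)
      · exact mul_zero _
      · exact z1
      · change inL k _ (KQ₁d.e k 0) * -flip k _ z = -flip k _ z
        rw [mul_neg, ← flip_inR, ← map_mul, z3]
      · exact mul_zero _)
    (by
      rintro (_ | _) (_ | _)
      · exact zero_mul _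
      · exact z2
      · change -flip k _ z * inR k _ (KQ₁d.e k 1) = -flip k _ z
        rw [neg_mul, ← flip_inL, ← map_mul, z4]
      · exact zero_mul _)
  have hb : ArrowBracket br (KQ₁d.e k) (KQ₁d.t k) (KQ₁d.s k) κ g :=
    ⟨hv false false, hv true true, hv false true⟩
  exact ⟨br, arrowPair_isQuasiPoisson (KQ₁d.e_complete k) hp hl hb hκ
    (Generates.of_adjoin KQ₁d.adjoin_eq_top), hb⟩

theorem vertexMatrices_complete (C : Type v) [Ring C] :
    CompleteOrthogonalIdempotents
      (![!![1, 0; 0, 0], !![0, 0; 0, 1]] : Fin 2 → Matrix (Fin 2) (Fin 2) C) where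
  idem a := by
    fin_cases a <;>
    · ext i j
      fin_cases i <;> fin_cases j <;> simp
  ortho a b hab := by
    fin_cases a <;> fin_cases b
    · exact (hab rfl).elim
    · ext i j
      fin_cases i <;> fin_cases j <;> simp
    · ext i j
      fin_cases i <;> fin_cases j <;> simp
    · exact (hab rfl).elim
  complete := by
    ext i j
    rw [Fin.sum_univ_two]
    fin_cases i <;> fin_cases j <;> simp

theorem KQ₁d.exists_matrixHom {C : Type v} [Ring C] [Algebra k C] (s t : C) :
    ∃ f : KQ₁d k →ₐ[k] Matrix (Fin 2) (Fin 2) C, f (KQ₁d.e k 0) = !![1, 0; 0, 0] ∧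
      f (KQ₁d.e k 1) = !![0, 0; 0, 1] ∧ f (KQ₁d.t k) = !![0, t; 0, 0] ∧
      f (KQ₁d.s k) = !![0, 0; s, 0] := by
  obtain ⟨f, h1, h2⟩ := PathAlgebra.exists_lift (k := k)
    (tail := fun b : Bool => if b then (1 : Fin 2) else 0)
    (head := fun b : Bool => if b then (0 : Fin 2) else 1) (vertexMatrices_complete C)
    (fun b => if b then !![0, 0; s, 0] else !![0, t; 0, 0])
    (by
      rintro (_ | _) <;>
      · ext i j
        fin_cases i <;> fin_cases j <;> simp)
    (by
      rintro (_ | _) <;>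
      · ext i j
        fin_cases i <;> fin_cases j <;> simp)
  exact ⟨f, h1 0, h1 1, h2 false, h2 true⟩

theorem fusedFromDoubleArrow [CharZero k] {br : DoubleBracket k (F2 k)} {c : Coeffs k}
    (h : HasForm c br) (hl : c.lam = 0) (hn : c.nu = 0) (hl' : c.l = 0) (hn' : c.n = 0)
    (hm : c.mu = 1 / 2) (hm' : c.m = -(1 / 2)) {κ g : k} (hκ : κ = 1 / 2 ∨ κ = -(1 / 2))
    (hts : br.toFun (F2.t k) (F2.s k) =
      quadTerm κ (-(1 / 2)) (1 / 2) κ g (F2.s k) (F2.t k)) :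
    FusedFromDoubleArrow br := by
  obtain ⟨br₁, hq₁, hb⟩ := KQ₁d.exists_bracket κ g hκ
  have he := KQ₁d.e_complete k
  have hij : (0 : Fin 2) ≠ 1 := by decide
  obtain ⟨brF, hF⟩ := exists_isFusion 0 1 he hq₁.linear_left
  refine ⟨br₁, hq₁, 0, 1, hij, brF, hF, ?_⟩
  have hp := KQ₁d.arrowPair (k := k)
  let t := fusMk k he 0 1 false true (KQ₁d.t k)
  let s := fusMk k he 0 1 true false (KQ₁d.s k)
  let F : F2 k →ₐ[k] FusionAlgebra k he 0 1 := F2.hom s t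
  have hFs : F (F2.s k) = s := F2.hom_s _ _
  have hFt : F (F2.t k) = t := F2.hom_t _ _
  have hcompat : br.Compatible brF F := h.compatible_hom hts
    (by rw [hl, hn, hm]; exact hp.fused_TT hb hF) (by rw [hl', hn', hm']; exact hp.fused_SS hb hF)
    (hp.fused_TS hb hF)
  refine isomorphic_of_bijective F ⟨?_, ?_⟩ hcompat
  -- The arrows act by off-diagonal matrices with entries t and s, and the component of each in the
  -- fusion algebra is mapped to that entry.
  · obtain ⟨f, h0, h1, ht, hs⟩ := KQ₁d.exists_matrixHom (k := k) (F2.s k) (F2.t k)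
    obtain ⟨G, hG⟩ := exists_fusionHom he hij f h0 h1
    refine injective_of_comp F2.generates F G ?_
    rintro _ (rfl | rfl)
    · rw [hFs]
      refine (hG true false _ (hp.placed_S he)).trans ?_
      rw [hs]
      rfl
    · rw [hFt]
      refine (hG false true _ (hp.placed_T he)).trans ?_
      rw [ht]
      rfl
  · have h0 := fusMk_vertex_eq_one (k := k) he
    have h1 := fusMk_vertex_eq_one' (k := k) he
    refine surjective_of_components he F hij ⟨1, (map_one F).trans h0.symm⟩
      KQ₁d.adjoin_eq_top ?_
    rintro _ (⟨v, rfl⟩ | rfl | rfl)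
    · fin_cases v
      · exact (placed_idem he hij).exists_fusMk he F ⟨1, (map_one F).trans h0.symm⟩
      · exact (placed_idem_self he).exists_fusMk he F ⟨1, (map_one F).trans h1.symm⟩
    · exact (hp.placed_T he).exists_fusMk he F ⟨_, hFt⟩
    · exact (hp.placed_S he).exists_fusMk he F ⟨_, hFs⟩

end DoubleArrow

end DoubleQP

end

open scoped TensorProduct

noncomputable section

namespace DoubleQP

universe u v w x y

open DoubleBracket

/-! ### Inverses of generators and localised arrows. -/

section Inverses

variable {k : Type u} [Field k]

/-- The right inverse w of TS + q gives T·(Sw) = p and the left inverse w' of ST + p gives (w'S)·T =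
q. The two candidates Sw and w'S coincide, as one-sided inverses do. -/
theorem exists_local_inverse {B : Type v} [Ring B] {p q T S w w' : B} (hpq : p + q = 1)
    (hqp : q * p = 0) (hq : q * q = q) (hp : p * p = p) (h1 : p * T = T) (h2 : T * q = T)
    (h3 : q * S = S) (h4 : S * p = S) (hw : (T * S + q) * w = 1) (hw' : w' * (S * T + p) = 1) :
    ∃ T', T * T' = p ∧ T' * T = q ∧ q * T' = T' ∧ T' * p = T' := by
  have hqT : q * T = 0 := by rw [← h1, ← mul_assoc, hqp, zero_mul]
  have hTp : T * p = 0 := by rw [← h2, mul_assoc, hqp, mul_zero]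
  have hqw : q * w = q := by
    have : q * ((T * S + q) * w) = q := by rw [hw, mul_one]
    rwa [← mul_assoc, mul_add, ← mul_assoc, hqT, zero_mul, zero_add, hq] at this
  have hwp : w' * p = p := by
    have : w' * (S * T + p) * p = p := by rw [hw', one_mul]
    rwa [mul_assoc, add_mul, mul_assoc, hTp, mul_zero, zero_add, hp] at this
  have hA : T * (S * w) = p := by
    rw [add_mul, hqw, mul_assoc, ← hpq] at hw
    exact add_right_cancel hw
  have hB : w' * S * T = q := by
    rw [mul_add, hwp, ← mul_assoc, ← hpq, add_comm p] at hw'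
    exact add_right_cancel hw'
  have hC : w' * S = S * w := calc
    w' * S = w' * (S * p) := by rw [h4]
    _ = w' * S * T * (S * w) := by rw [← hA]; simp only [mul_assoc]
    _ = S * w := by rw [hB, ← mul_assoc, h3]
  refine ⟨S * w, hA, by rw [← hC, hB], by rw [← mul_assoc, h3], by rw [← hC, mul_assoc, h4]⟩

theorem selfAt_inv {C : Type v} [Ring C] [Algebra k C] (br : DoubleBracket k C) {x x' : C}
    (h : x * x' = 1) (h' : x' * x = 1) {mu : k} (hx : br.toFun x x = selfAt 0 mu 0 1 x) :
    br.toFun x' x' = selfAt 0 (-mu) 0 1 x' := by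
  have h2 (a : C) : x' * (x * a) = a := by rw [← mul_assoc, h', one_mul]
  have hr : br.toFun x x' = _ := (br.isDer_right x).map_inv h h'
  have hl : br.toFun x' x' = _ := (br.isDer_left x').map_inv h h'
  rw [hl, LinearMap.flip_apply, hr, hx]
  simp only [selfAt, Algebra.TensorProduct.includeLeft_apply,
    Algebra.TensorProduct.includeRight_apply, mul_add, add_mul, mul_sub, sub_mul, mul_neg, neg_mul,
    mul_smul_comm, smul_mul_assoc, Algebra.TensorProduct.tmul_mul_tmul, one_mul, mul_one, mul_assoc,
    h, h', h2]
  module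

/-- The derivation ⦃t,−⦄ takes s⁻¹ to −s⁻¹⦃t,s⦄s⁻¹, which permutes the four quadratic tensors. This
exchange takes the quadratic representative with μ = ½ to the double-arrow shape. -/
theorem quadTerm_inv_right {C : Type v} [Ring C] [Algebra k C] (br : DoubleBracket k C) {s s' t : C}
    (h : s * s' = 1) (h' : s' * s = 1) {p q r w : k}
    (hts : br.toFun t s = quadTerm p q r w 0 s t) :
    br.toFun t s' = quadTerm (-q) (-p) (-w) (-r) 0 s' t := by
  have h2 (a : C) : s' * (s * a) = a := by rw [← mul_assoc, h', one_mul]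
  have hr : br.toFun t s' = _ := (br.isDer_right t).map_inv h h'
  rw [hr, hts]
  simp only [quadTerm, Algebra.TensorProduct.includeLeft_apply,
    Algebra.TensorProduct.includeRight_apply, mul_add, add_mul,
    mul_smul_comm, smul_mul_assoc, Algebra.TensorProduct.tmul_mul_tmul, one_mul, mul_one, mul_assoc,
    h, h', h2]
  module

theorem quadTerm_inv_left {C : Type v} [Ring C] [Algebra k C] (br : DoubleBracket k C) {s t t' : C}
    (h : t * t' = 1) (h' : t' * t = 1) {p q r w : k}
    (hts : br.toFun t s = quadTerm p q r w 0 s t) :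
    br.toFun t' s = quadTerm (-r) (-w) (-p) (-q) 0 s t' := by
  have h2 (a : C) : t' * (t * a) = a := by rw [← mul_assoc, h', one_mul]
  have hr : br.toFun t' s = _ := (br.isDer_left s).map_inv h h'
  rw [hr, LinearMap.flip_apply, hts]
  simp only [quadTerm, Algebra.TensorProduct.includeLeft_apply,
    Algebra.TensorProduct.includeRight_apply, mul_add, add_mul,
    mul_smul_comm, smul_mul_assoc, Algebra.TensorProduct.tmul_mul_tmul, one_mul, mul_one, mul_assoc,
    h, h', h2]
  module

theorem Generates.pair_inv_left {C : Type v} [Ring C] [Algebra k C] {s s' t : C}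
    (hg : Generates k ({s, t} : Set C)) (h : s * s' = 1) (h' : s' * s = 1) :
    Generates k ({s', t} : Set C) := fun U hU hinv => hg U (by
  rintro _ (rfl | rfl)
  · exact hinv _ _ h' h (hU (Or.inl rfl))
  · exact hU (Or.inr rfl)) hinv

theorem Generates.pair_inv_right {C : Type v} [Ring C] [Algebra k C] {s t t' : C}
    (hg : Generates k ({s, t} : Set C)) (h : t * t' = 1) (h' : t' * t = 1) :
    Generates k ({s, t'} : Set C) := by
  rw [Set.pair_comm] at hg ⊢
  exact hg.pair_inv_left h h'

end Inverses

section LocalisedFusion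

variable {k : Type u} [Field k]

/-- `C` is the algebra of noncommutative Laurent polynomials in `s` and `t`. -/
structure IsLaurentPair (k : Type u) [Field k] {C : Type u} [Ring C] [Algebra k C]
    (s s' t t' : C) : Prop where
  ss' : s * s' = 1
  s's : s' * s = 1
  tt' : t * t' = 1
  t't : t' * t = 1
  generates : Generates k ({s, t} : Set C)
  exists_lift : ∀ {D : Type u} [Ring D] [Algebra k D] {a a' b b' : D}, a * a' = 1 → a' * a = 1 →
    b * b' = 1 → b' * b = 1 → ∃ F : C →ₐ[k] D, F s = a ∧ F t = b

theorem IsLaurentPair.inv_left {C : Type u} [Ring C] [Algebra k C] {s s' t t' : C}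
    (h : IsLaurentPair k s s' t t') : IsLaurentPair k s' s t t' where
  ss' := h.s's
  s's := h.ss'
  tt' := h.tt'
  t't := h.t't
  generates := h.generates.pair_inv_left h.ss' h.s's
  exists_lift := fun {D} _ _ {a a' b b'} h1 h2 h3 h4 => by
    obtain ⟨F, hs, ht⟩ := h.exists_lift h2 h1 h3 h4
    refine ⟨F, ?_, ht⟩
    have : F s' * F s = 1 := by rw [← map_mul, h.s's, map_one]
    rw [hs] at this
    exact left_inv_eq_right_inv this h2

theorem IsLaurentPair.inv_right {C : Type u} [Ring C] [Algebra k C] {s s' t t' : C}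
    (h : IsLaurentPair k s s' t t') : IsLaurentPair k s s' t' t where
  ss' := h.ss'
  s's := h.s's
  tt' := h.t't
  t't := h.tt'
  generates := h.generates.pair_inv_right h.tt' h.t't
  exists_lift := fun {D} _ _ {a a' b b'} h1 h2 h3 h4 => by
    obtain ⟨F, hs, ht⟩ := h.exists_lift h1 h2 h4 h3
    refine ⟨F, hs, ?_⟩
    have : F t' * F t = 1 := by rw [← map_mul, h.t't, map_one]
    rw [ht] at this
    exact left_inv_eq_right_inv this h4

theorem Loc.exists_isLaurentPair : ∃ s' t' : Loc k ({F2.s k, F2.t k} : Set (F2 k)),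
    IsLaurentPair k (Loc.of k _ (F2.s k)) s' (Loc.of k _ (F2.t k)) t' := by
  let L : Set (F2 k) := {F2.s k, F2.t k}
  let xs : L := ⟨F2.s k, Or.inl rfl⟩
  let xt : L := ⟨F2.t k, Or.inr rfl⟩
  refine ⟨Adjoin.gen k (LocRel k L) xs, Adjoin.gen k (LocRel k L) xt, Loc.mul_gen xs,
    Loc.gen_mul xs, Loc.mul_gen xt, Loc.gen_mul xt, ?_, ?_⟩
  · have := Loc.generates (s := L) (F2.generates (k := k))
    rwa [Set.image_pair] at this
  · intro D _ _ a a' b b' h1 h2 h3 h4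
    have hw (x : L) : ∃ y, F2.hom a b x.1 * y = 1 ∧ y * F2.hom a b x.1 = 1 := by
      obtain ⟨_, rfl | rfl⟩ := x
      · exact ⟨a', by rw [F2.hom_s]; exact ⟨h1, h2⟩⟩
      · exact ⟨b', by rw [F2.hom_t]; exact ⟨h3, h4⟩⟩
    choose w hw using hw
    obtain ⟨F, hF, -⟩ := Loc.exists_lift (F2.hom a b) w (fun x => (hw x).1) (fun x => (hw x).2)
    exact ⟨F, by rw [hF, F2.hom_s], by rw [hF, F2.hom_t]⟩

/-- Linearity over the idempotents survives localisation, which is required before the localised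
bracket can be fused. -/
theorem compatible_loc_eq_zero {A : Type u} [Ring A] [Algebra k A] {L : Set A}
    {br : DoubleBracket k A} {brL : DoubleBracket k (Loc k L)} (h : br.Compatible brL (Loc.of k L))
    {a : A} (ha : ∀ b, br.toFun a b = 0) (z : Loc k L) : brL.toFun (Loc.of k L a) z = 0 := by
  have : brL.toFun (Loc.of k L a) = 0 :=
    Loc.generates_range.ext (brL.isDer_right _) IsDer.zero (by
      rintro _ ⟨b, rfl⟩
      refine (h a b).symm.trans ((congrArg _ (ha b)).trans ?_)
      exact map_zero _)
  rw [this]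
  rfl

end LocalisedFusion

end DoubleQP

end

open scoped TensorProduct

noncomputable section

namespace DoubleQP

universe u v w x y

open DoubleBracket

/-! ### Arrow pairs under homomorphisms, and the localised path algebra of the double quiver. -/

section ArrowPairMap

variable {k : Type u} [Field k] {A : Type v} [Ring A] [Algebra k A] {B : Type w} [Ring B]
  [Algebra k B] {e : Fin 2 → A} {T S : A} {br : DoubleBracket k A} {br' : DoubleBracket k B}
  {κ g : k}

theorem ArrowPair.map (h : ArrowPair e T S) (f : A →ₐ[k] B) :
    ArrowPair (fun v => f (e v)) (f T) (f S) := by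
  constructor <;> rw [← map_mul]
  exacts [congrArg f h.left_T, congrArg f h.T_right, congrArg f h.left_S, congrArg f h.S_right]

theorem ArrowBracket.map (h : ArrowBracket br e T S κ g) {f : A →ₐ[k] B}
    (hf : br.Compatible br' f) : ArrowBracket br' (fun v => f (e v)) (f T) (f S) κ g := by
  have hs (a b : A) : sq f (a ⊗ₜ[k] b) = f a ⊗ₜ[k] f b := rfl
  have hf' (a b : A) : br'.toFun (f a) (f b) = sq f (br.toFun a b) := (hf a b).symm
  constructor
  · rw [hf', h.TT, map_zero]
  · rw [hf', h.SS, map_zero]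
  · rw [hf', h.TS]
    simp only [map_add, map_smul, hs, map_mul]

end ArrowPairMap

section LocalisedDoubleArrow

variable {k : Type u} [Field k]

/-- The arrow `t` in the localisation of the path algebra. -/
abbrev KQ₁dLoc.t : KQ₁dLoc k := Loc.of k (KQ₁d.locSet k) (KQ₁d.t k)

/-- The arrow `s` in the localisation of the path algebra. -/
abbrev KQ₁dLoc.s : KQ₁dLoc k := Loc.of k (KQ₁d.locSet k) (KQ₁d.s k)

theorem KQ₁dLoc.arrowPair : ArrowPair (KQ₁dLoc.e k) (KQ₁dLoc.t (k := k)) KQ₁dLoc.s :=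
  KQ₁d.arrowPair.map _

/-- Inverting ts and st locally makes each arrow locally invertible. The adjoined inverses are
themselves products of the inverse arrows plus an idempotent, so arrows, inverse arrows and
idempotents generate the localisation in the ordinary sense, as `surjective_of_components` requires.
-/
theorem KQ₁dLoc.exists_inverses : ∃ T' S' : KQ₁dLoc k,
    KQ₁dLoc.t * T' = KQ₁dLoc.e k 0 ∧ T' * KQ₁dLoc.t = KQ₁dLoc.e k 1 ∧
    KQ₁dLoc.s * S' = KQ₁dLoc.e k 1 ∧ S' * KQ₁dLoc.s = KQ₁dLoc.e k 0 ∧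
    ArrowPair (KQ₁dLoc.e k) S' T' ∧
    Algebra.adjoin k (Set.range (KQ₁dLoc.e k) ∪ {KQ₁dLoc.t, KQ₁dLoc.s, T', S'}) = ⊤ := by
  let L := KQ₁d.locSet k
  let x₀ : L := ⟨_, Or.inl rfl⟩
  let x₁ : L := ⟨_, Or.inr rfl⟩
  have he := KQ₁dLoc.e_complete k
  have hp := KQ₁dLoc.arrowPair (k := k)
  have e00 : KQ₁dLoc.e k 0 * KQ₁dLoc.e k 0 = KQ₁dLoc.e k 0 := he.idem 0
  have e11 : KQ₁dLoc.e k 1 * KQ₁dLoc.e k 1 = KQ₁dLoc.e k 1 := he.idem 1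
  have e01 : KQ₁dLoc.e k 0 * KQ₁dLoc.e k 1 = 0 := he.ortho (by decide)
  have e10 : KQ₁dLoc.e k 1 * KQ₁dLoc.e k 0 = 0 := he.ortho (by decide)
  have hsum : KQ₁dLoc.e k 0 + KQ₁dLoc.e k 1 = 1 := by rw [← he.complete, Fin.sum_univ_two]
  have h₀ : (KQ₁dLoc.t * KQ₁dLoc.s + KQ₁dLoc.e k 1) * Adjoin.gen k (LocRel k L) x₀ = 1 := by
    have := Loc.mul_gen (k := k) x₀
    rwa [map_add, map_mul] at this
  have h₀' : Adjoin.gen k (LocRel k L) x₀ * (KQ₁dLoc.t * KQ₁dLoc.s + KQ₁dLoc.e k 1) = 1 := by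
    have := Loc.gen_mul (k := k) x₀
    rwa [map_add, map_mul] at this
  have h₁ : (KQ₁dLoc.s * KQ₁dLoc.t + KQ₁dLoc.e k 0) * Adjoin.gen k (LocRel k L) x₁ = 1 := by
    have := Loc.mul_gen (k := k) x₁
    rwa [map_add, map_mul] at this
  have h₁' : Adjoin.gen k (LocRel k L) x₁ * (KQ₁dLoc.s * KQ₁dLoc.t + KQ₁dLoc.e k 0) = 1 := by
    have := Loc.gen_mul (k := k) x₁
    rwa [map_add, map_mul] at this
  obtain ⟨T', hT1, hT2, hT3, hT4⟩ := exists_local_inverse hsum e10 e11 e00 hp.left_T hp.T_right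
    hp.left_S hp.S_right h₀ h₁'
  obtain ⟨S', hS1, hS2, hS3, hS4⟩ := exists_local_inverse ((add_comm _ _).trans hsum) e01 e00 e11
    hp.left_S hp.S_right hp.left_T hp.T_right h₁ h₀'
  -- The product S'T' is the local inverse of ts at the vertex 0, so both sides invert ts + e₁.
  have hg₀ : Adjoin.gen k (LocRel k L) x₀ = S' * T' + KQ₁dLoc.e k 1 := by
    refine left_inv_eq_right_inv h₀' ?_
    have z1 : KQ₁dLoc.s * KQ₁dLoc.e k 1 = 0 := by
      rw [← hp.S_right, mul_assoc, e01, mul_zero]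
    have z2 : KQ₁dLoc.e k 1 * S' = 0 := by rw [← hS3, ← mul_assoc, e10, zero_mul]
    rw [mul_add, add_mul, add_mul, ← mul_assoc (KQ₁dLoc.e k 1), z2, mul_assoc KQ₁dLoc.t,
      mul_assoc KQ₁dLoc.t, z1, ← mul_assoc KQ₁dLoc.s, hS1, hT3, hT1, e11, zero_mul, mul_zero,
      zero_add, add_zero, hsum]
  have hg₁ : Adjoin.gen k (LocRel k L) x₁ = T' * S' + KQ₁dLoc.e k 0 := by
    refine left_inv_eq_right_inv h₁' ?_
    have z1 : KQ₁dLoc.t * KQ₁dLoc.e k 0 = 0 := by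
      rw [← hp.T_right, mul_assoc, e10, mul_zero]
    have z2 : KQ₁dLoc.e k 0 * T' = 0 := by rw [← hT3, ← mul_assoc, e01, zero_mul]
    rw [mul_add, add_mul, add_mul, ← mul_assoc (KQ₁dLoc.e k 0), z2, mul_assoc KQ₁dLoc.s,
      mul_assoc KQ₁dLoc.s, z1, ← mul_assoc KQ₁dLoc.t, hT1, hS3, hS1, e00, zero_mul, mul_zero,
      zero_add, add_zero, add_comm, hsum]
  refine ⟨T', S', hT1, hT2, hS1, hS2, ⟨hS3, hS4, hT3, hT4⟩, ?_⟩
  set U := Algebra.adjoin k (Set.range (KQ₁dLoc.e k) ∪ {KQ₁dLoc.t, KQ₁dLoc.s, T', S'}) with hU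
  have hU' : Set.range (KQ₁dLoc.e k) ∪ {KQ₁dLoc.t, KQ₁dLoc.s, T', S'} ⊆ (U : Set _) :=
    Algebra.subset_adjoin
  have hTU : T' ∈ U := hU' (Or.inr (by simp))
  have hSU : S' ∈ U := hU' (Or.inr (by simp))
  have hofU (a : KQ₁d k) : Loc.of k L a ∈ U := by
    have : (⊤ : Subalgebra k (KQ₁d k)) ≤ U.comap (Loc.of k L) := by
      rw [← KQ₁d.adjoin_eq_top, Algebra.adjoin_le_iff]
      rintro _ (⟨v, rfl⟩ | rfl | rfl)
      · exact hU' (Or.inl ⟨v, rfl⟩)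
      · exact hU' (Or.inr (Or.inl rfl))
      · exact hU' (Or.inr (Or.inr (Or.inl rfl)))
    exact this Algebra.mem_top
  rw [eq_top_iff, ← Adjoin.adjoin_eq_top, Algebra.adjoin_le_iff]
  rintro _ (⟨a, rfl⟩ | ⟨⟨_, rfl | rfl⟩, rfl⟩)
  · exact hofU a
  · exact hg₀ ▸ add_mem (mul_mem hSU hTU) (hU' (Or.inl ⟨1, rfl⟩))
  · exact hg₁ ▸ add_mem (mul_mem hTU hSU) (hU' (Or.inl ⟨0, rfl⟩))

theorem KQ₁dLoc.exists_matrixHom {C : Type v} [Ring C] [Algebra k C] {s s' t t' : C}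
    (hs : s * s' = 1) (hs' : s' * s = 1) (ht : t * t' = 1) (ht' : t' * t = 1) :
    ∃ f : KQ₁dLoc k →ₐ[k] Matrix (Fin 2) (Fin 2) C, f (KQ₁dLoc.e k 0) = !![1, 0; 0, 0] ∧
      f (KQ₁dLoc.e k 1) = !![0, 0; 0, 1] ∧ f KQ₁dLoc.t = !![0, t; 0, 0] ∧
      f KQ₁dLoc.s = !![0, 0; s, 0] := by
  obtain ⟨f, h0, h1, hft, hfs⟩ := KQ₁d.exists_matrixHom (k := k) s t
  have h2 (a : C) : s * (s' * a) = a := by rw [← mul_assoc, hs, one_mul]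
  have h3 (a : C) : s' * (s * a) = a := by rw [← mul_assoc, hs', one_mul]
  have h4 (a : C) : t * (t' * a) = a := by rw [← mul_assoc, ht, one_mul]
  have h5 (a : C) : t' * (t * a) = a := by rw [← mul_assoc, ht', one_mul]
  have hw (x : KQ₁d.locSet k) : ∃ y, f x.1 * y = 1 ∧ y * f x.1 = 1 := by
    obtain ⟨_, rfl | rfl⟩ := x
    · refine ⟨!![s' * t', 0; 0, 1], ?_, ?_⟩ <;>
      · simp only [map_add, map_mul, hft, hfs, h1]
        ext i j
        fin_cases i <;> fin_cases j <;>
          simp [mul_assoc, h2, h5, hs', ht]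
    · refine ⟨!![1, 0; 0, t' * s'], ?_, ?_⟩ <;>
      · simp only [map_add, map_mul, hft, hfs, h0]
        ext i j
        fin_cases i <;> fin_cases j <;>
          simp [mul_assoc, h3, h4, hs, ht']
  choose w hw using hw
  obtain ⟨F, hF, -⟩ := Loc.exists_lift f w (fun x => (hw x).1) (fun x => (hw x).2)
  exact ⟨F, (hF _).trans h0, (hF _).trans h1, (hF _).trans hft, (hF _).trans hfs⟩

end LocalisedDoubleArrow

end DoubleQP

end

open scoped TensorProduct

noncomputable section

namespace DoubleQP

universe u v w x y

open DoubleBracket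

/-! ### Fusion of the localised double quiver. -/

section Quadratic

variable {k : Type u} [Field k]

/-- Fusion turns the local inverses of the arrows into genuine inverses of the fused loops, so the
universal property of noncommutative Laurent polynomials gives the comparison map. Compatibility on
s and t suffices, since inverses are then automatic. -/
theorem IsLaurentPair.isomorphic_fusion {C : Type u} [Ring C] [Algebra k C] {s s' t t' : C}
    (h : IsLaurentPair k s s' t t') {br : DoubleBracket k C} {κ g : k}
    (htt : br.toFun t t = selfAt 0 (1 / 2) 0 1 t) (hss : br.toFun s s = selfAt 0 (-(1 / 2)) 0 1 s)
    (hts : br.toFun t s = quadTerm κ (-(1 / 2)) (1 / 2) κ g s t)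
    {brL : DoubleBracket k (KQ₁dLoc k)}
    (hb : ArrowBracket brL (KQ₁dLoc.e k) (KQ₁dLoc.t (k := k)) KQ₁dLoc.s κ g)
    {brF : DoubleBracket k (FusionAlgebra k (KQ₁dLoc.e_complete k) 0 1)}
    (hF : IsFusion (KQ₁dLoc.e_complete k) 0 1 brL brF) : brF.Isomorphic br := by
  have he := KQ₁dLoc.e_complete k
  have hij : (0 : Fin 2) ≠ 1 := by decide
  have hp := KQ₁dLoc.arrowPair (k := k)
  obtain ⟨T', S', hTT', hT'T, hSS', hS'S, hp', hadj⟩ := KQ₁dLoc.exists_inverses (k := k)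
  have hT := hp.placed_T he
  have hS := hp.placed_S he
  have hS' := hp'.placed_T he
  have hT' := hp'.placed_S he
  have h0 := fusMk_vertex_eq_one (k := k) he
  have h1 := fusMk_vertex_eq_one' (k := k) he
  let y := fusMk k he 0 1 false true KQ₁dLoc.t
  let y' := fusMk k he 0 1 true false T'
  let x := fusMk k he 0 1 true false KQ₁dLoc.s
  let x' := fusMk k he 0 1 false true S'
  have hyy' : y * y' = 1 := by
    refine (fusMk_mul he hij hT hT').trans ?_
    rw [hTT', h0]
  have hy'y : y' * y = 1 := by
    refine (fusMk_mul he hij hT' hT).trans ?_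
    rw [hT'T, h1]
  have hxx' : x * x' = 1 := by
    refine (fusMk_mul he hij hS hS').trans ?_
    rw [hSS', h1]
  have hx'x : x' * x = 1 := by
    refine (fusMk_mul he hij hS' hS).trans ?_
    rw [hS'S, h0]
  obtain ⟨F, hFs, hFt⟩ := h.exists_lift hxx' hx'x hyy' hy'y
  have hFt' : F t' = y' := by
    have : F t' * F t = 1 := by rw [← map_mul, h.t't, map_one]
    rw [hFt] at this
    exact left_inv_eq_right_inv this hyy'
  have hFs' : F s' = x' := by
    have : F s' * F s = 1 := by rw [← map_mul, h.s's, map_one]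
    rw [hFs] at this
    exact left_inv_eq_right_inv this hxx'
  have hself (mu : k) (z : C) : sq F (selfAt 0 mu 0 1 z) = selfAt 0 mu 0 1 (F z) := by
    have := map_selfAt F.toLinearMap 0 mu 0 1 (map_mul F z z)
    rw [AlgHom.toLinearMap_apply, map_one] at this
    exact this
  have hcompat : br.Compatible brF F := by
    refine compatible_of_pair h.generates F ?_ ?_ ?_
    · rw [htt, hself, hFt]
      exact (hp.fused_TT hb hF).symm
    · rw [hss, hself, hFs]
      exact (hp.fused_SS hb hF).symm
    · rw [hts, sq_quadTerm, hFt, hFs]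
      exact (hp.fused_TS hb hF).symm
  refine isomorphic_of_bijective F ⟨?_, ?_⟩ hcompat
  · obtain ⟨f, hf0, hf1, hft, hfs⟩ := KQ₁dLoc.exists_matrixHom (k := k) h.ss' h.s's h.tt' h.t't
    obtain ⟨G, hG⟩ := exists_fusionHom he hij f hf0 hf1
    refine injective_of_comp h.generates F G ?_
    rintro _ (rfl | rfl)
    · rw [hFs]
      refine (hG true false _ hS).trans ?_
      rw [hfs]
      rfl
    · rw [hFt]
      refine (hG false true _ hT).trans ?_
      rw [hft]
      rfl
  · refine surjective_of_components he F hij ⟨1, (map_one F).trans h0.symm⟩ hadj ?_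
    rintro _ (⟨v, rfl⟩ | rfl | rfl | rfl | rfl)
    · fin_cases v
      · exact (placed_idem he hij).exists_fusMk he F ⟨1, (map_one F).trans h0.symm⟩
      · exact (placed_idem_self he).exists_fusMk he F ⟨1, (map_one F).trans h1.symm⟩
    · exact hT.exists_fusMk he F ⟨_, hFt⟩
    · exact hS.exists_fusMk he F ⟨_, hFs⟩
    · exact hT'.exists_fusMk he F ⟨_, hFt'⟩
    · exact hS'.exists_fusMk he F ⟨_, hFs'⟩

theorem fusedFromDoubleArrowLoc_of_pair [CharZero k] {br : DoubleBracket k (F2 k)}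
    {brL : DoubleBracket k (Loc k ({F2.s k, F2.t k} : Set (F2 k)))}
    (hL : br.Compatible brL (Loc.of k _)) {s s' t t' : Loc k ({F2.s k, F2.t k} : Set (F2 k))}
    (h : IsLaurentPair k s s' t t') {κ : k} (hκ : κ = 1 / 2 ∨ κ = -(1 / 2))
    (htt : brL.toFun t t = selfAt 0 (1 / 2) 0 1 t)
    (hss : brL.toFun s s = selfAt 0 (-(1 / 2)) 0 1 s)
    (hts : brL.toFun t s = quadTerm κ (-(1 / 2)) (1 / 2) κ 0 s t) : FusedFromDoubleArrowLoc br := by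
  obtain ⟨br₁, hq₁, hb⟩ := KQ₁d.exists_bracket κ 0 hκ
  obtain ⟨br₁L, h₁L⟩ := br₁.exists_loc (s := KQ₁d.locSet k)
  obtain ⟨brF, hF⟩ := exists_isFusion 0 1 (KQ₁dLoc.e_complete k) (br := br₁L)
    (fun v => compatible_loc_eq_zero h₁L (hq₁.linear_left v))
  exact ⟨brL, hL, br₁, hq₁, br₁L, h₁L, 0, 1, by decide, brF, hF,
    h.isomorphic_fusion htt hss hts (hb.map h₁L) hF⟩

/-- In the quadratic representative both self-brackets have the same sign μ, whereas fusing the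
double quiver gives opposite signs. Inverting one generator reverses its sign and makes the two
agree. -/
theorem fusedFromDoubleArrowLoc [CharZero k] {br : DoubleBracket k (F2 k)} {c : Coeffs k}
    (h : HasForm c br) (hl : c.lam = 0) (hn : c.nu = 0) (hl' : c.l = 0) (hn' : c.n = 0)
    (hm : c.mu = 1 / 2 ∨ c.mu = -(1 / 2)) (hm' : c.m = c.mu)
    (hts : br.toFun (F2.t k) (F2.s k) = quadTerm c.mu c.mu c.mu (-c.mu) 0 (F2.s k) (F2.t k)) :
    FusedFromDoubleArrowLoc br := by
  obtain ⟨brL, hL⟩ := br.exists_loc (s := {F2.s k, F2.t k})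
  obtain ⟨s', t', hp⟩ := Loc.exists_isLaurentPair (k := k)
  set s := Loc.of k ({F2.s k, F2.t k} : Set (F2 k)) (F2.s k) with hs
  set t := Loc.of k ({F2.s k, F2.t k} : Set (F2 k)) (F2.t k) with ht
  have hself (mu : k) (z : F2 k) : sq (Loc.of k ({F2.s k, F2.t k} : Set (F2 k)))
      (selfTerm 0 mu 0 z) = selfAt 0 mu 0 1 (Loc.of k _ z) := by
    have := map_selfAt (Loc.of k ({F2.s k, F2.t k} : Set (F2 k))).toLinearMap 0 mu 0 1
      (map_mul (Loc.of k ({F2.s k, F2.t k} : Set (F2 k))) z z)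
    rw [AlgHom.toLinearMap_apply, map_one] at this
    exact this
  have htt : brL.toFun t t = selfAt 0 c.mu 0 1 t := by
    have h1 := h.tt
    rw [hl, hn] at h1
    exact (hL _ _).symm.trans ((congrArg _ h1).trans (hself _ _))
  have hss : brL.toFun s s = selfAt 0 c.mu 0 1 s := by
    have h1 := h.ss
    rw [hl', hn', hm'] at h1
    exact (hL _ _).symm.trans ((congrArg _ h1).trans (hself _ _))
  have hts' : brL.toFun t s = quadTerm c.mu c.mu c.mu (-c.mu) 0 s t :=
    (hL _ _).symm.trans ((congrArg _ hts).trans (sq_quadTerm _ _ _ _ _ _ _ _))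
  -- The target has ½ for t and −½ for s. Hence s is inverted when μ = ½, which gives κ = −½, and t
  -- is inverted when μ = −½, which gives κ = ½.
  rcases hm with hm | hm <;> rw [hm] at htt hss hts'
  · have hx := quadTerm_inv_right brL hp.ss' hp.s's hts'
    rw [neg_neg] at hx
    exact fusedFromDoubleArrowLoc_of_pair hL hp.inv_left (Or.inr rfl) htt
      (selfAt_inv brL hp.ss' hp.s's hss) hx
  · have hx := quadTerm_inv_left brL hp.tt' hp.t't hts'
    have hy := selfAt_inv brL hp.tt' hp.t't htt
    simp only [neg_neg] at hx hy
    exact fusedFromDoubleArrowLoc_of_pair hL hp.inv_right (Or.inl rfl) hy hss hx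

end Quadratic

end DoubleQP

end

open scoped TensorProduct

noncomputable section

namespace DoubleQP

universe u v w x y

open DoubleBracket

/-! ### An arrow and a loop: the two successive fusions. -/

section ArrowLoop

variable {k : Type u} [Field k] {A : Type v} [Ring A] [Algebra k A] {I : Type w} [Fintype I]
  {e : I → A} {i j : I} {T S : A} {br : DoubleBracket k A} {b : Bool} {l m n : k}

/-- `T` is an arrow from `E` to some other vertex (`b = false`) or conversely (`b = true`) and
`S` is a loop at `E`, with the brackets obtained by attaching `S` to a vertex of the arrow `T`. -/
structure ArrowLoop (br : DoubleBracket k A) (E : A) (b : Bool) (l m n : k) (T S : A) : Prop where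
  T_mul : T * E = bif b then T else 0
  mul_T : E * T = bif b then 0 else T
  S_mul : S * E = S
  mul_S : E * S = S
  TT : br.toFun T T = 0
  SS : br.toFun S S = selfAt l m n E S
  TS : br.toFun T S = bif b then -(1 / 2 : k) • (S ⊗ₜ[k] T - E ⊗ₜ[k] (T * S))
    else (1 / 2 : k) • ((S * T) ⊗ₜ[k] E - T ⊗ₜ[k] S)

/-- In this first fusion the vertex of the loop is identified with one end of the arrow. The arrow
is seen only by Tr(E_i) and the loop only by Tr(E_j), so only the mixed bracket is created, and one
of the two terms of Tr(E_i) on T is zero according to `b`. -/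
theorem IsFusion.arrowLoop {he : CompleteOrthogonalIdempotents e}
    {brF : DoubleBracket k (FusionAlgebra k he i j)} (hF : IsFusion he i j br brF) (hij : i ≠ j)
    (hT : Placed e j false false T) (hS : Placed e j true true S)
    (hTe : T * e i = bif b then T else 0) (heT : e i * T = bif b then 0 else T)
    (hTT : br.toFun T T = 0) (hTS : br.toFun T S = 0)
    (hSS : br.toFun S S = selfAt l m n (e j) S) :
    ArrowLoop brF (fusMk k he i j false false (e i)) b l m n (fusMk k he i j false false T)
      (fusMk k he i j true true S) := by
  have hi := placed_idem (j := j) he hij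
  have hj := placed_idem_self (j := j) he
  have hji := fusMk_idem_self (k := k) he hij
  have hSE : fusMk k he i j true true S * fusMk k he i j false false (e i) =
      fusMk k he i j true true S := by
    rw [← hji, fusMk_mul he hij hS hj, hS.right, cond_true]
  have hES : fusMk k he i j false false (e i) * fusMk k he i j true true S =
      fusMk k he i j true true S := by
    rw [← hji, fusMk_mul he hij hj hS, hS.left, cond_true]
  have hTE : fusMk k he i j false false T * fusMk k he i j false false (e i) =
      bif b then fusMk k he i j false false T else 0 := by
    rw [fusMk_mul he hij hT hi, hTe]
    cases b
    exacts [map_zero _, rfl]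
  have hET : fusMk k he i j false false (e i) * fusMk k he i j false false T =
      bif b then 0 else fusMk k he i j false false T := by
    rw [fusMk_mul he hij hi hT, heT]
    cases b
    exacts [rfl, map_zero _]
  refine ⟨hTE, hET, hSE, hES, ?_, ?_, ?_⟩
  · rw [hF.apply_ff_ff hij hT hT, hTT, map_zero]
  · exact (hF.selfAt_tt hij hS hSS).trans (congrArg (fun u => selfAt l m n u _) hji)
  · refine (hF.apply he hij hT hS).trans ?_
    rw [hTS]
    have hEE : fusMk k he i j false false (e i) * fusMk k he i j false false (e i) =
      fusMk k he i j false false (e i) := by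
      rw [fusMk_mul he hij hi hi, he.idem i]
    cases b
    · simp only [cond_false] at hTe heT hET
      simp only [fusGauge₁, fusGauge₂, cond_true, cond_false, hTe, heT, map_zero,
        TensorProduct.zero_tmul, tensor_sub_zero, tensor_zero_sub, cross_neg_left,
        map_sub, cross_tmul, hES, hET, hEE]
      module
    · simp only [cond_true] at hTe heT hTE
      simp only [fusGauge₁, fusGauge₂, cond_true, cond_false, hTe, heT, map_zero,
        TensorProduct.tmul_zero, tensor_sub_zero,
        map_sub, cross_tmul, hSE, hTE, hEE]
      module

/-- The second fusion closes up the arrow. It gives T a quadratic self-bracket, as for the double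
quiver, leaves that of S alone, and adds the two missing terms to the mixed bracket. -/
theorem ArrowLoop.fused {he : CompleteOrthogonalIdempotents e}
    {brF : DoubleBracket k (FusionAlgebra k he i j)} (hF : IsFusion he i j br brF) (hij : i ≠ j)
    (hone : e i + e j = 1) (h : ArrowLoop br (e i) b l m n T S) (hT : Placed e j b (!b) T)
    (hS : Placed e j false false S) :
    brF.toFun (fusMk k he i j b (!b) T) (fusMk k he i j b (!b) T) =
        selfAt 0 (bif b then -(1 / 2) else 1 / 2) 0 1 (fusMk k he i j b (!b) T) ∧
      brF.toFun (fusMk k he i j false false S) (fusMk k he i j false false S) =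
        selfAt l m n 1 (fusMk k he i j false false S) ∧
      brF.toFun (fusMk k he i j b (!b) T) (fusMk k he i j false false S) =
        quadTerm (bif b then -(1 / 2) else 1 / 2) (-(bif b then -(1 / 2) else 1 / 2))
          (bif b then -(1 / 2) else 1 / 2) (-(bif b then -(1 / 2) else 1 / 2)) 0
          (fusMk k he i j false false S) (fusMk k he i j b (!b) T) := by
  have h1 := fusMk_idem_eq_one (k := k) he hij hone
  have hTe := h.T_mul
  have heT := h.mul_T
  refine ⟨?_, ?_, ?_⟩
  · refine (hF.apply he hij hT hT).trans ?_
    rw [h.TT]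
    cases b
    · simp only [cond_false] at heT
      simp only [fusGauge₁, fusGauge₂, cond_true, cond_false, Bool.not_false, h1, heT, map_zero,
        map_neg,
        tensor_sub_zero, tensor_zero_sub, cross_neg_left, cross_tmul, mul_one, selfAt]
      module
    · simp only [cond_true] at hTe
      simp only [fusGauge₁, fusGauge₂, cond_true, cond_false, Bool.not_true, h1, hTe, map_zero,
        map_neg,
        tensor_sub_zero, tensor_zero_sub, cross_neg_left, cross_tmul, mul_one, selfAt]
      module
  · exact (hF.selfAt_ff hij hS h.SS).trans (congrArg (fun u => selfAt l m n u _) h1)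
  · refine (hF.apply he hij hT hS).trans ?_
    rw [h.TS]
    cases b
    · have hST := fusMk_mul (k := k) he hij hS hT
      simp only [cond_false, Bool.not_false] at heT hST
      simp only [fusGauge₁, fusGauge₂, cond_true, cond_false, Bool.not_false, h1, heT, h.S_mul,
        h.mul_S, map_zero, map_sub, map_smul, TensorProduct.map_tmul, ← hST,
        tensor_sub_zero, cross_tmul, mul_one, quadTerm]
      module
    · have hTS := fusMk_mul (k := k) he hij hT hS
      simp only [cond_true, Bool.not_true] at hTe hTS
      simp only [fusGauge₁, fusGauge₂, cond_true, cond_false, Bool.not_true, h1, hTe, h.S_mul,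
        h.mul_S, map_zero, map_sub, map_smul, TensorProduct.map_tmul, ← hTS, cross_neg_left,
        tensor_sub_zero, tensor_zero_sub, cross_tmul, one_mul, mul_one, quadTerm]
      module

/-- A subalgebra of a fusion algebra containing the components of generators is everything. -/
theorem fusion_subalgebra_eq_top (he : CompleteOrthogonalIdempotents e) (hij : i ≠ j) {g : Set A}
    (hg : Algebra.adjoin k g = ⊤) (U : Subalgebra k (FusionAlgebra k he i j))
    (hi : fusMk k he i j false false (e i) ∈ U)
    (h : ∀ a ∈ g, ∃ p q, Placed e j p q a ∧ fusMk k he i j p q a ∈ U) : U = ⊤ := by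
  have hU {z : FusionAlgebra k he i j} (hz : z ∈ U) : ∃ c, U.val c = z := ⟨⟨z, hz⟩, rfl⟩
  have hs := surjective_of_components (C := U) he U.val hij (hU hi) hg (fun a ha => by
    obtain ⟨p, q, hpq, ha⟩ := h a ha
    exact hpq.exists_fusMk (i := i) (C := U) he U.val (hU ha))
  rw [eq_top_iff]
  rintro z -
  obtain ⟨c, rfl⟩ := hs z
  exact c.2

/-- A 3×3 representation loses its last row and column under the first fusion: the third basis
vector is identified with the first. The outcome is the 2×2 representation that `exists_fusionHom`
needs for the second fusion. -/
theorem exists_fusionHom_blocks (he : CompleteOrthogonalIdempotents e) (hij : i ≠ j) {C : Type x}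
    [Ring C] [Algebra k C] (f : A →ₐ[k] Matrix (Fin 2 ⊕ Unit) (Fin 2 ⊕ Unit) C)
    (hi : f (e i) = Matrix.single (Sum.inl 0) (Sum.inl 0) 1)
    (hj : f (e j) = Matrix.single (Sum.inr ()) (Sum.inr ()) 1) :
    ∃ G : FusionAlgebra k he i j →ₐ[k] Matrix (Fin 2) (Fin 2) C,
      (∀ a, Placed e j false false a → G (fusMk k he i j false false a) = (f a).toBlocks₁₁) ∧
      ∀ a, Placed e j true true a →
        G (fusMk k he i j true true a) = Matrix.single 0 0 (f a (Sum.inr ()) (Sum.inr ())) := by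
  obtain ⟨Φ, hΦ, hΦ₁₂, hΦ₂₁⟩ := Ext.exists_lift (p := e i) (q := e j) f
    (Matrix.single (Sum.inl 0) (Sum.inr ()) 1) (Matrix.single (Sum.inr ()) (Sum.inl 0) 1)
    (by rw [hi]; simp) (by rw [hj]; simp) (by rw [hj]; simp) (by rw [hi]; simp) (by rw [hi]; simp)
    (by rw [hj]; simp)
  have hε : Φ (fusEps k e i j) = Matrix.fromBlocks 1 0 0 0 := by
    rw [fusEps, map_sub, map_one, hΦ, hj]
    ext a b
    rcases a with a | a <;> rcases b with b | b <;> simp [Matrix.one_apply]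
  obtain ⟨G, hG⟩ := exists_cornerHom he Φ
    ⟨⟨fun M => M.toBlocks₁₁, fun _ _ => rfl⟩, fun _ _ => rfl⟩
    (by
      rw [hε]
      exact Matrix.toBlocks_fromBlocks₁₁ _ _ _ _)
    (fun x y => by
      rw [hε]
      change (x * _ * y).toBlocks₁₁ = x.toBlocks₁₁ * y.toBlocks₁₁
      conv_lhs => rw [← Matrix.fromBlocks_toBlocks x, ← Matrix.fromBlocks_toBlocks y]
      simp [Matrix.fromBlocks_multiply])
  have hG' (x) : G x = (Φ x.1).toBlocks₁₁ := hG x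
  refine ⟨G, fun a ha => ?_, fun a ha => ?_⟩
  · rw [hG', fusMk_val he hij ha]
    simp only [fusRow, fusCol, cond_false, one_mul, mul_one, hΦ]
  · rw [hG', fusMk_val he hij ha, map_mul Φ, map_mul Φ, hΦ]
    simp only [fusRow, fusCol, cond_true, hΦ₁₂, hΦ₂₁]
    rw [Matrix.single_mul_mul_single]
    ext a b
    simp [Matrix.toBlocks₁₁, Matrix.single_apply]

end ArrowLoop

end DoubleQP

end

open scoped TensorProduct

noncomputable section

namespace DoubleQP

universe u v w x y

open DoubleBracket

/-! ### Isomorphism of k⟨s,t⟩ with a twofold fusion. -/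

section TwoFusions

variable {k : Type u} [Field k]

/-- Both traced gauge elements vanish on the remaining idempotents, and so does the extended
bracket. The fused bracket is again linear over the idempotents and can be fused once more. -/
theorem IsFusion.idem_left {A : Type v} [Ring A] [Algebra k A] {I : Type w} [Fintype I] {e : I → A}
    {he : CompleteOrthogonalIdempotents e} {i j : I} {br : DoubleBracket k A}
    {brF : DoubleBracket k (FusionAlgebra k he i j)} (hF : IsFusion he i j br brF) (hij : i ≠ j)
    (hbr : ∀ s a, br.toFun (e s) a = 0) (s : {s : I // s ≠ j}) (x : FusionAlgebra k he i j) :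
    brF.toFun (fusedIdem k he i j s) x = 0 := by
  obtain ⟨brE, E₁, E₂, ⟨hE, h12, h21⟩, hE₁, hE₂, h⟩ := hF
  have hs := placed_idem he s.2
  have hE0 : brE.toFun (Ext.of k (e i) (e j) (e s.1)) = 0 :=
    Ext.generates_range.ext (brE.isDer_right _) IsDer.zero (by
      rintro _ ⟨a | a, rfl⟩
      · refine (hE _ a).symm.trans ((congrArg _ (hbr s.1 a)).trans ?_)
        exact map_zero _
      · cases a
        exacts [(h12 _).1, (h21 _).1])
  have hv : (fusMk k he i j false false (e s.1)).1 = Ext.of k (e i) (e j) (e s.1) := by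
    rw [fusMk_idem he hij, fusedIdem_val]
  have hG₁ : fusGauge₁ k he i j false false (e s.1) = 0 := by
    simp only [fusGauge₁, cond_false]
    by_cases hsi : s.1 = i
    · rw [hsi, he.idem i]
      exact sub_self _
    · rw [show e s.1 * e i = 0 from he.ortho hsi, show e i * e s.1 = 0 from he.ortho (Ne.symm hsi),
        map_zero, TensorProduct.zero_tmul, TensorProduct.tmul_zero]
      exact sub_self _
  have hG₂ : fusGauge₂ k he i j false false (e s.1) = 0 := by
    simp only [fusGauge₂, cond_false]
    exact sub_self _
  have h1 := trace_gauge₁ he hij hE₁ hs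
  have h2 := trace_gauge₂ he hij hE₂ hs
  rw [hG₁, map_zero] at h1
  rw [hG₂, map_zero] at h2
  have h3 := h (fusMk k he i j false false (e s.1)) x
  rw [h1, h2, cross_zero_left, cross_zero_left, sub_zero, smul_zero, sub_zero, hv] at h3
  rw [← fusMk_idem he hij]
  apply cornerIncl₂_injective (fusEps_idem k he i j) (k := k)
  refine h3.trans ((DFunLike.congr_fun hE0 x.1).trans ?_)
  rw [map_zero]
  rfl

/-- The vertex `0` if `b = false` and `1` if `b = true`. -/
abbrev vert (b : Bool) : Fin 2 := bif b then 1 else 0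

theorem vert_ne (b : Bool) : vert b ≠ vert !b := by cases b <;> decide

/-- The loop is attached to `vert b` and the other end of the arrow is then fused onto that vertex.
Only placements, brackets of T and S, generation and one block representation of the algebra enter.
-/
theorem exists_isomorphic_two_fusions {br : DoubleBracket k (F2 k)} {c : Coeffs k}
    (h : HasForm c br) (hl : c.lam = 0) (hn : c.nu = 0) {b : Bool}
    (hm : c.mu = bif b then -(1 / 2) else 1 / 2)
    (hts : br.toFun (F2.t k) (F2.s k) = quadTerm c.mu (-c.mu) c.mu (-c.mu) 0 (F2.s k) (F2.t k))
    {A : Type v} [Ring A] [Algebra k A] {e : Fin 2 ⊕ Unit → A}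
    (he : CompleteOrthogonalIdempotents e) {T S : A} {br₁ : DoubleBracket k A}
    (hbr : ∀ s a, br₁.toFun (e s) a = 0) (hT : Placed e (Sum.inr ()) false false T)
    (hS : Placed e (Sum.inr ()) true true S) (hTw : Placed e (Sum.inl (vert !b)) b (!b) T)
    (hTv : Placed e (Sum.inl (vert b)) (!b) b T)
    (hTT : br₁.toFun T T = 0) (hTS : br₁.toFun T S = 0)
    (hSS : br₁.toFun S S = selfAt c.l c.m c.n (e (Sum.inr ())) S)
    (hadj : Algebra.adjoin k (Set.range e ∪ {T, S}) = ⊤)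
    (f : A →ₐ[k] Matrix (Fin 2 ⊕ Unit) (Fin 2 ⊕ Unit) (F2 k))
    (hfv : f (e (Sum.inl (vert b))) = Matrix.single (Sum.inl 0) (Sum.inl 0) 1)
    (hfw : f (e (Sum.inl (vert !b))) = Matrix.single (Sum.inl 1) (Sum.inl 1) 1)
    (hfr : f (e (Sum.inr ())) = Matrix.single (Sum.inr ()) (Sum.inr ()) 1)
    (hfT : f T = Matrix.single (Sum.inl (vert b)) (Sum.inl (vert !b)) (F2.t k))
    (hfS : f S = Matrix.single (Sum.inr ()) (Sum.inr ()) (F2.s k)) :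
    ∃ i j : Fin 2 ⊕ Unit, i ≠ j ∧
    ∃ brF : DoubleBracket k (FusionAlgebra k he i j), IsFusion he i j br₁ brF ∧
    ∃ i' j' : {x : Fin 2 ⊕ Unit // x ≠ j}, i' ≠ j' ∧
    ∃ brF' : DoubleBracket k (FusionAlgebra k (fusedIdem_complete k he i j) i' j'),
      IsFusion _ i' j' brF brF' ∧ brF'.Isomorphic br := by
  have hij : (Sum.inl (vert b) : Fin 2 ⊕ Unit) ≠ Sum.inr () := Sum.inl_ne_inr
  let i' : {x : Fin 2 ⊕ Unit // x ≠ Sum.inr ()} := ⟨Sum.inl (vert b), Sum.inl_ne_inr⟩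
  let j' : {x : Fin 2 ⊕ Unit // x ≠ Sum.inr ()} := ⟨Sum.inl (vert !b), Sum.inl_ne_inr⟩
  have hij' : i' ≠ j' := fun h => vert_ne b (Sum.inl_injective (congrArg Subtype.val h))
  obtain ⟨brF, hF⟩ := exists_isFusion (Sum.inl (vert b)) (Sum.inr ()) he hbr
  have he' := fusedIdem_complete k he (Sum.inl (vert b)) (Sum.inr ())
  obtain ⟨brF', hF'⟩ := exists_isFusion i' j' he' (br := brF) (fun s x => hF.idem_left hij hbr s x)
  refine ⟨Sum.inl (vert b), Sum.inr (), hij, brF, hF, i', j', hij', brF', hF', ?_⟩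
  have hv : fusMk k he (Sum.inl (vert b)) (Sum.inr ()) false false (e (Sum.inl (vert b))) =
    fusedIdem k he _ _ i' := fusMk_idem he hij i'
  have hw : fusMk k he (Sum.inl (vert b)) (Sum.inr ()) false false (e (Sum.inl (vert !b))) =
    fusedIdem k he _ _ j' := fusMk_idem he hij j'
  let t₁ := fusMk k he (Sum.inl (vert b)) (Sum.inr ()) false false T
  let s₁ := fusMk k he (Sum.inl (vert b)) (Sum.inr ()) true true S
  have hloop : ArrowLoop brF (fusedIdem k he _ _ i') b c.l c.m c.n t₁ s₁ := by
    rw [← hv]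
    refine hF.arrowLoop hij hT hS ?_ ?_ hTT hTS hSS
    · exact hTv.right
    · refine hTv.left.trans ?_
      cases b <;> rfl
  have hew := placed_idem (j := Sum.inr ()) he (s := Sum.inl (vert !b)) Sum.inl_ne_inr
  have hev := placed_idem (j := Sum.inr ()) he (s := Sum.inl (vert b)) Sum.inl_ne_inr
  have ht₁ : Placed (fusedIdem k he (Sum.inl (vert b)) (Sum.inr ())) j' b (!b) t₁ := by
    constructor
    · rw [← hw]
      refine (fusMk_mul he hij hew hT).trans ?_
      rw [hTw.left]
      cases b
      exacts [map_zero _, rfl]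
    · rw [← hw]
      refine (fusMk_mul he hij hT hew).trans ?_
      rw [hTw.right]
      cases b
      exacts [rfl, map_zero _]
  have hs₁ : Placed (fusedIdem k he (Sum.inl (vert b)) (Sum.inr ())) j' false false s₁ := by
    have h1 : fusedIdem k he (Sum.inl (vert b)) (Sum.inr ()) j' * fusedIdem k he _ _ i' = 0 :=
      he'.ortho hij'.symm
    have h2 : fusedIdem k he (Sum.inl (vert b)) (Sum.inr ()) i' * fusedIdem k he _ _ j' = 0 :=
      he'.ortho hij'
    constructor
    · rw [← hloop.mul_S, ← mul_assoc, h1, zero_mul, cond_false]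
    · rw [← hloop.S_mul, mul_assoc, h2, mul_zero, cond_false]
  have hone : fusedIdem k he (Sum.inl (vert b)) (Sum.inr ()) i' + fusedIdem k he _ _ j' = 1 := by
    have hsum : e (Sum.inl (vert b)) + e (Sum.inl (vert !b)) = 1 - e (Sum.inr ()) := by
      rw [← he.complete, Fintype.sum_sum_type, Fin.sum_univ_two, Fintype.sum_unique]
      cases b
      · exact (add_sub_cancel_right _ _).symm
      · exact (add_comm _ _).trans (add_sub_cancel_right _ _).symm
    apply Subtype.ext
    change (fusedIdem k he _ _ i').1 + (fusedIdem k he _ _ j').1 = _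
    rw [fusedIdem_val, fusedIdem_val, Corner.one_val, fusEps, ← map_one (Ext.of k _ _), ← map_add,
      ← map_sub, hsum]
  obtain ⟨htt, hss, hts'⟩ := hloop.fused hF' hij' hone ht₁ hs₁
  let t := fusMk k he' i' j' b (!b) t₁
  let s := fusMk k he' i' j' false false s₁
  let F : F2 k →ₐ[k] FusionAlgebra k he' i' j' := F2.hom s t
  have hFs : F (F2.s k) = s := F2.hom_s _ _
  have hFt : F (F2.t k) = t := F2.hom_t _ _
  have hcompat : br.Compatible brF' F := h.compatible_hom hts
    (by rw [hl, hn, hm]; exact htt) hss (by rw [hm]; exact hts')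
  refine isomorphic_of_bijective F ⟨?_, ?_⟩ hcompat
  · obtain ⟨G₁, hG₁, hG₁'⟩ := exists_fusionHom_blocks he hij f hfv hfr
    have hGv : G₁ (fusedIdem k he _ _ i') = !![1, 0; 0, 0] := by
      rw [← hv, hG₁ _ hev, hfv]
      ext a b
      fin_cases a <;> fin_cases b <;> rfl
    have hGw : G₁ (fusedIdem k he _ _ j') = !![0, 0; 0, 1] := by
      rw [← hw, hG₁ _ hew, hfw]
      ext a b
      fin_cases a <;> fin_cases b <;> rfl
    obtain ⟨G, hG⟩ := exists_fusionHom he' hij' G₁ hGv hGw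
    refine injective_of_comp F2.generates F G ?_
    rintro _ (rfl | rfl)
    · rw [hFs]
      refine (hG false false s₁ hs₁).trans ?_
      rw [hG₁' S hS, hfS]
      simp
    · rw [hFt]
      refine (hG b (!b) t₁ ht₁).trans ?_
      rw [hG₁ T hT, hfT]
      simp [Matrix.toBlocks₁₁]
  · have h1 := fusMk_idem_eq_one (k := k) he' hij' hone
    have hFi : ∃ c, F c = fusMk k he' i' j' false false (fusedIdem k he _ _ i') :=
      ⟨1, (map_one F).trans h1.symm⟩
    refine surjective_of_components he' F hij' hFi
      (g := {fusedIdem k he _ _ i', fusedIdem k he _ _ j', t₁, s₁}) ?_ ?_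
    · refine fusion_subalgebra_eq_top he hij hadj _ ?_ ?_
      · rw [hv]
        exact Algebra.subset_adjoin (Or.inl rfl)
      · rintro _ (⟨v | _, rfl⟩ | rfl | rfl)
        · have hvert : v = vert b ∨ v = vert !b := by
            cases b <;> fin_cases v <;> simp
          rcases hvert with rfl | rfl
          · exact ⟨false, false, hev, hv ▸ Algebra.subset_adjoin (Or.inl rfl)⟩
          · exact ⟨false, false, hew, hw ▸ Algebra.subset_adjoin (Or.inr (Or.inl rfl))⟩
        · refine ⟨true, true, placed_idem_self he, ?_⟩
          rw [fusMk_idem_self he hij, hv]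
          exact Algebra.subset_adjoin (Or.inl rfl)
        · exact ⟨false, false, hT, Algebra.subset_adjoin (Or.inr (Or.inr (Or.inl rfl)))⟩
        · exact ⟨true, true, hS, Algebra.subset_adjoin (Or.inr (Or.inr (Or.inr rfl)))⟩
    · rintro _ (rfl | rfl | rfl | rfl)
      · exact (placed_idem he' hij').exists_fusMk he' F hFi
      · exact (placed_idem_self he').exists_fusMk he' F
          ⟨1, (map_one F).trans (h1.symm.trans (fusMk_idem_self he' hij').symm)⟩
      · exact ht₁.exists_fusMk he' F ⟨_, hFt⟩
      · exact hs₁.exists_fusMk he' F ⟨_, hFs⟩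

end TwoFusions

end DoubleQP

end

open scoped TensorProduct

noncomputable section

namespace DoubleQP

universe u v w x y

open DoubleBracket

/-! ### The arrow-and-loop case for kQ₁ ⊕ k[s]. -/

section ArrowAndLoop

variable {k : Type u} [Field k]

variable (k) in
/-- The arrow `t : 0 → 1` of `Q₁`. -/
abbrev KQ₁.t : KQ₁ k := PathAlgebra.arrow k _ _ ()

theorem KQ₁.e_zero_mul_t : KQ₁.e k 0 * KQ₁.t k = KQ₁.t k := PathAlgebra.tail_mul ()

theorem KQ₁.t_mul_e_one : KQ₁.t k * KQ₁.e k 1 = KQ₁.t k := PathAlgebra.mul_head ()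

theorem KQ₁.e_one_mul_t : KQ₁.e k 1 * KQ₁.t k = 0 := by
  have h : KQ₁.e k 1 * KQ₁.e k 0 = 0 := (KQ₁.e_complete k).ortho (by decide)
  rw [← KQ₁.e_zero_mul_t, ← mul_assoc, h, zero_mul]

theorem KQ₁.t_mul_e_zero : KQ₁.t k * KQ₁.e k 0 = 0 := by
  have h : KQ₁.e k 1 * KQ₁.e k 0 = 0 := (KQ₁.e_complete k).ortho (by decide)
  rw [← KQ₁.t_mul_e_one, mul_assoc, h, mul_zero]

theorem KQ₁.adjoin_eq_top : Algebra.adjoin k (Set.range (KQ₁.e k) ∪ {KQ₁.t k}) = ⊤ := by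
  rw [← PathAlgebra.adjoin_eq_top]
  congr 2
  ext x
  constructor
  · rintro rfl
    exact ⟨(), rfl⟩
  · rintro ⟨_, rfl⟩
    rfl

/-- The zero double bracket. -/
def zeroBracket (k : Type u) [Field k] (A : Type v) [Ring A] [Algebra k A] : DoubleBracket k A :=
  ⟨0, fun _ _ => by simp, fun _ _ _ => by simp⟩

/-- Since t² = 0, the right-hand side at (t,t,t) reduces to one term t⊗t⊗t from each vertex, with
opposite signs. -/
theorem KQ₁.zeroBracket_isQuasiPoisson : (zeroBracket k (KQ₁ k)).IsQuasiPoisson (KQ₁.e k) := by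
  refine isQuasiPoisson_of_generates _ (G := {KQ₁.t k}) (KQ₁.e_complete k) (fun _ _ => rfl)
    (Generates.of_adjoin KQ₁.adjoin_eq_top) ?_
  have htt : KQ₁.t k * KQ₁.t k = 0 := by
    nth_rw 1 [← KQ₁.t_mul_e_one]
    rw [mul_assoc, KQ₁.e_one_mul_t, mul_zero]
  rintro _ rfl _ rfl _ rfl
  have h0 : (zeroBracket k (KQ₁ k)).toFun (KQ₁.t k) (KQ₁.t k) = 0 := rfl
  rw [qpRhs_apply, Fin.sum_univ_two]
  simp only [triple, h0, map_zero, KQ₁.e_zero_mul_t, KQ₁.t_mul_e_one, KQ₁.e_one_mul_t,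
    KQ₁.t_mul_e_zero, htt, TensorProduct.zero_tmul, TensorProduct.tmul_zero, zero_mul]
  module

theorem KQ₁.exists_matrixHom {C : Type v} [Ring C] [Algebra k C] (t : C) (b : Bool) :
    ∃ f : KQ₁ k →ₐ[k] Matrix (Fin 2) (Fin 2) C, f (KQ₁.e k (vert b)) = !![1, 0; 0, 0] ∧
      f (KQ₁.e k (vert !b)) = !![0, 0; 0, 1] ∧
      f (KQ₁.t k) = Matrix.single (vert b) (vert !b) t := by
  let m : Fin 2 → Matrix (Fin 2) (Fin 2) C := ![!![1, 0; 0, 0], !![0, 0; 0, 1]]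
  -- The vertex that receives the loop must act as the first diagonal unit, so the two vertices are
  -- exchanged when it is the head of the arrow.
  let σ : Equiv.Perm (Fin 2) := if b then Equiv.swap 0 1 else Equiv.refl _
  have hm : CompleteOrthogonalIdempotents (m ∘ σ) :=
    (CompleteOrthogonalIdempotents.equiv σ).2 (vertexMatrices_complete C)
  obtain ⟨f, h1, h2⟩ := PathAlgebra.exists_lift (k := k) (tail := fun _ : Unit => (0 : Fin 2))
    (head := fun _ : Unit => (1 : Fin 2)) hm
    (fun _ => Matrix.single (vert b) (vert !b) t)
    (fun _ => by
      cases b <;>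
      · ext i j
        fin_cases i <;> fin_cases j <;> simp [m, σ, Matrix.mul_apply])
    (fun _ => by
      cases b <;>
      · ext i j
        fin_cases i <;> fin_cases j <;> simp [m, σ, Matrix.mul_apply])
  refine ⟨f, (h1 _).trans ?_, (h1 _).trans ?_, h2 ()⟩
  · cases b <;> simp [m, σ]
  · cases b <;> simp [m, σ]

theorem exists_blockHom {A : Type v} [Ring A] [Algebra k A] {B : Type w} [Ring B] [Algebra k B]
    {C : Type x} [Ring C] [Algebra k C] (f : A →ₐ[k] Matrix (Fin 2) (Fin 2) C) (g : B →ₐ[k] C) :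
    ∃ h : A × B →ₐ[k] Matrix (Fin 2 ⊕ Unit) (Fin 2 ⊕ Unit) C, ∀ z,
      h z = Matrix.fromBlocks (f z.1) 0 0 (Matrix.single () () (g z.2)) := by
  refine ⟨AlgHom.ofLinearMap
    ⟨⟨fun z => Matrix.fromBlocks (f z.1) 0 0 (Matrix.single () () (g z.2)), fun a b => ?_⟩,
      fun c a => ?_⟩ ?_ (fun a b => ?_), fun z => rfl⟩
  · simp [Matrix.fromBlocks_add, Matrix.single_add]
  · simp [Matrix.fromBlocks_smul, Matrix.smul_single]
  · change Matrix.fromBlocks (f 1) 0 0 (Matrix.single () () (g 1)) = 1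
    rw [map_one, map_one, ← Matrix.fromBlocks_one]
    congr 1
  · change Matrix.fromBlocks (f (a.1 * b.1)) 0 0 (Matrix.single () () (g (a.2 * b.2))) =
      Matrix.fromBlocks (f a.1) 0 0 (Matrix.single () () (g a.2)) *
        Matrix.fromBlocks (f b.1) 0 0 (Matrix.single () () (g b.2))
    simp [Matrix.fromBlocks_multiply]

/-- The arrow carries the zero bracket; its self-bracket after fusion comes only from closing it up.
The loop carries the restriction of the given bracket to k[s]. -/
theorem fusedFromArrowAndLoop [CharZero k] {br : DoubleBracket k (F2 k)} {c : Coeffs k}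
    (h : HasForm c br) (hq : br.IsQuasiPoisson (unitIdem _)) (hl : c.lam = 0) (hn : c.nu = 0)
    (hm : c.mu = 1 / 2 ∨ c.mu = -(1 / 2))
    (hts : br.toFun (F2.t k) (F2.s k) =
      quadTerm c.mu (-c.mu) c.mu (-c.mu) 0 (F2.s k) (F2.t k)) :
    FusedFromArrowAndLoop br := by
  -- The sign of μ decides at which end the loop is attached: the tail of t for ½, the head for −½.
  obtain ⟨b, hm⟩ : ∃ b : Bool, c.mu = bif b then -(1 / 2) else 1 / 2 := by
    rcases hm with hm | hm
    exacts [⟨false, hm⟩, ⟨true, hm⟩]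
  obtain ⟨br₂, hq₂, h₂⟩ := exists_polynomial_bracket hq (F2.hom_s _ _) h.ss
  refine ⟨zeroBracket k (KQ₁ k), br₂, KQ₁.zeroBracket_isQuasiPoisson, hq₂, ?_⟩
  have h1 (a : Polynomial k) : br₂.toFun 1 a = 0 := hq₂.linear_left () a
  have hprod (x y : KQ₁ k × Polynomial k) : ((zeroBracket k (KQ₁ k)).prod br₂).toFun x y =
      incl₂ k (KQ₁ k) (Polynomial k) (br₂.toFun x.2 y.2) := by
    change incl₁ _ _ _ 0 + incl₂ _ _ _ (br₂.toFun x.2 y.2) = _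
    rw [map_zero, zero_add]
  obtain ⟨φ, hφv, hφw, hφt⟩ := KQ₁.exists_matrixHom (k := k) (F2.t k) b
  obtain ⟨f, hf⟩ := exists_blockHom φ (Polynomial.aeval (F2.s k))
  have h01 := KQ₁.e_zero_mul_t (k := k)
  have h02 := KQ₁.t_mul_e_one (k := k)
  have h03 := KQ₁.e_one_mul_t (k := k)
  have h04 := KQ₁.t_mul_e_zero (k := k)
  refine exists_isomorphic_two_fusions h hl hn hm hts _ (T := (KQ₁.t k, 0))
    (S := (0, Polynomial.X)) ?_ ?_ ?_ ?_ ?_ ?_ ?_ ?_ ?_ f ?_ ?_ ?_ ?_ ?_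
  · rintro (s | s) a
    · refine (hprod _ _).trans ?_
      change incl₂ _ _ _ (br₂.toFun 0 a.2) = 0
      rw [map_zero, LinearMap.zero_apply, map_zero]
    · refine (hprod _ _).trans ?_
      change incl₂ _ _ _ (br₂.toFun 1 a.2) = 0
      rw [h1, map_zero]
  · constructor <;> simp [prodIdem, unitIdem]
  · constructor <;> simp [prodIdem, unitIdem]
  · cases b <;> constructor <;> simp [prodIdem, h01, h02, h03, h04]
  · cases b <;> constructor <;> simp [prodIdem, h01, h02, h03, h04]
  · rw [hprod, map_zero, map_zero]
  · rw [hprod, map_zero, LinearMap.zero_apply, map_zero]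
  · rw [hprod, h₂]
    exact map_selfAt _ _ _ _ _ (by simp)
  · rw [eq_top_iff, ← prod_adjoin_eq_top KQ₁.adjoin_eq_top Polynomial.adjoin_X,
      Algebra.adjoin_le_iff]
    have hmem (v) : prodIdem (KQ₁.e k) (unitIdem (Polynomial k)) v ∈
        Algebra.adjoin k (Set.range (prodIdem (KQ₁.e k) (unitIdem (Polynomial k))) ∪
          {(KQ₁.t k, 0), (0, Polynomial.X)}) := Algebra.subset_adjoin (Or.inl ⟨v, rfl⟩)
    rintro _ (⟨_, (⟨v, rfl⟩ | rfl) | rfl, rfl⟩ | ⟨_, rfl | rfl, rfl⟩)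
    · exact hmem (Sum.inl v)
    · exact Algebra.subset_adjoin (Or.inr (Or.inl rfl))
    · have : ((1 : KQ₁ k), (0 : Polynomial k)) = prodIdem (KQ₁.e k) (unitIdem (Polynomial k))
          (Sum.inl 0) + prodIdem (KQ₁.e k) (unitIdem (Polynomial k)) (Sum.inl 1) := by
        rw [← (KQ₁.e_complete k).complete, Fin.sum_univ_two]
        simp [prodIdem]
      change ((1 : KQ₁ k), (0 : Polynomial k)) ∈ Algebra.adjoin _ _
      rw [this]
      exact add_mem (hmem _) (hmem _)
    · exact Algebra.subset_adjoin (Or.inr (Or.inr rfl))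
    · exact hmem (Sum.inr ())
  · rw [hf]
    simp only [prodIdem, Sum.elim_inl, hφv, map_zero]
    ext i j
    rcases i with i | i <;> rcases j with j | j <;>
      [fin_cases i <;> fin_cases j; skip; skip; skip] <;> simp
  · rw [hf]
    simp only [prodIdem, Sum.elim_inl, hφw, map_zero]
    ext i j
    rcases i with i | i <;> rcases j with j | j <;>
      [fin_cases i <;> fin_cases j; skip; skip; skip] <;> simp
  · rw [hf]
    simp only [prodIdem, Sum.elim_inr, unitIdem, map_zero, map_one]
    ext i j
    rcases i with i | i <;> rcases j with j | j <;> simp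
  · rw [hf]
    simp only [hφt, map_zero]
    ext i j
    rcases i with i | i <;> rcases j with j | j <;> simp [Matrix.single_apply]
  · rw [hf]
    simp only [Polynomial.aeval_X, map_zero]
    ext i j
    rcases i with i | i <;> rcases j with j | j <;> simp

end ArrowAndLoop

end DoubleQP

end

/-! ### Assembly: each representative falls under one of the four cases. -/

theorem mainTheorem8 (k : Type*) [Field k] [CharZero k]
    (br : DoubleQP.DoubleBracket k (DoubleQP.F2 k)) (c : DoubleQP.Coeffs k)
    (hform : DoubleQP.HasForm c br) (hqp : br.IsQuasiPoisson (DoubleQP.unitIdem _)) :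
    ∃ (br' : DoubleQP.DoubleBracket k (DoubleQP.F2 k)) (c' : DoubleQP.Coeffs k),
      DoubleQP.HasForm c' br' ∧ c'.IsReduced ∧ br'.IsQuasiPoisson (DoubleQP.unitIdem _) ∧
      br.Isomorphic br' ∧
      (DoubleQP.FusedFromTwoLoops br' ∨ DoubleQP.FusedFromArrowAndLoop br' ∨
        DoubleQP.FusedFromDoubleArrow br' ∨ DoubleQP.FusedFromDoubleArrowLoc br') := by
  obtain ⟨br', c', h, hr, hq, hi, hrep⟩ := hform.exists_representative hqp
  refine ⟨br', c', h, hr, hq, hi, ?_⟩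
  rcases hrep with hts | ⟨hl, hn, hm, hts⟩ | ⟨hl, hn, hl', hn', hm, hm', κ, g, hκ, hts⟩ |
    ⟨hl, hn, hl', hn', hm, hm', hts⟩
  · exact Or.inl (DoubleQP.fusedFromTwoLoops h hq hts)
  · exact Or.inr (Or.inl (DoubleQP.fusedFromArrowAndLoop h hq hl hn hm hts))
  · exact Or.inr (Or.inr (Or.inl
      (DoubleQP.fusedFromDoubleArrow h hl hn hl' hn' hm hm' hκ hts)))
  · exact Or.inr (Or.inr (Or.inr
      (DoubleQP.fusedFromDoubleArrowLoc h hl hn hl' hn' hm hm' hts)))
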